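/- **Setting.** Let $F^0,F^1:[0,\infty)\to[-\infty,\infty)$ be concave and upper semi-continuous with $F^0\le F^1$. Assume that $F^0$ has a unique maximiser $u^0>0$ and is finite on $(0,u^0]$, and that $F^1$ has a unique maximiser $u^1<u^0$. Put $F^1(\infty):=-\infty$. A *supergradient* of $F^j$ at a point $u$ of the closure of $\{F^j>-\infty\}$ is an $\eta\in[-\infty,\infty]$ with $F^j(u')\le F^j(u)+\eta(u'-u)$ for all $u'\neq u$ in $[0,\infty)$ (with $-\infty+\infty:=\infty$ on the right, so that $\infty$ is always a supergradient at $0$). Let $u^\star$ be the greatest $u\in[0,u^0)$ at which $F^0$ and $F^1$ have a common supergradient, and assume that, if $u^\star>0$, it is a strict local maximum of $F^1-F^0$. Fix $r>0$. A *mechanism* $(x,X)$ is a Lebesgue-measurable $x:[0,\infty)\to[0,\infty)$ together with a function $X:[0,\infty)\to[0,\infty]$. It is *incentive-compatible (IC)* if for every $t\ge0$ both $X_t\ge r\int_t^{t+d}e^{-r(s-t)}x_s\,\mathrm ds+e^{-rd}X_{t+d}$ for all $d>0$ and $X_t\ge r\int_t^\infty e^{-r(s-t)}x_s\,\mathrm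 ds$. For a probability distribution $G$ on $[0,\infty)$ (with CDF also denoted $G$) of a random time $\tau$, let $$\Pi_G(x,X)=\mathbf E_G\Bigl(r\int_0^\tau e^{-rt}F^0(x_t)\,\mathrm dt+e^{-r\tau}F^1(X_\tau)\Bigr).$$ An IC mechanism is *undominated* if there is no IC mechanism whose payoff $\Pi_G$ is weakly higher for every distribution $G$ and strictly higher for some $G$. It is *optimal for $G$* if it is undominated and maximises $\Pi_G$ among all IC mechanisms. A *version* of $x$ is a function equal to $x$ almost everywhere on $[0,\infty)$. A mechanism $(x,X)$ *satisfies the Euler equation for $G$* if there are a measurable $\phi^0:[0,\infty)\to[0,\infty]$ and a $G$-integrable $\phi^1:[0,\infty)\to[-\infty,\infty]$ such that $\phi^0(t)$ is a supergradient of $F^0$ at $x_t$ for almost every $t\ge 0$ with $G(t)<1$, $X_t<\infty$ and $\phi^1(t)$ is a supergradient of $F^1$ at $X_t$ for $G$-almost every $t$, and $$[1-G(t)]\,\phi^0(t)+\int_{[0,t]}\phi^1\,\mathrm dG=0\qquad\text{for every }t\ge0 .$$ **Proposition.** Let $G$ be a distribution with unbounded support. 1. Suppose that $u^\star>0$, that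 $F^0$ and $F^1$ are differentiable on $(0,u^0)$, and that $G(0)=0$. Let $(x,X)$ be optimal for $G$. Then $0<X_t<u^0$ for every $t\ge 0$, the function $F^{1\prime}(X_\tau)$ is $G$-integrable with $$\mathbf E_G\bigl(F^{1\prime}(X_\tau)\bigr)=0,$$ and the condition $$0<x_t\le u^0,\qquad F^{0\prime}(x_t)\ \ge\ \mathbf E_G\bigl(F^{1\prime}(X_\tau)\,\big|\,\tau>t\bigr),\quad\text{with equality if }x_t<u^0,$$ holds for almost every $t\ge0$; moreover some version of $x$ satisfies this condition for every $t\ge0$. (Here $F^{0\prime}(u^0)$ denotes the left-hand derivative.) 2. Every mechanism that is optimal for $G$ satisfies the Euler equation for $G$. 3. Every undominated mechanism that satisfies the Euler equation for $G$ is optimal for $G$. -/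

import Mathlib

open MeasureTheory Set Filter Topology
open scoped NNReal ENNReal

namespace Breakthrough

/-! ### Extended-real integration -/

/-- Lebesgue integral of an extended-real-valued function: integral of the positive part minus
integral of the negative part. In all uses at least one of the two is finite. -/
noncomputable def eintegral {α : Type*} [MeasurableSpace α] (μ : Measure α) (f : α → EReal) :
    EReal :=
  ((∫⁻ a, (f a).toENNReal ∂μ : ℝ≥0∞) : EReal) - ((∫⁻ a, (-f a).toENNReal ∂μ : ℝ≥0∞) : EReal)

/-- Integrability of an extended-real-valued function. -/
def EIntegrable {α : Type*} [MeasurableSpace α] (μ : Measure α) (f : α → EReal) : Prop :=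
  AEMeasurable f μ ∧ ∫⁻ a, (f a).toENNReal ∂μ ≠ ∞ ∧ ∫⁻ a, (-f a).toENNReal ∂μ ≠ ∞

/-! ### Frontiers -/

/-- Concavity of a function `[0, ∞) → [-∞, ∞)`. -/
def EConcave (F : ℝ≥0 → EReal) : Prop :=
  ∀ u v a b : ℝ≥0, a + b = 1 →
    ((a : ℝ) : EReal) * F u + ((b : ℝ) : EReal) * F v ≤ F (a * u + b * v)

/-- `η ∈ [-∞, ∞]` is a supergradient of `F` at `u`, a point of the closure of the effective domain:
`F u' ≤ F u + η (u' - u)` for all `u' ≠ u`. The term in `η` is written on the left-hand side, so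
that indeterminate sums `-∞ + ∞` count as `-∞` there; thus `∞` is a supergradient at `0` also
when `F 0 = -∞`. -/
def IsSupergradient (F : ℝ≥0 → EReal) (u : ℝ≥0) (η : EReal) : Prop :=
  u ∈ closure {v | F v ≠ ⊥} ∧
    ∀ u' : ℝ≥0, u' ≠ u → F u' + η * (((u : ℝ) - (u' : ℝ) : ℝ) : EReal) ≤ F u

/-- The rightmost utility level below the peak `u0` of `F0` at which `F0` and `F1` have equal
slopes, that is, share a supergradient. (Every frontier has supergradient `∞` at `0`, so `0` is such
a level when `u0 > 0`. At `u0` itself the frontiers can only share negative slopes, where `F0` has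
a kink or ceases to be finite; this is not counted.) -/
noncomputable def ustar (F0 F1 : ℝ≥0 → EReal) (u0 : ℝ≥0) : ℝ≥0 :=
  sSup {u | u < u0 ∧ ∃ η : EReal, IsSupergradient F0 u η ∧ IsSupergradient F1 u η}

/-- The old frontier `F0` and the new frontier `F1`, with peaks `u0` and `u1`. -/
structure Technology where
  F0 : ℝ≥0 → EReal
  F1 : ℝ≥0 → EReal
  u0 : ℝ≥0
  u1 : ℝ≥0
  concave_F0 : EConcave F0
  concave_F1 : EConcave F1
  usc_F0 : UpperSemicontinuous F0
  usc_F1 : UpperSemicontinuous F1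
  F1_lt_top : ∀ u, F1 u < ⊤
  F0_le_F1 : ∀ u, F0 u ≤ F1 u
  peak_F0 : ∀ u, u ≠ u0 → F0 u < F0 u0
  peak_F1 : ∀ u, u ≠ u1 → F1 u < F1 u1
  u0_pos : 0 < u0
  finite_F0 : ∀ u, 0 < u → u ≤ u0 → F0 u ≠ ⊥
  /-- conflict of interest -/
  u1_lt_u0 : u1 < u0
  /-- `ustar` is a strict local maximum of `F1 - F0`. (When `ustar = 0`, this is automatic unless
  `F0 0 = F1 0 = -∞`, in which case the difference is undefined at `0`.) -/
  generic : 0 < ustar F0 F1 u0 →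
    ∀ᶠ u in 𝓝[≠] (ustar F0 F1 u0),
      F1 u - F0 u < F1 (ustar F0 F1 u0) - F0 (ustar F0 F1 u0)

/-- The real-valued version of a frontier. -/
noncomputable def realize (F : ℝ≥0 → EReal) : ℝ → ℝ := fun u => (F u.toNNReal).toReal

/-- The derivative of a frontier on `[0, u0]`: the ordinary derivative at interior points, the
right-hand derivative at `0` and the left-hand derivative at `u0`. -/
noncomputable def frontierDeriv (u0 : ℝ≥0) (F : ℝ≥0 → EReal) (u : ℝ) : ℝ :=
  derivWithin (realize F) (Icc 0 (u0 : ℝ)) u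

/-- Extension of a frontier to `[0, ∞]` by the value `-∞` at `∞`. -/
noncomputable def extendTop (F : ℝ≥0 → EReal) (u : ℝ≥0∞) : EReal :=
  if u = ∞ then ⊥ else F u.toNNReal

/-! ### Mechanisms

Times are the real numbers `t ≥ 0`; values at negative times play no role. -/

/-- The Lebesgue measure on the set `[0, ∞)` of times. -/
noncomputable def timeMeasure : Measure ℝ := volume.restrict (Ici 0)

/-- A mechanism: a pre-disclosure flow (Lebesgue measurable) and a disclosure reward. -/
structure Mechanism where
  flow : ℝ → ℝ≥0
  reward : ℝ → ℝ≥0∞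
  measurable_flow : AEMeasurable flow timeMeasure

/-- Present value at `t`, at discount rate `r`, of the flow `x` received during the set `S` of
times. -/
noncomputable def presentValue (r : ℝ) (x : ℝ → ℝ≥0) (t : ℝ) (S : Set ℝ) : ℝ≥0∞ :=
  ∫⁻ s in S, ENNReal.ofReal (r * Real.exp (-r * (s - t))) * (x s : ℝ≥0∞)

/-- Incentive-compatibility: prompt disclosure is weakly better than disclosing with delay `d`
and than never disclosing. -/
def Mechanism.IC (r : ℝ) (m : Mechanism) : Prop :=
  ∀ t : ℝ, 0 ≤ t →
    (∀ d : ℝ, 0 < d →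
      presentValue r m.flow t (Ioo t (t + d)) + ENNReal.ofReal (Real.exp (-r * d)) * m.reward (t + d)
        ≤ m.reward t) ∧
    presentValue r m.flow t (Ioi t) ≤ m.reward t

/-- Distributions of the breakthrough time: probability measures on `[0, ∞)`. -/
structure IsTimeDistribution (G : Measure ℝ) : Prop where
  isProbabilityMeasure : IsProbabilityMeasure G
  nonneg : G (Iio 0) = 0

/-- The principal's payoff
`E_G (r ∫_0^τ e^{-rt} F0(x_t) dt + e^{-rτ} F1(X_τ))`, in `[-∞, ∞)`. -/
noncomputable def payoff (T : Technology) (r : ℝ) (G : Measure ℝ) (m : Mechanism) : EReal :=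
  eintegral G fun τ =>
    eintegral (volume.restrict (Ioo 0 τ))
        (fun t => ((r * Real.exp (-r * t) : ℝ) : EReal) * T.F0 (m.flow t))
      + ((Real.exp (-r * τ) : ℝ) : EReal) * extendTop T.F1 (m.reward τ)

/-- `m` dominates `m'`: weakly better under every distribution, strictly under some. -/
def Dominates (T : Technology) (r : ℝ) (m m' : Mechanism) : Prop :=
  (∀ G, IsTimeDistribution G → payoff T r G m' ≤ payoff T r G m) ∧
    ∃ G, IsTimeDistribution G ∧ payoff T r G m' < payoff T r G m

/-- Incentive-compatible, and not dominated by any incentive-compatible mechanism. -/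
def Undominated (T : Technology) (r : ℝ) (m : Mechanism) : Prop :=
  m.IC r ∧ ∀ m' : Mechanism, m'.IC r → ¬ Dominates T r m' m

/-- Optimal for `G`: undominated, and maximising the payoff among all incentive-compatible
mechanisms. -/
def Optimal (T : Technology) (r : ℝ) (G : Measure ℝ) (m : Mechanism) : Prop :=
  Undominated T r m ∧ ∀ m' : Mechanism, m'.IC r → payoff T r G m' ≤ payoff T r G m

/-! ### Euler equations -/

/-- The superdifferential Euler equation for `G`. -/
def SatisfiesEuler (T : Technology) (G : Measure ℝ) (m : Mechanism) : Prop :=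
  ∃ (φ0 : ℝ → ℝ≥0∞) (φ1 : ℝ → EReal),
    AEMeasurable φ0 timeMeasure ∧
    EIntegrable G φ1 ∧
    (∀ᵐ t ∂timeMeasure, ProbabilityTheory.cdf G t < 1 →
      IsSupergradient T.F0 (m.flow t) ((φ0 t : ℝ≥0∞) : EReal)) ∧
    (∀ᵐ t ∂G, m.reward t ≠ ∞ ∧ IsSupergradient T.F1 (m.reward t).toNNReal (φ1 t)) ∧
    ∀ t : ℝ, 0 ≤ t →
      ((1 - ProbabilityTheory.cdf G t : ℝ) : EReal) * ((φ0 t : ℝ≥0∞) : EReal)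
        + eintegral (G.restrict (Icc 0 t)) φ1 = 0

/-- `F1'(X_t)`, where `X` is the disclosure reward of `m`. -/
noncomputable def rewardSlope (T : Technology) (m : Mechanism) (t : ℝ) : ℝ :=
  frontierDeriv T.u0 T.F1 (m.reward t).toReal

/-- The differential Euler condition at time `t`, for a version `x` of the flow of `m`:
`F0'(x_t) ≥ E_G (F1'(X_τ) | τ > t)`, with equality if `x_t < u0`. The first clause says that
`x_t` lies where `F0'` is a well-defined real number. -/
def EulerAt (T : Technology) (G : Measure ℝ) (m : Mechanism) (x : ℝ → ℝ≥0) (t : ℝ) : Prop :=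
  (0 < x t ∧ x t ≤ T.u0) ∧
    ∫ s, rewardSlope T m s ∂(ProbabilityTheory.cond G (Ioi t)) ≤ frontierDeriv T.u0 T.F0 (x t) ∧
    (x t < T.u0 →
      frontierDeriv T.u0 T.F0 (x t) = ∫ s, rewardSlope T m s ∂(ProbabilityTheory.cond G (Ioi t)))

end Breakthrough

namespace Breakthrough

/-! ### Extended-real integration -/

section EIntegral

variable {α : Type*} [MeasurableSpace α] {μ : Measure α}

/-! Call a mechanism regular (`Regular`) if it is undominated and its payoff is finite for
arbitrarily late breakthroughs. Optimal mechanisms are regular, and so are undominated ones that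
satisfy the Euler equation. Regularity pins down the rewards. Flow and rewards never exceed `u0`.
Incentive constraints bind, so that `X` is the continuation value of `x`
(`Regular.reward_eq_contValue`): slack would allow moving rewards towards `u1`, or raising the flow
towards `u1`. Continuation values never fall below `ustar` (`Regular.us_le_contValue`) and are
decreasing (`Regular.antitoneOn_contValue`), since above `ustar` the new frontier is strictly less
steep than the old one (`slope_F1_lt_F0`), so that replacing a rise by a constant level would be an
improvement.

Sufficiency (`RealEuler.optimal`) is concave programming. The gain from a deviation is at most its
linearisation at the supergradients. By Fubini and the Euler equation the flow part of the
linearisation cancels against the reward part, except for the integral of `f` against the discounted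
surplus `W` of the deviating reward over its own continuation value. Incentive-compatibility makes
`W` decreasing and nonnegative, while `f` has nonpositive integrals over initial segments, so the
remainder is nonpositive.

Necessity (`Optimal.exists_realEuler`) uses needle variations: discounted flow is moved from one
short interval to another (`Optimal.needle`). Each pair of dates yields an inequality between
one-sided slopes of `F0` at the two flows and integrals of one-sided slopes of `F1` over the rewards
in between. These inequalities say precisely that a path with increments in the allowed range fits
between the weighted right and left slopes of `F0`, and `exists_density_between` extracts one
selection `f` of supergradients of `F1` serving all dates at once. The flow cannot be lowered where
the continuation value is zero. In that case both frontiers have finite slope at zero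
(`Optimal.exists_slope_zero`), and they are extended to negative utilities so steeply that the
missing inequalities hold: every large number is a supergradient at zero.

With `ustar > 0` the flow stays above `ustar`, which bounds the slopes of `F0`. As the probability
of no breakthrough tends to zero, the Euler equation forces `f` to have mean zero
(`RealEuler.integral_eq_zero`), and the slope of `F0` becomes the conditional mean of `f`.
Differentiability identifies the supergradients with derivatives. -/

theorem eintegral_mono {f g : α → EReal} (h : ∀ᵐ a ∂μ, f a ≤ g a) :
    eintegral μ f ≤ eintegral μ g := by
  refine EReal.sub_le_sub ?_ ?_
  · exact EReal.coe_ennreal_le_coe_ennreal_iff.2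
      (lintegral_mono_ae (h.mono fun a ha => EReal.toENNReal_le_toENNReal ha))
  · exact EReal.coe_ennreal_le_coe_ennreal_iff.2
      (lintegral_mono_ae (h.mono fun a ha =>
        EReal.toENNReal_le_toENNReal (EReal.neg_le_neg_iff.2 ha)))

theorem eintegral_congr {f g : α → EReal} (h : f =ᵐ[μ] g) : eintegral μ f = eintegral μ g :=
  le_antisymm (eintegral_mono (h.mono fun _ ha => ha.le))
    (eintegral_mono (h.mono fun _ ha => ha.ge))

theorem eintegral_dirac [MeasurableSingletonClass α] (a : α) (f : α → EReal) :
    eintegral (Measure.dirac a) f = f a := by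
  unfold eintegral
  rw [lintegral_dirac, lintegral_dirac]
  rcases le_total 0 (f a) with h | h
  · rw [EReal.coe_toENNReal h, EReal.toENNReal_of_nonpos (by simpa using h)]
    simp
  · rw [EReal.toENNReal_of_nonpos h, EReal.coe_toENNReal (by simpa using h)]
    simp

theorem eintegral_coe {f : α → ℝ} (hf : Integrable f μ) :
    eintegral μ (fun a => (f a : EReal)) = ((∫ a, f a ∂μ : ℝ) : EReal) := by
  unfold eintegral
  rw [integral_eq_lintegral_pos_part_sub_lintegral_neg_part hf]
  have h1 : ∫⁻ a, (f a : EReal).toENNReal ∂μ ≠ ∞ := by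
    simpa [EReal.toENNReal_of_ne_top] using hf.lintegral_lt_top.ne
  have h2 : ∫⁻ a, (-(f a : EReal)).toENNReal ∂μ ≠ ∞ := by
    have := hf.neg.lintegral_lt_top.ne
    simpa [← EReal.coe_neg] using this
  have e1 : ∀ a, (f a : EReal).toENNReal = ENNReal.ofReal (f a) := fun a => by simp
  have e2 : ∀ a, (-(f a : EReal)).toENNReal = ENNReal.ofReal (-f a) := fun a => by
    rw [← EReal.coe_neg]; simp
  simp_rw [e1, e2] at h1 h2 ⊢
  rw [EReal.coe_sub, ← EReal.coe_ennreal_toReal h1, ← EReal.coe_ennreal_toReal h2]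

theorem EIntegrable.ae_real {f : α → EReal} (hf : EIntegrable μ f) :
    (∀ᵐ a ∂μ, f a ≠ ⊥ ∧ f a ≠ ⊤) ∧ Integrable (fun a => (f a).toReal) μ := by
  obtain ⟨hm, h1, h2⟩ := hf
  have m1 : AEMeasurable (fun a => (f a).toENNReal) μ :=
    measurable_ereal_toENNReal.comp_aemeasurable hm
  have m2 : AEMeasurable (fun a => (-f a).toENNReal) μ :=
    measurable_ereal_toENNReal.comp_aemeasurable (measurable_neg.comp_aemeasurable hm)
  have hne : ∀ᵐ a ∂μ, f a ≠ ⊥ ∧ f a ≠ ⊤ := by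
    filter_upwards [ae_lt_top' m1 h1, ae_lt_top' m2 h2] with a ha hb
    constructor <;> intro hc <;> simp [hc] at ha hb
  refine ⟨hne, (measurable_ereal_toReal.comp_aemeasurable hm).aestronglyMeasurable, ?_⟩
  rw [HasFiniteIntegral]
  have : ∫⁻ a, ‖(f a).toReal‖ₑ ∂μ ≤ ∫⁻ a, ((f a).toENNReal + (-f a).toENNReal) ∂μ := by
    refine lintegral_mono_ae ?_
    filter_upwards [hne] with a h1
    lift f a to ℝ using h1.symm with y
    rw [← EReal.coe_neg]
    simp only [EReal.toReal_coe]
    rw [Real.enorm_eq_ofReal_abs]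
    rcases le_total 0 y with h | h
    · rw [abs_of_nonneg h]; exact le_self_add
    · rw [abs_of_nonpos h]; exact le_add_self
  refine this.trans_lt ?_
  rw [lintegral_add_right' _ m2]
  exact ENNReal.add_lt_top.2 ⟨h1.lt_top, h2.lt_top⟩

theorem EIntegrable.eintegral_eq {f : α → EReal} (hf : EIntegrable μ f) :
    eintegral μ f = ((∫ a, (f a).toReal ∂μ : ℝ) : EReal) := by
  rw [← eintegral_coe hf.ae_real.2]
  refine eintegral_congr ?_
  filter_upwards [hf.ae_real.1] with a h
  exact (EReal.coe_toReal h.2 h.1).symm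

/-- A function bounded above by an integrable one has integral `-∞`, or is a.e. real-valued and
integrable. -/
theorem eintegral_eq_bot_or {f : α → EReal} {g : α → ℝ} (hf : AEMeasurable f μ)
    (hg : Integrable g μ) (hfg : ∀ᵐ a ∂μ, f a ≤ g a) :
    eintegral μ f = ⊥ ∨
      ((∀ᵐ a ∂μ, f a ≠ ⊥) ∧ Integrable (fun a => (f a).toReal) μ ∧
        eintegral μ f = ((∫ a, (f a).toReal ∂μ : ℝ) : EReal)) := by
  have hpos : ∫⁻ a, (f a).toENNReal ∂μ ≠ ∞ := by
    refine ne_top_of_le_ne_top hg.lintegral_lt_top.ne (lintegral_mono_ae ?_)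
    filter_upwards [hfg] with a ha
    simpa using EReal.toENNReal_le_toENNReal ha
  by_cases hneg : ∫⁻ a, (-f a).toENNReal ∂μ = ∞
  · left
    unfold eintegral
    rw [hneg, ← EReal.coe_ennreal_toReal hpos]
    simp
  · have h : EIntegrable μ f := ⟨hf, hpos, hneg⟩
    exact Or.inr ⟨h.ae_real.1.mono fun _ ha => ha.1, h.ae_real.2, h.eintegral_eq⟩

theorem EIntegrable.restrict {f : α → EReal} (hf : EIntegrable μ f) (s : Set α) :
    EIntegrable (μ.restrict s) f :=
  ⟨hf.1.mono_measure Measure.restrict_le_self,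
    ne_top_of_le_ne_top hf.2.1 (lintegral_mono' Measure.restrict_le_self le_rfl),
    ne_top_of_le_ne_top hf.2.2 (lintegral_mono' Measure.restrict_le_self le_rfl)⟩

theorem eIntegrable_coe {f : α → ℝ} (hf : Integrable f μ) :
    EIntegrable μ (fun a => (f a : EReal)) := by
  refine ⟨measurable_coe_real_ereal.comp_aemeasurable hf.aestronglyMeasurable.aemeasurable,
    ?_, ?_⟩
  · simpa using hf.lintegral_lt_top.ne
  · have := hf.neg.lintegral_lt_top.ne
    simpa [← EReal.coe_neg] using this

end EIntegral

/-! ### Payoffs -/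

/-- Discount weight of the flow at time `t`. -/
noncomputable def weight (r t : ℝ) : ℝ := r * Real.exp (-r * t)

theorem weight_pos {r : ℝ} (hr : 0 < r) (t : ℝ) : 0 < weight r t := by
  unfold weight; positivity

theorem continuous_weight (r : ℝ) : Continuous (weight r) := by
  unfold weight; fun_prop

/-- Payoff conditional on the breakthrough time. -/
noncomputable def payoffAt (T : Technology) (r : ℝ) (m : Mechanism) (τ : ℝ) : EReal :=
  eintegral (volume.restrict (Ioo 0 τ)) (fun t => ((weight r t : ℝ) : EReal) * T.F0 (m.flow t))
    + ((Real.exp (-r * τ) : ℝ) : EReal) * extendTop T.F1 (m.reward τ)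

theorem payoff_eq (T : Technology) (r : ℝ) (G : Measure ℝ) (m : Mechanism) :
    payoff T r G m = eintegral G (payoffAt T r m) := rfl

theorem IsTimeDistribution.ae_nonneg {G : Measure ℝ} (hG : IsTimeDistribution G) :
    ∀ᵐ t ∂G, 0 ≤ t := by
  rw [ae_iff]
  simpa [not_le, Set.Iio_def] using hG.nonneg

theorem isTimeDistribution_dirac {τ : ℝ} (hτ : 0 ≤ τ) : IsTimeDistribution (Measure.dirac τ) :=
  ⟨inferInstance, by rw [Measure.dirac_apply' _ measurableSet_Iio]; simp [hτ]⟩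

theorem payoff_mono {T : Technology} {r : ℝ} {m m' : Mechanism}
    (h : ∀ τ, 0 ≤ τ → payoffAt T r m τ ≤ payoffAt T r m' τ) {G : Measure ℝ}
    (hG : IsTimeDistribution G) : payoff T r G m ≤ payoff T r G m' :=
  eintegral_mono (hG.ae_nonneg.mono fun τ hτ => h τ hτ)

/-- Point masses are admissible distributions, so domination can be tested one breakthrough time at
a time. -/
theorem dominates_of_payoffAt {T : Technology} {r : ℝ} {m m' : Mechanism}
    (h : ∀ τ, 0 ≤ τ → payoffAt T r m τ ≤ payoffAt T r m' τ)
    (h' : ∃ τ, 0 ≤ τ ∧ payoffAt T r m τ < payoffAt T r m' τ) : Dominates T r m' m := by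
  obtain ⟨τ, hτ, hlt⟩ := h'
  refine ⟨fun G hG => payoff_mono h hG, Measure.dirac τ, isTimeDistribution_dirac hτ, ?_⟩
  rwa [payoff_eq, payoff_eq, eintegral_dirac, eintegral_dirac]

/-! ### Concave extended-real functions -/

/-- `η` is a (real) supergradient of `F` at the point `u` of its effective domain. -/
def SlopeAt (F : ℝ≥0 → EReal) (u : ℝ≥0) (η : ℝ) : Prop :=
  F u ≠ ⊥ ∧ ∀ v : ℝ≥0, F v ≤ (((F u).toReal + η * ((v : ℝ) - u) : ℝ) : EReal)

theorem SlopeAt.isSupergradient {F : ℝ≥0 → EReal} (hF : ∀ u, F u < ⊤) {u : ℝ≥0} {η : ℝ}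
    (h : SlopeAt F u η) : IsSupergradient F u η := by
  refine ⟨subset_closure h.1, fun v _ => ?_⟩
  have h2 := h.2 v
  have hu := EReal.coe_toReal (hF u).ne h.1
  by_cases hv : F v = ⊥
  · simp [hv]
  rw [← EReal.coe_toReal (hF v).ne hv] at h2 ⊢
  rw [← hu, ← EReal.coe_mul, ← EReal.coe_add]
  rw [EReal.coe_le_coe_iff] at h2 ⊢
  linarith

/-- A real supergradient at `u` bounds `F u` below through any point `v` where `F` is finite, so `u`
cannot be a mere limit point of the effective domain. -/
theorem IsSupergradient.slopeAt {F : ℝ≥0 → EReal} (hF : ∀ u, F u < ⊤) {u v : ℝ≥0} {η : ℝ}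
    (h : IsSupergradient F u η) (hv : F v ≠ ⊥) : SlopeAt F u η := by
  have hu : F u ≠ ⊥ := by
    by_cases hvu : v = u
    · rwa [← hvu]
    have := h.2 v hvu
    rw [← EReal.coe_toReal (hF v).ne hv, ← EReal.coe_mul, ← EReal.coe_add] at this
    exact ne_bot_of_le_ne_bot (EReal.coe_ne_bot _) this
  refine ⟨hu, fun w => ?_⟩
  by_cases hwu : w = u
  · subst hwu; simp [EReal.coe_toReal (hF w).ne hu]
  by_cases hw : F w = ⊥
  · simp [hw]
  have := h.2 w hwu
  rw [← EReal.coe_toReal (hF w).ne hw, ← EReal.coe_mul, ← EReal.coe_add,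
    ← EReal.coe_toReal (hF u).ne hu, EReal.coe_le_coe_iff] at this
  rw [← EReal.coe_toReal (hF w).ne hw, EReal.coe_le_coe_iff]
  linarith

theorem SlopeAt.le_toReal {F : ℝ≥0 → EReal} (hF : ∀ u, F u < ⊤) {u v : ℝ≥0} {η : ℝ}
    (h : SlopeAt F u η) (hv : F v ≠ ⊥) :
    (F v).toReal ≤ (F u).toReal + η * ((v : ℝ) - u) := by
  have := h.2 v
  rwa [← EReal.coe_toReal (hF v).ne hv, EReal.coe_le_coe_iff] at this

theorem EConcave.real {F : ℝ≥0 → EReal} (hc : EConcave F) (hF : ∀ u, F u < ⊤) {u v a b : ℝ≥0}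
    (hab : a + b = 1) (hu : F u ≠ ⊥) (hv : F v ≠ ⊥) :
    F (a * u + b * v) ≠ ⊥ ∧
      (a : ℝ) * (F u).toReal + b * (F v).toReal ≤ (F (a * u + b * v)).toReal := by
  have := hc u v a b hab
  rw [← EReal.coe_toReal (hF u).ne hu, ← EReal.coe_toReal (hF v).ne hv, ← EReal.coe_mul,
    ← EReal.coe_mul, ← EReal.coe_add] at this
  have hb : F (a * u + b * v) ≠ ⊥ := ne_bot_of_le_ne_bot (EReal.coe_ne_bot _) this
  refine ⟨hb, ?_⟩
  rwa [← EReal.coe_toReal (hF _).ne hb, EReal.coe_le_coe_iff] at this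

theorem exists_convex_comb {u w v : ℝ≥0} (h1 : u < w) (h2 : w < v) :
    ∃ a b : ℝ≥0, 0 < a ∧ 0 < b ∧ a + b = 1 ∧ a * u + b * v = w := by
  have h1' : (u : ℝ) < w := h1
  have h2' : (w : ℝ) < v := h2
  have h3 : (0 : ℝ) < v - u := by linarith
  refine ⟨⟨(v - w) / (v - u), div_nonneg (by linarith) h3.le⟩,
    ⟨(w - u) / (v - u), div_nonneg (by linarith) h3.le⟩, ?_, ?_, ?_, ?_⟩
  · exact div_pos (by linarith) h3
  · exact div_pos (by linarith) h3
  · apply NNReal.eq; push_cast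
    change (v - w) / (v - u) + (w - u) / (v - u) = (1 : ℝ)
    field_simp; ring
  · apply NNReal.eq; push_cast
    change (v - w) / (v - u) * u + (w - u) / (v - u) * v = (w : ℝ)
    field_simp; ring

/-- A linear upper bound that holds at a point between `u` and `v` extends to `v`. -/
theorem EConcave.le_of_between {F : ℝ≥0 → EReal} (hc : EConcave F) (hF : ∀ u, F u < ⊤)
    {u v : ℝ≥0} {η : ℝ} (hu : F u ≠ ⊥) {a b : ℝ≥0} (ha : 0 < a) (hab : a + b = 1)
    (h : F (a * v + b * u) ≤
      (((F u).toReal + η * (((a * v + b * u : ℝ≥0) : ℝ) - u) : ℝ) : EReal)) :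
    F v ≤ (((F u).toReal + η * ((v : ℝ) - u) : ℝ) : EReal) := by
  by_cases hv : F v = ⊥
  · simp [hv]
  obtain ⟨hb, hle⟩ := hc.real hF hab hv hu
  rw [← EReal.coe_toReal (hF _).ne hb, EReal.coe_le_coe_iff] at h
  rw [← EReal.coe_toReal (hF _).ne hv, EReal.coe_le_coe_iff]
  have hab' : (a : ℝ) + b = 1 := by exact_mod_cast hab
  have ha' : (0 : ℝ) < a := ha
  push_cast at h
  have hb' : (b : ℝ) = 1 - a := by linarith
  rw [hb'] at h hle
  have key : (a : ℝ) * (F v).toReal ≤ a * ((F u).toReal + η * ((v : ℝ) - u)) := by linarith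
  exact le_of_mul_le_mul_left key ha'

/-- Local supergradients are global. -/
theorem EConcave.slopeAt_of_eventually {F : ℝ≥0 → EReal} (hc : EConcave F) (hF : ∀ u, F u < ⊤)
    {u : ℝ≥0} {η : ℝ} (hu : F u ≠ ⊥)
    (h : ∀ᶠ v in 𝓝 u, F v ≤ (((F u).toReal + η * ((v : ℝ) - u) : ℝ) : EReal)) :
    SlopeAt F u η := by
  refine ⟨hu, fun v => ?_⟩
  -- Points of the segment from `u` to `v` close to `u` satisfy the local bound; concavity carries
  -- it out to `v`.
  have ht : Tendsto (fun n : ℕ => ((n : ℝ≥0) + 1)⁻¹ * v + (1 - ((n : ℝ≥0) + 1)⁻¹) * u) atTop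
      (𝓝 (0 * v + (1 - 0) * u)) := by
    have h0 : Tendsto (fun n : ℕ => ((n : ℝ≥0) + 1)⁻¹) atTop (𝓝 0) := by
      have := tendsto_one_div_add_atTop_nhds_zero_nat (𝕜 := ℝ≥0)
      simpa using this
    exact (h0.mul tendsto_const_nhds).add
      ((tendsto_const_nhds.sub h0).mul tendsto_const_nhds)
  simp only [zero_mul, tsub_zero, one_mul, zero_add] at ht
  obtain ⟨n, hn⟩ := (ht.eventually h).exists
  refine hc.le_of_between hF hu (a := ((n : ℝ≥0) + 1)⁻¹) (by positivity) ?_ hn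
  refine add_tsub_cancel_of_le ?_
  rw [inv_le_one₀ (by positivity)]
  simp

/-- The point `v` is a convex combination of `u` and the peak with positive weight on the peak,
which is strictly higher than `u`. -/
theorem EConcave.lt_of_lt_peak {F : ℝ≥0 → EReal} (hc : EConcave F) (hF : ∀ u, F u < ⊤) {p : ℝ≥0}
    (hp : ∀ u, u ≠ p → F u < F p) {u v : ℝ≥0} (huv : u < v) (hvp : v ≤ p) (hv : F v ≠ ⊥) :
    F u < F v := by
  rcases hvp.eq_or_lt with rfl | hvp
  · exact hp u huv.ne
  by_cases hu : F u = ⊥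
  · rw [hu]; exact bot_lt_iff_ne_bot.2 hv
  obtain ⟨a, b, ha, hb, hab, rfl⟩ := exists_convex_comb huv hvp
  have hpu := hp u (huv.trans hvp).ne
  have hpb : F p ≠ ⊥ := (bot_le.trans_lt hpu).ne'
  obtain ⟨h1, h2⟩ := hc.real hF hab hu hpb
  rw [← EReal.coe_toReal (hF _).ne hu, ← EReal.coe_toReal (hF _).ne h1, EReal.coe_lt_coe_iff]
  rw [← EReal.coe_toReal (hF _).ne hu, ← EReal.coe_toReal (hF _).ne hpb,
    EReal.coe_lt_coe_iff] at hpu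
  have hab' : (a : ℝ) + b = 1 := by exact_mod_cast hab
  have hb' : (0 : ℝ) < b := hb
  have hb'' : (a : ℝ) = 1 - b := by linarith
  rw [hb''] at h2
  nlinarith

theorem EConcave.lt_of_peak_lt {F : ℝ≥0 → EReal} (hc : EConcave F) (hF : ∀ u, F u < ⊤) {p : ℝ≥0}
    (hp : ∀ u, u ≠ p → F u < F p) {u v : ℝ≥0} (huv : u < v) (hpu : p ≤ u) (hu : F u ≠ ⊥) :
    F v < F u := by
  rcases hpu.eq_or_lt with rfl | hpu
  · exact hp v huv.ne'
  by_cases hv : F v = ⊥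
  · rw [hv]; exact bot_lt_iff_ne_bot.2 hu
  obtain ⟨a, b, ha, hb, hab, rfl⟩ := exists_convex_comb hpu huv
  have hpv := hp v (hpu.trans huv).ne'
  have hpb : F p ≠ ⊥ := (bot_le.trans_lt hpv).ne'
  obtain ⟨h1, h2⟩ := hc.real hF hab hpb hv
  rw [← EReal.coe_toReal (hF _).ne hv, ← EReal.coe_toReal (hF _).ne h1, EReal.coe_lt_coe_iff]
  rw [← EReal.coe_toReal (hF _).ne hv, ← EReal.coe_toReal (hF _).ne hpb,
    EReal.coe_lt_coe_iff] at hpv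
  have hab' : (a : ℝ) + b = 1 := by exact_mod_cast hab
  have ha' : (0 : ℝ) < a := ha
  have hb'' : (b : ℝ) = 1 - a := by linarith
  rw [hb''] at h2
  nlinarith

theorem realize_coe (F : ℝ≥0 → EReal) (u : ℝ≥0) : realize F u = (F u).toReal := by
  simp [realize]

theorem EConcave.concaveOn_realize {F : ℝ≥0 → EReal} (hc : EConcave F) (hF : ∀ u, F u < ⊤)
    {S : Set ℝ} (hS : Convex ℝ S) (h0 : ∀ u ∈ S, 0 ≤ u) (hb : ∀ u ∈ S, F u.toNNReal ≠ ⊥) :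
    ConcaveOn ℝ S (realize F) := by
  refine ⟨hS, fun u hu v hv a b ha hb' hab => ?_⟩
  obtain ⟨h1, h2⟩ := hc.real hF (a := a.toNNReal) (b := b.toNNReal)
    (by rw [← Real.toNNReal_add ha hb', hab, Real.toNNReal_one]) (hb u hu) (hb v hv)
  rw [Real.coe_toNNReal _ ha, Real.coe_toNNReal _ hb'] at h2
  have : (a • u + b • v).toNNReal = a.toNNReal * u.toNNReal + b.toNNReal * v.toNNReal := by
    simp only [smul_eq_mul]
    rw [Real.toNNReal_add (mul_nonneg ha (h0 u hu)) (mul_nonneg hb' (h0 v hv)),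
      Real.toNNReal_mul ha, Real.toNNReal_mul hb']
  simp only [realize, this]
  exact h2

/-- Any slope between the two one-sided derivatives of a concave function supports it. -/
theorem _root_.ConcaveOn.le_of_mem_sideDerivs {S : Set ℝ} {f : ℝ → ℝ} (hf : ConcaveOn ℝ S f)
    {u v η : ℝ} (hu : u ∈ interior S) (hv : v ∈ S)
    (hR : derivWithin f (Ioi u) u ≤ η) (hL : η ≤ derivWithin f (Iio u) u) :
    f v ≤ f u + η * (v - u) := by
  have hd1 : DifferentiableWithinAt ℝ f (Ioi u) u := by
    simpa using (hf.neg.differentiableWithinAt_Ioi_of_mem_interior hu).neg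
  have hd2 : DifferentiableWithinAt ℝ f (Iio u) u := by
    simpa using (hf.neg.differentiableWithinAt_Iio_of_mem_interior hu).neg
  rcases lt_trichotomy u v with h | h | h
  · have := (hf.slope_le_rightDeriv (interior_subset hu) hv h hd1).trans hR
    rw [slope_def_field, div_le_iff₀ (by linarith)] at this
    linarith
  · subst h; simp
  · have := hL.trans (hf.leftDeriv_le_slope hv (interior_subset hu) h hd2)
    rw [slope_def_field, le_div_iff₀ (by linarith)] at this
    linarith

theorem _root_.ConcaveOn.rightDeriv_le_leftDeriv {S : Set ℝ} {f : ℝ → ℝ} (hf : ConcaveOn ℝ S f)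
    {u : ℝ} (hu : u ∈ interior S) : derivWithin f (Ioi u) u ≤ derivWithin f (Iio u) u := by
  have := hf.neg.leftDeriv_le_rightDeriv_of_mem_interior hu
  rw [derivWithin.neg, derivWithin.neg] at this
  linarith

/-! ### The two frontiers -/

namespace Technology

variable (T : Technology)

theorem F0_lt_top (u : ℝ≥0) : T.F0 u < ⊤ := (T.F0_le_F1 u).trans_lt (T.F1_lt_top u)

theorem F1_ne_bot {u : ℝ≥0} (h : 0 < u) (h' : u ≤ T.u0) : T.F1 u ≠ ⊥ :=
  ne_bot_of_le_ne_bot (T.finite_F0 u h h') (T.F0_le_F1 u)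

theorem F0_u0_ne_bot : T.F0 T.u0 ≠ ⊥ := T.finite_F0 _ T.u0_pos le_rfl

theorem F1_u0_ne_bot : T.F1 T.u0 ≠ ⊥ := T.F1_ne_bot T.u0_pos le_rfl

theorem F0_le_peak (u : ℝ≥0) : T.F0 u ≤ T.F0 T.u0 := by
  by_cases h : u = T.u0
  · rw [h]
  · exact (T.peak_F0 u h).le

theorem F1_le_peak (u : ℝ≥0) : T.F1 u ≤ T.F1 T.u1 := by
  by_cases h : u = T.u1
  · rw [h]
  · exact (T.peak_F1 u h).le

theorem F1_u1_ne_bot : T.F1 T.u1 ≠ ⊥ := ne_bot_of_le_ne_bot T.F1_u0_ne_bot (T.F1_le_peak _)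

theorem F0_strictMono {u v : ℝ≥0} (huv : u < v) (hv : v ≤ T.u0) : T.F0 u < T.F0 v :=
  T.concave_F0.lt_of_lt_peak T.F0_lt_top T.peak_F0 huv hv
    (T.finite_F0 v (bot_le.trans_lt huv) hv)

theorem F0_mono {u v : ℝ≥0} (huv : u ≤ v) (hv : v ≤ T.u0) : T.F0 u ≤ T.F0 v := by
  rcases huv.eq_or_lt with rfl | h
  · exact le_rfl
  · exact (T.F0_strictMono h hv).le

theorem F0_le_min (u : ℝ≥0) : T.F0 u ≤ T.F0 (min u T.u0) := by
  rcases le_total u T.u0 with h | h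
  · rw [min_eq_left h]
  · rw [min_eq_right h]; exact T.F0_le_peak u

theorem F1_strictMono {u v : ℝ≥0} (huv : u < v) (hv : v ≤ T.u1) : T.F1 u < T.F1 v :=
  T.concave_F1.lt_of_lt_peak T.F1_lt_top T.peak_F1 huv hv
    (T.F1_ne_bot (bot_le.trans_lt huv) (hv.trans T.u1_lt_u0.le))

theorem F1_strictAnti {u v : ℝ≥0} (huv : u < v) (hu : T.u1 ≤ u) (hu0 : u ≤ T.u0) :
    T.F1 v < T.F1 u := by
  refine T.concave_F1.lt_of_peak_lt T.F1_lt_top T.peak_F1 huv hu ?_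
  rcases hu.eq_or_lt with rfl | h
  · exact T.F1_u1_ne_bot
  · exact T.F1_ne_bot (bot_le.trans_lt h) hu0

/-- Moving a reward towards the peak `u1`. -/
theorem F1_anti {u v : ℝ≥0} (huv : u ≤ v) (hu : T.u1 ≤ u) (hu0 : u ≤ T.u0) :
    T.F1 v ≤ T.F1 u := by
  rcases huv.eq_or_lt with rfl | h
  · exact le_rfl
  · exact (T.F1_strictAnti h hu hu0).le

theorem concaveOn_F0 : ConcaveOn ℝ (Ioc 0 (T.u0 : ℝ)) (realize T.F0) := by
  refine T.concave_F0.concaveOn_realize T.F0_lt_top (convex_Ioc _ _) (fun u hu => hu.1.le)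
    fun u hu => T.finite_F0 _ (Real.toNNReal_pos.2 hu.1) (Real.toNNReal_le_iff_le_coe.2 hu.2)

theorem concaveOn_F1 : ConcaveOn ℝ (Ioc 0 (T.u0 : ℝ)) (realize T.F1) := by
  refine T.concave_F1.concaveOn_realize T.F1_lt_top (convex_Ioc _ _) (fun u hu => hu.1.le)
    fun u hu => T.F1_ne_bot (Real.toNNReal_pos.2 hu.1) (Real.toNNReal_le_iff_le_coe.2 hu.2)

end Technology

theorem EConcave.exists_slopeAt {F : ℝ≥0 → EReal} (hc : EConcave F) (hF : ∀ u, F u < ⊤) {p u : ℝ≥0}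
    (hfin : ∀ u, 0 < u → u ≤ p → F u ≠ ⊥) (hu : 0 < u) (hup : u < p) : ∃ η, SlopeAt F u η := by
  have hconc : ConcaveOn ℝ (Ioc 0 (p : ℝ)) (realize F) :=
    hc.concaveOn_realize hF (convex_Ioc _ _) (fun u hu => hu.1.le)
      fun u hu => hfin _ (Real.toNNReal_pos.2 hu.1) (Real.toNNReal_le_iff_le_coe.2 hu.2)
  have hui : (u : ℝ) ∈ interior (Ioc 0 (p : ℝ)) := by
    rw [interior_Ioc]; exact ⟨hu, hup⟩
  refine ⟨derivWithin (realize F) (Ioi u) u, hc.slopeAt_of_eventually hF (hfin u hu hup.le) ?_⟩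
  filter_upwards [Ioo_mem_nhds hu hup] with v hv
  have := hconc.le_of_mem_sideDerivs hui (v := (v : ℝ)) ⟨hv.1, hv.2.le⟩ le_rfl
    (hconc.rightDeriv_le_leftDeriv hui)
  rw [realize_coe, realize_coe] at this
  rwa [← EReal.coe_toReal (hF v).ne (hfin v hv.1 hv.2.le), EReal.coe_le_coe_iff]

/-! ### Comparison of the slopes of the two frontiers -/

namespace Technology

variable (T : Technology)

/-- At a local maximum of `F1 - F0`, supergradients of `F0` are supergradients of `F1`. -/
theorem slopeAt_F1_of_localMax {w : ℝ≥0} {η : ℝ} (h : SlopeAt T.F0 w η)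
    (hmax : ∀ᶠ v in 𝓝 w, T.F1 v - T.F0 v ≤ T.F1 w - T.F0 w)
    (hfin : ∀ᶠ v in 𝓝 w, T.F0 v ≠ ⊥) : SlopeAt T.F1 w η := by
  have hw1 : T.F1 w ≠ ⊥ := ne_bot_of_le_ne_bot h.1 (T.F0_le_F1 w)
  refine T.concave_F1.slopeAt_of_eventually T.F1_lt_top hw1 ?_
  filter_upwards [hmax, hfin] with v hv hb
  have hv1 : T.F1 v ≠ ⊥ := ne_bot_of_le_ne_bot hb (T.F0_le_F1 v)
  have h0 := h.le_toReal T.F0_lt_top hb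
  rw [← EReal.coe_toReal (T.F1_lt_top v).ne hv1, ← EReal.coe_toReal (T.F0_lt_top v).ne hb,
    ← EReal.coe_toReal (T.F1_lt_top w).ne hw1, ← EReal.coe_toReal (T.F0_lt_top w).ne h.1,
    ← EReal.coe_sub, ← EReal.coe_sub, EReal.coe_le_coe_iff] at hv
  rw [← EReal.coe_toReal (T.F1_lt_top v).ne hv1, EReal.coe_le_coe_iff]
  linarith

/-- The rightmost level with equal slopes. -/
noncomputable abbrev us : ℝ≥0 := ustar T.F0 T.F1 T.u0

theorem le_us {u : ℝ≥0} (hu : u < T.u0) {η : ℝ} (h0 : SlopeAt T.F0 u η) (h1 : SlopeAt T.F1 u η) :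
    u ≤ T.us :=
  le_csSup ⟨T.u0, fun _ hv => hv.1.le⟩
    ⟨hu, η, h0.isSupergradient T.F0_lt_top, h1.isSupergradient T.F1_lt_top⟩

/-- Strictly between `u1` and `u0` the old frontier still rises towards its peak, so its
supergradients are positive, while those of the new frontier are negative. No supergradient can be
shared there. -/
theorem us_le_u1 : T.us ≤ T.u1 := by
  refine csSup_le' ?_
  rintro u ⟨hu, η, h0, h1⟩
  by_contra! hlt
  have h0' := h0.2 T.u0 hu.ne'
  have h1' := h1.2 T.u1 hlt.ne
  have hu1 : T.F1 u ≠ ⊥ := T.F1_ne_bot (bot_le.trans_lt hlt) hu.le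
  have hu0 : T.F0 u ≠ ⊥ := T.finite_F0 u (bot_le.trans_lt hlt) hu.le
  have hp0 := T.peak_F0 u hu.ne
  have hp1 := T.peak_F1 u hlt.ne'
  have d0 : (u : ℝ) - T.u0 < 0 := sub_neg.2 hu
  have d1 : (0 : ℝ) < (u : ℝ) - T.u1 := sub_pos.2 hlt
  rw [← EReal.coe_toReal (T.F0_lt_top u).ne hu0,
    ← EReal.coe_toReal (T.F0_lt_top T.u0).ne T.F0_u0_ne_bot] at h0' hp0
  rw [← EReal.coe_toReal (T.F1_lt_top u).ne hu1,
    ← EReal.coe_toReal (T.F1_lt_top T.u1).ne T.F1_u1_ne_bot] at h1' hp1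
  rw [EReal.coe_lt_coe_iff] at hp0 hp1
  induction η with
  | bot =>
    rw [EReal.bot_mul_coe_of_neg d0, EReal.coe_add_top] at h0'
    exact absurd h0' (by simp)
  | top =>
    rw [EReal.top_mul_coe_of_pos d1, EReal.coe_add_top] at h1'
    exact absurd h1' (by simp)
  | coe η =>
    rw [← EReal.coe_mul, ← EReal.coe_add, EReal.coe_le_coe_iff] at h0' h1'
    have : 0 < η := by nlinarith
    nlinarith

theorem us_lt_u0 : T.us < T.u0 := T.us_le_u1.trans_lt T.u1_lt_u0

theorem eventually_F0_ne_bot {w : ℝ≥0} (h : 0 < w) (h' : w < T.u0) :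
    ∀ᶠ v in 𝓝 w, T.F0 v ≠ ⊥ := by
  filter_upwards [Ioo_mem_nhds h h'] with v hv using T.finite_F0 v hv.1 hv.2.le

/-- Supergradients of `F0` at `ustar > 0` are supergradients of `F1`. -/
theorem slopeAt_us (h : 0 < T.us) {η : ℝ} (h0 : SlopeAt T.F0 T.us η) : SlopeAt T.F1 T.us η := by
  refine T.slopeAt_F1_of_localMax h0 ?_ (T.eventually_F0_ne_bot h T.us_lt_u0)
  have := T.generic h
  rw [eventually_nhdsWithin_iff] at this
  filter_upwards [this] with v hv
  by_cases hvu : v = T.us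
  · rw [hvu]
  · exact (hv hvu).le

/-- Between `ustar` and the peak `u0`, the new frontier is less steep than the old. -/
theorem slope_F1_lt_F0 {u : ℝ≥0} (hu : T.us < u) (hu0 : u < T.u0) {η0 η1 : ℝ}
    (h0 : SlopeAt T.F0 u η0) (h1 : SlopeAt T.F1 u η1) : η1 < η0 := by
  by_contra! hle
  have hupos : 0 < u := bot_le.trans_lt hu
  -- The contradiction comes from maximising `F1 - F0` over `[u, v]`: at a maximiser below `v` the
  -- frontiers share a supergradient, to the right of `ustar`.
  obtain ⟨v, hv1, hv2⟩ := exists_between (max_lt hu0 T.u1_lt_u0)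
  have huv : u < v := (le_max_left _ _).trans_lt hv1
  have h1v : T.u1 < v := (le_max_right _ _).trans_lt hv1
  have hcont : ∀ f : ℝ → ℝ, ConcaveOn ℝ (Ioc 0 (T.u0 : ℝ)) f → ContinuousOn f (Icc u v) := by
    intro f hf
    have hf' := hf.subset Ioo_subset_Ioc_self (convex_Ioo _ _)
    refine (hf'.continuousOn isOpen_Ioo).mono fun z hz => ⟨?_, ?_⟩
    · exact lt_of_lt_of_le (show (0 : ℝ) < u from hupos) hz.1
    · exact lt_of_le_of_lt hz.2 hv2
  obtain ⟨z, hz, hmax⟩ := isCompact_Icc.exists_isMaxOn (nonempty_Icc.2 (NNReal.coe_le_coe.2 huv.le))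
    ((hcont _ T.concaveOn_F1).sub (hcont _ T.concaveOn_F0))
  have hz0 : 0 ≤ z := u.2.trans hz.1
  lift z to ℝ≥0 using hz0
  have huz : u ≤ z := hz.1
  have hzv : z ≤ v := hz.2
  have hmax' : ∀ w : ℝ≥0, u ≤ w → w ≤ v → (T.F1 w).toReal - (T.F0 w).toReal ≤
      (T.F1 z).toReal - (T.F0 z).toReal := by
    intro w h1 h2
    have := hmax (show (w : ℝ) ∈ Icc (u : ℝ) v from ⟨h1, h2⟩)
    simpa [realize_coe] using this
  have fin0 : ∀ w : ℝ≥0, u ≤ w → w ≤ v → T.F0 w ≠ ⊥ := fun w h1 h2 =>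
    T.finite_F0 w (hupos.trans_le h1) (h2.trans hv2.le)
  have fin1 : ∀ w : ℝ≥0, u ≤ w → w ≤ v → T.F1 w ≠ ⊥ := fun w h1 h2 =>
    T.F1_ne_bot (hupos.trans_le h1) (h2.trans hv2.le)
  -- The right end point is not a maximiser: beyond `max u u1`, `F1` falls and `F0` rises.
  have hzv' : z < v := by
    by_contra! hvz
    obtain rfl : z = v := le_antisymm hzv hvz
    have hw := hmax' (max u T.u1) (le_max_left _ _) hv1.le
    have f1 := T.F1_strictAnti hv1 (le_max_right _ _) (hv1.le.trans hv2.le)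
    have f0 := T.F0_strictMono hv1 hv2.le
    have b0 := fin0 (max u T.u1) (le_max_left _ _) hv1.le
    have b1 := fin1 (max u T.u1) (le_max_left _ _) hv1.le
    rw [← EReal.coe_toReal (T.F1_lt_top _).ne b1,
      ← EReal.coe_toReal (T.F1_lt_top _).ne (fin1 z huz le_rfl), EReal.coe_lt_coe_iff] at f1
    rw [← EReal.coe_toReal (T.F0_lt_top _).ne b0,
      ← EReal.coe_toReal (T.F0_lt_top _).ne (fin0 z huz le_rfl), EReal.coe_lt_coe_iff] at f0
    linarith
  have hzu0 : z < T.u0 := hzv'.trans hv2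
  rcases huz.eq_or_lt with rfl | huz'
  · -- the maximum is at `u`
    -- To the right of `u` the bound comes from maximality, to the left from the supergradient `η1 ≥
    -- η0` of `F1`.
    have : SlopeAt T.F1 u η0 := by
      refine T.concave_F1.slopeAt_of_eventually T.F1_lt_top h1.1 ?_
      filter_upwards [Ioo_mem_nhds hupos huv] with w hw
      rcases le_total u w with h | h
      · have hb := fin1 w h hw.2.le
        rw [← EReal.coe_toReal (T.F1_lt_top _).ne hb, EReal.coe_le_coe_iff]
        have e1 := hmax' w h hw.2.le
        have e2 := h0.le_toReal T.F0_lt_top (fin0 w h hw.2.le)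
        linarith
      · refine (h1.2 w).trans ?_
        rw [EReal.coe_le_coe_iff]
        have : (w : ℝ) - u ≤ 0 := sub_nonpos.2 h
        nlinarith
    exact absurd (T.le_us hu0 h0 this) (not_le.2 hu)
  · obtain ⟨η, hη⟩ := T.concave_F0.exists_slopeAt T.F0_lt_top T.finite_F0
      (hupos.trans huz') hzu0
    have : SlopeAt T.F1 z η := by
      refine T.slopeAt_F1_of_localMax hη ?_ (T.eventually_F0_ne_bot (hupos.trans huz') hzu0)
      filter_upwards [Ioo_mem_nhds huz' hzv'] with w hw
      rw [← EReal.coe_toReal (T.F1_lt_top _).ne (fin1 w hw.1.le hw.2.le),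
        ← EReal.coe_toReal (T.F1_lt_top _).ne (fin1 z huz hzv),
        ← EReal.coe_toReal (T.F0_lt_top _).ne (fin0 w hw.1.le hw.2.le),
        ← EReal.coe_toReal (T.F0_lt_top _).ne (fin0 z huz hzv),
        ← EReal.coe_sub, ← EReal.coe_sub, EReal.coe_le_coe_iff]
      exact hmax' w hw.1.le hw.2.le
    exact absurd (T.le_us hzu0 hη this) (not_le.2 (hu.trans huz'))

end Technology

/-! ### Discounted flows -/

/-- The discounted flow, extended by zero to negative times. -/
noncomputable def dflow (r : ℝ) (x : ℝ → ℝ≥0) : ℝ → ℝ :=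
  indicator (Ici 0) fun s => weight r s * x s

/-- Discounted flow received up to time `t`. -/
noncomputable def cum (r : ℝ) (x : ℝ → ℝ≥0) (t : ℝ) : ℝ := ∫ s in (0 : ℝ)..t, dflow r x s

/-- Discounted flow received over the whole time axis. -/
noncomputable def total (r : ℝ) (x : ℝ → ℝ≥0) : ℝ := ∫ s, dflow r x s

/-- Continuation value at time `t`. -/
noncomputable def contValue (r : ℝ) (x : ℝ → ℝ≥0) (t : ℝ) : ℝ :=
  Real.exp (r * t) * (total r x - cum r x t)

/-- A measurable flow bounded by `K`. -/
structure BddFlow (x : ℝ → ℝ≥0) (K : ℝ≥0) : Prop where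
  meas : AEMeasurable x timeMeasure
  le : ∀ᵐ t ∂timeMeasure, x t ≤ K

theorem integrableOn_weight {r : ℝ} (hr : 0 < r) : IntegrableOn (weight r) (Ici 0) := by
  rw [integrableOn_Ici_iff_integrableOn_Ioi]
  exact (integrableOn_exp_mul_Ioi (neg_lt_zero.2 hr) 0).const_mul r

theorem integral_weight {r : ℝ} (a b : ℝ) :
    ∫ s in a..b, weight r s = Real.exp (-r * a) - Real.exp (-r * b) := by
  have h : ∀ s ∈ uIcc a b, HasDerivAt (fun s => -Real.exp (-r * s)) (weight r s) s := by
    intro s _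
    have := ((hasDerivAt_id s).const_mul (-r)).exp.neg
    refine this.congr_deriv ?_
    simp only [weight, id]; ring
  rw [intervalIntegral.integral_eq_sub_of_hasDerivAt h
    ((continuous_weight r).intervalIntegrable _ _)]
  ring

section BddFlow

variable {r : ℝ} {x : ℝ → ℝ≥0} {K : ℝ≥0}

theorem dflow_nonneg (hr : 0 < r) (x : ℝ → ℝ≥0) (s : ℝ) : 0 ≤ dflow r x s :=
  indicator_nonneg (fun s _ => mul_nonneg (weight_pos hr s).le (x s).2) s

theorem dflow_of_nonneg {s : ℝ} (hs : 0 ≤ s) : dflow r x s = weight r s * x s :=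
  indicator_of_mem (mem_Ici.2 hs) _

theorem BddFlow.integrable_mul (hx : BddFlow x K) {g : ℝ → ℝ}
    (hg : Integrable g timeMeasure) : Integrable (fun s => g s * (x s : ℝ)) timeMeasure := by
  have hm : AEStronglyMeasurable (fun s => (x s : ℝ)) timeMeasure :=
    hx.meas.coe_nnreal_real.aestronglyMeasurable
  refine hg.mul_bdd (c := (K : ℝ)) hm ?_
  filter_upwards [hx.le] with s hs
  simpa using hs

theorem BddFlow.integrable_dflow (hr : 0 < r) (hx : BddFlow x K) : Integrable (dflow r x) := by
  unfold dflow
  rw [integrable_indicator_iff measurableSet_Ici]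
  exact hx.integrable_mul (integrableOn_weight hr)

theorem cum_zero (r : ℝ) (x : ℝ → ℝ≥0) : cum r x 0 = 0 := intervalIntegral.integral_same

theorem BddFlow.cum_sub (hr : 0 < r) (hx : BddFlow x K) (a b : ℝ) :
    cum r x b - cum r x a = ∫ s in a..b, dflow r x s :=
  intervalIntegral.integral_interval_sub_left ((hx.integrable_dflow hr).intervalIntegrable)
    ((hx.integrable_dflow hr).intervalIntegrable)

theorem BddFlow.cum_mono (hr : 0 < r) (hx : BddFlow x K) : Monotone (cum r x) := by
  intro a b hab
  have := hx.cum_sub hr a b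
  have h2 : 0 ≤ ∫ s in a..b, dflow r x s :=
    intervalIntegral.integral_nonneg hab fun s _ => dflow_nonneg hr x s
  linarith

theorem BddFlow.tendsto_cum (hr : 0 < r) (hx : BddFlow x K) :
    Tendsto (cum r x) atTop (𝓝 (total r x)) := by
  have h := intervalIntegral_tendsto_integral_Ioi (0 : ℝ)
    (hx.integrable_dflow hr).integrableOn tendsto_id
  have e : ∫ s in Ioi (0 : ℝ), dflow r x s = total r x := by
    unfold total
    rw [← integral_Ici_eq_integral_Ioi]
    exact setIntegral_eq_integral_of_forall_compl_eq_zero fun s hs => indicator_of_notMem hs _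
  rw [e] at h
  exact h

theorem BddFlow.cum_le_total (hr : 0 < r) (hx : BddFlow x K) (t : ℝ) : cum r x t ≤ total r x :=
  (hx.cum_mono hr).ge_of_tendsto (hx.tendsto_cum hr) t

theorem BddFlow.continuous_cum (hr : 0 < r) (hx : BddFlow x K) : Continuous (cum r x) :=
  intervalIntegral.continuous_primitive
    (fun _ _ => (hx.integrable_dflow hr).intervalIntegrable) 0

theorem BddFlow.total_sub_cum (hr : 0 < r) (hx : BddFlow x K) (t : ℝ) :
    total r x - cum r x t = ∫ s in Ioi t, dflow r x s := by
  have h := intervalIntegral_tendsto_integral_Ioi t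
    (hx.integrable_dflow hr).integrableOn tendsto_id
  refine tendsto_nhds_unique ?_ h
  refine ((hx.tendsto_cum hr).sub_const (cum r x t)).congr fun b => ?_
  exact hx.cum_sub hr t b

theorem BddFlow.ae_hasDerivAt_cum (hr : 0 < r) (hx : BddFlow x K) :
    ∀ᵐ t ∂timeMeasure, HasDerivAt (cum r x) (weight r t * x t) t := by
  have h := LocallyIntegrable.ae_hasDerivAt_integral (hx.integrable_dflow hr).locallyIntegrable
  filter_upwards [ae_restrict_of_ae h, ae_restrict_mem measurableSet_Ici] with t ht ht0
  have := ht 0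
  rwa [dflow_of_nonneg ht0] at this

theorem BddFlow.cum_sub_le (hr : 0 < r) (hx : BddFlow x K) {a b : ℝ} (ha : 0 ≤ a) (hab : a ≤ b) :
    cum r x b - cum r x a ≤ (Real.exp (-r * a) - Real.exp (-r * b)) * K := by
  rw [hx.cum_sub hr, ← integral_weight, ← intervalIntegral.integral_mul_const,
    intervalIntegral.integral_of_le hab, intervalIntegral.integral_of_le hab]
  refine setIntegral_mono_ae_restrict (hx.integrable_dflow hr).integrableOn
    ((((continuous_weight r).mul continuous_const).integrableOn_Icc).mono_set
      Ioc_subset_Icc_self) ?_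
  have hsub : Ioc a b ⊆ Ici 0 := fun s hs => ha.trans hs.1.le
  filter_upwards [ae_restrict_of_ae_restrict_of_subset hsub hx.le,
    ae_restrict_mem measurableSet_Ioc] with s hs hs'
  rw [dflow_of_nonneg (hsub hs')]
  exact mul_le_mul_of_nonneg_left hs (weight_pos hr s).le

theorem tendsto_exp_neg_mul (hr : 0 < r) :
    Tendsto (fun t : ℝ => Real.exp (-r * t)) atTop (𝓝 0) := by
  have : Tendsto (fun t : ℝ => r * t) atTop atTop := tendsto_id.const_mul_atTop hr
  refine (Real.tendsto_exp_neg_atTop_nhds_zero.comp this).congr fun t => ?_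
  simp

theorem exp_mul_exp_neg (r t : ℝ) : Real.exp (r * t) * Real.exp (-r * t) = 1 := by
  rw [← Real.exp_add]; simp

theorem exp_neg_mul_contValue (r : ℝ) (x : ℝ → ℝ≥0) (t : ℝ) :
    Real.exp (-r * t) * contValue r x t = total r x - cum r x t := by
  unfold contValue
  rw [← mul_assoc, mul_comm (Real.exp (-r * t)), exp_mul_exp_neg, one_mul]

theorem BddFlow.total_sub_cum_le (hr : 0 < r) (hx : BddFlow x K) {a : ℝ} (ha : 0 ≤ a) :
    total r x - cum r x a ≤ Real.exp (-r * a) * K := by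
  have h1 := (hx.tendsto_cum hr).sub_const (cum r x a)
  have h2 : Tendsto (fun b : ℝ => (Real.exp (-r * a) - Real.exp (-r * b)) * K) atTop
      (𝓝 ((Real.exp (-r * a) - 0) * K)) :=
    (tendsto_const_nhds.sub (tendsto_exp_neg_mul hr)).mul_const _
  rw [sub_zero] at h2
  refine le_of_tendsto_of_tendsto h1 h2 ?_
  filter_upwards [eventually_ge_atTop a] with b hb using hx.cum_sub_le hr ha hb

theorem BddFlow.contValue_nonneg (hr : 0 < r) (hx : BddFlow x K) (t : ℝ) :
    0 ≤ contValue r x t :=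
  mul_nonneg (Real.exp_pos _).le (sub_nonneg.2 (hx.cum_le_total hr t))

theorem BddFlow.contValue_le (hr : 0 < r) (hx : BddFlow x K) {t : ℝ} (ht : 0 ≤ t) :
    contValue r x t ≤ K := by
  have := mul_le_mul_of_nonneg_left (hx.total_sub_cum_le hr ht) (Real.exp_pos (r * t)).le
  rwa [← mul_assoc, exp_mul_exp_neg, one_mul] at this

theorem BddFlow.continuous_contValue (hr : 0 < r) (hx : BddFlow x K) :
    Continuous (contValue r x) := by
  have := hx.continuous_cum hr
  unfold contValue
  fun_prop

theorem contValue_zero (r : ℝ) (x : ℝ → ℝ≥0) : contValue r x 0 = total r x := by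
  simp [contValue, cum_zero]

theorem presentValue_eq (hr : 0 < r) (hx : BddFlow x K) {t : ℝ} {S : Set ℝ} (hS : MeasurableSet S)
    (hS0 : S ⊆ Ici 0) :
    presentValue r x t S = ENNReal.ofReal (Real.exp (r * t) * ∫ s in S, dflow r x s) := by
  unfold presentValue
  rw [← integral_const_mul, ofReal_integral_eq_lintegral_ofReal]
  · refine setLIntegral_congr_fun hS fun s hs => ?_
    have hs0 := hS0 hs
    simp only [dflow_of_nonneg (mem_Ici.1 hs0), weight]
    rw [← ENNReal.ofReal_coe_nnreal, ← ENNReal.ofReal_mul (by positivity)]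
    congr 1
    rw [show -r * (s - t) = r * t + -r * s by ring, Real.exp_add]
    ring
  · exact ((hx.integrable_dflow hr).integrableOn).const_mul _
  · exact ae_of_all _ fun s => mul_nonneg (Real.exp_pos _).le (dflow_nonneg hr x s)

/-- Incentive-compatibility in terms of accumulated value. -/
theorem ic_iff (hr : 0 < r) {m : Mechanism} (hx : BddFlow m.flow K)
    (hX : ∀ t, 0 ≤ t → m.reward t ≠ ∞) :
    m.IC r ↔ AntitoneOn (fun t => Real.exp (-r * t) * (m.reward t).toReal + cum r m.flow t)
      (Ici 0) := by
  have key : ∀ t d : ℝ, 0 ≤ t → 0 < d →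
      ((presentValue r m.flow t (Ioo t (t + d)) +
        ENNReal.ofReal (Real.exp (-r * d)) * m.reward (t + d) ≤ m.reward t) ↔
      Real.exp (-r * (t + d)) * (m.reward (t + d)).toReal + cum r m.flow (t + d) ≤
        Real.exp (-r * t) * (m.reward t).toReal + cum r m.flow t) := by
    intro t d ht hd
    rw [presentValue_eq hr hx measurableSet_Ioo (fun s hs => ht.trans hs.1.le),
      ← integral_Ioc_eq_integral_Ioo, ← intervalIntegral.integral_of_le (by linarith),
      ← hx.cum_sub hr]
    have hc : 0 ≤ cum r m.flow (t + d) - cum r m.flow t :=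
      sub_nonneg.2 (hx.cum_mono hr (by linarith))
    conv_lhs => rw [← ENNReal.ofReal_toReal (hX t ht),
      ← ENNReal.ofReal_toReal (hX (t + d) (by linarith))]
    rw [← ENNReal.ofReal_mul (Real.exp_pos _).le, ← ENNReal.ofReal_add (by positivity)
      (by positivity), ENNReal.ofReal_le_ofReal_iff ENNReal.toReal_nonneg]
    have e1 : Real.exp (-r * (t + d)) = Real.exp (-r * t) * Real.exp (-r * d) := by
      rw [← Real.exp_add]; ring_nf
    have e2 : Real.exp (-r * t) * Real.exp (r * t) = 1 := by
      rw [← Real.exp_add]; simp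
    rw [← mul_le_mul_iff_of_pos_left (Real.exp_pos (-r * t)), mul_add, ← mul_assoc, e2, e1]
    constructor <;> intro h <;> linarith
  constructor
  · intro h t ht t' ht' htt'
    rcases htt'.eq_or_lt with rfl | hlt
    · exact le_rfl
    have := (key t (t' - t) ht (by linarith)).1 ((h t ht).1 _ (by linarith))
    simpa using this
  · intro h t ht
    refine ⟨fun d hd => (key t d ht hd).2 (h ht (mem_Ici.2 (by linarith))
      (by linarith)), ?_⟩
    rw [presentValue_eq hr hx measurableSet_Ioi (fun s hs => ht.trans (le_of_lt hs)),
      ← hx.total_sub_cum hr, ← ENNReal.ofReal_toReal (hX t ht)]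
    refine ENNReal.ofReal_le_ofReal ?_
    have e2 : Real.exp (r * t) * Real.exp (-r * t) = 1 := by
      rw [← Real.exp_add]; simp
    -- The constraint against never disclosing is the limit of those against long delays, because
    -- rewards are nonnegative.
    have hle : total r m.flow ≤ Real.exp (-r * t) * (m.reward t).toReal + cum r m.flow t := by
      refine le_of_tendsto (hx.tendsto_cum hr) ?_
      filter_upwards [eventually_ge_atTop t] with s hs
      refine le_trans ?_ (h ht (mem_Ici.2 (ht.trans hs)) hs)
      simp only [le_add_iff_nonneg_left]
      positivity
    calc Real.exp (r * t) * (total r m.flow - cum r m.flow t)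
        ≤ Real.exp (r * t) * (Real.exp (-r * t) * (m.reward t).toReal) :=
          mul_le_mul_of_nonneg_left (by linarith) (Real.exp_pos _).le
      _ = (m.reward t).toReal := by rw [← mul_assoc, e2, one_mul]

end BddFlow

/-! ### Mechanisms that are not dominated -/

theorem _root_.EReal.coe_mul_lt_coe_mul {a : ℝ} (ha : 0 < a) {x y : EReal} (h : x < y) :
    (a : EReal) * x < a * y := by
  induction x <;> induction y
  · simp at h
  · rw [EReal.coe_mul_bot_of_pos ha, ← EReal.coe_mul]; exact EReal.bot_lt_coe _
  · rw [EReal.coe_mul_bot_of_pos ha, EReal.coe_mul_top_of_pos ha]; exact bot_lt_top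
  · simp at h
  · rw [EReal.coe_lt_coe_iff] at h
    rw [← EReal.coe_mul, ← EReal.coe_mul, EReal.coe_lt_coe_iff]
    exact mul_lt_mul_of_pos_left h ha
  · rw [EReal.coe_mul_top_of_pos ha, ← EReal.coe_mul]; exact EReal.coe_lt_top _
  · simp at h
  · simp at h
  · simp at h

theorem _root_.EReal.coe_mul_le_coe_mul {a : ℝ} (ha : 0 < a) {x y : EReal} (h : x ≤ y) :
    (a : EReal) * x ≤ a * y := by
  rcases h.eq_or_lt with rfl | h
  · exact le_rfl
  · exact (EReal.coe_mul_lt_coe_mul ha h).le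

theorem extendTop_coe (F : ℝ≥0 → EReal) (u : ℝ≥0) : extendTop F (u : ℝ≥0∞) = F u := by
  simp [extendTop]

theorem extendTop_of_ne_top (F : ℝ≥0 → EReal) {u : ℝ≥0∞} (h : u ≠ ∞) :
    extendTop F u = F u.toNNReal := by
  simp [extendTop, h]

/-- Payoff from the flow received before `τ`. -/
noncomputable def flowPayoff (T : Technology) (r : ℝ) (x : ℝ → ℝ≥0) (τ : ℝ) : EReal :=
  eintegral (volume.restrict (Ioo 0 τ)) (fun t => ((weight r t : ℝ) : EReal) * T.F0 (x t))

theorem payoffAt_eq (T : Technology) (r : ℝ) (m : Mechanism) (τ : ℝ) :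
    payoffAt T r m τ = flowPayoff T r m.flow τ
      + ((Real.exp (-r * τ) : ℝ) : EReal) * extendTop T.F1 (m.reward τ) := rfl

theorem ae_Ioo_of_ae_timeMeasure {p : ℝ → Prop} (h : ∀ᵐ t ∂timeMeasure, p t) (τ : ℝ) :
    ∀ᵐ t ∂(volume.restrict (Ioo 0 τ)), p t :=
  ae_restrict_of_ae_restrict_of_subset (fun _ hs => hs.1.le) h

theorem ae_timeMeasure_of_forall {p : ℝ → Prop}
    (h : ∀ τ : ℝ, ∀ᵐ t ∂(volume.restrict (Ioo 0 τ)), p t) : ∀ᵐ t ∂timeMeasure, p t := by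
  unfold timeMeasure
  rw [← restrict_Ioi_eq_restrict_Ici]
  have : Ioi (0 : ℝ) = ⋃ n : ℕ, Ioo 0 (n : ℝ) := by
    ext t
    simp only [mem_Ioi, mem_iUnion, mem_Ioo]
    refine ⟨fun ht => ?_, fun ⟨n, hn⟩ => hn.1⟩
    obtain ⟨n, hn⟩ := exists_nat_gt t
    exact ⟨n, ht, hn⟩
  rw [this, ae_restrict_iUnion_iff]
  exact fun n => h n

/-- The flow yields a finite payoff over bounded periods. -/
structure FlowFinite (T : Technology) (r : ℝ) (x : ℝ → ℝ≥0) : Prop where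
  ne_bot : ∀ᵐ t ∂timeMeasure, T.F0 (x t) ≠ ⊥
  int : ∀ τ, IntegrableOn (fun t => weight r t * (T.F0 (x t)).toReal) (Ioo 0 τ)

theorem FlowFinite.flowPayoff_eq {T : Technology} {r : ℝ} {x : ℝ → ℝ≥0} (h : FlowFinite T r x)
    (τ : ℝ) : flowPayoff T r x τ =
      ((∫ t in Ioo 0 τ, weight r t * (T.F0 (x t)).toReal : ℝ) : EReal) := by
  rw [← eintegral_coe (h.int τ)]
  refine eintegral_congr ?_
  filter_upwards [ae_Ioo_of_ae_timeMeasure h.ne_bot τ] with t ht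
  rw [EReal.coe_mul, EReal.coe_toReal (T.F0_lt_top _).ne ht]

/-- The integrand is bounded above by the peak of `F0`, so the only alternative to integrability is
a payoff of `-∞`. -/
theorem flowPayoff_eq_bot_or (T : Technology) {r : ℝ} (hr : 0 < r) {x : ℝ → ℝ≥0}
    (hx : AEMeasurable x timeMeasure) (τ : ℝ) :
    flowPayoff T r x τ = ⊥ ∨
      ((∀ᵐ t ∂(volume.restrict (Ioo 0 τ)), T.F0 (x t) ≠ ⊥) ∧
        IntegrableOn (fun t => weight r t * (T.F0 (x t)).toReal) (Ioo 0 τ)) := by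
  have hx' : AEMeasurable x (volume.restrict (Ioo 0 τ)) :=
    hx.mono_measure (Measure.restrict_mono (fun _ hs => hs.1.le) le_rfl)
  have hm : AEMeasurable (fun t => ((weight r t : ℝ) : EReal) * T.F0 (x t))
      (volume.restrict (Ioo 0 τ)) :=
    ((continuous_weight r).measurable.coe_real_ereal.aemeasurable).mul
      (T.usc_F0.measurable.comp_aemeasurable hx')
  have hg : Integrable (fun t => weight r t * (T.F0 T.u0).toReal)
      (volume.restrict (Ioo 0 τ)) :=
    (((continuous_weight r).mul continuous_const).integrableOn_Icc).mono_set Ioo_subset_Icc_self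
  have hfg : ∀ t, ((weight r t : ℝ) : EReal) * T.F0 (x t) ≤
      ((weight r t * (T.F0 T.u0).toReal : ℝ) : EReal) := fun t => by
    rw [EReal.coe_mul, EReal.coe_toReal (T.F0_lt_top _).ne T.F0_u0_ne_bot]
    exact EReal.coe_mul_le_coe_mul (weight_pos hr t) (T.F0_le_peak _)
  rcases eintegral_eq_bot_or hm hg (ae_of_all _ hfg) with h | ⟨h1, h2, -⟩
  · exact Or.inl h
  · refine Or.inr ⟨?_, ?_⟩
    · filter_upwards [h1] with t ht hb
      rw [hb, EReal.coe_mul_bot_of_pos (weight_pos hr t)] at ht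
      exact ht rfl
    · refine h2.congr (ae_of_all _ fun t => ?_)
      simp only
      rw [EReal.toReal_mul, EReal.toReal_coe]

/-- Undominated, with a finite payoff for arbitrarily late breakthroughs. -/
structure Regular (T : Technology) (r : ℝ) (m : Mechanism) : Prop where
  undominated : Undominated T r m
  finite : ∀ S : ℝ, ∃ τ, S < τ ∧ 0 ≤ τ ∧ payoffAt T r m τ ≠ ⊥

section Regular

variable {T : Technology} {r : ℝ} {m : Mechanism}

/-- A finite payoff at a breakthrough time beyond `τ` leaves no room for an infinite loss before
`τ`. Finiteness is what lets flow terms be cancelled in comparisons of payoffs; with payoffs equal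
to `-∞` improvements would go unnoticed. -/
theorem Regular.flowFinite (hr : 0 < r) (h : Regular T r m) : FlowFinite T r m.flow := by
  have key : ∀ τ : ℝ, (∀ᵐ t ∂(volume.restrict (Ioo 0 τ)), T.F0 (m.flow t) ≠ ⊥) ∧
      IntegrableOn (fun t => weight r t * (T.F0 (m.flow t)).toReal) (Ioo 0 τ) := by
    intro τ
    obtain ⟨τ', h1, -, h2⟩ := h.finite τ
    have hsub : Ioo 0 τ ⊆ Ioo 0 τ' := Ioo_subset_Ioo_right h1.le
    rcases flowPayoff_eq_bot_or T hr m.measurable_flow τ' with h3 | ⟨h3, h4⟩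
    · rw [payoffAt_eq, h3, EReal.bot_add] at h2
      exact absurd rfl h2
    · exact ⟨ae_restrict_of_ae_restrict_of_subset hsub h3, h4.mono_set hsub⟩
  exact ⟨ae_timeMeasure_of_forall fun τ => (key τ).1, fun τ => (key τ).2⟩

theorem Regular.payoffAt_eq_of_le (h : Regular T r m) {m' : Mechanism} (hm' : m'.IC r)
    (hle : ∀ τ, 0 ≤ τ → payoffAt T r m τ ≤ payoffAt T r m' τ) {τ : ℝ} (hτ : 0 ≤ τ) :
    payoffAt T r m τ = payoffAt T r m' τ := by
  by_contra hne
  exact h.undominated.2 m' hm' (dominates_of_payoffAt hle ⟨τ, hτ, lt_of_le_of_ne (hle τ hτ) hne⟩)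

/-- Improving the reward of a regular mechanism is impossible. -/
theorem Regular.reward_eq (hr : 0 < r) (h : Regular T r m) {X : ℝ → ℝ≥0∞}
    (hIC : (Mechanism.mk m.flow X m.measurable_flow).IC r)
    (hle : ∀ t, 0 ≤ t → extendTop T.F1 (m.reward t) ≤ extendTop T.F1 (X t)) {t : ℝ} (ht : 0 ≤ t) :
    extendTop T.F1 (m.reward t) = extendTop T.F1 (X t) := by
  by_contra hne
  refine absurd (h.payoffAt_eq_of_le hIC (fun τ hτ => ?_) ht) (ne_of_lt ?_)
  · exact add_le_add le_rfl (EReal.coe_mul_le_coe_mul (Real.exp_pos _) (hle τ hτ))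
  · rw [payoffAt_eq, payoffAt_eq, (h.flowFinite hr).flowPayoff_eq]
    exact EReal.add_lt_add_left_coe
      (EReal.coe_mul_lt_coe_mul (Real.exp_pos _) (lt_of_le_of_ne (hle t ht) hne)) _

/-- Improving the flow of a regular mechanism is impossible. -/
theorem Regular.flow_eq (hr : 0 < r) (h : Regular T r m) {x : ℝ → ℝ≥0}
    (hx : AEMeasurable x timeMeasure) (hIC : (Mechanism.mk x m.reward hx).IC r)
    (hle : ∀ᵐ t ∂timeMeasure, T.F0 (m.flow t) ≤ T.F0 (x t)) :
    ∀ᵐ t ∂timeMeasure, T.F0 (m.flow t) = T.F0 (x t) := by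
  have hfl : ∀ τ, flowPayoff T r m.flow τ ≤ flowPayoff T r x τ := by
    intro τ
    refine eintegral_mono ?_
    filter_upwards [ae_Ioo_of_ae_timeMeasure hle τ] with t ht
    exact EReal.coe_mul_le_coe_mul (weight_pos hr t) ht
  have hff := h.flowFinite hr
  have hne : ∀ᵐ t ∂timeMeasure, T.F0 (x t) ≠ ⊥ := by
    filter_upwards [hff.ne_bot, hle] with t h1 h2 using ne_bot_of_le_ne_bot h1 h2
  have hff' : FlowFinite T r x := by
    refine ⟨hne, fun τ => ?_⟩
    rcases flowPayoff_eq_bot_or T hr hx τ with h3 | ⟨-, h4⟩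
    · have := hfl τ
      rw [h3, hff.flowPayoff_eq, le_bot_iff] at this
      exact absurd this (EReal.coe_ne_bot _)
    · exact h4
  -- At some time beyond `S` the payoff is finite, so the reward term cancels from the equality of
  -- payoffs. The improvement in the flow payoff is then a nonnegative function with zero integral.
  have key : ∀ S : ℝ, ∀ᵐ t ∂(volume.restrict (Ioo 0 S)), T.F0 (m.flow t) = T.F0 (x t) := by
    intro S
    obtain ⟨τ, hS, hτ, hb⟩ := h.finite S
    have heq := h.payoffAt_eq_of_le hIC (fun τ hτ => add_le_add (hfl τ) le_rfl) hτ
    have hb' : ((Real.exp (-r * τ) : ℝ) : EReal) * extendTop T.F1 (m.reward τ) ≠ ⊥ := by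
      intro hc
      rw [payoffAt_eq, hc, EReal.add_bot] at hb
      exact hb rfl
    have ht' : ((Real.exp (-r * τ) : ℝ) : EReal) * extendTop T.F1 (m.reward τ) ≠ ⊤ := by
      intro hc
      have : extendTop T.F1 (m.reward τ) < ⊤ := by
        unfold extendTop; split_ifs
        · exact bot_lt_top
        · exact T.F1_lt_top _
      have := EReal.coe_mul_lt_coe_mul (Real.exp_pos (-r * τ)) this
      rw [hc] at this
      exact not_top_lt this
    have hF : payoffAt T r ⟨x, m.reward, hx⟩ τ = flowPayoff T r x τ +
      ((Real.exp (-r * τ) : ℝ) : EReal) * extendTop T.F1 (m.reward τ) := rfl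
    rw [hF, payoffAt_eq, hff.flowPayoff_eq, hff'.flowPayoff_eq, ← EReal.coe_toReal ht' hb',
      ← EReal.coe_add, ← EReal.coe_add, EReal.coe_eq_coe_iff] at heq
    have h0 : ∫ t in Ioo 0 τ, (weight r t * (T.F0 (x t)).toReal -
        weight r t * (T.F0 (m.flow t)).toReal) = 0 := by
      rw [integral_sub (hff'.int τ) (hff.int τ)]; linarith
    have hnn : 0 ≤ᵐ[volume.restrict (Ioo 0 τ)] fun t => weight r t * (T.F0 (x t)).toReal -
        weight r t * (T.F0 (m.flow t)).toReal := by
      filter_upwards [ae_Ioo_of_ae_timeMeasure hle τ, ae_Ioo_of_ae_timeMeasure hne τ,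
        ae_Ioo_of_ae_timeMeasure hff.ne_bot τ] with t h1 h2 h3
      rw [← EReal.coe_toReal (T.F0_lt_top _).ne h2, ← EReal.coe_toReal (T.F0_lt_top _).ne h3,
        EReal.coe_le_coe_iff] at h1
      have := mul_le_mul_of_nonneg_left h1 (weight_pos hr t).le
      simpa using this
    have h0' := (integral_eq_zero_iff_of_nonneg_ae hnn ((hff'.int τ).sub (hff.int τ))).1 h0
    refine ae_restrict_of_ae_restrict_of_subset (Ioo_subset_Ioo_right hS.le) ?_
    filter_upwards [h0', ae_Ioo_of_ae_timeMeasure hne τ,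
      ae_Ioo_of_ae_timeMeasure hff.ne_bot τ] with t h1 h2 h3
    rw [← EReal.coe_toReal (T.F0_lt_top _).ne h2, ← EReal.coe_toReal (T.F0_lt_top _).ne h3,
      EReal.coe_eq_coe_iff]
    have h1' : weight r t * ((T.F0 (x t)).toReal - (T.F0 (m.flow t)).toReal) = 0 := by
      rw [mul_sub]; exact h1
    rcases mul_eq_zero.1 h1' with h | h
    · exact absurd h (weight_pos hr t).ne'
    · linarith
  exact ae_timeMeasure_of_forall key

/-! ### Capping -/

theorem presentValue_mono {x y : ℝ → ℝ≥0} {t : ℝ} (ht : 0 ≤ t) {S : Set ℝ}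
    (hSt : S ⊆ Ioi t) (h : ∀ᵐ s ∂timeMeasure, x s ≤ y s) :
    presentValue r x t S ≤ presentValue r y t S := by
  refine lintegral_mono_ae ?_
  have : ∀ᵐ s ∂(volume.restrict S), x s ≤ y s :=
    ae_restrict_of_ae_restrict_of_subset (fun s hs => ht.trans (le_of_lt (hSt hs))) h
  filter_upwards [this] with s hs
  gcongr

theorem bddFlow_const (K : ℝ≥0) : BddFlow (fun _ => K) K :=
  ⟨aemeasurable_const, ae_of_all _ fun _ => le_rfl⟩

/-- The constant flow `K` with constant reward `K` leaves the agent exactly indifferent, which makes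
it the benchmark for capping. -/
theorem presentValue_const (hr : 0 < r) {t d : ℝ} (ht : 0 ≤ t) (hd : 0 < d) (K : ℝ≥0) :
    presentValue r (fun _ => K) t (Ioo t (t + d)) + ENNReal.ofReal (Real.exp (-r * d)) * K = K := by
  rw [presentValue_eq hr (bddFlow_const K) measurableSet_Ioo (fun s hs => ht.trans hs.1.le),
    ← integral_Ioc_eq_integral_Ioo, ← intervalIntegral.integral_of_le (by linarith)]
  have : ∫ s in t..t + d, dflow r (fun _ => K) s = ∫ s in t..t + d, weight r s * K := by
    refine intervalIntegral.integral_congr fun s hs => ?_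
    rw [uIcc_of_le (by linarith)] at hs
    exact dflow_of_nonneg (ht.trans hs.1)
  rw [this, intervalIntegral.integral_mul_const, integral_weight, ← ENNReal.ofReal_coe_nnreal,
    ← ENNReal.ofReal_mul (Real.exp_pos _).le]
  have e : Real.exp (r * t) * ((Real.exp (-r * t) - Real.exp (-r * (t + d))) * K) =
      (1 - Real.exp (-r * d)) * K := by
    rw [← mul_assoc, mul_sub, exp_mul_exp_neg, ← Real.exp_add]
    ring_nf
  have hle : Real.exp (-r * d) ≤ 1 := Real.exp_le_one_iff.2 (by nlinarith)
  rw [e, ← ENNReal.ofReal_add (mul_nonneg (by linarith) K.coe_nonneg)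
    (mul_nonneg (Real.exp_pos _).le K.coe_nonneg)]
  congr 1
  ring

theorem Mechanism.IC.mono_flow (h : m.IC r) {x : ℝ → ℝ≥0}
    (hx : AEMeasurable x timeMeasure) (hle : ∀ᵐ s ∂timeMeasure, x s ≤ m.flow s) :
    (Mechanism.mk x m.reward hx).IC r := by
  intro t ht
  refine ⟨fun d hd => le_trans ?_ ((h t ht).1 d hd), le_trans ?_ (h t ht).2⟩
  · exact add_le_add (presentValue_mono ht (fun s hs => hs.1) hle) le_rfl
  · exact presentValue_mono ht (fun s hs => hs) hle

/-- The value of a delay is bounded by the original reward and, since the flow is at most `K`, also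
by the value of the constant mechanism at level `K`. Hence it is bounded by the minimum of the two.
-/
theorem Mechanism.IC.cap_reward (hr : 0 < r) (h : m.IC r) {K : ℝ≥0}
    (hle : ∀ᵐ s ∂timeMeasure, m.flow s ≤ K) :
    (Mechanism.mk m.flow (fun t => min (m.reward t) K) m.measurable_flow).IC r := by
  intro t ht
  have key : ∀ d : ℝ, 0 < d → presentValue r m.flow t (Ioo t (t + d)) +
      ENNReal.ofReal (Real.exp (-r * d)) * min (m.reward (t + d)) K ≤ min (m.reward t) K := by
    intro d hd
    refine le_min (le_trans ?_ ((h t ht).1 d hd)) (le_trans ?_ (presentValue_const hr ht hd K).le)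
    · gcongr
      exact min_le_left _ _
    · refine add_le_add (presentValue_mono ht (fun s hs => hs.1) hle) ?_
      gcongr
      exact min_le_right _ _
  refine ⟨key, le_min (h t ht).2 ?_⟩
  have hx : BddFlow m.flow K := ⟨m.measurable_flow, hle⟩
  rw [presentValue_eq hr hx measurableSet_Ioi (fun s hs => ht.trans (le_of_lt hs)),
    ← hx.total_sub_cum hr, ← ENNReal.ofReal_coe_nnreal]
  exact ENNReal.ofReal_le_ofReal (hx.contValue_le hr ht)

theorem extendTop_F1_le_min (T : Technology) (u : ℝ≥0∞) :
    extendTop T.F1 u ≤ extendTop T.F1 (min u T.u0) := by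
  rcases le_total u T.u0 with h | h
  · rw [min_eq_left h]
  · rw [min_eq_right h, extendTop_coe]
    by_cases hu : u = ∞
    · simp [extendTop, hu]
    · rw [extendTop_of_ne_top _ hu]
      lift u to ℝ≥0 using hu
      exact T.F1_anti (by exact_mod_cast h) T.u1_lt_u0.le le_rfl

/-- Lowering the flow to `u0` where it is higher relaxes the incentive constraints and strictly
raises `F0`. -/
theorem Regular.bddFlow (hr : 0 < r) (h : Regular T r m) : BddFlow m.flow T.u0 := by
  refine ⟨m.measurable_flow, ?_⟩
  have hx : AEMeasurable (fun t => min (m.flow t) T.u0) timeMeasure :=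
    m.measurable_flow.min aemeasurable_const
  filter_upwards [h.flow_eq hr hx
    (h.undominated.1.mono_flow hx (ae_of_all _ fun s => min_le_left _ _))
    (ae_of_all _ fun t => T.F0_le_min _)] with t ht
  by_contra! hlt
  rw [min_eq_right hlt.le] at ht
  exact (T.peak_F0 _ hlt.ne').ne ht

/-- With the flow below `u0`, rewards can be capped at `u0`; since `u1 < u0`, this strictly raises
`F1` wherever the cap bites. -/
theorem Regular.reward_le (hr : 0 < r) (h : Regular T r m) {t : ℝ} (ht : 0 ≤ t) :
    m.reward t ≤ T.u0 := by
  have heq := h.reward_eq hr (h.undominated.1.cap_reward hr (h.bddFlow hr).le)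
    (fun t _ => extendTop_F1_le_min T _) ht
  by_contra! hlt
  simp only [min_eq_right hlt.le, extendTop_coe] at heq
  by_cases hu : m.reward t = ∞
  · rw [hu] at heq
    simp only [extendTop, if_true] at heq
    exact T.F1_u0_ne_bot heq.symm
  · rw [extendTop_of_ne_top _ hu] at heq
    refine (T.F1_strictAnti ?_ T.u1_lt_u0.le le_rfl).ne heq
    rw [← ENNReal.coe_lt_coe, ENNReal.coe_toNNReal hu]
    exact hlt

end Regular

/-! ### Antitone functions squeezed around an obstacle

`V` is antitone and equals both the upper envelope from the right of `min V l` and the lower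
envelope from the left of `max V l`. Then `V` moves only where it touches `l`. -/

section Levels

variable {V l : ℝ → ℝ}

/-- The time at which `V` passes the level `w` is a supremum. If `l` were below `w` there, `hB`
would hold `V` below `w` just before it; if `l` were above `w`, `hF` would hold `V` at `w` or more
just after it. -/
theorem exists_level (hV : AntitoneOn V (Ici 0)) (hl : Continuous l)
    (hB : ∀ t c, 0 ≤ t → (∀ s, t ≤ s → min (V s) (l s) ≤ c) → V t ≤ c)
    (hF : ∀ t c, 0 ≤ t → (∀ s, 0 ≤ s → s ≤ t → c ≤ max (V s) (l s)) → c ≤ V t)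
    {a b w : ℝ} (ha : 0 ≤ a) (hab : a ≤ b) (hb : V b < w) (hw : w < V a) :
    ∃ t ∈ Icc a b, l t = w ∧ (∀ s, 0 ≤ s → s < t → w ≤ V s) ∧ ∀ s, t < s → V s < w := by
  set S := {t | t ∈ Icc a b ∧ w ≤ V t} with hS
  have haS : a ∈ S := ⟨⟨le_rfl, hab⟩, hw.le⟩
  have hbdd : BddAbove S := ⟨b, fun t ht => ht.1.2⟩
  set t := sSup S with ht
  have hat : a ≤ t := le_csSup hbdd haS
  have htb : t ≤ b := csSup_le ⟨a, haS⟩ fun s hs => hs.1.2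
  have h1 : ∀ s, 0 ≤ s → s < t → w ≤ V s := by
    intro s hs hst
    obtain ⟨s', hs', hlt⟩ := exists_lt_of_lt_csSup ⟨a, haS⟩ hst
    exact hs'.2.trans (hV hs (ha.trans hs'.1.1) hlt.le)
  have h2 : ∀ s, t < s → V s < w := by
    intro s hst
    rcases le_or_gt s b with h | h
    · by_contra! hc
      exact absurd (le_csSup hbdd (show s ∈ S from ⟨⟨hat.trans hst.le, h⟩, hc⟩)) (not_le.2 hst)
    · exact (hV (ha.trans hab) (ha.trans (hab.trans h.le)) h.le).trans_lt hb
  refine ⟨t, ⟨hat, htb⟩, ?_, h1, h2⟩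
  rcases lt_trichotomy (l t) w with hlt | heq | hgt
  · exfalso
    obtain ⟨c, hc1, hc2⟩ := exists_between hlt
    obtain ⟨δ, hδ, hδl⟩ := Metric.eventually_nhds_iff.1 ((hl.tendsto t).eventually_lt_const hc1)
    obtain ⟨s, hsS, hs⟩ := exists_lt_of_lt_csSup ⟨a, haS⟩ (show t - δ < sSup S by linarith)
    have hst : s ≤ t := le_csSup hbdd hsS
    have hs0 : 0 ≤ s := ha.trans hsS.1.1
    -- Times before `t + δ` are controlled by `l < c`, later ones by the value of `V` just after
    -- `t`, which is already below `w`.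
    have hVs := hB s (max c (V (t + δ / 2))) hs0 fun z hz => by
      rcases lt_or_ge z (t + δ) with h | h
      · refine (min_le_right _ _).trans (le_trans ?_ (le_max_left _ _))
        refine (hδl ?_).le
        rw [Real.dist_eq, abs_lt]
        constructor <;> linarith
      · refine (min_le_left _ _).trans (le_trans ?_ (le_max_right _ _))
        refine hV ?_ ?_ (by linarith)
        · exact mem_Ici.2 (by linarith)
        · exact mem_Ici.2 (by linarith)
    exact absurd (hsS.2.trans hVs) (not_le.2 (max_lt hc2 (h2 _ (by linarith))))
  · exact heq
  · exfalso
    obtain ⟨δ, hδ, hδl⟩ := Metric.eventually_nhds_iff.1 ((hl.tendsto t).eventually_const_lt hgt)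
    have hw' := hF (t + δ / 2) w (by linarith) fun z hz0 hz => by
      rcases lt_or_ge z t with h | h
      · exact (h1 z hz0 h).trans (le_max_left _ _)
      · refine le_trans (hδl ?_).le (le_max_right _ _)
        rw [Real.dist_eq, abs_lt]
        constructor <;> linarith
    exact absurd hw' (not_le.2 (h2 _ (by linarith)))

/-- `V` cannot fall faster than `l`, because `l` has to pass through the levels that `V` passes,
within the same interval. -/
theorem sub_le_of_levels (hV : AntitoneOn V (Ici 0)) (hl : Continuous l)
    (hB : ∀ t c, 0 ≤ t → (∀ s, t ≤ s → min (V s) (l s) ≤ c) → V t ≤ c)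
    (hF : ∀ t c, 0 ≤ t → (∀ s, 0 ≤ s → s ≤ t → c ≤ max (V s) (l s)) → c ≤ V t)
    {K : ℝ} (hK : 0 ≤ K) (hlK : ∀ s t, 0 ≤ s → s ≤ t → l s - l t ≤ K * (t - s))
    {s t : ℝ} (hs : 0 ≤ s) (hst : s ≤ t) : V s - V t ≤ K * (t - s) := by
  by_contra! hlt
  -- The two levels lie `e` apart, centred between `V t` and `V s`. Since `e` exceeds `K * (t - s)`,
  -- `l` cannot fall from one to the other in time.
  obtain ⟨e, he1, he2⟩ := exists_between hlt
  have hKst : 0 ≤ K * (t - s) := mul_nonneg hK (by linarith)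
  obtain ⟨t1, ht1, hl1, hV1, hV1'⟩ := exists_level hV hl hB hF hs hst
    (w := V t + (V s - V t - e) / 2 + e) (by linarith) (by linarith)
  obtain ⟨t2, ht2, hl2, hV2, hV2'⟩ := exists_level hV hl hB hF hs hst
    (w := V t + (V s - V t - e) / 2) (by linarith) (by linarith)
  have h12 : t1 ≤ t2 := by
    by_contra! h
    obtain ⟨z, hz1, hz2⟩ := exists_between h
    have a1 := hV1 z (by linarith [ht2.1]) hz2
    have a2 := hV2' z hz1
    linarith
  have := hlK t1 t2 (hs.trans ht1.1) h12
  have : K * (t2 - t1) ≤ K * (t - s) :=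
    mul_le_mul_of_nonneg_left (by linarith [ht1.1, ht2.2]) hK
  linarith

/-- If the derivative of `V` were neither zero nor that of `l`, then near `z`, and away from it, `V`
would differ from `V z` and from `l`. But the fall of `V` just after `z` produces a time with `V =
l`. -/
theorem deriv_eq_zero_or_of_levels (hV : AntitoneOn V (Ici 0)) (hl : Continuous l)
    (hB : ∀ t c, 0 ≤ t → (∀ s, t ≤ s → min (V s) (l s) ≤ c) → V t ≤ c)
    (hF : ∀ t c, 0 ≤ t → (∀ s, 0 ≤ s → s ≤ t → c ≤ max (V s) (l s)) → c ≤ V t)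
    (hVc : ContinuousOn V (Ici 0)) {z v' l' : ℝ} (hz : 0 < z) (hv : HasDerivAt V v' z)
    (hl' : HasDerivAt l l' z) : v' = 0 ∨ v' = l' := by
  by_contra! hne
  have hD := (hv.sub hl').eventually_ne (c := 0) (sub_ne_zero.2 hne.2)
  have hVne := hv.eventually_ne (c := V z) hne.1
  rw [eventually_nhdsWithin_iff, Metric.eventually_nhds_iff] at hD hVne
  obtain ⟨δ, hδ, hD⟩ := hD
  obtain ⟨ε, hε, hVne⟩ := hVne
  set y := z + min δ ε / 2 with hy
  have hmin : 0 < min δ ε := lt_min hδ hε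
  have hzy : z < y := by linarith
  have hyne : V y ≠ V z := hVne (by
    rw [Real.dist_eq, abs_of_pos (by linarith)]
    have := min_le_right δ ε; linarith) hzy.ne'
  have hylt : V y < V z := lt_of_le_of_ne (hV hz.le (hz.trans hzy).le hzy.le) hyne
  obtain ⟨t, ht, hlt, h1, h2⟩ := exists_level hV hl hB hF hz.le hzy.le
    (w := (V y + V z) / 2) (by linarith) (by linarith)
  have htpos : 0 < t := hz.trans_le ht.1
  have hVt : V t = (V y + V z) / 2 := by
    have hca : ContinuousAt V t := hVc.continuousAt (Ici_mem_nhds htpos)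
    refine le_antisymm ?_ ?_
    · refine le_of_tendsto (hca.tendsto.mono_left (nhdsWithin_le_nhds (s := Ioi t))) ?_
      filter_upwards [self_mem_nhdsWithin] with s hs using (h2 s hs).le
    · refine ge_of_tendsto (hca.tendsto.mono_left (nhdsWithin_le_nhds (s := Iio t))) ?_
      filter_upwards [self_mem_nhdsWithin, nhdsWithin_le_nhds (Ioi_mem_nhds htpos)] with s hs hs'
      exact h1 s (le_of_lt hs') hs
  have htz : t ≠ z := by
    rintro rfl
    linarith
  refine hD (y := t) ?_ htz ?_
  · rw [Real.dist_eq, abs_of_nonneg (by linarith [ht.1])]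
    have := min_le_left δ ε
    linarith [ht.2]
  · simp [hVt, hlt]

end Levels

/-! ### The incentive constraints bind -/

section Binding

variable {T : Technology} {r : ℝ} {m : Mechanism}

/-- Accumulated value of the agent. -/
noncomputable def accValue (r : ℝ) (m : Mechanism) (t : ℝ) : ℝ :=
  Real.exp (-r * t) * (m.reward t).toReal + cum r m.flow t

/-- Accumulated value when the reward at `t` is `u`. -/
noncomputable def accLevel (r : ℝ) (m : Mechanism) (u : ℝ≥0) (t : ℝ) : ℝ :=
  Real.exp (-r * t) * u + cum r m.flow t

theorem Regular.reward_ne_top (hr : 0 < r) (h : Regular T r m) {t : ℝ} (ht : 0 ≤ t) :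
    m.reward t ≠ ∞ := ne_top_of_le_ne_top ENNReal.coe_ne_top (h.reward_le hr ht)

theorem Regular.antitoneOn_accValue (hr : 0 < r) (h : Regular T r m) :
    AntitoneOn (accValue r m) (Ici 0) :=
  (ic_iff hr (h.bddFlow hr) fun _ ht => h.reward_ne_top hr ht).1 h.undominated.1

/-- Changing the accumulated value to another antitone function with rewards closer to `u1` is
impossible. -/
theorem Regular.accValue_eq (hr : 0 < r) (h : Regular T r m) {V : ℝ → ℝ}
    (hV : AntitoneOn V (Ici 0))
    (h1 : ∀ t, 0 ≤ t → min (accValue r m t) (accLevel r m T.u1 t) ≤ V t)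
    (h2 : ∀ t, 0 ≤ t → V t ≤ max (accValue r m t) (accLevel r m T.u1 t))
    {t : ℝ} (ht : 0 ≤ t) : V t = accValue r m t := by
  have hx : BddFlow m.flow T.u0 := h.bddFlow hr
  have hexp : ∀ t, Real.exp (-r * t) * Real.exp (r * t) = 1 := fun t => by
    rw [mul_comm, exp_mul_exp_neg]
  set Y : ℝ → ℝ := fun t => Real.exp (r * t) * (V t - cum r m.flow t) with hY
  have hYV : ∀ t, Real.exp (-r * t) * Y t + cum r m.flow t = V t := fun t => by
    simp only [hY]; rw [← mul_assoc, hexp]; ring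
  have hle : ∀ t (u v : ℝ), Real.exp (-r * t) * u + cum r m.flow t ≤
      Real.exp (-r * t) * v + cum r m.flow t ↔ u ≤ v := fun t u v => by
    rw [add_le_add_iff_right, mul_le_mul_iff_of_pos_left (Real.exp_pos _)]
  have hmin : ∀ t, 0 ≤ t → min (m.reward t).toReal T.u1 ≤ Y t := by
    intro t ht
    rw [min_le_iff, ← hle t _ (Y t), ← hle t (T.u1 : ℝ) (Y t), hYV, ← min_le_iff]
    exact h1 t ht
  have hmax : ∀ t, 0 ≤ t → Y t ≤ max (m.reward t).toReal T.u1 := by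
    intro t ht
    rw [le_max_iff, ← hle t (Y t), ← hle t (Y t), hYV, ← le_max_iff]
    exact h2 t ht
  have hY0 : ∀ t, 0 ≤ t → 0 ≤ Y t := fun t ht =>
    (le_min ENNReal.toReal_nonneg T.u1.coe_nonneg).trans (hmin t ht)
  have hIC : (Mechanism.mk m.flow (fun t => ENNReal.ofReal (Y t)) m.measurable_flow).IC r := by
    refine (ic_iff hr (m := ⟨m.flow, fun t => ENNReal.ofReal (Y t), m.measurable_flow⟩)
      hx (fun _ _ => ENNReal.ofReal_ne_top)).2 ?_
    refine hV.congr fun t ht => ?_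
    simp only
    rw [ENNReal.toReal_ofReal (hY0 t ht), hYV]
  -- The new reward lies between the old one and the peak `u1`, so `F1` increases, strictly where
  -- the reward changes.
  have hval : ∀ t, 0 ≤ t → T.F1 (m.reward t).toNNReal ≤ T.F1 (Y t).toNNReal ∧
      ((m.reward t).toNNReal ≠ (Y t).toNNReal →
        T.F1 (m.reward t).toNNReal < T.F1 (Y t).toNNReal) := by
    intro t ht
    have hle0 : (m.reward t).toNNReal ≤ T.u0 := by
      have := h.reward_le hr ht
      rw [← ENNReal.coe_toNNReal (h.reward_ne_top hr ht)] at this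
      exact_mod_cast this
    set u := (m.reward t).toNNReal with hu
    have hur : (m.reward t).toReal = u := rfl
    have hYt := Real.coe_toNNReal _ (hY0 t ht)
    set v := (Y t).toNNReal with hv
    have a1 := hmin t ht
    have a2 := hmax t ht
    rw [hur, ← hYt] at a1 a2
    have a1' : min u T.u1 ≤ v := by exact_mod_cast a1
    have a2' : v ≤ max u T.u1 := by exact_mod_cast a2
    suffices hs : u ≠ v → T.F1 u < T.F1 v by
      refine ⟨?_, hs⟩
      by_cases he : u = v
      · rw [he]
      · exact (hs he).le
    intro hne
    rcases le_total u T.u1 with hc | hc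
    · rw [min_eq_left hc] at a1'
      rw [max_eq_right hc] at a2'
      exact T.F1_strictMono (lt_of_le_of_ne a1' hne) a2'
    · rw [min_eq_right hc] at a1'
      rw [max_eq_left hc] at a2'
      exact T.F1_strictAnti (lt_of_le_of_ne a2' hne.symm) a1' (a2'.trans hle0)
  have hfin := h.reward_eq hr hIC (fun t ht => by
    rw [extendTop_of_ne_top _ (h.reward_ne_top hr ht), extendTop_of_ne_top _ ENNReal.ofReal_ne_top]
    exact (hval t ht).1) ht
  rw [extendTop_of_ne_top _ (h.reward_ne_top hr ht), extendTop_of_ne_top _ ENNReal.ofReal_ne_top]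
    at hfin
  have heq : (m.reward t).toNNReal = (Y t).toNNReal := by
    by_contra hne
    exact ((hval t ht).2 hne).ne hfin
  have : (m.reward t).toReal = Y t := by
    rw [← Real.coe_toNNReal _ (hY0 t ht), ← heq]; rfl
  rw [accValue, this, hYV]

/-- Apply `Regular.accValue_eq` to the running supremum from the right of the minimum of `accValue`
and the level of `u1`. It is antitone, hence incentive-compatible, and lowers rewards towards `u1`
as far as later constraints permit. -/
theorem Regular.accValue_le_of_min_le (hr : 0 < r) (h : Regular T r m) (t c : ℝ) (ht : 0 ≤ t)
    (hc : ∀ s, t ≤ s → min (accValue r m s) (accLevel r m T.u1 s) ≤ c) : accValue r m t ≤ c := by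
  have hanti := h.antitoneOn_accValue hr
  set V : ℝ → ℝ := fun t =>
    sSup ((fun s => min (accValue r m s) (accLevel r m T.u1 s)) '' Ici t) with hV
  have hub : ∀ t, 0 ≤ t → ∀ s, t ≤ s →
      min (accValue r m s) (accLevel r m T.u1 s) ≤ accValue r m t := fun t ht s hs =>
    (min_le_left _ _).trans (hanti ht (ht.trans hs) hs)
  have hbdd : ∀ t, 0 ≤ t →
      BddAbove ((fun s => min (accValue r m s) (accLevel r m T.u1 s)) '' Ici t) := by
    rintro t ht
    refine ⟨accValue r m t, ?_⟩
    rintro _ ⟨s, hs, rfl⟩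
    exact hub t ht s hs
  have hle : ∀ t, 0 ≤ t → V t ≤ accValue r m t := by
    intro t ht
    refine csSup_le (nonempty_Ici.image _) ?_
    rintro _ ⟨s, hs, rfl⟩
    exact hub t ht s hs
  have := h.accValue_eq hr (V := V) ?_ ?_ (fun t ht => (hle t ht).trans (le_max_left _ _)) ht
  · rw [← this]
    refine csSup_le (nonempty_Ici.image _) ?_
    rintro _ ⟨s, hs, rfl⟩
    exact hc s hs
  · intro s hs t ht hst
    exact csSup_le_csSup (hbdd s hs) (nonempty_Ici.image _) (image_mono (Ici_subset_Ici.2 hst))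
  · intro t ht
    exact le_csSup (hbdd t ht) ⟨t, self_mem_Ici, rfl⟩

/-- The mirror image: the running infimum from the left raises rewards towards `u1` as far as
earlier constraints permit. -/
theorem Regular.le_accValue_of_le_max (hr : 0 < r) (h : Regular T r m) (t c : ℝ) (ht : 0 ≤ t)
    (hc : ∀ s, 0 ≤ s → s ≤ t → c ≤ max (accValue r m s) (accLevel r m T.u1 s)) :
    c ≤ accValue r m t := by
  have hanti := h.antitoneOn_accValue hr
  set V : ℝ → ℝ := fun t =>
    sInf ((fun s => max (accValue r m s) (accLevel r m T.u1 s)) '' Icc 0 t) with hV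
  have hlb : ∀ t, 0 ≤ t → ∀ s ∈ Icc 0 t,
      accValue r m t ≤ max (accValue r m s) (accLevel r m T.u1 s) := fun t ht s hs =>
    (hanti hs.1 ht hs.2).trans (le_max_left _ _)
  have hbdd : ∀ t, 0 ≤ t →
      BddBelow ((fun s => max (accValue r m s) (accLevel r m T.u1 s)) '' Icc 0 t) := by
    rintro t ht
    refine ⟨accValue r m t, ?_⟩
    rintro _ ⟨s, hs, rfl⟩
    exact hlb t ht s hs
  have hle : ∀ t, 0 ≤ t → accValue r m t ≤ V t := by
    intro t ht
    refine le_csInf ((nonempty_Icc.2 ht).image _) ?_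
    rintro _ ⟨s, hs, rfl⟩
    exact hlb t ht s hs
  have := h.accValue_eq hr (V := V) ?_ (fun t ht => (min_le_left _ _).trans (hle t ht)) ?_ ht
  · rw [← this]
    refine le_csInf ((nonempty_Icc.2 ht).image _) ?_
    rintro _ ⟨s, hs, rfl⟩
    exact hc s hs.1 hs.2
  · intro s hs t ht hst
    exact csInf_le_csInf (hbdd t ht) ((nonempty_Icc.2 hs).image _)
      (image_mono (Icc_subset_Icc_right hst))
  · intro t ht
    exact csInf_le (hbdd t ht) ⟨t, right_mem_Icc.2 ht, rfl⟩

theorem exp_neg_sub_le (hr : 0 < r) {s t : ℝ} (hs : 0 ≤ s) (hst : s ≤ t) :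
    Real.exp (-r * s) - Real.exp (-r * t) ≤ r * (t - s) := by
  have h1 : Real.exp (-r * t) = Real.exp (-r * s) * Real.exp (-(r * (t - s))) := by
    rw [← Real.exp_add]; ring_nf
  have h2 : Real.exp (-r * s) ≤ 1 := Real.exp_le_one_iff.2 (by nlinarith)
  have h3 := Real.add_one_le_exp (-(r * (t - s)))
  have h4 := Real.exp_pos (-r * s)
  have h5 : 0 ≤ r * (t - s) := mul_nonneg hr.le (by linarith)
  rw [h1]
  nlinarith

/-- The level of `u1` falls at rate at most `r * u1`, and `accValue` inherits this rate. Lipschitz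
continuity allows `accValue` to be recovered from its derivative. -/
theorem Regular.lipschitz_accValue (hr : 0 < r) (h : Regular T r m) :
    LipschitzOnWith (r * T.u1).toNNReal (accValue r m) (Ici 0) := by
  have hx := h.bddFlow hr
  have hcont : Continuous (accLevel r m T.u1) := by
    have := hx.continuous_cum hr
    unfold accLevel; fun_prop
  have hK : (0 : ℝ) ≤ r * T.u1 := mul_nonneg hr.le T.u1.coe_nonneg
  have key : ∀ s t, 0 ≤ s → s ≤ t → accValue r m s - accValue r m t ≤ r * T.u1 * (t - s) := by
    intro s t hs hst
    refine sub_le_of_levels (h.antitoneOn_accValue hr) hcont (h.accValue_le_of_min_le hr)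
      (h.le_accValue_of_le_max hr) hK ?_ hs hst
    intro s t hs hst
    have h1 := hx.cum_mono hr hst
    have h2 := exp_neg_sub_le hr hs hst
    unfold accLevel
    nlinarith [T.u1.coe_nonneg]
  refine LipschitzOnWith.of_le_add_mul' _ fun s hs t ht => ?_
  rw [Real.dist_eq]
  rcases le_total s t with hst | hst
  · have := key s t hs hst
    rw [abs_of_nonpos (by linarith)]
    linarith
  · have := h.antitoneOn_accValue hr ht hs hst
    have : 0 ≤ r * T.u1 * |s - t| := by positivity
    linarith

/-- Wherever accumulated value falls, the constraint is slack and the loss can be paid out as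
additional flow without touching rewards. A falling `accValue` moves with the level of `u1`, so the
additional flow brings the total to exactly `u1 < u0`, where `F0` is still strictly increasing.
Since the mechanism is regular, the additional flow is zero almost everywhere. -/
theorem Regular.accValue_const (hr : 0 < r) (h : Regular T r m) {t : ℝ} (ht : 0 ≤ t) :
    accValue r m t = accValue r m 0 := by
  have hx := h.bddFlow hr
  have hlip := h.lipschitz_accValue hr
  have hanti := h.antitoneOn_accValue hr
  have hcont : Continuous (accLevel r m T.u1) := by
    have := hx.continuous_cum hr
    unfold accLevel; fun_prop
  have hac : ∀ b, 0 ≤ b → AbsolutelyContinuousOnInterval (accValue r m) 0 b := fun b hb =>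
    (hlip.mono (by rw [uIcc_of_le hb]; exact fun s hs => hs.1)).absolutelyContinuousOnInterval
  have hdiff : ∀ᵐ t ∂timeMeasure, DifferentiableAt ℝ (accValue r m) t := by
    refine ae_timeMeasure_of_forall fun τ => ?_
    rcases le_total τ 0 with h0 | h0
    · rw [Ioo_eq_empty (not_lt.2 h0)]; simp
    · have := (hac τ h0).ae_differentiableAt
      filter_upwards [ae_restrict_of_ae this, ae_restrict_mem measurableSet_Ioo] with s hs hs'
      exact hs (by rw [uIcc_of_le h0]; exact Ioo_subset_Icc_self hs')
  have hpos : ∀ᵐ t ∂timeMeasure, 0 < t := by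
    unfold timeMeasure
    rw [← restrict_Ioi_eq_restrict_Ici]
    exact ae_restrict_mem measurableSet_Ioi
  -- The flow that, once discounted, makes up for the fall in accumulated value.
  set y : ℝ → ℝ := fun t => -deriv (accValue r m) t / weight r t with hy
  have hdich : ∀ᵐ t ∂timeMeasure, 0 ≤ y t ∧ (y t = 0 ∨ (m.flow t : ℝ) + y t = T.u1) := by
    filter_upwards [hdiff, hx.ae_hasDerivAt_cum hr, hpos] with s h1 h2 h3
    have hl' : HasDerivAt (accLevel r m T.u1) (-weight r s * T.u1 + weight r s * m.flow s) s := by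
      have := ((((hasDerivAt_id s).const_mul (-r)).exp).mul_const (T.u1 : ℝ)).add h2
      refine this.congr_deriv ?_
      simp only [weight, id]; ring
    have hd : deriv (accValue r m) s ≤ 0 := by
      have ha : AntitoneOn (accValue r m) (Ioi 0) := hanti.mono Ioi_subset_Ici_self
      have hmem : Ioi (0 : ℝ) ∈ 𝓝 s := Ioi_mem_nhds h3
      rw [← derivWithin_of_mem_nhds hmem]
      exact ha.derivWithin_nonpos
    have hw := weight_pos hr s
    refine ⟨div_nonneg (by linarith) hw.le, ?_⟩
    rcases deriv_eq_zero_or_of_levels hanti hcont (h.accValue_le_of_min_le hr)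
      (h.le_accValue_of_le_max hr) hlip.continuousOn h3 h1.hasDerivAt hl' with h4 | h4
    · left; simp [hy, h4]
    · right
      simp only [hy]
      rw [h4]
      field_simp
      ring
  have hm : AEMeasurable (fun t => ((m.flow t : ℝ) + y t).toNNReal) timeMeasure :=
    (m.measurable_flow.coe_nnreal_real.add (((measurable_deriv _).neg.div
      (continuous_weight r).measurable).aemeasurable)).real_toNNReal
  have hcoe : ∀ᵐ t ∂timeMeasure, ((((m.flow t : ℝ) + y t).toNNReal : ℝ≥0) : ℝ) =
      m.flow t + y t := by
    filter_upwards [hdich] with s hs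
    exact Real.coe_toNNReal _ (add_nonneg (m.flow s).coe_nonneg hs.1)
  have hx' : BddFlow (fun t => ((m.flow t : ℝ) + y t).toNNReal) T.u0 := by
    refine ⟨hm, ?_⟩
    filter_upwards [hdich, hcoe, hx.le] with s h1 h2 h3
    rw [← NNReal.coe_le_coe, h2]
    rcases h1.2 with h4 | h4
    · rw [h4, add_zero]; exact h3
    · rw [h4]; exact T.u1_lt_u0.le
  have hcum : ∀ t, 0 ≤ t → cum r (fun t => ((m.flow t : ℝ) + y t).toNNReal) t =
      cum r m.flow t - (accValue r m t - accValue r m 0) := by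
    intro t ht
    rw [← (hac t ht).integral_deriv_eq_sub]
    unfold cum
    rw [← intervalIntegral.integral_sub (hx.integrable_dflow hr).intervalIntegrable
      (hac t ht).intervalIntegrable_deriv]
    refine intervalIntegral.integral_congr_ae ?_
    rw [uIoc_of_le ht, ← ae_restrict_iff' measurableSet_Ioc]
    have hsub : Ioc 0 t ⊆ Ici 0 := fun s hs => hs.1.le
    filter_upwards [ae_restrict_of_ae_restrict_of_subset hsub hcoe,
      ae_restrict_mem measurableSet_Ioc] with s h1 h2
    rw [dflow_of_nonneg h2.1.le, dflow_of_nonneg h2.1.le, h1]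
    have := weight_pos hr s
    simp only [hy]
    field_simp
    ring
  -- With `y` added to the flow, accumulated value is constant.
  have hIC : (Mechanism.mk (fun t => ((m.flow t : ℝ) + y t).toNNReal) m.reward hm).IC r := by
    refine (ic_iff hr (m := ⟨_, m.reward, hm⟩) hx' (fun _ ht => h.reward_ne_top hr ht)).2 ?_
    have hc : AntitoneOn (fun _ : ℝ => accValue r m 0) (Ici 0) := antitoneOn_const
    refine hc.congr fun t ht => ?_
    simp only [hcum t ht, accValue]
    ring
  have hF := h.flow_eq hr hm hIC (by
    filter_upwards [hdich, hcoe] with s h1 h2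
    rcases h1.2 with h4 | h4
    · rw [h4, add_zero, Real.toNNReal_coe]
    · rw [h4, Real.toNNReal_coe]
      refine T.F0_mono ?_ T.u1_lt_u0.le
      rw [← NNReal.coe_le_coe, ← h4]
      linarith [h1.1])
  have hy0 : ∀ᵐ t ∂timeMeasure, deriv (accValue r m) t = 0 := by
    filter_upwards [hF, hdich] with s h1 h2
    have hw := weight_pos hr s
    have hys : y s = 0 := by
      rcases h2.2 with h4 | h4
      · exact h4
      · by_contra hne
        have hlt : m.flow s < T.u1 := by
          rw [← NNReal.coe_lt_coe, ← h4]
          have := lt_of_le_of_ne h2.1 (Ne.symm hne)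
          linarith
        rw [h4, Real.toNNReal_coe] at h1
        exact (T.F0_strictMono hlt T.u1_lt_u0.le).ne h1
    simp only [hy, div_eq_zero_iff, hw.ne', or_false, neg_eq_zero] at hys
    exact hys
  have hinteg := (hac t ht).integral_deriv_eq_sub
  have : ∫ s in (0 : ℝ)..t, deriv (accValue r m) s = ∫ s in (0 : ℝ)..t, (0 : ℝ) := by
    refine intervalIntegral.integral_congr_ae ?_
    rw [uIoc_of_le ht, ← ae_restrict_iff' measurableSet_Ioc]
    exact ae_restrict_of_ae_restrict_of_subset (fun s hs => hs.1.le) hy0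
  rw [this, intervalIntegral.integral_zero] at hinteg
  linarith

/-- The agent is kept indifferent between disclosing promptly and never. -/
theorem Regular.reward_eq_contValue (hr : 0 < r) (h : Regular T r m) {t : ℝ} (ht : 0 ≤ t) :
    m.reward t = ENNReal.ofReal (contValue r m.flow t) := by
  have hx := h.bddFlow hr
  -- Rewards are bounded, so the discounted reward vanishes in the limit and only the accumulated
  -- flow remains.
  have hlim : Tendsto (accValue r m) atTop (𝓝 (0 + total r m.flow)) := by
    refine Tendsto.add ?_ (hx.tendsto_cum hr)
    refine squeeze_zero' (g := fun t => Real.exp (-r * t) * T.u0) ?_ ?_ ?_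
    · exact Eventually.of_forall fun t => by positivity
    · filter_upwards [eventually_ge_atTop 0] with t ht
      refine mul_le_mul_of_nonneg_left ?_ (Real.exp_pos _).le
      exact ENNReal.toReal_mono ENNReal.coe_ne_top (h.reward_le hr ht)
    · simpa using (tendsto_exp_neg_mul hr).mul_const (T.u0 : ℝ)
  have hconst : Tendsto (accValue r m) atTop (𝓝 (accValue r m 0)) := by
    refine tendsto_const_nhds.congr' ?_
    filter_upwards [eventually_ge_atTop 0] with t ht using (h.accValue_const hr ht).symm
  have heq := tendsto_nhds_unique hconst hlim
  have := h.accValue_const hr ht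
  rw [heq, zero_add, accValue] at this
  have e : (m.reward t).toReal = contValue r m.flow t := by
    have h1 := exp_neg_mul_contValue r m.flow t
    have h2 : Real.exp (-r * t) * (m.reward t).toReal =
        Real.exp (-r * t) * contValue r m.flow t := by linarith
    exact mul_left_cancel₀ (Real.exp_pos _).ne' h2
  rw [← e, ENNReal.ofReal_toReal (h.reward_ne_top hr ht)]

/-- No earlier constraint limits the reward at time zero, so a reward below `u1` could be raised
there. -/
theorem Regular.u1_le_total (hr : 0 < r) (h : Regular T r m) : (T.u1 : ℝ) ≤ total r m.flow := by
  have h1 := h.le_accValue_of_le_max hr 0 T.u1 le_rfl fun s hs hs' => by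
    obtain rfl : s = 0 := le_antisymm hs' hs
    refine le_trans ?_ (le_max_right _ _)
    simp [accLevel, cum_zero]
  rw [accValue, h.reward_eq_contValue hr le_rfl,
    ENNReal.toReal_ofReal ((h.bddFlow hr).contValue_nonneg hr 0), contValue_zero] at h1
  simpa [cum_zero] using h1

end Binding

/-! ### Mechanisms that keep the agent indifferent -/

section Indifferent

variable {T : Technology} {r : ℝ} {m : Mechanism} {x y : ℝ → ℝ≥0} {K : ℝ≥0}

/-- The mechanism with flow `x` whose rewards are the continuation values. -/
noncomputable def indifferent (r : ℝ) (x : ℝ → ℝ≥0) (hx : AEMeasurable x timeMeasure) :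
    Mechanism :=
  ⟨x, fun t => ENNReal.ofReal (contValue r x t), hx⟩

theorem ic_indifferent (hr : 0 < r) (hx : BddFlow x K) : (indifferent r x hx.meas).IC r := by
  refine (ic_iff hr (m := indifferent r x hx.meas) hx (fun _ _ => ENNReal.ofReal_ne_top)).2 ?_
  have hc : AntitoneOn (fun _ : ℝ => total r x) (Ici 0) := antitoneOn_const
  refine hc.congr fun t _ => ?_
  simp only [indifferent]
  rw [ENNReal.toReal_ofReal (hx.contValue_nonneg hr t), exp_neg_mul_contValue]
  ring

theorem contValue_const (hr : 0 < r) (K : ℝ≥0) {t : ℝ} (ht : 0 ≤ t) :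
    contValue r (fun _ => K) t = K := by
  have hx := bddFlow_const K
  have hcum : ∀ t, 0 ≤ t → cum r (fun _ => K) t = (1 - Real.exp (-r * t)) * K := by
    intro t ht
    have : cum r (fun _ => K) t = ∫ s in (0 : ℝ)..t, weight r s * K := by
      refine intervalIntegral.integral_congr fun s hs => ?_
      rw [uIcc_of_le ht] at hs
      exact dflow_of_nonneg hs.1
    rw [this, intervalIntegral.integral_mul_const, integral_weight]
    simp
  have htot : total r (fun _ => K) = K := by
    refine tendsto_nhds_unique (hx.tendsto_cum hr) ?_
    have : Tendsto (fun t : ℝ => (1 - Real.exp (-r * t)) * (K : ℝ)) atTop (𝓝 ((1 - 0) * K)) :=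
      (tendsto_const_nhds.sub (tendsto_exp_neg_mul hr)).mul_const _
    rw [sub_zero, one_mul] at this
    refine this.congr' ?_
    filter_upwards [eventually_ge_atTop 0] with t ht using (hcum t ht).symm
  unfold contValue
  rw [htot, hcum t ht, show (K : ℝ) - (1 - Real.exp (-r * t)) * K = Real.exp (-r * t) * K by ring,
    ← mul_assoc, exp_mul_exp_neg, one_mul]

/-- The flow `x` until time `b`, the flow `y` thereafter. -/
noncomputable def concat (x y : ℝ → ℝ≥0) (b : ℝ) (t : ℝ) : ℝ≥0 := if t ≤ b then x t else y t

theorem bddFlow_concat (hx : BddFlow x K) (hy : BddFlow y K) (b : ℝ) : BddFlow (concat x y b) K := by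
  refine ⟨?_, ?_⟩
  · refine ⟨fun t => if t ≤ b then hx.meas.mk x t else hy.meas.mk y t,
      Measurable.ite measurableSet_Iic hx.meas.measurable_mk hy.meas.measurable_mk, ?_⟩
    filter_upwards [hx.meas.ae_eq_mk, hy.meas.ae_eq_mk] with t h1 h2
    simp only [concat, ← h1, ← h2]
  filter_upwards [hx.le, hy.le] with t h1 h2
  unfold concat
  split_ifs <;> assumption

/-- If the two flows have the same continuation value at the splicing time `b`, an agent looking
ahead from before `b` does not notice the change. -/
theorem contValue_concat (hr : 0 < r) (hx : BddFlow x K) (hy : BddFlow y K) {b : ℝ}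
    (hb : contValue r x b = contValue r y b) (t : ℝ) :
    contValue r (concat x y b) t = if t ≤ b then contValue r x t else contValue r y t := by
  have hz := bddFlow_concat hx hy b
  have hright : ∀ t, b ≤ t → ∫ s in Ioi t, dflow r (concat x y b) s = ∫ s in Ioi t, dflow r y s := by
    intro t ht
    refine setIntegral_congr_fun measurableSet_Ioi fun s hs => ?_
    have : ¬ s ≤ b := not_le.2 (ht.trans_lt hs)
    simp [dflow, concat, this, indicator]
  unfold contValue
  rw [hz.total_sub_cum hr]
  split_ifs with h
  · have hsplit : Ioi t = Ioc t b ∪ Ioi b := (Ioc_union_Ioi_eq_Ioi h).symm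
    have hi := hz.integrable_dflow hr
    rw [hsplit, setIntegral_union (Ioc_disjoint_Ioi le_rfl)
      measurableSet_Ioi hi.integrableOn hi.integrableOn, hright b le_rfl, ← hy.total_sub_cum hr,
      ← exp_neg_mul_contValue, ← hb, exp_neg_mul_contValue]
    have : ∫ s in Ioc t b, dflow r (concat x y b) s = ∫ s in Ioc t b, dflow r x s := by
      refine setIntegral_congr_fun measurableSet_Ioc fun s hs => ?_
      simp [dflow, concat, hs.2, indicator]
    rw [this, ← intervalIntegral.integral_of_le h, ← hx.cum_sub hr]
    ring
  · rw [hright t (not_le.1 h).le, ← hy.total_sub_cum hr]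

theorem Technology.measurable_F0 (T : Technology) : Measurable T.F0 := T.usc_F0.measurable

/-- If the frontiers lie below parallel lines through the values of another indifference mechanism
with the same initial value, then they touch these lines. -/
theorem Regular.touch (hr : 0 < r) (h : Regular T r m) (hx : BddFlow x T.u0)
    (htot : total r x = total r m.flow) {η : ℝ}
    (h0 : ∀ᵐ t ∂timeMeasure, T.F0 (x t) ≠ ⊥ ∧ (T.F0 (m.flow t)).toReal ≤
      (T.F0 (x t)).toReal + η * (m.flow t - x t))
    (h1 : ∀ t, 0 ≤ t → T.F1 (contValue r x t).toNNReal ≠ ⊥ ∧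
      T.F1 (contValue r m.flow t).toNNReal ≤
        (((T.F1 (contValue r x t).toNNReal).toReal +
          η * (contValue r m.flow t - contValue r x t) : ℝ) : EReal)) :
    (∀ᵐ t ∂timeMeasure, (T.F0 (m.flow t)).toReal =
      (T.F0 (x t)).toReal + η * (m.flow t - x t)) ∧
    ∀ t, 0 ≤ t → T.F1 (contValue r m.flow t).toNNReal =
        (((T.F1 (contValue r x t).toNNReal).toReal +
          η * (contValue r m.flow t - contValue r x t) : ℝ) : EReal) := by
  have hm := h.bddFlow hr
  have hff := h.flowFinite hr
  have hlin : ∀ τ, IntegrableOn (fun t => η * (weight r t * m.flow t - weight r t * x t))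
      (Ioo 0 τ) := by
    intro τ
    have h1 := hm.integrable_mul (integrableOn_weight hr)
    have h2 := hx.integrable_mul (integrableOn_weight hr)
    have h3 : IntegrableOn (fun t => η * (weight r t * m.flow t - weight r t * x t)) (Ici 0) :=
      (h1.sub h2).const_mul η
    exact h3.mono_set fun s hs => hs.1.le
  -- The payoff of `x` is squeezed between that of `m` corrected by a linear term and the peak of
  -- `F0`.
  have hff' : FlowFinite T r x := by
    refine ⟨h0.mono fun t ht => ht.1, fun τ => ?_⟩
    have hup : IntegrableOn (fun t => weight r t * (T.F0 T.u0).toReal) (Ioo 0 τ) :=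
      (((continuous_weight r).mul continuous_const).integrableOn_Icc).mono_set Ioo_subset_Icc_self
    have hlow := (hff.int τ).sub (hlin τ)
    have hmeas : AEMeasurable x (volume.restrict (Ioo 0 τ)) :=
      hx.meas.mono_measure (Measure.restrict_mono (fun _ hs => hs.1.le) le_rfl)
    refine integrable_of_le_of_le ?_ ?_ ?_ hlow hup
    · exact ((continuous_weight r).measurable.aemeasurable.mul
        (T.measurable_F0.comp_aemeasurable hmeas).ereal_toReal).aestronglyMeasurable
    · filter_upwards [ae_Ioo_of_ae_timeMeasure h0 τ] with t ht
      have := mul_le_mul_of_nonneg_left ht.2 (weight_pos hr t).le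
      simp only [Pi.sub_apply]
      linarith
    · filter_upwards [ae_Ioo_of_ae_timeMeasure h0 τ] with t ht
      refine mul_le_mul_of_nonneg_left ?_ (weight_pos hr t).le
      exact EReal.toReal_le_toReal (T.F0_le_peak _) ht.1 (T.F0_lt_top _).ne
  have hcum : ∀ {y : ℝ → ℝ≥0} {K : ℝ≥0}, BddFlow y K → ∀ τ, 0 ≤ τ →
      ∫ t in Ioo 0 τ, weight r t * y t = cum r y τ := by
    intro y K hy τ hτ
    unfold cum
    rw [intervalIntegral.integral_of_le hτ, integral_Ioc_eq_integral_Ioo]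
    exact setIntegral_congr_fun measurableSet_Ioo fun s hs => (dflow_of_nonneg hs.1.le).symm
  have hinteg : ∀ {y : ℝ → ℝ≥0} {K : ℝ≥0}, BddFlow y K → ∀ τ,
      IntegrableOn (fun t => weight r t * (y t : ℝ)) (Ioo 0 τ) := by
    intro y K hy τ
    have : IntegrableOn (fun t => weight r t * (y t : ℝ)) (Ici 0) :=
      hy.integrable_mul (integrableOn_weight hr)
    exact this.mono_set fun s hs => hs.1.le
  set gap : ℝ → ℝ := fun t => weight r t * (T.F0 (x t)).toReal +
    η * (weight r t * m.flow t - weight r t * x t) - weight r t * (T.F0 (m.flow t)).toReal with hgap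
  have hgap_int : ∀ τ, IntegrableOn gap (Ioo 0 τ) := fun τ =>
    ((hff'.int τ).add (hlin τ)).sub (hff.int τ)
  have hgap0 : ∀ᵐ t ∂timeMeasure, 0 ≤ gap t := by
    filter_upwards [h0] with t ht
    have := mul_le_mul_of_nonneg_left ht.2 (weight_pos hr t).le
    simp only [hgap]
    linarith
  -- As both flows have the same initial value, the linear terms accumulated before `τ` cancel
  -- against the linear term of the reward at `τ`. This makes lines of one common slope suffice for
  -- both frontiers.
  have hgapI : ∀ τ, 0 ≤ τ → ∫ t in Ioo 0 τ, gap t =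
      (∫ t in Ioo 0 τ, weight r t * (T.F0 (x t)).toReal) +
      η * (Real.exp (-r * τ) * (contValue r x τ - contValue r m.flow τ)) -
      ∫ t in Ioo 0 τ, weight r t * (T.F0 (m.flow t)).toReal := by
    intro τ hτ
    simp only [hgap]
    have hadd : IntegrableOn (fun t => weight r t * (T.F0 (x t)).toReal +
        η * (weight r t * m.flow t - weight r t * x t)) (Ioo 0 τ) := (hff'.int τ).add (hlin τ)
    rw [integral_sub hadd (hff.int τ),
      integral_add (hff'.int τ) (hlin τ), integral_const_mul,
      integral_sub (hinteg hm τ) (hinteg hx τ), hcum hm τ hτ, hcum hx τ hτ,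
      mul_sub (Real.exp (-r * τ)), exp_neg_mul_contValue, exp_neg_mul_contValue, htot]
    ring
  have hgapI0 : ∀ τ, 0 ≤ ∫ t in Ioo 0 τ, gap t := fun τ =>
    integral_nonneg_of_ae (ae_Ioo_of_ae_timeMeasure hgap0 τ)
  have hpay : ∀ τ, 0 ≤ τ → payoffAt T r m τ =
      ((∫ t in Ioo 0 τ, weight r t * (T.F0 (m.flow t)).toReal : ℝ) : EReal) +
      ((Real.exp (-r * τ) : ℝ) : EReal) * T.F1 (contValue r m.flow τ).toNNReal := by
    intro τ hτ
    rw [payoffAt_eq, hff.flowPayoff_eq, h.reward_eq_contValue hr hτ,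
      extendTop_of_ne_top _ ENNReal.ofReal_ne_top]
    rfl
  have hpay' : ∀ τ, 0 ≤ τ → payoffAt T r (indifferent r x hx.meas) τ =
      (((∫ t in Ioo 0 τ, weight r t * (T.F0 (x t)).toReal) +
        Real.exp (-r * τ) * (T.F1 (contValue r x τ).toNNReal).toReal : ℝ) : EReal) := by
    intro τ hτ
    have : payoffAt T r (indifferent r x hx.meas) τ = flowPayoff T r x τ +
      ((Real.exp (-r * τ) : ℝ) : EReal) * extendTop T.F1 (ENNReal.ofReal (contValue r x τ)) := rfl
    rw [this, hff'.flowPayoff_eq, extendTop_of_ne_top _ ENNReal.ofReal_ne_top, EReal.coe_add,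
      EReal.coe_mul, EReal.coe_toReal (T.F1_lt_top _).ne (h1 τ hτ).1]
    rfl
  have hle : ∀ τ, 0 ≤ τ → payoffAt T r m τ ≤ payoffAt T r (indifferent r x hx.meas) τ := by
    intro τ hτ
    rw [hpay τ hτ, hpay' τ hτ]
    refine (add_le_add le_rfl (EReal.coe_mul_le_coe_mul (Real.exp_pos _) (h1 τ hτ).2)).trans ?_
    rw [← EReal.coe_mul, ← EReal.coe_add, EReal.coe_le_coe_iff]
    have a1 := hgapI τ hτ
    have a2 := hgapI0 τ
    linarith
  have heq : ∀ τ, 0 ≤ τ → T.F1 (contValue r m.flow τ).toNNReal ≠ ⊥ ∧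
      (T.F1 (contValue r m.flow τ).toNNReal).toReal =
        (T.F1 (contValue r x τ).toNNReal).toReal +
          η * (contValue r m.flow τ - contValue r x τ) ∧ ∫ t in Ioo 0 τ, gap t = 0 := by
    intro τ hτ
    have e := h.payoffAt_eq_of_le (ic_indifferent hr hx) hle hτ
    rw [hpay τ hτ, hpay' τ hτ] at e
    have hb : T.F1 (contValue r m.flow τ).toNNReal ≠ ⊥ := by
      intro hb
      rw [hb, EReal.coe_mul_bot_of_pos (Real.exp_pos _), EReal.add_bot] at e
      exact EReal.coe_ne_bot _ e.symm
    have b1 := (h1 τ hτ).2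
    rw [← EReal.coe_toReal (T.F1_lt_top _).ne hb, EReal.coe_le_coe_iff] at b1
    rw [← EReal.coe_toReal (T.F1_lt_top _).ne hb, ← EReal.coe_mul, ← EReal.coe_add,
      EReal.coe_eq_coe_iff] at e
    have a1 := hgapI τ hτ
    have a2 := hgapI0 τ
    have hexp := Real.exp_pos (-r * τ)
    have key : (∫ t in Ioo 0 τ, gap t) + Real.exp (-r * τ) *
      ((T.F1 (contValue r x τ).toNNReal).toReal + η * (contValue r m.flow τ - contValue r x τ)
        - (T.F1 (contValue r m.flow τ).toNNReal).toReal) = 0 := by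
      linarith
    have a3 := mul_nonneg hexp.le (sub_nonneg.2 b1)
    have a4 : Real.exp (-r * τ) *
      ((T.F1 (contValue r x τ).toNNReal).toReal + η * (contValue r m.flow τ - contValue r x τ)
        - (T.F1 (contValue r m.flow τ).toNNReal).toReal) = 0 := by linarith
    refine ⟨hb, ?_, by linarith⟩
    rcases mul_eq_zero.1 a4 with h | h
    · exact absurd h hexp.ne'
    · linarith
  constructor
  · refine ae_timeMeasure_of_forall fun τ => ?_
    rcases le_total τ 0 with hτ | hτ
    · rw [Ioo_eq_empty (not_lt.2 hτ)]; simp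
    have hz := (heq τ hτ).2.2
    rw [integral_eq_zero_iff_of_nonneg_ae (ae_Ioo_of_ae_timeMeasure hgap0 τ) (hgap_int τ)] at hz
    filter_upwards [hz] with t ht
    have : weight r t * ((T.F0 (x t)).toReal + η * (m.flow t - x t) -
        (T.F0 (m.flow t)).toReal) = 0 := by
      rw [← show gap t = 0 from ht]; simp only [hgap]; ring
    rcases mul_eq_zero.1 this with h | h
    · exact absurd h (weight_pos hr t).ne'
    · linarith
  · intro τ hτ
    rw [← (heq τ hτ).2.1, EReal.coe_toReal (T.F1_lt_top _).ne (heq τ hτ).1]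

/-! ### Rewards decrease and stay above `ustar` -/

theorem Technology.exists_slopeAt_F0 (T : Technology) {u : ℝ≥0} (h : 0 < u) (h' : u < T.u0) :
    ∃ η, SlopeAt T.F0 u η :=
  T.concave_F0.exists_slopeAt T.F0_lt_top T.finite_F0 h h'

theorem Technology.exists_slopeAt_F1 (T : Technology) {u : ℝ≥0} (h : 0 < u) (h' : u < T.u0) :
    ∃ η, SlopeAt T.F1 u η :=
  T.concave_F1.exists_slopeAt T.F1_lt_top (fun _ h h' => T.F1_ne_bot h h') h h'

theorem Regular.F1_ne_bot_of_pos (hr : 0 < r) (h : Regular T r m) {t : ℝ} (ht : 0 ≤ t)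
    (hpos : 0 < contValue r m.flow t) : T.F1 (contValue r m.flow t).toNNReal ≠ ⊥ :=
  T.F1_ne_bot (Real.toNNReal_pos.2 hpos)
    (Real.toNNReal_le_iff_le_coe.2 ((h.bddFlow hr).contValue_le hr ht))

/-- If a concave function touches a supporting line at two points, it coincides with the line in
between. -/
theorem SlopeAt.eq_between {F : ℝ≥0 → EReal} (hc : EConcave F) (hF : ∀ u, F u < ⊤) {u v w : ℝ≥0}
    {η : ℝ} (hs : SlopeAt F w η) (hu : F u ≠ ⊥)
    (he : (F u).toReal = (F w).toReal + η * ((u : ℝ) - w)) (h1 : u < v) (h2 : v < w) :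
    F v = (((F w).toReal + η * ((v : ℝ) - w) : ℝ) : EReal) := by
  refine le_antisymm (hs.2 v) ?_
  obtain ⟨a, b, -, -, hab, rfl⟩ := exists_convex_comb h1 h2
  obtain ⟨hb, hle⟩ := hc.real hF hab hu hs.1
  rw [← EReal.coe_toReal (hF _).ne hb, EReal.coe_le_coe_iff]
  refine le_trans (le_of_eq ?_) hle
  have hab' : (a : ℝ) + b = 1 := by exact_mod_cast hab
  have hb' : (b : ℝ) = 1 - a := by linarith
  rw [he]
  push_cast
  rw [hb']
  ring

/-- The continuation value is a weighted average of the later flow, so a value below `u` requires a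
flow below `u` on a set of positive measure. -/
theorem BddFlow.exists_flow_lt (hr : 0 < r) (hx : BddFlow x K) {c u : ℝ} (hc : 0 ≤ c)
    (hlt : contValue r x c < u) {p : ℝ → Prop} (hp : ∀ᵐ t ∂timeMeasure, p t) :
    ∃ t, c < t ∧ (x t : ℝ) < u ∧ p t := by
  by_contra! hcon
  have hu : 0 ≤ u := (hx.contValue_nonneg hr c).trans hlt.le
  have hge : ∀ᵐ t ∂timeMeasure, c < t → u ≤ x t := by
    filter_upwards [hp] with t ht hct
    by_contra! h
    exact hcon t hct h ht
  have : u ≤ contValue r x c := by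
    have hconst := contValue_const hr u.toNNReal hc
    rw [Real.coe_toNNReal _ hu] at hconst
    rw [← hconst]
    unfold contValue
    refine mul_le_mul_of_nonneg_left ?_ (Real.exp_pos _).le
    have hy := bddFlow_const u.toNNReal
    rw [hy.total_sub_cum hr, hx.total_sub_cum hr]
    refine setIntegral_mono_ae_restrict (hy.integrable_dflow hr).integrableOn
      (hx.integrable_dflow hr).integrableOn ?_
    filter_upwards [ae_restrict_of_ae_restrict_of_subset (Ioi_subset_Ici hc) hge,
      ae_restrict_mem measurableSet_Ioi] with t h1 h2
    have h0 : 0 ≤ t := hc.trans (le_of_lt h2)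
    rw [dflow_of_nonneg h0, dflow_of_nonneg h0, Real.coe_toNNReal _ hu]
    exact mul_le_mul_of_nonneg_left (h1 h2) (weight_pos hr t).le
  linarith

theorem exists_first_hit {f : ℝ → ℝ} (hf : Continuous f) {a c u : ℝ} (hac : a ≤ c) (ha : u ≤ f a)
    (hc : f c < u) : ∃ b, a ≤ b ∧ b < c ∧ f b = u ∧ ∀ t, a ≤ t → t ≤ b → u ≤ f t := by
  have hcomp : IsCompact (Icc a c ∩ f ⁻¹' {u}) :=
    isCompact_Icc.inter_right (isClosed_singleton.preimage hf)
  obtain ⟨b0, hb0, hb0u⟩ := intermediate_value_Icc' hac hf.continuousOn ⟨hc.le, ha⟩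
  obtain ⟨b, hb, hmin⟩ := hcomp.exists_isLeast ⟨b0, hb0, hb0u⟩
  have hbu : f b = u := hb.2
  refine ⟨b, hb.1.1, lt_of_le_of_ne hb.1.2 ?_, hbu, fun t hat htb => ?_⟩
  · rintro rfl; linarith
  · by_contra! hlt
    obtain ⟨s, hs, hsu⟩ := intermediate_value_Icc' hat hf.continuousOn ⟨hlt.le, ha⟩
    have hbs := hmin ⟨⟨hs.1, hs.2.trans (htb.trans hb.1.2)⟩, hsu⟩
    obtain rfl : s = t := le_antisymm hs.2 (htb.trans hbs)
    linarith

/-- Suppose the value falls below `ustar`. From the last moment before which it has stayed above,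
hold the flow at `ustar` for ever. A supergradient of `F0` at `ustar` also supports `F1` there, so
`Regular.touch` applies and both frontiers coincide with parallel lines just to the left of `ustar`.
Then `F1 - F0` is constant there, and `ustar` is not a strict local maximum. -/
theorem Regular.us_le_contValue (hr : 0 < r) (h : Regular T r m) {c : ℝ} (hc : 0 ≤ c) :
    (T.us : ℝ) ≤ contValue r m.flow c := by
  have hm := h.bddFlow hr
  by_contra! hlt
  have huspos : 0 < T.us := by
    have := (hm.contValue_nonneg hr c).trans_lt hlt
    exact_mod_cast this
  have h0 : (T.us : ℝ) ≤ contValue r m.flow 0 := by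
    rw [contValue_zero]
    exact le_trans (by exact_mod_cast T.us_le_u1) (h.u1_le_total hr)
  obtain ⟨a, ha, hac, haeq, hbefore⟩ :=
    exists_first_hit (hm.continuous_contValue hr) hc h0 hlt
  obtain ⟨η, hη0⟩ := T.exists_slopeAt_F0 huspos T.us_lt_u0
  have hη1 := T.slopeAt_us huspos hη0
  have hk : BddFlow (fun _ => T.us) T.u0 := ⟨aemeasurable_const, ae_of_all _ fun _ => T.us_lt_u0.le⟩
  have hx := bddFlow_concat hm hk a
  have hcv := contValue_concat hr hm hk (b := a) (by rw [haeq, contValue_const hr _ ha])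
  have hff := h.flowFinite hr
  obtain ⟨e0, e1⟩ := h.touch hr hx (η := η)
    (by rw [← contValue_zero, hcv, if_pos ha, contValue_zero])
    (by
      filter_upwards [hff.ne_bot] with t ht
      unfold concat
      split_ifs
      · exact ⟨ht, by simp⟩
      · exact ⟨hη0.1, hη0.le_toReal T.F0_lt_top ht⟩)
    (by
      intro t ht
      rw [hcv]
      split_ifs with hta
      · have hb := h.F1_ne_bot_of_pos hr ht
          (lt_of_lt_of_le (by exact_mod_cast huspos) (hbefore t ht hta))
        refine ⟨hb, ?_⟩
        rw [sub_self, mul_zero, add_zero, EReal.coe_toReal (T.F1_lt_top _).ne hb]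
      · rw [contValue_const hr _ ht, Real.toNNReal_coe]
        refine ⟨hη1.1, ?_⟩
        have := hη1.2 (contValue r m.flow t).toNNReal
        rwa [Real.coe_toNNReal _ (hm.contValue_nonneg hr t)] at this)
  -- both frontiers are affine with the same slope on the left of `ustar`
  set p := (contValue r m.flow c).toNNReal with hp
  have hpc : (p : ℝ) = contValue r m.flow c := Real.coe_toNNReal _ (hm.contValue_nonneg hr c)
  have hpus : p < T.us := by rw [← NNReal.coe_lt_coe, hpc]; exact hlt
  have e1c := e1 c hc
  rw [hcv, if_neg (not_le.2 hac), contValue_const hr _ hc, Real.toNNReal_coe, ← hpc,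
    Real.toNNReal_coe] at e1c
  have hp1 : T.F1 p ≠ ⊥ := by rw [e1c]; exact EReal.coe_ne_bot _
  have e1c' : (T.F1 p).toReal = (T.F1 T.us).toReal + η * ((p : ℝ) - T.us) := by
    rw [e1c, EReal.toReal_coe]
  obtain ⟨t, hct, htlt, htb, hte⟩ := hm.exists_flow_lt hr hc hlt (hff.ne_bot.and e0)
  have hqus : m.flow t < T.us := by exact_mod_cast htlt
  simp only [concat, if_neg (not_le.2 (hac.trans hct))] at hte
  have hgen := T.generic huspos
  have hgen' : ∀ᶠ u in 𝓝[<] T.us, T.F1 u - T.F0 u < T.F1 T.us - T.F0 T.us :=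
    nhdsWithin_mono _ (fun u (hu : u < T.us) => hu.ne) hgen
  have hnear : ∀ᶠ u in 𝓝[<] T.us, u ∈ Ioo (max p (m.flow t)) T.us :=
    Ioo_mem_nhdsLT (max_lt hpus hqus)
  have : (𝓝[<] T.us).NeBot := nhdsLT_neBot_of_exists_lt ⟨p, hpus⟩
  obtain ⟨u, hu1, hu2⟩ := (hgen'.and hnear).exists
  rw [hη1.eq_between T.concave_F1 T.F1_lt_top hp1 e1c' ((le_max_left _ _).trans_lt hu2.1) hu2.2,
    hη0.eq_between T.concave_F0 T.F0_lt_top htb hte ((le_max_right _ _).trans_lt hu2.1) hu2.2,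
    ← EReal.coe_toReal (T.F1_lt_top _).ne hη1.1, ← EReal.coe_toReal (T.F0_lt_top _).ne hη0.1,
    ← EReal.coe_sub, ← EReal.coe_sub, EReal.coe_lt_coe_iff] at hu1
  simp only [EReal.toReal_coe] at hu1
  linarith

theorem exists_last_hit {f : ℝ → ℝ} (hf : Continuous f) {a c u : ℝ} (hac : a ≤ c) (ha : f a < u)
    (hc : u ≤ f c) : ∃ b, a < b ∧ b ≤ c ∧ f b = u ∧ ∀ t, b ≤ t → t ≤ c → u ≤ f t := by
  obtain ⟨b, h1, h2, h3, h4⟩ := exists_first_hit (f := fun t => f (-t)) (by fun_prop)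
    (neg_le_neg hac) (u := u) (by simpa using hc) (by simpa using ha)
  refine ⟨-b, by linarith, by linarith, h3, fun t ht1 ht2 => ?_⟩
  simpa using h4 (-t) (by linarith) (by linarith)

theorem BddFlow.ae_eq_zero_of_contValue (hr : 0 < r) (hx : BddFlow x K) {c : ℝ} (hc : 0 ≤ c)
    (h0 : contValue r x c = 0) : ∀ᵐ t ∂timeMeasure, c < t → x t = 0 := by
  have hinteg := hx.integrable_dflow hr
  have hz : ∫ s in Ioi c, dflow r x s = 0 := by
    rw [← hx.total_sub_cum hr, ← exp_neg_mul_contValue, h0, mul_zero]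
  rw [integral_eq_zero_iff_of_nonneg_ae (ae_of_all _ (dflow_nonneg hr x)) hinteg.integrableOn,
    EventuallyEq, ae_restrict_iff' measurableSet_Ioi] at hz
  refine ae_restrict_of_ae (hz.mono fun t ht hct => ?_)
  have := ht hct
  rw [dflow_of_nonneg (hc.trans (le_of_lt hct))] at this
  have hw := (weight_pos hr t).ne'
  have : (x t : ℝ) = 0 := by
    rcases mul_eq_zero.1 this with h | h
    · exact absurd h hw
    · exact h
  exact_mod_cast this

/-- Once the continuation value is zero the flow is zero almost always, and the payoff from the flow
is finite. -/
theorem Regular.F0_zero_ne_bot (hr : 0 < r) (h : Regular T r m) {t : ℝ} (ht : 0 ≤ t)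
    (h0 : contValue r m.flow t = 0) : T.F0 0 ≠ ⊥ := by
  obtain ⟨s, hts, -, hs⟩ := (h.bddFlow hr).exists_flow_lt hr ht (u := 1) (by rw [h0]; norm_num)
    (((h.bddFlow hr).ae_eq_zero_of_contValue hr ht h0).and (h.flowFinite hr).ne_bot)
  rw [hs.1 hts] at hs
  exact hs.2

theorem Regular.F1_ne_bot (hr : 0 < r) (h : Regular T r m) {t : ℝ} (ht : 0 ≤ t) :
    T.F1 (contValue r m.flow t).toNNReal ≠ ⊥ := by
  rcases ((h.bddFlow hr).contValue_nonneg hr t).eq_or_lt with h0 | h0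
  · rw [← h0, Real.toNNReal_zero]
    exact fun hb => h.F0_zero_ne_bot hr ht h0.symm (le_bot_iff.1 (hb ▸ T.F0_le_F1 0))
  · exact h.F1_ne_bot_of_pos hr ht h0

/-- At `v > ustar` every supergradient `η1` of `F1` is below the supergradient `η` of `F0`. Values
above `v` thus lie strictly below the line of slope `η` through `F1 v`, whereas `Regular.touch` puts
them on it. -/
theorem Regular.not_rise (hr : 0 < r) (h : Regular T r m) (hx : BddFlow x T.u0)
    (htot : total r x = total r m.flow) {v : ℝ≥0} (hv : T.us < v) (hv' : v < T.u0)
    (hflow : ∀ t, x t = m.flow t ∨ x t = v)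
    (hval : ∀ t, 0 ≤ t → contValue r x t = contValue r m.flow t ∨
      contValue r x t = v ∧ (v : ℝ) ≤ contValue r m.flow t)
    {c : ℝ} (hc : 0 ≤ c) (hcx : contValue r x c = v) : contValue r m.flow c ≤ v := by
  have hm := h.bddFlow hr
  have hff := h.flowFinite hr
  have hvpos : 0 < v := zero_le.trans_lt hv
  obtain ⟨η, hη0⟩ := T.exists_slopeAt_F0 hvpos hv'
  obtain ⟨η1, hη1⟩ := T.exists_slopeAt_F1 hvpos hv'
  have hlt := T.slope_F1_lt_F0 hv hv' hη0 hη1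
  have hup : ∀ t, T.F1 (contValue r m.flow t).toNNReal ≤
      (((T.F1 v).toReal + η1 * (contValue r m.flow t - v) : ℝ) : EReal) := fun t => by
    have := hη1.2 (contValue r m.flow t).toNNReal
    rwa [Real.coe_toNNReal _ (hm.contValue_nonneg hr t)] at this
  obtain ⟨-, e1⟩ := h.touch hr hx (η := η) htot
    (by
      filter_upwards [hff.ne_bot] with t ht
      rcases hflow t with e | e
      · rw [e]; exact ⟨ht, by simp⟩
      · rw [e]; exact ⟨hη0.1, hη0.le_toReal T.F0_lt_top ht⟩)
    (by
      intro t ht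
      rcases hval t ht with e | ⟨e, hle⟩
      · rw [e]
        have hb := h.F1_ne_bot hr ht
        refine ⟨hb, ?_⟩
        rw [sub_self, mul_zero, add_zero, EReal.coe_toReal (T.F1_lt_top _).ne hb]
      · rw [e, Real.toNNReal_coe]
        refine ⟨hη1.1, (hup t).trans ?_⟩
        rw [EReal.coe_le_coe_iff]
        have := mul_le_mul_of_nonneg_right hlt.le (sub_nonneg.2 hle)
        linarith)
  have e := e1 c hc
  rw [hcx, Real.toNNReal_coe] at e
  have := hup c
  rw [e, EReal.coe_le_coe_iff] at this
  nlinarith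

/-- If the value rises past a level `v`, flatten the excursion above `v`: hold the flow at `v` from
the last crossing before `c` until the first return, or for ever if there is none.
`Regular.not_rise` excludes this. -/
theorem Regular.antitoneOn_contValue (hr : 0 < r) (h : Regular T r m) :
    AntitoneOn (contValue r m.flow) (Ici 0) := by
  have hm := h.bddFlow hr
  have hcont := hm.continuous_contValue hr
  intro a ha c hc hac
  by_contra! hlt
  obtain ⟨v, hv1, hv2⟩ := exists_between hlt
  lift v to ℝ≥0 using (hm.contValue_nonneg hr a).trans hv1.le
  have hv : T.us < v := by exact_mod_cast (h.us_le_contValue hr ha).trans_lt hv1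
  have hv' : v < T.u0 := by exact_mod_cast hv2.trans_le (hm.contValue_le hr hc)
  obtain ⟨b, hab, hbc, hbv, hb⟩ := exists_last_hit hcont hac hv1 hv2.le
  have hb0 : 0 ≤ b := le_trans ha hab.le
  have hbc' : b < c := lt_of_le_of_ne hbc (by rintro rfl; linarith)
  have hk : BddFlow (fun _ => v) T.u0 := ⟨aemeasurable_const, ae_of_all _ fun _ => hv'.le⟩
  have hx := bddFlow_concat hm hk b
  have hcv := contValue_concat hr hm hk (b := b) (by rw [hbv, contValue_const hr _ hb0])
  have hflow : ∀ t, concat m.flow (fun _ => v) b t = m.flow t ∨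
      concat m.flow (fun _ => v) b t = v := by
    intro t; unfold concat; split_ifs <;> simp
  -- If the value returns to `v`, the original flow resumes at that time, where the continuation
  -- values agree.
  by_cases hret : ∃ t, c ≤ t ∧ contValue r m.flow t < v
  · obtain ⟨t, hct, ht⟩ := hret
    obtain ⟨d, hcd, -, hdv, hd⟩ := exists_first_hit hcont hct hv2.le ht
    have hd0 : 0 ≤ d := hb0.trans (hbc.trans hcd)
    have hx' := bddFlow_concat hx hm d
    have hcv' := contValue_concat hr hx hm (b := d) (by
      rw [hcv, if_neg (not_le.2 (hbc'.trans_le hcd)), contValue_const hr _ hd0, hdv])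
    refine absurd (h.not_rise hr hx' ?_ hv hv' ?_ ?_ hc ?_) (not_le.2 hv2)
    · rw [← contValue_zero, hcv', if_pos hd0, hcv, if_pos hb0, contValue_zero]
    · intro t
      by_cases htd : t ≤ d
      · rw [concat, if_pos htd]; exact hflow t
      · rw [concat, if_neg htd]; exact Or.inl rfl
    · intro t ht
      rw [hcv']
      split_ifs with htd
      · rw [hcv]
        split_ifs with htb
        · exact Or.inl rfl
        · refine Or.inr ⟨contValue_const hr _ ht, ?_⟩
          rcases le_total t c with htc | htc
          · exact hb t (not_le.1 htb).le htc
          · exact hd t htc htd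
      · exact Or.inl rfl
    · rw [hcv', if_pos hcd, hcv, if_neg (not_le.2 hbc'), contValue_const hr _ hc]
  · push Not at hret
    refine absurd (h.not_rise hr hx ?_ hv hv' hflow ?_ hc ?_) (not_le.2 hv2)
    · rw [← contValue_zero, hcv, if_pos hb0, contValue_zero]
    · intro t ht
      rw [hcv]
      split_ifs with htb
      · exact Or.inl rfl
      · refine Or.inr ⟨contValue_const hr _ ht, ?_⟩
        rcases le_total t c with htc | htc
        · exact hb t (not_le.1 htb).le htc
        · exact hret t htc
    · rw [hcv, if_neg (not_le.2 hbc'), contValue_const hr _ hc]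

/-- The continuation value solves `X' = r * (X - x)` almost everywhere and is decreasing. -/
theorem Regular.contValue_le_flow (hr : 0 < r) (h : Regular T r m) :
    ∀ᵐ t ∂timeMeasure, contValue r m.flow t ≤ m.flow t := by
  have hm := h.bddFlow hr
  have hpos : ∀ᵐ t ∂timeMeasure, 0 < t := by
    unfold timeMeasure
    rw [← restrict_Ioi_eq_restrict_Ici]
    exact ae_restrict_mem measurableSet_Ioi
  filter_upwards [hm.ae_hasDerivAt_cum hr, hpos] with t ht h0
  have hd : HasDerivAt (contValue r m.flow) (r * (contValue r m.flow t - m.flow t)) t := by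
    have h1 := (((hasDerivAt_id t).const_mul r).exp).mul
      (ht.const_sub (total r m.flow))
    refine h1.congr_deriv ?_
    have e := exp_mul_exp_neg r t
    simp only [weight, contValue, id]
    linear_combination (-(r * (m.flow t : ℝ))) * e
  have ha : AntitoneOn (contValue r m.flow) (Ioi 0) :=
    (h.antitoneOn_contValue hr).mono Ioi_subset_Ici_self
  have hle : deriv (contValue r m.flow) t ≤ 0 := by
    rw [← derivWithin_of_mem_nhds (Ioi_mem_nhds h0)]
    exact ha.derivWithin_nonpos
  rw [hd.deriv] at hle
  have := nonpos_of_mul_nonpos_right hle hr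
  linarith

end Indifferent

/-! ### Exchanging the order of integration -/

section Swap

variable {G : Measure ℝ}

theorem measure_Ioi_pos (hsupp : ¬ BddAbove G.support) (t : ℝ) : 0 < G (Ioi t) := by
  rw [not_bddAbove_iff] at hsupp
  obtain ⟨s, hs, hts⟩ := hsupp t
  exact (Measure.mem_support_iff_forall s).1 hs _ (Ioi_mem_nhds hts)

/-- Probability that the breakthrough occurs after `t`. -/
noncomputable def tail (G : Measure ℝ) (t : ℝ) : ℝ := G.real (Ioi t)

theorem tail_nonneg (G : Measure ℝ) (t : ℝ) : 0 ≤ tail G t := measureReal_nonneg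

theorem tail_le_one [IsProbabilityMeasure G] (t : ℝ) : tail G t ≤ 1 := measureReal_le_one

theorem tail_pos [IsFiniteMeasure G] (hsupp : ¬ BddAbove G.support) (t : ℝ) : 0 < tail G t :=
  ENNReal.toReal_pos (measure_Ioi_pos hsupp t).ne' (measure_ne_top _ _)

theorem one_sub_cdf [IsProbabilityMeasure G] (t : ℝ) : 1 - ProbabilityTheory.cdf G t = tail G t := by
  rw [ProbabilityTheory.cdf_eq_real, tail, ← compl_Iic, probReal_compl_eq_one_sub measurableSet_Iic]

theorem antitone_tail [IsFiniteMeasure G] : Antitone (tail G) := fun _ _ h =>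
  measureReal_mono (Ioi_subset_Ioi h)

theorem integral_timeMeasure_Iio (a : ℝ → ℝ) (τ : ℝ) :
    ∫ t, (Iio τ).indicator a t ∂timeMeasure = ∫ t in Ioo 0 τ, a t := by
  rw [integral_indicator measurableSet_Iio, timeMeasure, Measure.restrict_restrict measurableSet_Iio,
    inter_comm, Ici_inter_Iio, integral_Ico_eq_integral_Ioo]

/-- The expected integral up to the breakthrough. -/
theorem integral_swap_tail [IsFiniteMeasure G] {a : ℝ → ℝ}
    (ha : AEStronglyMeasurable a timeMeasure)
    (haP : Integrable (fun t => a t * tail G t) timeMeasure) :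
    Integrable (fun τ => ∫ t in Ioo 0 τ, a t) G ∧
      ∫ τ, (∫ t in Ioo 0 τ, a t) ∂G = ∫ t, a t * tail G t ∂timeMeasure := by
  have : SFinite timeMeasure := by unfold timeMeasure; infer_instance
  set H : ℝ × ℝ → ℝ := {p : ℝ × ℝ | p.1 < p.2}.indicator fun p => a p.1 with hH
  have hmeas : AEStronglyMeasurable H (timeMeasure.prod G) :=
    (ha.comp_fst).indicator (measurableSet_lt measurable_fst measurable_snd)
  have hrow : ∀ t, (fun τ => H (t, τ)) = (Ioi t).indicator fun _ => a t := by
    intro t; ext τ; simp [hH, indicator]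
  have hrowI : ∀ t, ∫ τ, H (t, τ) ∂G = a t * tail G t := by
    intro t
    rw [show (∫ τ, H (t, τ) ∂G) = ∫ τ, (Ioi t).indicator (fun _ => a t) τ ∂G by rw [← hrow],
      integral_indicator measurableSet_Ioi, setIntegral_const, tail, smul_eq_mul, mul_comm]
  have hinteg : Integrable H (timeMeasure.prod G) := by
    rw [integrable_prod_iff hmeas]
    refine ⟨ae_of_all _ fun t => ?_, ?_⟩
    · rw [hrow]; exact (integrable_const _).indicator measurableSet_Ioi
    · refine haP.norm.congr (ae_of_all _ fun t => ?_)
      have : (fun τ => ‖H (t, τ)‖) = (Ioi t).indicator fun _ => ‖a t‖ := by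
        ext τ; rw [show H (t, τ) = (Ioi t).indicator (fun _ => a t) τ by rw [← hrow],
          norm_indicator_eq_indicator_norm]
      simp only
      rw [this, integral_indicator measurableSet_Ioi, setIntegral_const, norm_mul,
        Real.norm_of_nonneg (tail_nonneg G t), tail, smul_eq_mul, mul_comm]
  have hcol : ∀ τ, ∫ t, H (t, τ) ∂timeMeasure = ∫ t in Ioo 0 τ, a t := by
    intro τ
    rw [← integral_timeMeasure_Iio]
    rfl
  refine ⟨hinteg.integral_prod_right.congr (ae_of_all _ hcol), ?_⟩
  rw [integral_congr_ae (ae_of_all _ fun τ => (hcol τ).symm),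
    ← integral_prod_symm _ hinteg, integral_prod _ hinteg]
  exact integral_congr_ae (ae_of_all _ hrowI)

/-- Integration by parts for the distribution function of `f G`. -/
theorem integral_swap_Icc (hG : IsTimeDistribution G) {a f : ℝ → ℝ} (ha : Integrable a timeMeasure)
    (hf : Integrable f G) :
    ∫ t, a t * (∫ τ in Icc 0 t, f τ ∂G) ∂timeMeasure =
      ∫ τ, f τ * (∫ t in Ioi τ, (Ici 0).indicator a t) ∂G := by
  have := hG.isProbabilityMeasure
  have : SFinite timeMeasure := by unfold timeMeasure; infer_instance
  set H : ℝ × ℝ → ℝ := {p : ℝ × ℝ | p.2 ≤ p.1}.indicator fun p => a p.1 * f p.2 with hH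
  have hinteg : Integrable H (timeMeasure.prod G) :=
    (ha.mul_prod hf).indicator (measurableSet_le measurable_snd measurable_fst)
  have e1 : ∀ t, ∫ τ, H (t, τ) ∂G = a t * (∫ τ in Icc 0 t, f τ ∂G) := by
    intro t
    have hrow : (fun τ => H (t, τ)) =ᵐ[G] (Icc 0 t).indicator fun τ => a t * f τ := by
      filter_upwards [hG.ae_nonneg] with τ hτ
      simp [hH, indicator, hτ]
    rw [integral_congr_ae hrow, integral_indicator measurableSet_Icc, integral_const_mul]
  have e2 : ∀ τ, ∫ t, H (t, τ) ∂timeMeasure = f τ * (∫ t in Ioi τ, (Ici 0).indicator a t) := by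
    intro τ
    have hcol : (fun t => H (t, τ)) = (Ici τ).indicator fun t => f τ * a t := by
      ext t; simp [hH, indicator, mul_comm]
    rw [hcol, integral_indicator measurableSet_Ici, integral_const_mul, timeMeasure,
      ← integral_Ici_eq_integral_Ioi, setIntegral_indicator measurableSet_Ici,
      Measure.restrict_restrict measurableSet_Ici]
  rw [← integral_congr_ae (ae_of_all _ e1), ← integral_congr_ae (ae_of_all _ e2),
    ← integral_prod_symm _ hinteg, integral_prod _ hinteg]

/-- A lower set of reals is a closed half-line or an increasing union of countably many closed
half-lines, unless it is empty. -/
theorem setIntegral_lower_nonpos (hG : IsTimeDistribution G) {f : ℝ → ℝ} (hf : Integrable f G)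
    (hneg : ∀ t, 0 ≤ t → ∫ τ in Icc 0 t, f τ ∂G ≤ 0) {I : Set ℝ} (hI : IsLowerSet I) :
    ∫ τ in I, f τ ∂G ≤ 0 := by
  have hIic : ∀ t, ∫ τ in Iic t, f τ ∂G ≤ 0 := by
    intro t
    have hr : (G.restrict (Ici 0)) = G := Measure.restrict_eq_self_of_ae_mem hG.ae_nonneg
    have e : ∫ τ in Iic t, f τ ∂G = ∫ τ in Icc 0 t, f τ ∂G := by
      conv_lhs => rw [← hr, Measure.restrict_restrict measurableSet_Iic, inter_comm, Ici_inter_Iic]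
    rw [e]
    rcases le_or_gt 0 t with h | h
    · exact hneg t h
    · rw [Icc_eq_empty (not_le.2 h)]; simp
  have hlim : ∀ {J : Set ℝ} (a : ℕ → ℝ), Monotone a → (⋃ n, Iic (a n)) = J →
      ∫ τ in J, f τ ∂G ≤ 0 := by
    rintro _ a ha rfl
    exact le_of_tendsto' (tendsto_setIntegral_of_monotone (fun _ => measurableSet_Iic)
      (fun m n h => Iic_subset_Iic.2 (ha h)) hf.integrableOn) fun n => hIic _
  by_cases hb : BddAbove I
  · rcases I.eq_empty_or_nonempty with rfl | hne
    · simp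
    by_cases hmem : sSup I ∈ I
    · have : I = Iic (sSup I) :=
        subset_antisymm (fun t ht => le_csSup hb ht) fun t ht => hI ht hmem
      rw [this]; exact hIic _
    · refine hlim (fun n : ℕ => sSup I - 1 / ((n : ℝ) + 1)) ?_ ?_
      · intro m n h
        exact sub_le_sub_left (Nat.one_div_le_one_div h) _
      · ext t
        simp only [mem_iUnion, mem_Iic]
        constructor
        · rintro ⟨n, hn⟩
          have hlt : t < sSup I := hn.trans_lt (sub_lt_self _ Nat.one_div_pos_of_nat)
          obtain ⟨s, hs, hts⟩ := exists_lt_of_lt_csSup hne hlt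
          exact hI hts.le hs
        · intro ht
          have hlt : t < sSup I := lt_of_le_of_ne (le_csSup hb ht) (by rintro rfl; exact hmem ht)
          obtain ⟨n, hn⟩ := exists_nat_one_div_lt (sub_pos.2 hlt)
          exact ⟨n, by linarith⟩
  · refine hlim (fun n : ℕ => (n : ℝ)) Nat.mono_cast ?_
    ext t
    simp only [mem_iUnion, mem_Iic]
    refine ⟨fun _ => ?_, fun _ => exists_nat_ge t⟩
    obtain ⟨s, hs, hts⟩ := not_bddAbove_iff.1 hb t
    exact hI hts.le hs

/-- A function with nonpositive integrals over initial segments has a nonpositive integral against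
decreasing weights. -/
theorem integral_mul_antitone_nonpos (hG : IsTimeDistribution G) {f W : ℝ → ℝ}
    (hf : Integrable f G) (hneg : ∀ t, 0 ≤ t → ∫ τ in Icc 0 t, f τ ∂G ≤ 0) (hW : Antitone W)
    (hW0 : ∀ t, 0 ≤ W t) {K : ℝ} (hWK : ∀ t, W t ≤ K) : ∫ τ, f τ * W τ ∂G ≤ 0 := by
  have := hG.isProbabilityMeasure
  set ν : Measure ℝ := volume.restrict (Ioo 0 K) with hν
  have hfin : IsFiniteMeasure ν := by rw [hν]; infer_instance
  -- Layer-cake formula: `W τ` is the length of the set of `s` in `(0, K)` below `W τ`, and for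
  -- fixed `s` the times with `s < W` form a lower set.
  set H : ℝ × ℝ → ℝ := {p : ℝ × ℝ | p.1 < W p.2}.indicator fun p => f p.2 with hH
  have hinteg : Integrable H (ν.prod G) := by
    refine Integrable.indicator ?_
      (measurableSet_lt measurable_fst (hW.measurable.comp measurable_snd))
    exact hf.comp_snd ν
  have e1 : ∀ s, ∫ τ, H (s, τ) ∂G = ∫ τ in {τ | s < W τ}, f τ ∂G := fun s => by
    rw [← integral_indicator (measurableSet_lt measurable_const hW.measurable)]; rfl
  have e2 : ∀ τ, ∫ s, H (s, τ) ∂ν = f τ * W τ := by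
    intro τ
    have : (fun s => H (s, τ)) = (Iio (W τ)).indicator fun _ => f τ := by
      ext s; simp [hH, indicator]
    rw [this, integral_indicator measurableSet_Iio, setIntegral_const, hν, measureReal_def,
      Measure.restrict_apply measurableSet_Iio, inter_comm, Ioo_inter_Iio, min_eq_right (hWK τ),
      Real.volume_Ioo, sub_zero, ENNReal.toReal_ofReal (hW0 τ), smul_eq_mul, mul_comm]
  rw [← integral_congr_ae (ae_of_all _ e2), ← integral_prod_symm _ hinteg, integral_prod _ hinteg]
  refine integral_nonpos fun s => ?_
  simp only [e1]
  exact setIntegral_lower_nonpos hG hf hneg fun a b hba ha => lt_of_lt_of_le ha (hW hba)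

end Swap

/-! ### Sufficiency of the Euler equation -/

section Payoff

variable {T : Technology} {r : ℝ} {m : Mechanism} {x : ℝ → ℝ≥0} {G : Measure ℝ}

theorem Technology.measurable_F1 (T : Technology) : Measurable T.F1 := T.usc_F1.measurable

/-- The payoff from the flow, real-valued. -/
noncomputable def flowReturn (T : Technology) (r : ℝ) (x : ℝ → ℝ≥0) (τ : ℝ) : ℝ :=
  ∫ t in Ioo 0 τ, weight r t * (T.F0 (x t)).toReal

theorem FlowFinite.aemeasurable_flowReturn (h : FlowFinite T r x) (hG : IsTimeDistribution G) :
    AEMeasurable (flowReturn T r x) G := by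
  set g : ℝ → ℝ := (Ioi 0).indicator fun t => weight r t * (T.F0 (x t)).toReal with hg
  have hinteg : ∀ a b, IntervalIntegrable g volume a b := by
    intro a b
    have key : ∀ a b, a ≤ b → IntegrableOn g (Ioo a b) := by
      intro a b _
      rw [hg, IntegrableOn, integrable_indicator_iff measurableSet_Ioi, IntegrableOn,
        Measure.restrict_restrict measurableSet_Ioi]
      exact (h.int b).mono_set fun t ht => ⟨ht.1, ht.2.2⟩
    rcases le_total a b with hab | hab
    · rw [intervalIntegrable_iff_integrableOn_Ioo_of_le hab]; exact key a b hab
    · refine IntervalIntegrable.symm ?_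
      rw [intervalIntegrable_iff_integrableOn_Ioo_of_le hab]; exact key b a hab
  refine ⟨fun τ => ∫ t in (0 : ℝ)..τ, g t,
    (intervalIntegral.continuous_primitive hinteg 0).measurable, ?_⟩
  filter_upwards [hG.ae_nonneg] with τ hτ
  rw [intervalIntegral.integral_of_le hτ, integral_Ioc_eq_integral_Ioo, flowReturn]
  refine setIntegral_congr_fun measurableSet_Ioo fun t ht => ?_
  rw [hg, indicator_of_mem (mem_Ioi.2 ht.1)]

theorem integral_weight_Ioo {τ : ℝ} (hτ : 0 ≤ τ) :
    ∫ t in Ioo 0 τ, weight r t = 1 - Real.exp (-r * τ) := by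
  rw [← integral_Ioc_eq_integral_Ioo, ← intervalIntegral.integral_of_le hτ, integral_weight]
  simp

/-- The payoff of a mechanism with flow `x` and rewards `X`, conditional on the breakthrough. -/
noncomputable def realPayoff (T : Technology) (r : ℝ) (x : ℝ → ℝ≥0) (X : ℝ → ℝ≥0) (τ : ℝ) : ℝ :=
  flowReturn T r x τ + Real.exp (-r * τ) * (T.F1 (X τ)).toReal

theorem FlowFinite.payoffAt_eq (h : FlowFinite T r m.flow) {τ : ℝ} (hX : m.reward τ ≠ ∞)
    (hb : T.F1 (m.reward τ).toNNReal ≠ ⊥) :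
    payoffAt T r m τ = (realPayoff T r m.flow (fun t => (m.reward t).toNNReal) τ : EReal) := by
  rw [Breakthrough.payoffAt_eq, h.flowPayoff_eq, extendTop_of_ne_top _ hX, realPayoff,
    EReal.coe_add, EReal.coe_mul, EReal.coe_toReal (T.F1_lt_top _).ne hb]
  rfl

theorem FlowFinite.realPayoff_le (hr : 0 < r) (h : FlowFinite T r x) (X : ℝ → ℝ≥0) {τ : ℝ}
    (hτ : 0 ≤ τ) (hb : T.F1 (X τ) ≠ ⊥) :
    realPayoff T r x X τ ≤ |(T.F0 T.u0).toReal| + |(T.F1 T.u1).toReal| := by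
  have h1 : flowReturn T r x τ ≤ |(T.F0 T.u0).toReal| := by
    have hup : IntegrableOn (fun t => weight r t * (T.F0 T.u0).toReal) (Ioo 0 τ) :=
      (((continuous_weight r).mul continuous_const).integrableOn_Icc).mono_set Ioo_subset_Icc_self
    have : flowReturn T r x τ ≤ ∫ t in Ioo 0 τ, weight r t * (T.F0 T.u0).toReal := by
      refine integral_mono_ae (h.int τ) hup ?_
      filter_upwards [ae_Ioo_of_ae_timeMeasure h.ne_bot τ] with t ht
      exact mul_le_mul_of_nonneg_left
        (EReal.toReal_le_toReal (T.F0_le_peak _) ht (T.F0_lt_top _).ne) (weight_pos hr t).le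
    refine this.trans ?_
    rw [integral_mul_const, integral_weight_Ioo hτ]
    have he := Real.exp_pos (-r * τ)
    have he' : Real.exp (-r * τ) ≤ 1 := Real.exp_le_one_iff.2 (by nlinarith)
    nlinarith [le_abs_self (T.F0 T.u0).toReal, abs_nonneg (T.F0 T.u0).toReal]
  have h2 : Real.exp (-r * τ) * (T.F1 (X τ)).toReal ≤ |(T.F1 T.u1).toReal| := by
    have a1 := EReal.toReal_le_toReal (T.F1_le_peak (X τ)) hb (T.F1_lt_top _).ne
    have he := Real.exp_pos (-r * τ)
    have he' : Real.exp (-r * τ) ≤ 1 := Real.exp_le_one_iff.2 (by nlinarith)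
    nlinarith [le_abs_self (T.F1 T.u1).toReal, abs_nonneg (T.F1 T.u1).toReal]
  exact add_le_add h1 h2

/-- Comparison of integrals of extended-real functions through an integrable bound on the
difference. -/
theorem eintegral_le_of_le_add {f : ℝ → EReal} {h k : ℝ → ℝ} {K : ℝ} [IsFiniteMeasure G]
    (hh : AEMeasurable h G) (hhK : ∀ᵐ τ ∂G, h τ ≤ K) (hk : Integrable k G) (hk0 : ∫ τ, k τ ∂G ≤ 0)
    (hf : ∀ᵐ τ ∂G, f τ ≤ ((h τ + k τ : ℝ) : EReal)) :
    eintegral G f ≤ eintegral G fun τ => (h τ : EReal) := by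
  refine (eintegral_mono hf).trans ?_
  have hm : AEMeasurable (fun τ => ((h τ + k τ : ℝ) : EReal)) G :=
    (hh.add hk.aestronglyMeasurable.aemeasurable).coe_real_ereal
  -- Either the larger integral is `-∞`, or `h + k` is integrable and then so is `h`.
  rcases eintegral_eq_bot_or hm ((integrable_const K).add hk)
    (hhK.mono fun τ hτ => by
      simp only [Pi.add_apply]; exact_mod_cast add_le_add_left hτ (k τ)) with hb | ⟨-, hi, he⟩
  · rw [hb]; exact bot_le
  · simp only [EReal.toReal_coe] at hi he
    have hhi : Integrable h G := by
      refine (hi.sub hk).congr (ae_of_all _ fun τ => ?_)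
      simp
    rw [he, eintegral_coe hhi, EReal.coe_le_coe_iff, integral_add hhi hk]
    linarith

/-- A flow and rewards bounded by `u0` do better than any given mechanism. -/
theorem exists_capped (hr : 0 < r) {m' : Mechanism} (hm' : m'.IC r) :
    ∃ m'' : Mechanism, m''.IC r ∧ BddFlow m''.flow T.u0 ∧ (∀ t, m''.reward t ≤ T.u0) ∧
      ∀ τ, 0 ≤ τ → payoffAt T r m' τ ≤ payoffAt T r m'' τ := by
  have hx : AEMeasurable (fun t => min (m'.flow t) T.u0) timeMeasure :=
    m'.measurable_flow.min aemeasurable_const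
  have h1 := hm'.mono_flow hx (ae_of_all _ fun t => min_le_left _ _)
  have hle : ∀ᵐ t ∂timeMeasure, min (m'.flow t) T.u0 ≤ T.u0 := ae_of_all _ fun t => min_le_right _ _
  refine ⟨_, h1.cap_reward hr hle, ⟨hx, hle⟩, fun t => min_le_right _ _, fun τ hτ => ?_⟩
  refine add_le_add (eintegral_mono (ae_of_all _ fun t => ?_))
    (EReal.coe_mul_le_coe_mul (Real.exp_pos _) (extendTop_F1_le_min T _))
  exact EReal.coe_mul_le_coe_mul (weight_pos hr t) (T.F0_le_min _)

end Payoff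

/-! ### The Euler equation in real terms and its sufficiency -/

section Sufficiency

variable {T : Technology} {r : ℝ} {m : Mechanism} {G : Measure ℝ}

/-- The Euler equation in real terms. -/
structure RealEuler (T : Technology) (G : Measure ℝ) (m : Mechanism) (p f : ℝ → ℝ) : Prop where
  meas : AEMeasurable p timeMeasure
  nonneg : ∀ t, 0 ≤ t → 0 ≤ p t
  int : Integrable f G
  slope0 : ∀ᵐ t ∂timeMeasure, SlopeAt T.F0 (m.flow t) (p t)
  slope1 : ∀ᵐ t ∂G, m.reward t ≠ ∞ ∧ SlopeAt T.F1 (m.reward t).toNNReal (f t)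
  eq : ∀ t, 0 ≤ t → tail G t * p t + ∫ τ in Icc 0 t, f τ ∂G = 0

/-- Unbounded support keeps the probability of later breakthroughs positive. So the slope condition
on the flow is in force at almost all times, and an infinite `φ0` would contradict the equation. -/
theorem SatisfiesEuler.exists_realEuler (hG : IsTimeDistribution G)
    (hsupp : ¬ BddAbove G.support) (h : SatisfiesEuler T G m) : ∃ p f, RealEuler T G m p f := by
  have := hG.isProbabilityMeasure
  obtain ⟨φ0, φ1, hm0, hi, hs0, hs1, he⟩ := h
  have hne : ∀ t, 0 ≤ t → φ0 t ≠ ∞ := by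
    intro t ht htop
    have := he t ht
    rw [htop, one_sub_cdf, (hi.restrict _).eintegral_eq, EReal.coe_ennreal_top,
      EReal.coe_mul_top_of_pos (tail_pos hsupp t), EReal.top_add_coe] at this
    simp at this
  have hcoe : ∀ t, 0 ≤ t → ((φ0 t : ℝ≥0∞) : EReal) = (((φ0 t).toReal : ℝ) : EReal) := fun t ht =>
    (EReal.coe_ennreal_toReal (hne t ht)).symm
  refine ⟨fun t => (φ0 t).toReal, fun t => (φ1 t).toReal, hm0.ennreal_toReal,
    fun _ _ => ENNReal.toReal_nonneg, hi.ae_real.2, ?_, ?_, ?_⟩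
  · filter_upwards [hs0, ae_restrict_mem measurableSet_Ici] with t ht h0
    have hlt : ProbabilityTheory.cdf G t < 1 := by
      have := tail_pos hsupp t
      rw [← one_sub_cdf] at this
      linarith
    have hs := ht hlt
    rw [hcoe t h0] at hs
    exact hs.slopeAt T.F0_lt_top T.F0_u0_ne_bot
  · filter_upwards [hs1, hi.ae_real.1] with t ht hf
    refine ⟨ht.1, ?_⟩
    have hs := ht.2
    rw [← EReal.coe_toReal hf.2 hf.1] at hs
    exact hs.slopeAt T.F1_lt_top T.F1_u0_ne_bot
  · intro t ht
    have := he t ht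
    rw [one_sub_cdf, hcoe t ht, (hi.restrict _).eintegral_eq, ← EReal.coe_mul, ← EReal.coe_add,
      ← EReal.coe_zero, EReal.coe_eq_coe_iff] at this
    exact this

variable {p f : ℝ → ℝ}

theorem RealEuler.tail_mul_le (h : RealEuler T G m p f) {t : ℝ} (ht : 0 ≤ t) :
    tail G t * p t ≤ ∫ τ, |f τ| ∂G := by
  have h1 := h.eq t ht
  have h2 : -∫ τ in Icc 0 t, f τ ∂G ≤ ∫ τ, |f τ| ∂G := by
    refine (neg_le_abs _).trans (abs_integral_le_integral_abs.trans ?_)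
    exact setIntegral_le_integral h.int.abs (ae_of_all _ fun _ => abs_nonneg _)
  linarith

/-- The Euler equation bounds `p` on `(0, τ)`, as the tail is bounded away from zero there.
Supporting lines with bounded slopes bound `F0` along the flow from below. Rewards have real
supergradients `G`-almost surely, hence finite `F1` at some arbitrarily late times. -/
theorem RealEuler.regular (hr : 0 < r) (hG : IsTimeDistribution G) (hsupp : ¬ BddAbove G.support)
    (h : RealEuler T G m p f) (hu : Undominated T r m) : Regular T r m := by
  have := hG.isProbabilityMeasure
  have hff : FlowFinite T r m.flow := by
    refine ⟨h.slope0.mono fun t ht => ht.1, fun τ => ?_⟩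
    set K := (∫ τ, |f τ| ∂G) / tail G τ with hK
    have hpK : ∀ t ∈ Ioo 0 τ, p t ≤ K := by
      intro t ht
      rw [hK, le_div_iff₀ (tail_pos hsupp τ)]
      have h1 := h.tail_mul_le ht.1.le
      have h2 := mul_le_mul_of_nonneg_right (antitone_tail (G := G) ht.2.le) (h.nonneg t ht.1.le)
      linarith
    have hw : IntegrableOn (weight r) (Ioo 0 τ) :=
      (continuous_weight r).integrableOn_Icc.mono_set Ioo_subset_Icc_self
    have hmeas : AEMeasurable m.flow (volume.restrict (Ioo 0 τ)) :=
      m.measurable_flow.mono_measure (Measure.restrict_mono (fun _ hs => hs.1.le) le_rfl)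
    refine integrable_of_le_of_le ?_ ?_ ?_
      (hw.mul_const ((T.F0 T.u0).toReal - K * T.u0)) (hw.mul_const ((T.F0 T.u0).toReal))
    · exact ((continuous_weight r).measurable.aemeasurable.mul
        (T.measurable_F0.comp_aemeasurable hmeas).ereal_toReal).aestronglyMeasurable
    · filter_upwards [ae_Ioo_of_ae_timeMeasure h.slope0 τ, ae_restrict_mem measurableSet_Ioo]
        with t ht ht'
      refine mul_le_mul_of_nonneg_left ?_ (weight_pos hr t).le
      have h1 := ht.le_toReal T.F0_lt_top T.F0_u0_ne_bot
      have h2 : p t * ((T.u0 : ℝ) - m.flow t) ≤ K * T.u0 := by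
        have a1 := mul_le_mul_of_nonneg_right (hpK t ht') (NNReal.coe_nonneg T.u0)
        have a2 := mul_nonneg (h.nonneg t ht'.1.le) (NNReal.coe_nonneg (m.flow t))
        rw [mul_sub]; linarith
      linarith
    · filter_upwards [ae_Ioo_of_ae_timeMeasure h.slope0 τ] with t ht
      exact mul_le_mul_of_nonneg_left
        (EReal.toReal_le_toReal (T.F0_le_peak _) ht.1 (T.F0_lt_top _).ne) (weight_pos hr t).le
  refine ⟨hu, fun S => ?_⟩
  have hpos : 0 < G (Ioi (max S 0)) := measure_Ioi_pos hsupp _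
  obtain ⟨τ, hτ, hs⟩ : ∃ τ ∈ Ioi (max S 0), m.reward τ ≠ ∞ ∧
      SlopeAt T.F1 (m.reward τ).toNNReal (f τ) := by
    by_contra! hcon
    refine hpos.ne' (measure_mono_null (fun τ hτ => ?_) (ae_iff.1 h.slope1))
    simp only [mem_ofPred_eq, not_and]
    exact hcon τ hτ
  refine ⟨τ, (le_max_left _ _).trans_lt hτ, (le_max_right _ _).trans (le_of_lt hτ), ?_⟩
  rw [hff.payoffAt_eq hs.1 hs.2.1]
  exact EReal.coe_ne_bot _

/-- The linearised gain `k` of a deviation from `m` integrates to the integral of `f * W`, where `W`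
is the discounted surplus of the deviating reward over its own continuation value. It is nonpositive
because `W` decreases and `f` has nonpositive initial integrals. -/
theorem RealEuler.optimal (hr : 0 < r) (hG : IsTimeDistribution G) (hsupp : ¬ BddAbove G.support)
    (h : RealEuler T G m p f) (hu : Undominated T r m) : Optimal T r G m := by
  have := hG.isProbabilityMeasure
  have hreg := h.regular hr hG hsupp hu
  have hff := hreg.flowFinite hr
  have hx := hreg.bddFlow hr
  refine ⟨hu, fun m' hm' => ?_⟩
  obtain ⟨m'', hIC, hx', hX', hcap⟩ := exists_capped (T := T) hr hm'
  refine (payoff_mono hcap hG).trans ?_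
  have hXtop : ∀ t, m''.reward t ≠ ∞ := fun t => ne_top_of_le_ne_top ENNReal.coe_ne_top (hX' t)
  set X : ℝ → ℝ≥0 := fun t => (m.reward t).toNNReal with hXdef
  set X' : ℝ → ℝ := fun t => (m''.reward t).toReal with hX'def
  have hXcv : ∀ t, 0 ≤ t → (X t : ℝ) = contValue r m.flow t := fun t ht => by
    simp only [hXdef]
    rw [hreg.reward_eq_contValue hr ht]
    exact Real.coe_toNNReal _ (hx.contValue_nonneg hr t)
  -- the marginal value of the deviation
  set a : ℝ → ℝ := fun t => weight r t * (p t * ((m''.flow t : ℝ) - m.flow t)) with ha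
  set k : ℝ → ℝ := fun τ => (∫ t in Ioo 0 τ, a t) +
    f τ * (Real.exp (-r * τ) * (X' τ - X τ)) with hk
  have hd : Integrable (fun t => weight r t * ((m''.flow t : ℝ) - m.flow t)) timeMeasure := by
    refine ((hx'.integrable_mul (integrableOn_weight hr)).sub
      (hx.integrable_mul (integrableOn_weight hr))).congr (ae_of_all _ fun t => ?_)
    simp [mul_sub]
  have ha_meas : AEStronglyMeasurable a timeMeasure :=
    ((continuous_weight r).measurable.aemeasurable.mul (h.meas.mul
      (hx'.meas.coe_nnreal_real.sub hx.meas.coe_nnreal_real))).aestronglyMeasurable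
  -- The Euler equation replaces the weighted slope of `F0` by the cumulated slope of `F1`; this
  -- also gives integrability although `p` may be unbounded.
  have haP : ∀ t, 0 ≤ t → a t * tail G t =
      -((weight r t * ((m''.flow t : ℝ) - m.flow t)) * ∫ τ in Icc 0 t, f τ ∂G) := by
    intro t ht
    have := h.eq t ht
    simp only [ha]
    linear_combination (weight r t * ((m''.flow t : ℝ) - m.flow t)) * this
  have haP' : (fun t => a t * tail G t) =ᵐ[timeMeasure]
      fun t => -((weight r t * ((m''.flow t : ℝ) - m.flow t)) * ∫ τ in Icc 0 t, f τ ∂G) := by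
    filter_upwards [ae_restrict_mem measurableSet_Ici] with t ht using haP t ht
  have haP_int : Integrable (fun t => a t * tail G t) timeMeasure := by
    refine Integrable.mono' (g := fun t => (∫ τ, |f τ| ∂G) *
      |weight r t * ((m''.flow t : ℝ) - m.flow t)|) (hd.abs.const_mul _) ?_ ?_
    · exact ha_meas.mul antitone_tail.measurable.aestronglyMeasurable
    · filter_upwards [ae_restrict_mem measurableSet_Ici] with t ht
      have h1 := h.tail_mul_le (mem_Ici.1 ht)
      have h0 : 0 ≤ tail G t * p t := mul_nonneg (tail_nonneg G t) (h.nonneg t ht)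
      have e : a t * tail G t = (tail G t * p t) * (weight r t * ((m''.flow t : ℝ) - m.flow t)) := by
        simp only [ha]; ring
      rw [e, Real.norm_eq_abs, abs_mul, abs_of_nonneg h0]
      exact mul_le_mul_of_nonneg_right h1 (abs_nonneg _)
  obtain ⟨hI1, hE1⟩ := integral_swap_tail ha_meas haP_int
  -- the surplus of the deviation over its continuation values
  set W : ℝ → ℝ := fun t => Real.exp (-r * max t 0) * X' (max t 0) + cum r m''.flow (max t 0)
    - total r m''.flow with hW
  have hanti := (ic_iff hr hx' (fun t _ => hXtop t)).1 hIC
  -- `W` is accumulated value less the total flow, so it decreases by incentive-compatibility;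
  -- freezing it at negative times makes it antitone on the whole line.
  have hWanti : Antitone W := fun s t hst => by
    have := hanti (mem_Ici.2 (le_max_right s 0)) (mem_Ici.2 (le_max_right t 0))
      (max_le_max_right 0 hst)
    simp only [hW, hX'def]
    simp only at this
    linarith
  have hWnonneg : ∀ t, 0 ≤ W t := by
    intro t
    have hlim : Tendsto (fun s => cum r m''.flow s - total r m''.flow) atTop (𝓝 0) := by
      simpa using (hx'.tendsto_cum hr).sub_const (total r m''.flow)
    refine le_of_tendsto hlim ?_
    filter_upwards [eventually_ge_atTop (max t 0)] with s hs
    have h1 := hWanti ((le_max_left t 0).trans hs)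
    have h2 : cum r m''.flow s - total r m''.flow ≤ W s := by
      have hs0 : max s 0 = s := max_eq_left ((le_max_right t 0).trans hs)
      have : 0 ≤ Real.exp (-r * s) * X' s := mul_nonneg (Real.exp_pos _).le ENNReal.toReal_nonneg
      simp only [hW, hs0]; linarith
    linarith
  have hWle : ∀ t, W t ≤ W 0 := fun t => by
    have := hWanti (le_max_right t 0)
    simpa [hW] using this
  -- The reward of `m` equals its continuation value, so only the surplus of the deviation appears.
  have hval : ∀ τ, 0 ≤ τ → (∫ t in Ioi τ, (Ici 0).indicator
      (fun t => weight r t * ((m''.flow t : ℝ) - m.flow t)) t) =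
      Real.exp (-r * τ) * (X' τ - X τ) - W τ := by
    intro τ hτ
    have e1 : (Ici 0).indicator (fun t => weight r t * ((m''.flow t : ℝ) - m.flow t)) =
        fun t => dflow r m''.flow t - dflow r m.flow t := by
      ext t
      simp only [dflow, indicator]
      split_ifs <;> ring
    rw [e1, integral_sub (hx'.integrable_dflow hr).integrableOn (hx.integrable_dflow hr).integrableOn,
      ← hx'.total_sub_cum hr, ← hx.total_sub_cum hr, ← exp_neg_mul_contValue r m.flow, ← hXcv τ hτ]
    simp only [hW, max_eq_left hτ]
    ring
  have hI2 : Integrable (fun τ => f τ * (Real.exp (-r * τ) * (X' τ - X τ))) G := by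
    have hXm : AEStronglyMeasurable (fun τ => Real.exp (-r * τ) * (X' τ - X τ)) G := by
      refine AEMeasurable.aestronglyMeasurable ⟨fun τ => W τ - (cum r m''.flow τ - total r m''.flow)
        - (total r m.flow - cum r m.flow τ), ?_, ?_⟩
      · exact (hWanti.measurable.sub ((hx'.continuous_cum hr).measurable.sub_const _)).sub
          ((hx.continuous_cum hr).measurable.const_sub _)
      · filter_upwards [hG.ae_nonneg] with τ hτ
        rw [← exp_neg_mul_contValue r m.flow, ← hXcv τ hτ]
        simp only [hW, max_eq_left hτ]
        ring
    refine h.int.mul_bdd (c := (T.u0 : ℝ)) hXm ?_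
    filter_upwards [hG.ae_nonneg] with τ hτ
    have b1 : X' τ ≤ T.u0 := by
      have := ENNReal.toReal_mono ENNReal.coe_ne_top (hX' τ)
      simpa using this
    have b2 : 0 ≤ X' τ := ENNReal.toReal_nonneg
    have b3 : (X τ : ℝ) ≤ T.u0 := by rw [hXcv τ hτ]; exact hx.contValue_le hr hτ
    have b4 : (0 : ℝ) ≤ X τ := NNReal.coe_nonneg _
    have he := Real.exp_pos (-r * τ)
    have he' : Real.exp (-r * τ) ≤ 1 := Real.exp_le_one_iff.2 (by nlinarith)
    rw [Real.norm_eq_abs, abs_mul, abs_of_pos he]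
    have : |X' τ - X τ| ≤ T.u0 := abs_le.2 ⟨by linarith, by linarith⟩
    nlinarith [abs_nonneg (X' τ - X τ)]
  have hk_int : Integrable k G := hI1.add hI2
  have hneg : ∀ t, 0 ≤ t → ∫ τ in Icc 0 t, f τ ∂G ≤ 0 := by
    intro t ht
    have h1 := h.eq t ht
    have h2 := mul_nonneg (tail_nonneg G t) (h.nonneg t ht)
    linarith
  have hk0 : ∫ τ, k τ ∂G ≤ 0 := by
    have hWint : Integrable (fun τ => f τ * W τ) G :=
      h.int.mul_bdd (c := W 0) hWanti.measurable.aestronglyMeasurable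
        (ae_of_all _ fun τ => by rw [Real.norm_of_nonneg (hWnonneg τ)]; exact hWle τ)
    -- Fubini twice: from flow up to the breakthrough to slopes cumulated up to `t`, and from there
    -- to the flow after `τ`.
    have e2 : ∫ τ, (∫ t in Ioo 0 τ, a t) ∂G =
        -∫ τ, (f τ * (Real.exp (-r * τ) * (X' τ - X τ)) - f τ * W τ) ∂G := by
      rw [hE1, integral_congr_ae haP', integral_neg, integral_swap_Icc hG hd h.int]
      congr 1
      refine integral_congr_ae ?_
      filter_upwards [hG.ae_nonneg] with τ hτ
      rw [hval τ hτ]; ring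
    rw [hk, integral_add hI1 hI2, e2, integral_sub hI2 hWint]
    have := integral_mul_antitone_nonpos hG h.int hneg hWanti hWnonneg hWle
    linarith
  have hpay : payoffAt T r m =ᵐ[G] fun τ => (realPayoff T r m.flow X τ : EReal) := by
    filter_upwards [h.slope1] with τ hτ
    exact hff.payoffAt_eq hτ.1 hτ.2.1
  rw [payoff_eq, payoff_eq, eintegral_congr hpay]
  refine eintegral_le_of_le_add (K := |(T.F0 T.u0).toReal| + |(T.F1 T.u1).toReal|) ?_ ?_ hk_int hk0 ?_
  · refine (hff.aemeasurable_flowReturn hG).add ?_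
    refine AEMeasurable.mul (by fun_prop) ?_
    refine (T.measurable_F1.comp_aemeasurable ?_).ereal_toReal
    refine ⟨fun τ => (contValue r m.flow τ).toNNReal,
      (hx.continuous_contValue hr).measurable.real_toNNReal, ?_⟩
    filter_upwards [hG.ae_nonneg] with τ hτ
    rw [← hXcv τ hτ, Real.toNNReal_coe]
  · filter_upwards [hG.ae_nonneg, h.slope1] with τ hτ hs
    exact hff.realPayoff_le hr X hτ hs.2.1
  · filter_upwards [hG.ae_nonneg, h.slope1] with τ hτ hs
    -- Before `τ` the tail is at least `tail G τ > 0`, so dividing by it preserves integrability.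
    have hloc : IntegrableOn a (Ioo 0 τ) := by
      have hmeas' : AEStronglyMeasurable a (volume.restrict (Ioo 0 τ)) :=
        ha_meas.mono_measure (Measure.restrict_mono (fun _ hs => hs.1.le) le_rfl)
      have hinteg : IntegrableOn (fun t => a t * tail G t) (Ioo 0 τ) :=
        IntegrableOn.mono_set (s := Ioo 0 τ) (t := Ici 0) haP_int fun _ hs => hs.1.le
      refine Integrable.mono' (hinteg.abs.mul_const (tail G τ)⁻¹) hmeas' ?_
      filter_upwards [ae_restrict_mem measurableSet_Ioo] with t ht
      have htp := tail_pos hsupp τ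
      rw [Real.norm_eq_abs, abs_mul (a t), abs_of_nonneg (tail_nonneg G t), mul_assoc]
      refine le_mul_of_one_le_right (abs_nonneg _) ?_
      rw [← div_eq_mul_inv, one_le_div htp]
      exact antitone_tail ht.2.le
    have hflow : flowPayoff T r m''.flow τ ≤
        ((flowReturn T r m.flow τ + ∫ t in Ioo 0 τ, a t : ℝ) : EReal) := by
      have hi : IntegrableOn (fun t => weight r t * (T.F0 (m.flow t)).toReal + a t) (Ioo 0 τ) :=
        (hff.int τ).add hloc
      rw [flowReturn, ← integral_add (hff.int τ) hloc, ← eintegral_coe hi]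
      refine eintegral_mono ?_
      filter_upwards [ae_Ioo_of_ae_timeMeasure h.slope0 τ] with t ht
      refine (EReal.coe_mul_le_coe_mul (weight_pos hr t) (ht.2 (m''.flow t))).trans ?_
      rw [← EReal.coe_mul, EReal.coe_le_coe_iff, ha, mul_add]
    have hrew : ((Real.exp (-r * τ) : ℝ) : EReal) * extendTop T.F1 (m''.reward τ) ≤
        ((Real.exp (-r * τ) * (T.F1 (X τ)).toReal +
          f τ * (Real.exp (-r * τ) * (X' τ - X τ)) : ℝ) : EReal) := by
      rw [extendTop_of_ne_top _ (hXtop τ)]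
      refine (EReal.coe_mul_le_coe_mul (Real.exp_pos _) (hs.2.2 _)).trans ?_
      rw [← EReal.coe_mul, EReal.coe_le_coe_iff]
      refine le_of_eq ?_
      have : (((m''.reward τ).toNNReal : ℝ≥0) : ℝ) = X' τ := rfl
      rw [this]; ring
    refine (add_le_add hflow hrew).trans ?_
    rw [← EReal.coe_add, EReal.coe_le_coe_iff]
    simp only [realPayoff, hk]
    linarith

end Sufficiency

/-! ### Selecting a density between two bounds -/

section Tube

variable {G : Measure ℝ}

theorem continuousWithinAt_setIntegral_Iic {g : ℝ → ℝ} (hg : ∀ t, IntegrableOn g (Iic t) G) (t : ℝ) :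
    ContinuousWithinAt (fun t => ∫ τ in Iic t, g τ ∂G) (Ici t) t := by
  have e : ∀ t, ∫ τ in Iic t, g τ ∂G = ∫ τ, (Iic t).indicator g τ ∂G := fun t =>
    (integral_indicator measurableSet_Iic).symm
  simp only [ContinuousWithinAt, e]
  refine tendsto_integral_filter_of_dominated_convergence
    (fun τ => ‖(Iic (t + 1)).indicator g τ‖) ?_ ?_ ?_ ?_
  · exact Eventually.of_forall fun s =>
      ((hg s).integrable_indicator measurableSet_Iic).aestronglyMeasurable
  · have : ∀ᶠ s in 𝓝[≥] t, s ≤ t + 1 :=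
      mem_nhdsWithin_of_mem_nhds (Iic_mem_nhds (by linarith))
    filter_upwards [this] with s hs
    refine ae_of_all _ fun τ => ?_
    rw [norm_indicator_eq_indicator_norm, norm_indicator_eq_indicator_norm]
    exact indicator_le_indicator_of_subset (Iic_subset_Iic.2 hs) (fun _ => norm_nonneg _) τ
  · exact ((hg (t + 1)).integrable_indicator measurableSet_Iic).norm
  · refine ae_of_all _ fun τ => ?_
    refine tendsto_const_nhds.congr' ?_
    rcases le_or_gt τ t with h | h
    · filter_upwards [self_mem_nhdsWithin] with s hs
      rw [indicator_of_mem (mem_Iic.2 h), indicator_of_mem (mem_Iic.2 (h.trans hs))]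
    · filter_upwards [mem_nhdsWithin_of_mem_nhds (Iio_mem_nhds h)] with s hs
      rw [indicator_of_notMem (notMem_Iic.2 h), indicator_of_notMem (notMem_Iic.2 hs)]

theorem setIntegral_Iic_sub {g : ℝ → ℝ} (hg : ∀ t, IntegrableOn g (Iic t) G) {s t : ℝ}
    (hst : s ≤ t) :
    ∫ τ in Iic t, g τ ∂G - ∫ τ in Iic s, g τ ∂G = ∫ τ in Ioc s t, g τ ∂G := by
  rw [← Iic_union_Ioc_eq_Iic hst, setIntegral_union (Iic_disjoint_Ioc le_rfl) measurableSet_Ioc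
    (hg s) ((hg t).mono_set Ioc_subset_Iic_self)]
  ring

/-- A function whose increments lie between those of the integrals of `c` and `d` is the integral
of a density between `c` and `d`. -/
theorem exists_density [IsFiniteMeasure G] {c d Φ : ℝ → ℝ} (hcd : ∀ t, c t ≤ d t)
    (hc : ∀ t, IntegrableOn c (Iic t) G) (hd : ∀ t, IntegrableOn d (Iic t) G)
    (hlow : ∀ s t, s ≤ t → ∫ τ in Ioc s t, c τ ∂G ≤ Φ t - Φ s)
    (hup : ∀ s t, s ≤ t → Φ t - Φ s ≤ ∫ τ in Ioc s t, d τ ∂G) :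
    ∃ f : ℝ → ℝ, AEStronglyMeasurable f G ∧ (∀ᵐ τ ∂G, c τ ≤ f τ ∧ f τ ≤ d τ) ∧
      ∀ s t, s ≤ t → ∫ τ in Ioc s t, f τ ∂G = Φ t - Φ s := by
  set C : ℝ → ℝ := fun t => ∫ τ in Iic t, c τ ∂G with hC
  set D : ℝ → ℝ := fun t => ∫ τ in Iic t, d τ ∂G with hD
  have hCs : ∀ s t, s ≤ t → C t - C s ≤ Φ t - Φ s := fun s t h => by
    rw [hC, setIntegral_Iic_sub hc h]; exact hlow s t h
  have hDs : ∀ s t, s ≤ t → Φ t - Φ s ≤ D t - D s := fun s t h => by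
    rw [hD, setIntegral_Iic_sub hd h]; exact hup s t h
  have hgi : ∀ t, IntegrableOn (fun τ => d τ - c τ) (Iic t) G := fun t => (hd t).sub (hc t)
  have hDC : ∀ t, ContinuousWithinAt (fun t => D t - C t) (Ici t) t := fun t =>
    (continuousWithinAt_setIntegral_Iic hd t).sub (continuousWithinAt_setIntegral_Iic hc t)
  -- A monotone function whose increments are dominated by those of the right-continuous `D - C` is
  -- right-continuous.
  have hrc : ∀ φ : ℝ → ℝ, Monotone φ → (∀ s t, s ≤ t → φ t - φ s ≤ (D t - C t) - (D s - C s)) →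
      ∀ t, ContinuousWithinAt φ (Ici t) t := by
    intro φ hmono hφ t
    refine tendsto_of_tendsto_of_tendsto_of_le_of_le' (f := φ) (g := fun _ => φ t)
      (h := fun s => φ t + ((D s - C s) - (D t - C t))) tendsto_const_nhds ?_ ?_ ?_
    · have := (hDC t).sub_const (D t - C t)
      have h2 := this.const_add (φ t)
      simpa using h2
    · filter_upwards [self_mem_nhdsWithin] with s hs using hmono hs
    · filter_upwards [self_mem_nhdsWithin] with s hs
      have := hφ t s hs
      linarith
  -- The excess of `Φ` over `C` and its shortfall from `D` define measures that add up to the one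
  -- with density `d - c`. The first is therefore absolutely continuous, with density at most `d -
  -- c`, and adding `c` gives the density sought.
  let f1 : StieltjesFunction ℝ :=
    { toFun := fun t => Φ t - C t
      mono' := fun s t h => by have := hCs s t h; linarith
      right_continuous' := hrc _ (fun s t h => by have := hCs s t h; linarith)
        fun s t h => by have := hDs s t h; linarith }
  let f2 : StieltjesFunction ℝ :=
    { toFun := fun t => D t - Φ t
      mono' := fun s t h => by have := hDs s t h; linarith
      right_continuous' := hrc _ (fun s t h => by have := hDs s t h; linarith)
        fun s t h => by have := hCs s t h; linarith }
  set g : ℝ → ℝ≥0∞ := fun τ => ENNReal.ofReal (d τ - c τ) with hg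
  have hρ : ∀ a b, a ≤ b → G.withDensity g (Ioc a b) = ENNReal.ofReal ((D b - C b) - (D a - C a)) := by
    intro a b hab
    have h1 : IntegrableOn (fun τ => d τ - c τ) (Ioc a b) G := (hgi b).mono_set Ioc_subset_Iic_self
    rw [withDensity_apply _ measurableSet_Ioc, hg,
      ← ofReal_integral_eq_lintegral_ofReal h1 (ae_of_all _ fun τ => sub_nonneg.2 (hcd τ)),
      integral_sub ((hd b).mono_set Ioc_subset_Iic_self) ((hc b).mono_set Ioc_subset_Iic_self),
      ← setIntegral_Iic_sub hd hab, ← setIntegral_Iic_sub hc hab]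
    congr 1
    simp only [hC, hD]
    ring
  have hsum : f1.measure + f2.measure = G.withDensity g := by
    rw [← StieltjesFunction.measure_add]
    refine Measure.ext_of_Ioc _ _ fun a b hab => ?_
    rw [StieltjesFunction.measure_add, Measure.add_apply, StieltjesFunction.measure_Ioc, StieltjesFunction.measure_Ioc,
      hρ a b hab.le, ← ENNReal.ofReal_add]
    · congr 1
      change (Φ b - C b - (Φ a - C a)) + (D b - Φ b - (D a - Φ a)) = _
      ring
    · exact sub_nonneg.2 (f1.mono hab.le)
    · exact sub_nonneg.2 (f2.mono hab.le)
  have hle : f1.measure ≤ G.withDensity g := by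
    rw [← hsum]; exact Measure.le_add_right le_rfl
  have hac : f1.measure ≪ G :=
    (Measure.absolutelyContinuous_of_le hle).trans (withDensity_absolutelyContinuous _ _)
  have hdens := Measure.withDensity_rnDeriv_eq _ _ hac
  set ψ : ℝ → ℝ≥0∞ := f1.measure.rnDeriv G with hψ
  have hψm : Measurable ψ := Measure.measurable_rnDeriv _ _
  have hψle : ∀ᵐ τ ∂G, ψ τ ≤ g τ := by
    refine ae_le_of_forall_setLIntegral_le_of_sigmaFinite hψm fun s hs _ => ?_
    rw [← withDensity_apply _ hs, ← withDensity_apply _ hs, hdens]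
    exact hle s
  have hψr : ∀ᵐ τ ∂G, (ψ τ).toReal ≤ d τ - c τ := by
    filter_upwards [hψle] with τ hτ
    exact ENNReal.toReal_le_of_le_ofReal (sub_nonneg.2 (hcd τ)) hτ
  have hcm : AEStronglyMeasurable c G := by
    have h := aestronglyMeasurable_iUnion_iff (μ := G) (f := c) (s := fun n : ℕ => Iic (n : ℝ))
    rw [iUnion_Iic_of_not_bddAbove_range] at h
    · simpa using h.2 fun n => (hc n).aestronglyMeasurable
    · rw [not_bddAbove_iff]
      intro t
      obtain ⟨n, hn⟩ := exists_nat_gt t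
      exact ⟨n, ⟨n, rfl⟩, hn⟩
  refine ⟨fun τ => c τ + (ψ τ).toReal,
    hcm.add hψm.ennreal_toReal.aestronglyMeasurable, ?_, ?_⟩
  · filter_upwards [hψr] with τ hτ
    exact ⟨le_add_of_nonneg_right ENNReal.toReal_nonneg, by linarith⟩
  · intro s t hst
    have hψint : IntegrableOn (fun τ => (ψ τ).toReal) (Ioc s t) G := by
      refine Integrable.mono' ((hgi t).mono_set Ioc_subset_Iic_self)
        hψm.ennreal_toReal.aestronglyMeasurable ?_
      filter_upwards [ae_restrict_of_ae hψr] with τ hτ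
      rwa [Real.norm_of_nonneg ENNReal.toReal_nonneg]
    rw [integral_add ((hc t).mono_set Ioc_subset_Iic_self) hψint,
      integral_toReal hψm.aemeasurable, ← withDensity_apply _ measurableSet_Ioc, hdens,
      StieltjesFunction.measure_Ioc, ENNReal.toReal_ofReal (sub_nonneg.2 (f1.mono hst)),
      ← setIntegral_Iic_sub hc hst]
    · change C t - C s + (Φ t - C t - (Φ s - C s)) = _
      ring
    · filter_upwards [ae_restrict_of_ae hψle] with τ hτ using hτ.trans_lt ENNReal.ofReal_lt_top

/-- If at a set of times bounds `A ≤ B` are given that are pairwise compatible with increments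
between those of the integrals of `-d` and `-c`, then some density between `c` and `d` meets them
all. -/
theorem exists_density_between [IsFiniteMeasure G] {c d A B : ℝ → ℝ} {E : Set ℝ} {t₀ : ℝ}
    (hcd : ∀ t, c t ≤ d t) (hc : ∀ t, IntegrableOn c (Iic t) G) (hd : ∀ t, IntegrableOn d (Iic t) G)
    (h₀ : t₀ ∈ E) (hE : ∀ t ∈ E, t₀ ≤ t) (hA : A t₀ = 0) (hB : B t₀ = 0)
    (hlow : ∀ s ∈ E, ∀ t ∈ E, s ≤ t → A t ≤ B s - ∫ τ in Ioc s t, c τ ∂G)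
    (hup : ∀ s ∈ E, ∀ t ∈ E, s ≤ t → A s ≤ B t + ∫ τ in Ioc s t, d τ ∂G) :
    ∃ f : ℝ → ℝ, AEStronglyMeasurable f G ∧ (∀ᵐ τ ∂G, c τ ≤ f τ ∧ f τ ≤ d τ) ∧
      ∀ t ∈ E, A t ≤ -∫ τ in Ioc t₀ t, f τ ∂G ∧ -∫ τ in Ioc t₀ t, f τ ∂G ≤ B t := by
  set C : ℝ → ℝ := fun t => ∫ τ in Iic t, c τ ∂G with hC
  set D : ℝ → ℝ := fun t => ∫ τ in Iic t, d τ ∂G with hD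
  have hCs : ∀ s t, s ≤ t → ∫ τ in Ioc s t, c τ ∂G = C t - C s := fun s t h =>
    (setIntegral_Iic_sub hc h).symm
  have hDs : ∀ s t, s ≤ t → ∫ τ in Ioc s t, d τ ∂G = D t - D s := fun s t h =>
    (setIntegral_Iic_sub hd h).symm
  have hCD : ∀ s t, s ≤ t → C t - C s ≤ D t - D s := fun s t h => by
    rw [← hCs s t h, ← hDs s t h]
    exact integral_mono ((hc t).mono_set Ioc_subset_Iic_self)
      ((hd t).mono_set Ioc_subset_Iic_self) hcd
  replace hlow : ∀ s ∈ E, ∀ t ∈ E, s ≤ t → A t ≤ B s - (C t - C s) := fun s hs t ht h => by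
    rw [← hCs s t h]; exact hlow s hs t ht h
  replace hup : ∀ s ∈ E, ∀ t ∈ E, s ≤ t → A s ≤ B t + (D t - D s) := fun s hs t ht h => by
    rw [← hDs s t h]; exact hup s hs t ht h
  -- `U s` is the highest path with admissible increments that takes the value `B s` at `s`. The
  -- infimum `Φ` of these paths is admissible and stays below `B`; compatibility of the bounds keeps
  -- it above `A`.
  set U : ℝ → ℝ → ℝ := fun s t => if s ≤ t then B s - (C t - C s) else B s + (D s - D t) with hU
  have hU1 : ∀ s t₁ t₂, t₁ ≤ t₂ → U s t₂ ≤ U s t₁ - (C t₂ - C t₁) := by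
    intro s t₁ t₂ h
    simp only [hU]
    split_ifs with h2 h1 h1
    · linarith
    · have := hCD t₁ s (not_le.1 h1).le; linarith
    · exact absurd (h1.trans h) h2
    · have := hCD t₁ t₂ h; linarith
  have hU2 : ∀ s t₁ t₂, t₁ ≤ t₂ → U s t₁ ≤ U s t₂ + (D t₂ - D t₁) := by
    intro s t₁ t₂ h
    simp only [hU]
    split_ifs with h1 h2 h2
    · have := hCD t₁ t₂ h; linarith
    · exact absurd (h1.trans h) h2
    · have := hCD s t₂ h2; linarith
    · linarith
  have hUlow : ∀ s ∈ E, ∀ t, -(D t - D t₀) ≤ U s t := by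
    intro s hs t
    have h1 := hup t₀ h₀ s hs (hE s hs)
    simp only [hU]
    split_ifs with h2
    · have := hCD s t h2; linarith
    · linarith
  have hbdd : ∀ t, BddBelow (range fun s : E => U s t) := fun t =>
    ⟨-(D t - D t₀), by rintro _ ⟨s, rfl⟩; exact hUlow s s.2 t⟩
  have : Nonempty E := ⟨⟨t₀, h₀⟩⟩
  set Φ : ℝ → ℝ := fun t => ⨅ s : E, U s t with hΦ
  have hΦA : ∀ t ∈ E, A t ≤ Φ t := by
    intro t ht
    refine le_ciInf fun s => ?_
    simp only [hU]
    split_ifs with h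
    · exact hlow s s.2 t ht h
    · exact hup t ht s s.2 (not_le.1 h).le
  have hΦB : ∀ t ∈ E, Φ t ≤ B t := by
    intro t ht
    refine (ciInf_le (hbdd t) ⟨t, ht⟩).trans ?_
    simp [hU]
  have hΦ1 : ∀ s t, s ≤ t → C t - C s ≤ -Φ t - -Φ s := by
    intro s t h
    have : Φ t + (C t - C s) ≤ Φ s :=
      le_ciInf fun u => by
        have h1 := ciInf_le (hbdd t) u
        have h2 := hU1 u s t h
        linarith
    linarith
  have hΦ2 : ∀ s t, s ≤ t → -Φ t - -Φ s ≤ D t - D s := by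
    intro s t h
    have : Φ s - (D t - D s) ≤ Φ t :=
      le_ciInf fun u => by
        have h1 := ciInf_le (hbdd s) u
        have h2 := hU2 u s t h
        linarith
    linarith
  obtain ⟨f, hfm, hf, hfΦ⟩ := exists_density (Φ := fun t => -Φ t) hcd hc hd
    (fun s t h => by rw [hCs s t h]; exact hΦ1 s t h)
    (fun s t h => by rw [hDs s t h]; exact hΦ2 s t h)
  have hzero : Φ t₀ = 0 := le_antisymm (hB ▸ hΦB t₀ h₀) (hA ▸ hΦA t₀ h₀)
  refine ⟨f, hfm, hf, fun t ht => ?_⟩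
  rw [hfΦ t₀ t (hE t ht)]
  constructor
  · have := hΦA t ht; linarith
  · have := hΦB t ht; linarith

end Tube

/-! ### Deviations from an optimal mechanism -/

section Gain

variable {T : Technology} {r : ℝ} {m : Mechanism} {G : Measure ℝ} {x y : ℝ → ℝ≥0} {K : ℝ≥0}

/-- The deviation to the flow `y`, disposed of above `u0`, with the continuation values of `y` as
rewards. -/
noncomputable def deviation (T : Technology) (r : ℝ) (hy : BddFlow y K) : Mechanism :=
  ⟨fun t => min (y t) T.u0, fun t => ENNReal.ofReal (contValue r y t),
    hy.meas.min aemeasurable_const⟩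

theorem ic_deviation (hr : 0 < r) (hy : BddFlow y K) : (deviation T r hy).IC r :=
  (ic_indifferent hr hy).mono_flow _ (ae_of_all _ fun _ => min_le_left _ _)

/-- The mechanism with flow and reward constantly equal to `u0` is incentive-compatible and has
bounded payoffs. -/
theorem payoff_ne_bot_of_optimal (hr : 0 < r) (hG : IsTimeDistribution G) (h : Optimal T r G m) :
    payoff T r G m ≠ ⊥ := by
  have := hG.isProbabilityMeasure
  have hk := bddFlow_const T.u0
  refine ne_bot_of_le_ne_bot ?_ (h.2 _ (ic_indifferent hr hk))
  have hff : FlowFinite T r (indifferent r (fun _ => T.u0) hk.meas).flow :=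
    ⟨ae_of_all _ fun _ => T.F0_u0_ne_bot, fun τ =>
      Integrable.mul_const (c := (T.F0 T.u0).toReal)
        ((continuous_weight r).integrableOn_Icc.mono_set Ioo_subset_Icc_self)⟩
  have hlow : ∀ τ, 0 ≤ τ →
      ((-|(T.F0 T.u0).toReal| - |(T.F1 T.u0).toReal| : ℝ) : EReal) ≤
        payoffAt T r (indifferent r (fun _ => T.u0) hk.meas) τ := by
    intro τ hτ
    have hX : ((indifferent r (fun _ => T.u0) hk.meas).reward τ).toNNReal = T.u0 := by
      simp only [indifferent]
      rw [contValue_const hr _ hτ]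
      simp
    rw [hff.payoffAt_eq ENNReal.ofReal_ne_top (by rw [hX]; exact T.F1_u0_ne_bot),
      EReal.coe_le_coe_iff, realPayoff, hX, flowReturn]
    simp only [indifferent]
    rw [integral_mul_const, integral_weight_Ioo hτ]
    have he := Real.exp_pos (-r * τ)
    have he' : Real.exp (-r * τ) ≤ 1 := Real.exp_le_one_iff.2 (by nlinarith)
    nlinarith [neg_abs_le (T.F0 T.u0).toReal, neg_abs_le (T.F1 T.u0).toReal,
      abs_nonneg (T.F0 T.u0).toReal, abs_nonneg (T.F1 T.u0).toReal]
  rw [payoff_eq]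
  refine ne_bot_of_le_ne_bot ?_ (eintegral_mono (hG.ae_nonneg.mono hlow))
  rw [eintegral_coe (integrable_const _)]
  exact EReal.coe_ne_bot _

/-- If all late payoffs were `-∞`, unbounded support would make the expected payoff `-∞`. -/
theorem Optimal.regular (hr : 0 < r) (hG : IsTimeDistribution G) (hsupp : ¬ BddAbove G.support)
    (h : Optimal T r G m) : Regular T r m := by
  refine ⟨h.1, fun S => ?_⟩
  by_contra! hcon
  refine payoff_ne_bot_of_optimal hr hG h ?_
  have htop : ∫⁻ τ, (-payoffAt T r m τ).toENNReal ∂G = ∞ := by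
    have hpos : 0 < G (Ioi (max S 0)) := measure_Ioi_pos hsupp _
    refine top_le_iff.1 (le_trans ?_ (setLIntegral_le_lintegral (Ioi (max S 0)) _))
    rw [setLIntegral_congr_fun (g := fun _ => ∞) measurableSet_Ioi]
    · simp [ENNReal.top_mul hpos.ne']
    · intro τ hτ
      have := hcon τ ((le_max_left _ _).trans_lt hτ) ((le_max_right _ _).trans (le_of_lt hτ))
      simp [this]
  rw [payoff_eq, eintegral, htop]
  simp

theorem Optimal.integrable_realPayoff (hr : 0 < r) (hG : IsTimeDistribution G)
    (hsupp : ¬ BddAbove G.support) (h : Optimal T r G m) :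
    Integrable (realPayoff T r m.flow fun t => (contValue r m.flow t).toNNReal) G ∧
      payoff T r G m = ((∫ τ, realPayoff T r m.flow (fun t => (contValue r m.flow t).toNNReal) τ ∂G :
        ℝ) : EReal) := by
  have := hG.isProbabilityMeasure
  have hreg := h.regular hr hG hsupp
  have hff := hreg.flowFinite hr
  have hx := hreg.bddFlow hr
  have hpay : payoffAt T r m =ᵐ[G]
      fun τ => (realPayoff T r m.flow (fun t => (contValue r m.flow t).toNNReal) τ : EReal) := by
    filter_upwards [hG.ae_nonneg] with τ hτ
    have e : (m.reward τ).toNNReal = (contValue r m.flow τ).toNNReal := by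
      rw [hreg.reward_eq_contValue hr hτ]; rfl
    rw [hff.payoffAt_eq (by rw [hreg.reward_eq_contValue hr hτ]; exact ENNReal.ofReal_ne_top)
      (by rw [e]; exact hreg.F1_ne_bot hr hτ), realPayoff, e, realPayoff]
  have hm : AEMeasurable (realPayoff T r m.flow fun t => (contValue r m.flow t).toNNReal) G := by
    refine (hff.aemeasurable_flowReturn hG).add (AEMeasurable.mul (by fun_prop) ?_)
    exact (T.measurable_F1.comp
      (hx.continuous_contValue hr).measurable.real_toNNReal).ereal_toReal.aemeasurable
  have hne := payoff_ne_bot_of_optimal hr hG h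
  rw [payoff_eq, eintegral_congr hpay] at hne ⊢
  rcases eintegral_eq_bot_or hm.coe_real_ereal
    (integrable_const (|(T.F0 T.u0).toReal| + |(T.F1 T.u1).toReal|))
    (by
      filter_upwards [hG.ae_nonneg] with τ hτ
      rw [EReal.coe_le_coe_iff]
      exact hff.realPayoff_le hr _ hτ (hreg.F1_ne_bot hr hτ)) with hb | ⟨-, hi, he⟩
  · exact absurd hb hne
  · simp only [EReal.toReal_coe] at hi he
    exact ⟨hi, he⟩

/-- Deviations from an optimal mechanism do not pay. -/
theorem Optimal.gain_nonpos (hr : 0 < r) (hG : IsTimeDistribution G)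
    (hsupp : ¬ BddAbove G.support) (h : Optimal T r G m) (hy : BddFlow y K)
    (hy0 : ∀ᵐ t ∂timeMeasure, T.F0 (min (y t) T.u0) ≠ ⊥)
    (hY : ∀ t, 0 ≤ t → T.F1 (contValue r y t).toNNReal ≠ ⊥)
    (hi0 : Integrable (fun t => weight r t *
      ((T.F0 (min (y t) T.u0)).toReal - (T.F0 (m.flow t)).toReal)) timeMeasure)
    (hi1 : Integrable (fun τ => Real.exp (-r * τ) * ((T.F1 (contValue r y τ).toNNReal).toReal -
      (T.F1 (contValue r m.flow τ).toNNReal).toReal)) G) :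
    ∫ t, weight r t * ((T.F0 (min (y t) T.u0)).toReal - (T.F0 (m.flow t)).toReal) * tail G t
        ∂timeMeasure +
      ∫ τ, Real.exp (-r * τ) * ((T.F1 (contValue r y τ).toNNReal).toReal -
        (T.F1 (contValue r m.flow τ).toNNReal).toReal) ∂G ≤ 0 := by
  have := hG.isProbabilityMeasure
  have hreg := h.regular hr hG hsupp
  have hff := hreg.flowFinite hr
  obtain ⟨hinteg, hpay⟩ := h.integrable_realPayoff hr hG hsupp
  have hi0' : ∀ τ, IntegrableOn (fun t => weight r t *
      ((T.F0 (min (y t) T.u0)).toReal - (T.F0 (m.flow t)).toReal)) (Ioo 0 τ) := fun τ =>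
    IntegrableOn.mono_set (t := Ici 0) hi0 fun _ hs => hs.1.le
  have hff' : FlowFinite T r (deviation T r hy).flow := by
    refine ⟨hy0, fun τ => ((hff.int τ).add (hi0' τ)).congr (ae_of_all _ fun t => ?_)⟩
    simp only [deviation, Pi.add_apply]
    ring
  set k : ℝ → ℝ := fun τ => (∫ t in Ioo 0 τ, weight r t *
      ((T.F0 (min (y t) T.u0)).toReal - (T.F0 (m.flow t)).toReal)) +
    Real.exp (-r * τ) * ((T.F1 (contValue r y τ).toNNReal).toReal -
        (T.F1 (contValue r m.flow τ).toNNReal).toReal) with hk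
  have hiP : Integrable (fun t => weight r t *
      ((T.F0 (min (y t) T.u0)).toReal - (T.F0 (m.flow t)).toReal) * tail G t) timeMeasure :=
    hi0.mul_bdd (c := 1) antitone_tail.measurable.aestronglyMeasurable
      (ae_of_all _ fun t => by rw [Real.norm_of_nonneg (tail_nonneg G t)]; exact tail_le_one t)
  obtain ⟨hI, hE⟩ := integral_swap_tail hi0.aestronglyMeasurable hiP
  have hki : Integrable k G := hI.add hi1
  have hdev : payoffAt T r (deviation T r hy) =ᵐ[G] fun τ =>
      ((realPayoff T r m.flow (fun t => (contValue r m.flow t).toNNReal) τ + k τ : ℝ) : EReal) := by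
    filter_upwards [hG.ae_nonneg] with τ hτ
    have e : ((deviation T r hy).reward τ).toNNReal = (contValue r y τ).toNNReal := rfl
    rw [hff'.payoffAt_eq ENNReal.ofReal_ne_top (by rw [e]; exact hY τ hτ), realPayoff, e,
      EReal.coe_eq_coe_iff, realPayoff, hk]
    have : flowReturn T r (deviation T r hy).flow τ = flowReturn T r m.flow τ +
        ∫ t in Ioo 0 τ, weight r t *
          ((T.F0 (min (y t) T.u0)).toReal - (T.F0 (m.flow t)).toReal) := by
      rw [flowReturn, flowReturn, ← integral_add (hff.int τ) (hi0' τ)]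
      refine integral_congr_ae (ae_of_all _ fun t => ?_)
      simp only [deviation]
      ring
    rw [this]
    ring
  have hle := h.2 _ (ic_deviation (T := T) hr hy)
  have hsum : Integrable (fun τ =>
      realPayoff T r m.flow (fun t => (contValue r m.flow t).toNNReal) τ + k τ) G := hinteg.add hki
  rw [hpay, payoff_eq, eintegral_congr hdev, eintegral_coe hsum, EReal.coe_le_coe_iff,
    integral_add hinteg hki] at hle
  have e2 : ∫ τ, k τ ∂G = ∫ t, weight r t * ((T.F0 (min (y t) T.u0)).toReal -
      (T.F0 (m.flow t)).toReal) * tail G t ∂timeMeasure +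
      ∫ τ, Real.exp (-r * τ) * ((T.F1 (contValue r y τ).toNNReal).toReal -
        (T.F1 (contValue r m.flow τ).toNNReal).toReal) ∂G := by
    rw [hk, integral_add hI hi1, hE]
  linarith

/-- Here `z` is the increment of the discounted flow; continuation values depend on it linearly. -/
theorem contValue_add (hr : 0 < r) {K' : ℝ≥0} (hx : BddFlow x K) (hy : BddFlow y K') {z : ℝ → ℝ}
    (hz : ∀ᵐ t ∂timeMeasure, weight r t * (y t : ℝ) = weight r t * x t + z t) {τ : ℝ} (hτ : 0 ≤ τ) :
    contValue r y τ = contValue r x τ + Real.exp (r * τ) * ∫ t in Ioi τ, z t := by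
  have e : ∫ t in Ioi τ, z t = (∫ t in Ioi τ, dflow r y t) - ∫ t in Ioi τ, dflow r x t := by
    rw [← integral_sub (hy.integrable_dflow hr).integrableOn (hx.integrable_dflow hr).integrableOn]
    refine integral_congr_ae ?_
    filter_upwards [ae_restrict_of_ae_restrict_of_subset (Ioi_subset_Ici hτ) hz,
      ae_restrict_mem measurableSet_Ioi] with t ht ht'
    have h0 : 0 ≤ t := hτ.trans (le_of_lt ht')
    rw [dflow_of_nonneg h0, dflow_of_nonneg h0, ht]
    ring
  rw [e, ← hx.total_sub_cum hr, ← hy.total_sub_cum hr]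
  unfold contValue
  ring

theorem integral_weight_Ioi (hr : 0 < r) {a : ℝ} (ha : 0 ≤ a) :
    ∫ t in Ioi a, weight r t = Real.exp (-r * a) := by
  have h := (bddFlow_const 1).total_sub_cum hr a
  rw [← exp_neg_mul_contValue, contValue_const hr _ ha, NNReal.coe_one, mul_one] at h
  rw [h]
  refine setIntegral_congr_fun measurableSet_Ioi fun t ht => ?_
  rw [dflow_of_nonneg (ha.trans (le_of_lt ht))]
  simp

theorem tendsto_tail [IsProbabilityMeasure G] : Tendsto (tail G) atTop (𝓝 0) := by
  have := (ProbabilityTheory.tendsto_cdf_atTop G).const_sub 1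
  rw [sub_self] at this
  exact this.congr fun t => one_sub_cdf t

/-- Chords of a concave function get flatter to the right. -/
theorem _root_.ConcaveOn.chord_le {S : Set ℝ} {f : ℝ → ℝ} (hf : ConcaveOn ℝ S f) {p q a b : ℝ}
    (hp : p ∈ S) (hb : b ∈ S) (hpq : p ≤ q) (hqa : q ≤ a) (hab : a < b) :
    (f b - f a) / (b - a) * (q - p) ≤ f q - f p := by
  have hmem : ∀ u, p ≤ u → u ≤ b → u ∈ S := fun u h1 h2 =>
    hf.1.ordConnected.out hp hb ⟨h1, h2⟩
  rcases hpq.eq_or_lt with rfl | hpq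
  · simp
  rw [← le_div_iff₀ (by linarith)]
  rcases hqa.eq_or_lt with rfl | hqa
  · exact hf.slope_anti_adjacent hp hb hpq hab
  · exact (hf.slope_anti_adjacent (hmem q hpq.le (by linarith)) hb hqa hab).trans
      (hf.slope_anti_adjacent hp (hmem a (by linarith) hab.le) hpq hqa)

/-- A concave function lies above its chords. -/
theorem _root_.ConcaveOn.chord_above {S : Set ℝ} {f : ℝ → ℝ} (hf : ConcaveOn ℝ S f) {p q b : ℝ}
    (hp : p ∈ S) (hb : b ∈ S) (hpq : p ≤ q) (hqb : q ≤ b) (hpb : p < b) :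
    (f p - f b) / (b - p) * (b - q) ≤ f q - f b := by
  have h0 : 0 < b - p := sub_pos.2 hpb
  have hl : 0 ≤ (b - q) / (b - p) := div_nonneg (by linarith) h0.le
  have hu : 0 ≤ (q - p) / (b - p) := div_nonneg (by linarith) h0.le
  have h := hf.2 hp hb hl hu (by field_simp; ring)
  have e : ((b - q) / (b - p)) • p + ((q - p) / (b - p)) • b = q := by
    simp only [smul_eq_mul]; field_simp; ring
  rw [e] at h
  have e2 : (f p - f b) / (b - p) * (b - q) =
      ((b - q) / (b - p)) • f p + ((q - p) / (b - p)) • f b - f b := by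
    simp only [smul_eq_mul]; field_simp; ring
  linarith

/-- If the initial value were `u0`, flow and rewards would be constantly `u0`. Lowering the flow to
some `v` between `u1` and `u0` from `S` on costs only if the breakthrough comes after `S`, while it
moves every earlier reward towards `u1`. Discounted to time zero, both effects carry the factor `exp
(-r * S)`; as `S` grows the probability of the cost vanishes and that of the gain tends to one. -/
theorem Optimal.contValue_lt (hr : 0 < r) (hG : IsTimeDistribution G)
    (hsupp : ¬ BddAbove G.support) (h : Optimal T r G m) {t : ℝ} (ht : 0 ≤ t) :
    contValue r m.flow t < T.u0 := by
  have := hG.isProbabilityMeasure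
  have hreg := h.regular hr hG hsupp
  have hx := hreg.bddFlow hr
  refine (hreg.antitoneOn_contValue hr (mem_Ici.2 le_rfl) ht ht).trans_lt ?_
  by_contra! hge
  -- otherwise the flow and the rewards are constant
  have hconst : ∀ᵐ t ∂timeMeasure, m.flow t = T.u0 := by
    have hk := bddFlow_const T.u0
    have hi := (hk.integrable_dflow hr).sub (hx.integrable_dflow hr)
    have hn : ∀ᵐ s, 0 ≤ (dflow r (fun _ => T.u0) - dflow r m.flow) s := by
      have := hx.le
      rw [timeMeasure, ae_restrict_iff' measurableSet_Ici] at this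
      filter_upwards [this] with s hs
      rw [Pi.sub_apply, sub_nonneg, dflow, dflow]
      refine indicator_le_indicator' fun h0 => mul_le_mul_of_nonneg_left ?_ (weight_pos hr s).le
      exact_mod_cast hs h0
    have hz : ∫ s, (dflow r (fun _ => T.u0) - dflow r m.flow) s = 0 := by
      have e : ∫ s, (dflow r (fun _ => T.u0) - dflow r m.flow) s =
          total r (fun _ => T.u0) - total r m.flow :=
        integral_sub (hk.integrable_dflow hr) (hx.integrable_dflow hr)
      rw [← contValue_zero, ← contValue_zero, contValue_const hr _ le_rfl] at e
      refine le_antisymm (by linarith) (integral_nonneg_of_ae hn)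
    rw [integral_eq_zero_iff_of_nonneg_ae hn hi] at hz
    filter_upwards [ae_restrict_of_ae hz, ae_restrict_mem measurableSet_Ici] with s hs h0
    simp only [Pi.sub_apply, Pi.zero_apply] at hs
    rw [dflow_of_nonneg h0, dflow_of_nonneg h0, ← mul_sub] at hs
    rcases mul_eq_zero.1 hs with h | h
    · exact absurd h (weight_pos hr s).ne'
    · exact_mod_cast (sub_eq_zero.1 h).symm
  have hval : ∀ t, 0 ≤ t → contValue r m.flow t = T.u0 := by
    intro t ht
    have := contValue_add hr (bddFlow_const T.u0) hx (z := fun _ => 0)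
      (hconst.mono fun t ht => by rw [ht, add_zero]) ht
    rw [this, contValue_const hr _ ht]; simp
  obtain ⟨v, hv1, hv0⟩ := exists_between T.u1_lt_u0
  have hvpos : 0 < v := zero_le.trans_lt hv1
  -- `β` bounds the loss per unit of discounted time, and `κ` is the rate at which `F1` rises along
  -- its chord from `u0` down to `v`.
  set β := (T.F0 T.u0).toReal - (T.F0 v).toReal with hβ
  set κ := ((T.F1 v).toReal - (T.F1 T.u0).toReal) / ((T.u0 : ℝ) - v) with hκ
  have hv0' : (0 : ℝ) < (T.u0 : ℝ) - v := sub_pos.2 (by exact_mod_cast hv0)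
  have hκpos : 0 < κ := by
    refine div_pos (sub_pos.2 ?_) hv0'
    have := T.F1_strictAnti hv0 hv1.le hv0.le
    rwa [← EReal.coe_lt_coe_iff, EReal.coe_toReal (T.F1_lt_top _).ne T.F1_u0_ne_bot,
      EReal.coe_toReal (T.F1_lt_top _).ne (T.F1_ne_bot hvpos hv0.le)]
  have hgain : ∀ Y : ℝ, v ≤ Y → Y ≤ T.u0 →
      κ * ((T.u0 : ℝ) - Y) ≤ (T.F1 Y.toNNReal).toReal - (T.F1 T.u0).toReal := by
    intro Y h1 h2
    have := T.concaveOn_F1.chord_above (p := v) (q := Y) (b := T.u0) ⟨hvpos, by exact_mod_cast hv0.le⟩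
      ⟨T.u0_pos, le_rfl⟩ h1 h2 (by exact_mod_cast hv0)
    rwa [realize_coe, realize_coe] at this
  have hβ0 : 0 ≤ β :=
    sub_nonneg.2 (EReal.toReal_le_toReal (T.F0_le_peak _) (T.finite_F0 v hvpos hv0.le)
      (T.F0_lt_top _).ne)
  -- lower the flow from time `S` on
  have key : ∀ S, 0 ≤ S → κ * ((T.u0 : ℝ) - v) * (1 - tail G S) ≤ β * tail G S := by
    intro S hS
    have hky : BddFlow (fun _ => v) T.u0 := ⟨aemeasurable_const, ae_of_all _ fun _ => hv0.le⟩
    have hy := bddFlow_concat (bddFlow_const T.u0) hky S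
    set y := concat (fun _ => T.u0) (fun _ => v) S with hydef
    set Y := contValue r y with hYdef
    have hYeq : ∀ τ, 0 ≤ τ → Real.exp (-r * τ) * ((T.u0 : ℝ) - Y τ) =
        ((T.u0 : ℝ) - v) * Real.exp (-r * max τ S) := by
      intro τ hτ
      have hz : ∀ᵐ t ∂timeMeasure, weight r t * (y t : ℝ) = weight r t * ((fun _ => T.u0) t : ℝ≥0) +
          (Ioi S).indicator (fun t => -(((T.u0 : ℝ) - v) * weight r t)) t := by
        refine ae_of_all _ fun t => ?_
        by_cases hts : t ≤ S
        · rw [indicator_of_notMem (notMem_Ioi.2 hts), hydef]; simp [concat, hts]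
        · rw [indicator_of_mem (mem_Ioi.2 (not_le.1 hts)), hydef]; simp [concat, hts]; ring
      have e := contValue_add hr (bddFlow_const T.u0) hy hz hτ
      rw [contValue_const hr _ hτ, setIntegral_indicator measurableSet_Ioi, Ioi_inter_Ioi,
        integral_neg, integral_const_mul, integral_weight_Ioi hr (hτ.trans (le_max_left _ _))] at e
      rw [hYdef, e]
      have := exp_mul_exp_neg r τ
      linear_combination (((T.u0 : ℝ) - v) * Real.exp (-r * max τ S)) * this
    have hYv : ∀ τ, 0 ≤ τ → v ≤ Y τ ∧ Y τ ≤ T.u0 := by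
      intro τ hτ
      have e := hYeq τ hτ
      have h1 : Real.exp (-r * max τ S) ≤ Real.exp (-r * τ) :=
        Real.exp_le_exp.2 (by nlinarith [le_max_left τ S])
      have h2 := Real.exp_pos (-r * τ)
      have h3 := Real.exp_pos (-r * max τ S)
      constructor
      · have : Real.exp (-r * τ) * ((T.u0 : ℝ) - Y τ) ≤ Real.exp (-r * τ) * ((T.u0 : ℝ) - v) := by
          rw [e]; nlinarith
        have := le_of_mul_le_mul_left this h2
        linarith
      · have : 0 ≤ Real.exp (-r * τ) * ((T.u0 : ℝ) - Y τ) := by rw [e]; positivity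
        have := nonneg_of_mul_nonneg_right this h2
        linarith
    have hYb : ∀ τ, 0 ≤ τ → T.F1 (Y τ).toNNReal ≠ ⊥ := fun τ hτ =>
      T.F1_ne_bot (Real.toNNReal_pos.2 (lt_of_lt_of_le (by exact_mod_cast hvpos) (hYv τ hτ).1))
        (Real.toNNReal_le_iff_le_coe.2 (hYv τ hτ).2)
    have hcap : ∀ t, min (y t) T.u0 = y t := fun t => by
      refine min_eq_left ?_
      rw [hydef, concat]; split_ifs <;> [exact le_rfl; exact hv0.le]
    have hflow : (fun t => weight r t * ((T.F0 (min (y t) T.u0)).toReal -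
        (T.F0 (m.flow t)).toReal)) =ᵐ[timeMeasure]
        (Ioi S).indicator fun t => -(β * weight r t) := by
      filter_upwards [hconst] with t ht
      rw [hcap, ht]
      by_cases hts : t ≤ S
      · rw [indicator_of_notMem (notMem_Ioi.2 hts), hydef]; simp [concat, hts]
      · rw [indicator_of_mem (mem_Ioi.2 (not_le.1 hts)), hydef]; simp [concat, hts, hβ]; ring
    have hwi : Integrable (weight r) timeMeasure := integrableOn_weight hr
    have hi0 := ((hwi.const_mul β).neg.indicator
      (measurableSet_Ioi (a := S))).congr hflow.symm
    have hrew : ∀ τ, 0 ≤ τ → κ * (((T.u0 : ℝ) - v) * Real.exp (-r * max τ S)) ≤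
        Real.exp (-r * τ) * ((T.F1 (Y τ).toNNReal).toReal -
          (T.F1 (contValue r m.flow τ).toNNReal).toReal) := by
      intro τ hτ
      rw [hval τ hτ, Real.toNNReal_coe, ← hYeq τ hτ]
      have := mul_le_mul_of_nonneg_left (hgain _ (hYv τ hτ).1 (hYv τ hτ).2)
        (Real.exp_pos (-r * τ)).le
      linarith
    have hi1 : Integrable (fun τ => Real.exp (-r * τ) * ((T.F1 (Y τ).toNNReal).toReal -
        (T.F1 (contValue r m.flow τ).toNNReal).toReal)) G := by
      refine Integrable.mono' (integrable_const ((T.F1 T.u1).toReal - (T.F1 T.u0).toReal)) ?_ ?_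
      · refine Measurable.aestronglyMeasurable (Measurable.mul (by fun_prop) (Measurable.sub ?_ ?_))
        · exact (T.measurable_F1.comp
            (hy.continuous_contValue hr).measurable.real_toNNReal).ereal_toReal
        · exact (T.measurable_F1.comp
            (hx.continuous_contValue hr).measurable.real_toNNReal).ereal_toReal
      · filter_upwards [hG.ae_nonneg] with τ hτ
        have h1 := hrew τ hτ
        have h0 : 0 ≤ κ * (((T.u0 : ℝ) - v) * Real.exp (-r * max τ S)) := by positivity
        rw [Real.norm_of_nonneg (h0.trans h1), hval τ hτ, Real.toNNReal_coe]
        have h2 := EReal.toReal_le_toReal (T.F1_le_peak (Y τ).toNNReal) (hYb τ hτ) (T.F1_lt_top _).ne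
        have h3 := EReal.toReal_le_toReal (T.F1_le_peak T.u0) T.F1_u0_ne_bot (T.F1_lt_top _).ne
        have he := Real.exp_pos (-r * τ)
        have he' : Real.exp (-r * τ) ≤ 1 := Real.exp_le_one_iff.2 (by nlinarith)
        nlinarith
    have hg := h.gain_nonpos hr hG hsupp hy
      (ae_of_all _ fun t => by
        rw [hcap, hydef, concat]
        split_ifs <;> [exact T.F0_u0_ne_bot; exact T.finite_F0 v hvpos hv0.le]) hYb hi0 hi1
    have hL : -(β * tail G S * Real.exp (-r * S)) ≤ ∫ t, weight r t *
        ((T.F0 (min (y t) T.u0)).toReal - (T.F0 (m.flow t)).toReal) * tail G t ∂timeMeasure := by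
      have e : -(β * tail G S * Real.exp (-r * S)) =
          ∫ t, (Ioi S).indicator (fun t => -(β * tail G S * weight r t)) t ∂timeMeasure := by
        rw [integral_indicator measurableSet_Ioi, timeMeasure,
          Measure.restrict_restrict measurableSet_Ioi,
          inter_eq_self_of_subset_left (Ioi_subset_Ici hS), integral_neg, integral_const_mul,
          integral_weight_Ioi hr hS]
      rw [e]
      refine integral_mono_ae ((hwi.const_mul _).neg.indicator measurableSet_Ioi) ?_ ?_
      · exact hi0.mul_bdd (c := 1) antitone_tail.measurable.aestronglyMeasurable
          (ae_of_all _ fun t => by rw [Real.norm_of_nonneg (tail_nonneg G t)]; exact tail_le_one t)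
      · filter_upwards [hflow] with t ht
        rw [ht]
        by_cases hts : t ≤ S
        · rw [indicator_of_notMem (notMem_Ioi.2 hts), indicator_of_notMem (notMem_Ioi.2 hts)]; simp
        · rw [indicator_of_mem (mem_Ioi.2 (not_le.1 hts)), indicator_of_mem (mem_Ioi.2 (not_le.1 hts))]
          have h1 := antitone_tail (G := G) (not_le.1 hts).le
          have h2 := mul_le_mul_of_nonneg_left h1 (mul_nonneg hβ0 (weight_pos hr t).le)
          linarith
    have hR : κ * (((T.u0 : ℝ) - v) * Real.exp (-r * S)) * (1 - tail G S) ≤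
        ∫ τ, Real.exp (-r * τ) * ((T.F1 (Y τ).toNNReal).toReal -
          (T.F1 (contValue r m.flow τ).toNNReal).toReal) ∂G := by
      have e : κ * (((T.u0 : ℝ) - v) * Real.exp (-r * S)) * (1 - tail G S) =
          ∫ τ, (Iic S).indicator (fun _ => κ * (((T.u0 : ℝ) - v) * Real.exp (-r * S))) τ ∂G := by
        rw [integral_indicator measurableSet_Iic, setIntegral_const, ← one_sub_cdf,
          ProbabilityTheory.cdf_eq_real, smul_eq_mul]
        ring
      rw [e]
      refine integral_mono_ae ((integrable_const _).indicator measurableSet_Iic) hi1 ?_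
      filter_upwards [hG.ae_nonneg] with τ hτ
      have h1 := hrew τ hτ
      by_cases hts : τ ≤ S
      · rw [indicator_of_mem (mem_Iic.2 hts)]
        rwa [max_eq_right hts] at h1
      · rw [indicator_of_notMem (notMem_Iic.2 (not_le.1 hts))]
        exact le_trans (by positivity) h1
    have he := Real.exp_pos (-r * S)
    have : Real.exp (-r * S) * (κ * ((T.u0 : ℝ) - v) * (1 - tail G S)) ≤
        Real.exp (-r * S) * (β * tail G S) := by linarith
    exact le_of_mul_le_mul_left this he
  -- In the limit the loss disappears, and the strictly positive gain cannot be at most zero.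
  have h1 : Tendsto (fun S => κ * ((T.u0 : ℝ) - v) * (1 - tail G S)) atTop
      (𝓝 (κ * ((T.u0 : ℝ) - v) * (1 - 0))) := (tendsto_tail.const_sub 1).const_mul _
  have h2 : Tendsto (fun S => β * tail G S) atTop (𝓝 (β * 0)) := tendsto_tail.const_mul _
  have := le_of_tendsto_of_tendsto h1 h2 (by
    filter_upwards [eventually_ge_atTop 0] with S hS using key S hS)
  have hpos := mul_pos hκpos hv0'
  linarith

end Gain

/-! ### Finite slopes at zero -/

section ZeroSlope

variable {T : Technology} {r : ℝ} {m : Mechanism} {G : Measure ℝ}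

theorem Technology.concaveOn_F0_zero (T : Technology) (h : T.F0 0 ≠ ⊥) :
    ConcaveOn ℝ (Icc 0 (T.u0 : ℝ)) (realize T.F0) := by
  refine T.concave_F0.concaveOn_realize T.F0_lt_top (convex_Icc _ _) (fun u hu => hu.1) fun u hu => ?_
  rcases hu.1.eq_or_lt with h0 | h0
  · rw [← h0, Real.toNNReal_zero]; exact h
  · exact T.finite_F0 _ (Real.toNNReal_pos.2 h0) (Real.toNNReal_le_iff_le_coe.2 hu.2)

theorem Technology.concaveOn_F1_zero (T : Technology) (h : T.F0 0 ≠ ⊥) :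
    ConcaveOn ℝ (Icc 0 (T.u0 : ℝ)) (realize T.F1) := by
  refine T.concave_F1.concaveOn_realize T.F1_lt_top (convex_Icc _ _) (fun u hu => hu.1) fun u hu => ?_
  rcases hu.1.eq_or_lt with h0 | h0
  · rw [← h0, Real.toNNReal_zero]; exact ne_bot_of_le_ne_bot h (T.F0_le_F1 0)
  · exact T.F1_ne_bot (Real.toNNReal_pos.2 h0) (Real.toNNReal_le_iff_le_coe.2 hu.2)

/-- If an optimal mechanism stops rewarding, the old frontier has a finite slope at zero. -/
theorem Optimal.exists_slope_zero (hr : 0 < r) (hG : IsTimeDistribution G)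
    (hsupp : ¬ BddAbove G.support) (h : Optimal T r G m) {S : ℝ} (hS : 0 ≤ S)
    (hS0 : contValue r m.flow S = 0) :
    ∃ K, 0 ≤ K ∧ ∀ v : ℝ, 0 ≤ v → v ≤ T.u0 → realize T.F0 v - realize T.F0 0 ≤ K * v := by
  have := hG.isProbabilityMeasure
  have hreg := h.regular hr hG hsupp
  have hx := hreg.bddFlow hr
  have hff := hreg.flowFinite hr
  have hF0 := hreg.F0_zero_ne_bot hr hS hS0
  have hc0 := T.concaveOn_F0_zero hF0
  have hc1 := T.concaveOn_F1_zero hF0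
  have hX0 := h.contValue_lt hr hG hsupp le_rfl
  have hzero := hx.ae_eq_zero_of_contValue hr hS hS0
  have hanti := hreg.antitoneOn_contValue hr
  -- The chord of `F1` from `w` to `u0` is flatter than all chords to the left of `w`, so raising a
  -- reward within `[0, w]` costs at most `M` per unit.
  obtain ⟨w, hw1, hw2⟩ := exists_between hX0
  set M := |(realize T.F1 T.u0 - realize T.F1 w) / ((T.u0 : ℝ) - w)| with hM
  set ω := Real.exp (-r * S) - Real.exp (-r * (S + 1)) with hω
  have hωpos : 0 < ω := sub_pos.2 (Real.exp_lt_exp.2 (by nlinarith))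
  have hden : 0 < ω * tail G (S + 1) := mul_pos hωpos (tail_pos hsupp _)
  set K := M / (ω * tail G (S + 1)) with hK
  have hX0nn := hx.contValue_nonneg hr 0
  have hu0 : (0 : ℝ) < T.u0 := T.u0_pos
  set v₀ := min (w - contValue r m.flow 0) T.u0 with hv₀
  have hv₀pos : 0 < v₀ := lt_min (by linarith) hu0
  have hsmall : ∀ v : ℝ, 0 ≤ v → v ≤ v₀ → realize T.F0 v - realize T.F0 0 ≤ K * v := by
    intro v hv hv'
    have hvw : contValue r m.flow 0 + v ≤ w := by have := hv'.trans (min_le_left _ _); linarith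
    have hvu : v ≤ T.u0 := hv'.trans (min_le_right _ _)
    have hvu' : v.toNNReal ≤ T.u0 := Real.toNNReal_le_iff_le_coe.2 hvu
    -- Add `v` to the flow on `(S, S + 1]`, where it is zero. The gain is at least `(F0 v - F0 0) *
    -- ω * tail G (S + 1)`. Every reward rises by at most `v`, which costs at most `M * v`.
    set y : ℝ → ℝ≥0 := fun t => m.flow t + (Ioc S (S + 1)).indicator (fun _ => v.toNNReal) t with hy
    have hyb : BddFlow y (T.u0 + v.toNNReal) := by
      refine ⟨hx.meas.add ((measurable_const.indicator measurableSet_Ioc).aemeasurable), ?_⟩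
      filter_upwards [hx.le] with t ht
      exact add_le_add ht (indicator_le_self' (fun _ _ => zero_le) t)
    set z : ℝ → ℝ := (Ioc S (S + 1)).indicator fun t => v * weight r t with hz
    have hzy : ∀ᵐ t ∂timeMeasure, weight r t * (y t : ℝ) = weight r t * m.flow t + z t := by
      refine ae_of_all _ fun t => ?_
      by_cases ht : t ∈ Ioc S (S + 1)
      · simp only [hy, hz, indicator_of_mem ht, NNReal.coe_add, Real.coe_toNNReal _ hv]; ring
      · simp only [hy, hz, indicator_of_notMem ht]; simp
    have hY : ∀ τ, 0 ≤ τ → contValue r m.flow τ ≤ contValue r y τ ∧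
        contValue r y τ ≤ contValue r m.flow τ + v := by
      intro τ hτ
      have hzi : IntegrableOn z (Ioi τ) := by
        refine Integrable.integrableOn ?_
        rw [hz, integrable_indicator_iff measurableSet_Ioc]
        exact (((continuous_weight r).integrableOn_Icc).mono_set Ioc_subset_Icc_self).const_mul v
      have h1 : 0 ≤ ∫ t in Ioi τ, z t := integral_nonneg fun t =>
        indicator_nonneg (fun t _ => mul_nonneg hv (weight_pos hr t).le) t
      have h2 : ∫ t in Ioi τ, z t ≤ v * Real.exp (-r * τ) := by
        rw [← integral_weight_Ioi hr hτ, ← integral_const_mul]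
        refine setIntegral_mono hzi (((integrableOn_weight hr).mono_set
          (Ioi_subset_Ici hτ)).const_mul v) fun t => ?_
        exact indicator_le_self' (fun t _ => mul_nonneg hv (weight_pos hr t).le) t
      rw [contValue_add hr hx hyb hzy hτ]
      have he := Real.exp_pos (r * τ)
      have he' := exp_mul_exp_neg r τ
      refine ⟨le_add_of_nonneg_right (mul_nonneg he.le h1), ?_⟩
      have := mul_le_mul_of_nonneg_left h2 he.le
      have e : Real.exp (r * τ) * (v * Real.exp (-r * τ)) = v := by
        rw [mul_left_comm, he', mul_one]
      linarith
    have hXle : ∀ τ, 0 ≤ τ → contValue r m.flow τ ≤ contValue r m.flow 0 := fun τ hτ =>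
      hanti (mem_Ici.2 le_rfl) hτ hτ
    have hYw : ∀ τ, 0 ≤ τ → contValue r y τ ≤ w := fun τ hτ => by
      have h1 := (hY τ hτ).2
      have h2 := hXle τ hτ
      linarith
    have hYb : ∀ τ, 0 ≤ τ → T.F1 (contValue r y τ).toNNReal ≠ ⊥ := by
      intro τ hτ
      rcases (hyb.contValue_nonneg hr τ).eq_or_lt with h0 | h0
      · rw [← h0, Real.toNNReal_zero]; exact ne_bot_of_le_ne_bot hF0 (T.F0_le_F1 0)
      · exact T.F1_ne_bot (Real.toNNReal_pos.2 h0)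
          (Real.toNNReal_le_iff_le_coe.2 ((hYw τ hτ).trans hw2.le))
    have hrew : ∀ τ, 0 ≤ τ → -(M * v) ≤ (T.F1 (contValue r y τ).toNNReal).toReal -
          (T.F1 (contValue r m.flow τ).toNNReal).toReal := by
      intro τ hτ
      have h1 := hc1.chord_le (p := contValue r m.flow τ) (q := contValue r y τ) (a := w)
        (b := T.u0) ⟨hx.contValue_nonneg hr τ, hx.contValue_le hr hτ⟩ ⟨hu0.le, le_rfl⟩
        (hY τ hτ).1 (hYw τ hτ) hw2
      refine le_trans ?_ h1
      have h2 := neg_abs_le ((realize T.F1 T.u0 - realize T.F1 w) / ((T.u0 : ℝ) - w))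
      have h3 := (hY τ hτ).1
      have h4 := (hY τ hτ).2
      have hM0 : 0 ≤ M := abs_nonneg _
      nlinarith
    set δ := realize T.F0 v - realize T.F0 0 with hδ
    have hδ0 : 0 ≤ δ := by
      refine sub_nonneg.2 (EReal.toReal_le_toReal (T.F0_mono ?_ hvu') ?_ (T.F0_lt_top _).ne)
      · exact Real.toNNReal_le_toNNReal hv
      · simpa using hF0
    have hflow : (fun t => weight r t * ((T.F0 (min (y t) T.u0)).toReal -
        (T.F0 (m.flow t)).toReal)) =ᵐ[timeMeasure]
        (Ioc S (S + 1)).indicator fun t => δ * weight r t := by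
      filter_upwards [hx.le, hzero] with t ht ht0
      by_cases hts : t ∈ Ioc S (S + 1)
      · simp only [hy, indicator_of_mem hts, ht0 hts.1, zero_add, min_eq_left hvu', hδ, realize,
          Real.toNNReal_zero]
        ring
      · simp only [hy, indicator_of_notMem hts, add_zero, min_eq_left ht, sub_self, mul_zero]
    have hwi : Integrable (weight r) timeMeasure := integrableOn_weight hr
    have hi0 := ((hwi.const_mul δ).indicator (measurableSet_Ioc (a := S) (b := S + 1))).congr
      hflow.symm
    have hyF : ∀ᵐ t ∂timeMeasure, T.F0 (min (y t) T.u0) ≠ ⊥ := by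
      filter_upwards [hff.ne_bot] with t ht
      refine ne_bot_of_le_ne_bot (b := T.F0 (min (m.flow t) T.u0)) ?_ ?_
      · exact ne_bot_of_le_ne_bot ht (T.F0_le_min _)
      · exact T.F0_mono (min_le_min_right _ le_self_add) (min_le_right _ _)
    have hi1 : Integrable (fun τ => Real.exp (-r * τ) * ((T.F1 (contValue r y τ).toNNReal).toReal -
        (T.F1 (contValue r m.flow τ).toNNReal).toReal)) G := by
      obtain ⟨B, hB⟩ : ∃ B, ∀ τ, 0 ≤ τ → -(T.F1 (contValue r m.flow τ).toNNReal).toReal ≤ B := by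
        refine ⟨M * T.u0 - realize T.F1 0, fun τ hτ => ?_⟩
        have h1 := hc1.chord_le (p := 0) (q := contValue r m.flow τ) (a := w) (b := T.u0)
          ⟨le_rfl, hu0.le⟩ ⟨hu0.le, le_rfl⟩ (hx.contValue_nonneg hr τ)
          (((hXle τ hτ).trans hw1.le)) hw2
        have h2 := neg_abs_le ((realize T.F1 T.u0 - realize T.F1 w) / ((T.u0 : ℝ) - w))
        have h3 := hx.contValue_nonneg hr τ
        have h4 := hx.contValue_le hr hτ
        have hM0 : 0 ≤ M := abs_nonneg _
        change -realize T.F1 (contValue r m.flow τ) ≤ _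
        nlinarith
      refine Integrable.mono' (integrable_const (M * v + |(T.F1 T.u1).toReal + B|)) ?_ ?_
      · refine Measurable.aestronglyMeasurable (Measurable.mul (by fun_prop) (Measurable.sub ?_ ?_))
        · exact (T.measurable_F1.comp
            (hyb.continuous_contValue hr).measurable.real_toNNReal).ereal_toReal
        · exact (T.measurable_F1.comp
            (hx.continuous_contValue hr).measurable.real_toNNReal).ereal_toReal
      · filter_upwards [hG.ae_nonneg] with τ hτ
        have h1 := hrew τ hτ
        have h2 := EReal.toReal_le_toReal (T.F1_le_peak (contValue r y τ).toNNReal) (hYb τ hτ)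
          (T.F1_lt_top _).ne
        have h3 := hB τ hτ
        have he := Real.exp_pos (-r * τ)
        have he' : Real.exp (-r * τ) ≤ 1 := Real.exp_le_one_iff.2 (by nlinarith)
        have hMv : 0 ≤ M * v := mul_nonneg (abs_nonneg _) hv
        rw [norm_mul, Real.norm_of_nonneg he.le]
        refine (mul_le_of_le_one_left (norm_nonneg _) he').trans ?_
        rw [Real.norm_eq_abs, abs_le]
        have h4 := le_abs_self ((T.F1 T.u1).toReal + B)
        constructor <;> linarith [abs_nonneg ((T.F1 T.u1).toReal + B)]
    have hg := h.gain_nonpos hr hG hsupp hyb hyF hYb hi0 hi1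
    have hL : δ * (ω * tail G (S + 1)) ≤ ∫ t, weight r t *
        ((T.F0 (min (y t) T.u0)).toReal - (T.F0 (m.flow t)).toReal) * tail G t ∂timeMeasure := by
      have e : δ * (ω * tail G (S + 1)) =
          ∫ t, (Ioc S (S + 1)).indicator (fun t => δ * tail G (S + 1) * weight r t) t
            ∂timeMeasure := by
        rw [integral_indicator measurableSet_Ioc, timeMeasure,
          Measure.restrict_restrict measurableSet_Ioc,
          inter_eq_self_of_subset_left
            (show Ioc S (S + 1) ⊆ Ici 0 from fun t ht => hS.trans ht.1.le), integral_const_mul,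
          ← intervalIntegral.integral_of_le (by linarith), integral_weight]
        ring
      rw [e]
      refine integral_mono_ae ((hwi.const_mul _).indicator measurableSet_Ioc) ?_ ?_
      · exact hi0.mul_bdd (c := 1) antitone_tail.measurable.aestronglyMeasurable
          (ae_of_all _ fun t => by rw [Real.norm_of_nonneg (tail_nonneg G t)]; exact tail_le_one t)
      · filter_upwards [hflow] with t ht
        rw [ht]
        by_cases hts : t ∈ Ioc S (S + 1)
        · rw [indicator_of_mem hts, indicator_of_mem hts]
          have h1 := antitone_tail (G := G) hts.2
          have h2 := mul_le_mul_of_nonneg_left h1 (mul_nonneg hδ0 (weight_pos hr t).le)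
          linarith
        · rw [indicator_of_notMem hts, indicator_of_notMem hts]; simp
    have hR : -(M * v) ≤ ∫ τ, Real.exp (-r * τ) * ((T.F1 (contValue r y τ).toNNReal).toReal -
          (T.F1 (contValue r m.flow τ).toNNReal).toReal) ∂G := by
      have e : -(M * v) = ∫ _, -(M * v) ∂G := by simp
      rw [e]
      refine integral_mono_ae (integrable_const _) hi1 ?_
      filter_upwards [hG.ae_nonneg] with τ hτ
      have h1 := hrew τ hτ
      have he := Real.exp_pos (-r * τ)
      have he' : Real.exp (-r * τ) ≤ 1 := Real.exp_le_one_iff.2 (by nlinarith)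
      have hMv : 0 ≤ M * v := mul_nonneg (abs_nonneg _) hv
      nlinarith
    rw [hK, div_mul_eq_mul_div, le_div_iff₀ hden]
    linarith
  have hK0 : 0 ≤ K := div_nonneg (abs_nonneg _) hden.le
  refine ⟨K, hK0, fun v hv hvu => ?_⟩
  -- For large `v`, slopes from zero decrease by concavity.
  rcases le_or_gt v v₀ with hle | hgt
  · exact hsmall v hv hle
  · have h1 := hsmall v₀ hv₀pos.le le_rfl
    have h2 := hc0.chord_above (p := 0) (q := v₀) (b := v) ⟨le_rfl, hu0.le⟩ ⟨hv, hvu⟩ hv₀pos.le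
      hgt.le (hv₀pos.trans hgt)
    have hvpos := hv₀pos.trans hgt
    rw [sub_zero, div_mul_eq_mul_div, div_le_iff₀ hvpos] at h2
    have h3 : v₀ * (realize T.F0 v - realize T.F0 0) ≤ v₀ * (K * v) := by nlinarith
    exact le_of_mul_le_mul_left h3 hv₀pos

theorem Technology.F0_slope_le (T : Technology) {K : ℝ} (hF0 : T.F0 0 ≠ ⊥)
    (hK : ∀ v : ℝ, 0 ≤ v → v ≤ T.u0 → realize T.F0 v - realize T.F0 0 ≤ K * v) {p q : ℝ}
    (hp : 0 ≤ p) (hpq : p ≤ q) (hq : q ≤ T.u0) : realize T.F0 q - realize T.F0 p ≤ K * (q - p) := by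
  rcases hpq.eq_or_lt with rfl | hlt
  · simp
  rcases hp.eq_or_lt with rfl | hp
  · simpa using hK q hpq hq
  have h1 := (T.concaveOn_F0_zero hF0).chord_le (p := 0) (q := p) (a := p) (b := q)
    ⟨le_rfl, hp.le.trans (hpq.trans hq)⟩ ⟨hp.le.trans hpq, hq⟩ hp.le le_rfl hlt
  have h2 := hK p hp.le (hpq.trans hq)
  rw [sub_zero] at h1
  have h3 : (realize T.F0 q - realize T.F0 p) / (q - p) ≤ K :=
    le_of_mul_le_mul_right (h1.trans h2) hp
  rwa [div_le_iff₀ (by linarith)] at h3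

/-- With `ustar = 0` the new frontier is less steep than the old one at every interior level, so it
inherits the bound `K`. The end point `0` is reached by upper semicontinuity. -/
theorem Technology.F1_slope_le (T : Technology) {K : ℝ} (hF0 : T.F0 0 ≠ ⊥) (hus : T.us = 0)
    (hK : ∀ v : ℝ, 0 ≤ v → v ≤ T.u0 → realize T.F0 v - realize T.F0 0 ≤ K * v) {p q : ℝ}
    (hp : 0 ≤ p) (hpq : p ≤ q) (hq : q ≤ T.u0) : realize T.F1 q - realize T.F1 p ≤ K * (q - p) := by
  have hpos : ∀ p : ℝ, 0 < p → p ≤ q → realize T.F1 q - realize T.F1 p ≤ K * (q - p) := by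
    intro p hp hpq
    rcases hpq.eq_or_lt with rfl | hlt
    · simp
    lift p to ℝ≥0 using hp.le
    have hp' : 0 < p := hp
    have hpu : p < T.u0 := by exact_mod_cast hlt.trans_le hq
    obtain ⟨η0, h0⟩ := T.exists_slopeAt_F0 hp' hpu
    obtain ⟨η1, h1⟩ := T.exists_slopeAt_F1 hp' hpu
    have hlt' := T.slope_F1_lt_F0 (by rw [hus]; exact hp') hpu h0 h1
    have hη0 : η0 ≤ K := by
      have a1 := h0.le_toReal T.F0_lt_top hF0
      have a2 := hK p hp.le (hpq.trans hq)
      rw [realize_coe, ← NNReal.coe_zero, realize_coe] at a2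
      have a3 : η0 * p ≤ K * p := by simp only [NNReal.coe_zero] at a1; linarith
      exact le_of_mul_le_mul_right a3 hp
    have hqb : T.F1 q.toNNReal ≠ ⊥ :=
      T.F1_ne_bot (Real.toNNReal_pos.2 (hp.trans hlt)) (Real.toNNReal_le_iff_le_coe.2 hq)
    have a1 := h1.le_toReal T.F1_lt_top hqb
    rw [Real.coe_toNNReal _ (hp.le.trans hpq)] at a1
    rw [realize_coe, realize]
    nlinarith
  rcases hp.eq_or_lt with rfl | hp
  swap
  · exact hpos p hp hpq
  rcases hpq.eq_or_lt with rfl | hqpos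
  · simp
  have hF1 : T.F1 0 ≠ ⊥ := ne_bot_of_le_ne_bot hF0 (T.F0_le_F1 0)
  refine le_of_forall_pos_le_add fun ε hε => ?_
  -- Only a bound on `F1` near zero from above is needed, to replace `F1 p` by `F1 0` as `p` tends
  -- to zero.
  have husc : ∀ᶠ u in 𝓝 (0 : ℝ≥0), T.F1 u < (((T.F1 0).toReal + ε / 2 : ℝ) : EReal) := by
    refine T.usc_F1 0 _ ?_
    have e := EReal.coe_toReal (T.F1_lt_top 0).ne hF1
    change T.F1 0 < _
    nth_rewrite 1 [← e]
    rw [EReal.coe_lt_coe_iff]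
    linarith
  have hcont : Tendsto (fun p : ℝ => p.toNNReal) (𝓝[>] 0) (𝓝 0) := by
    have := (continuous_real_toNNReal.tendsto 0).mono_left (nhdsWithin_le_nhds (s := Ioi 0))
    simpa using this
  have hKε : ∀ᶠ p in 𝓝[>] (0 : ℝ), -(ε / 2) < K * p := by
    have : Tendsto (fun p : ℝ => K * p) (𝓝[>] 0) (𝓝 (K * 0)) :=
      (tendsto_id.const_mul K).mono_left nhdsWithin_le_nhds
    rw [mul_zero] at this
    exact this.eventually (lt_mem_nhds (by linarith))
  obtain ⟨p, h1, h2, h3⟩ := ((hcont.eventually husc).and (hKε.and (Ioo_mem_nhdsGT hqpos))).exists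
  have h4 := hpos p h3.1 h3.2.le
  have hpb : T.F1 p.toNNReal ≠ ⊥ :=
    T.F1_ne_bot (Real.toNNReal_pos.2 h3.1) (Real.toNNReal_le_iff_le_coe.2 (h3.2.le.trans hq))
  rw [← EReal.coe_toReal (T.F1_lt_top _).ne hpb, EReal.coe_lt_coe_iff] at h1
  have e0 : realize T.F1 0 = (T.F1 0).toReal := by simp [realize]
  have ep : realize T.F1 p = (T.F1 p.toNNReal).toReal := rfl
  rw [e0]
  rw [ep] at h4
  nlinarith

end ZeroSlope

/-! ### One-sided slopes of concave functions -/

section Slopes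

/-- Right-hand derivative. -/
noncomputable def rightSlope (g : ℝ → ℝ) (u : ℝ) : ℝ := derivWithin g (Ioi u) u

/-- Left-hand derivative. -/
noncomputable def leftSlope (g : ℝ → ℝ) (u : ℝ) : ℝ := derivWithin g (Iio u) u

/-- Directional derivative. -/
noncomputable def dirSlope (g : ℝ → ℝ) (u q : ℝ) : ℝ :=
  if 0 ≤ q then rightSlope g u * q else leftSlope g u * q

variable {S : Set ℝ} {g : ℝ → ℝ} {u v : ℝ}

theorem dirSlope_mul {w : ℝ} (hw : 0 < w) (q : ℝ) : dirSlope g u (w * q) = w * dirSlope g u q := by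
  unfold dirSlope
  simp only [mul_nonneg_iff_of_pos_left hw]
  split_ifs <;> ring

theorem dirSlope_zero : dirSlope g u 0 = 0 := by simp [dirSlope]

theorem _root_.ConcaveOn.hasDerivWithinAt_rightSlope (hg : ConcaveOn ℝ S g) (hu : u ∈ interior S) :
    HasDerivWithinAt g (rightSlope g u) (Ioi u) u := by
  have : DifferentiableWithinAt ℝ g (Ioi u) u := by
    simpa using (hg.neg.differentiableWithinAt_Ioi_of_mem_interior hu).neg
  exact this.hasDerivWithinAt

theorem _root_.ConcaveOn.hasDerivWithinAt_leftSlope (hg : ConcaveOn ℝ S g) (hu : u ∈ interior S) :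
    HasDerivWithinAt g (leftSlope g u) (Iio u) u := by
  have : DifferentiableWithinAt ℝ g (Iio u) u := by
    simpa using (hg.neg.differentiableWithinAt_Iio_of_mem_interior hu).neg
  exact this.hasDerivWithinAt

theorem _root_.ConcaveOn.tendsto_dirSlope (hg : ConcaveOn ℝ S g) (hu : u ∈ interior S) (q : ℝ) :
    Tendsto (fun ε => (g (u + ε * q) - g u) / ε) (𝓝[>] 0) (𝓝 (dirSlope g u q)) := by
  have key : ∀ (R : ℝ) (I : Set ℝ), HasDerivWithinAt g R I u → (∀ ε : ℝ, 0 < ε → u + ε * q ∈ I) →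
      Tendsto (fun ε => (g (u + ε * q) - g u) / ε) (𝓝[>] 0) (𝓝 (R * q)) := by
    intro R I hR hI
    have hlin : HasDerivWithinAt (fun ε : ℝ => u + ε * q) q (Ioi 0) 0 := by
      simpa using (((hasDerivAt_id (0 : ℝ)).mul_const q).const_add u).hasDerivWithinAt
    have hR' : HasDerivWithinAt g R I ((fun ε : ℝ => u + ε * q) 0) := by simpa using hR
    have h := hR'.comp (0 : ℝ) hlin (fun ε hε => hI ε hε)
    rw [hasDerivWithinAt_iff_tendsto_slope' (by simp)] at h
    refine h.congr fun ε => ?_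
    simp [slope_def_field]
  unfold dirSlope
  rcases lt_trichotomy q 0 with hq | rfl | hq
  · rw [if_neg (not_le.2 hq)]
    refine key _ _ (hg.hasDerivWithinAt_leftSlope hu) fun ε hε => ?_
    have := mul_neg_of_pos_of_neg hε hq
    simp only [mem_Iio]; linarith
  · simp
  · rw [if_pos hq.le]
    refine key _ _ (hg.hasDerivWithinAt_rightSlope hu) fun ε hε => ?_
    have := mul_pos hε hq
    simp only [mem_Ioi]; linarith

theorem _root_.ConcaveOn.antitoneOn_rightSlope (hg : ConcaveOn ℝ S g) :
    AntitoneOn (rightSlope g) (interior S) := by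
  intro a ha b hb hab
  have := hg.neg.monotoneOn_rightDeriv ha hb hab
  simp only [derivWithin.neg] at this
  unfold rightSlope
  linarith

theorem _root_.ConcaveOn.antitoneOn_leftSlope (hg : ConcaveOn ℝ S g) :
    AntitoneOn (leftSlope g) (interior S) := by
  intro a ha b hb hab
  have := hg.neg.monotoneOn_leftDeriv ha hb hab
  simp only [derivWithin.neg] at this
  unfold leftSlope
  linarith

theorem _root_.ConcaveOn.exists_lipschitz (hg : ConcaveOn ℝ S g) (hS : IsOpen S) {p q : ℝ}
    (hpq : Icc p q ⊆ S) :
    ∃ K, 0 ≤ K ∧ ∀ u ∈ Icc p q, ∀ v ∈ Icc p q, |g u - g v| ≤ K * |u - v| := by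
  obtain ⟨K, hK⟩ := ((hg.locallyLipschitzOn hS).mono hpq).exists_lipschitzOnWith_of_compact
    isCompact_Icc
  refine ⟨K, K.2, fun u hu v hv => ?_⟩
  have := hK.dist_le_mul u hu v hv
  rwa [Real.dist_eq, Real.dist_eq] at this

end Slopes

/-! ### First-order conditions -/

section FirstOrder

variable {T : Technology} {r l : ℝ} {m : Mechanism} {G : Measure ℝ} {g0 g1 : ℝ → ℝ}

/-- Concave functions on open intervals that contain the levels of the mechanism and agree there
with the frontiers, the old one being flattened above `u0`. -/
structure Extension (T : Technology) (r : ℝ) (m : Mechanism) (l : ℝ) (g0 g1 : ℝ → ℝ) : Prop where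
  concave0 : ConcaveOn ℝ (Ioi l) g0
  concave1 : ConcaveOn ℝ (Ioo l T.u0) g1
  eq0 : ∀ u : ℝ≥0, l < u → T.F0 (min u T.u0) ≠ ⊥ ∧ (T.F0 (min u T.u0)).toReal = g0 u
  eq1 : ∀ u : ℝ≥0, l < u → u < T.u0 → T.F1 u ≠ ⊥ ∧ (T.F1 u).toReal = g1 u
  lt_value : ∀ t, 0 ≤ t → l < contValue r m.flow t

/-- The discounted flow is perturbed by `ε * ζ`, which changes the continuation value at `τ` by `ε *
exp (r * τ)` times the integral of `ζ` after `τ`. Dividing the gain by `ε` and letting `ε` decrease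
to zero gives directional derivatives; concave functions are Lipschitz on compact subintervals,
which provides the domination. The last hypothesis lets the flow be lowered only where it is bounded
away from zero. -/
theorem Optimal.first_order (hr : 0 < r) (hG : IsTimeDistribution G)
    (hsupp : ¬ BddAbove G.support) (h : Optimal T r G m) (hE : Extension T r m l g0 g1)
    {ζ : ℝ → ℝ} (hζm : Measurable ζ) {K S δ : ℝ} (hS : 0 ≤ S) (hζK : ∀ t, |ζ t| ≤ K)
    (hζS : ∀ t, t ∉ Icc 0 S → ζ t = 0) (hδ : 0 < δ)
    (hneg : ∀ t, 0 ≤ t → ζ t < 0 → δ ≤ contValue r m.flow t) :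
    ∫ t, dirSlope g0 (m.flow t) (ζ t) * tail G t ∂timeMeasure +
      ∫ τ, dirSlope g1 (contValue r m.flow τ) (∫ t in Ioi τ, ζ t) ∂G ≤ 0 := by
  have := hG.isProbabilityMeasure
  have hreg := h.regular hr hG hsupp
  have hx := hreg.bddFlow hr
  have hff := hreg.flowFinite hr
  have hanti := hreg.antitoneOn_contValue hr
  set X := contValue r m.flow with hX
  set Z : ℝ → ℝ := fun τ => ∫ t in Ioi τ, ζ t with hZ
  have hX0 : X 0 < T.u0 := h.contValue_lt hr hG hsupp le_rfl
  have hXS : l < X S := hE.lt_value S hS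
  have hK0 : 0 ≤ K := (abs_nonneg _).trans (hζK 0)
  have hZK : ∀ τ, 0 ≤ τ → |Z τ| ≤ K * S := by
    intro τ hτ
    have e : Z τ = ∫ t in Ioi τ ∩ Icc 0 S, ζ t := by
      rw [hZ, ← setIntegral_indicator measurableSet_Icc]
      refine integral_congr_ae (ae_of_all _ fun t => ?_)
      by_cases ht : t ∈ Icc 0 S
      · simp [ht]
      · simp [ht, hζS t ht]
    rw [e, ← Real.norm_eq_abs]
    have hfin : volume (Ioi τ ∩ Icc 0 S) < ∞ :=
      (measure_mono inter_subset_right).trans_lt measure_Icc_lt_top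
    refine (norm_setIntegral_le_of_norm_le_const hfin fun t _ => hζK t).trans ?_
    refine mul_le_mul_of_nonneg_left ?_ hK0
    have : volume.real (Ioi τ ∩ Icc 0 S) ≤ volume.real (Icc 0 S) :=
      measureReal_mono inter_subset_right measure_Icc_lt_top.ne
    rwa [Real.volume_real_Icc_of_le hS, sub_zero] at this
  have hZS : ∀ τ, S < τ → Z τ = 0 := by
    intro τ hτ
    refine setIntegral_eq_zero_of_forall_eq_zero fun t ht => hζS t fun h => ?_
    exact absurd (hτ.trans ht) (not_lt.2 h.2)
  -- admissible step sizes
  set ρ := min δ (min ((X S - l) / 2) ((T.u0 - X 0) / 2)) with hρ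
  have hρpos : 0 < ρ := lt_min hδ (lt_min (by linarith) (by linarith))
  have hρ1 : ρ ≤ δ := min_le_left _ _
  have hρ2 : ρ ≤ (X S - l) / 2 := (min_le_right _ _).trans (min_le_left _ _)
  have hρ3 : ρ ≤ (T.u0 - X 0) / 2 := (min_le_right _ _).trans (min_le_right _ _)
  -- `N` bounds the perturbations of the flow and of the continuation value per unit of `ε`, so
  -- steps `ε ≤ ρ / N` move both by at most `ρ`. The summand 1 makes it positive.
  set N := K / weight r S + Real.exp (r * S) * (K * S) + 1 with hN
  have hwS := weight_pos hr S
  have hN1 : 0 ≤ K / weight r S := div_nonneg hK0 hwS.le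
  have hN2 : 0 ≤ Real.exp (r * S) * (K * S) := by positivity
  have hNpos : 0 < N := by linarith
  have hweight : ∀ t, t ≤ S → weight r S ≤ weight r t := fun t ht => by
    unfold weight
    exact mul_le_mul_of_nonneg_left (Real.exp_le_exp.2 (by nlinarith)) hr.le
  have hq : ∀ t, |ζ t / weight r t| ≤ N := by
    intro t
    by_cases ht : t ∈ Icc 0 S
    · rw [abs_div, abs_of_pos (weight_pos hr t)]
      have := div_le_div₀ hK0 (hζK t) hwS (hweight t ht.2)
      linarith
    · rw [hζS t ht]; simpa using hNpos.le
  have hQ : ∀ τ, 0 ≤ τ → |Real.exp (r * τ) * Z τ| ≤ N := by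
    intro τ hτ
    rcases le_or_gt τ S with ht | ht
    · rw [abs_mul, abs_of_pos (Real.exp_pos _)]
      have h1 : Real.exp (r * τ) ≤ Real.exp (r * S) := Real.exp_le_exp.2 (by nlinarith)
      have := mul_le_mul h1 (hZK τ hτ) (abs_nonneg _) (Real.exp_pos _).le
      linarith
    · rw [hZS τ ht]; simpa using hNpos.le
  have hstep : ∀ ε, 0 < ε → ε ≤ ρ / N → ∀ q, |q| ≤ N → |ε * q| ≤ ρ := by
    intro ε hε hε' q hq
    rw [abs_mul, abs_of_pos hε]
    calc ε * |q| ≤ ρ / N * N := mul_le_mul hε' hq (abs_nonneg _) (by positivity)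
      _ = ρ := by field_simp
  -- Lipschitz bounds
  set p := (X S + l) / 2 with hp
  obtain ⟨K0, hK0', hLip0⟩ := hE.concave0.exists_lipschitz isOpen_Ioi (p := p) (q := T.u0 + ρ)
    (fun u hu => mem_Ioi.2 (by have := hu.1; linarith))
  obtain ⟨K1, hK1', hLip1⟩ := hE.concave1.exists_lipschitz isOpen_Ioo (p := p)
    (q := (T.u0 + X 0) / 2) (fun u hu => ⟨by have := hu.1; linarith, by have := hu.2; linarith⟩)
  have hXlow : ∀ τ, 0 ≤ τ → τ ≤ S → X S ≤ X τ := fun τ h0 h1 => hanti h0 hS h1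
  have hXup : ∀ τ, 0 ≤ τ → X τ ≤ X 0 := fun τ h0 => hanti (mem_Ici.2 le_rfl) h0 h0
  have hgood : ∀ᵐ t ∂timeMeasure, 0 ≤ t ∧ X t ≤ m.flow t ∧ (m.flow t : ℝ) ≤ T.u0 ∧
      T.F0 (m.flow t) ≠ ⊥ := by
    filter_upwards [hreg.contValue_le_flow hr, hx.le, hff.ne_bot, ae_restrict_mem measurableSet_Ici]
      with t h1 h2 h3 h4
    exact ⟨h4, h1, by exact_mod_cast h2, h3⟩
  set D0 : ℝ → ℝ → ℝ := fun ε t =>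
    weight r t * ((g0 (m.flow t + ε * (ζ t / weight r t)) - g0 (m.flow t)) / ε) * tail G t with hD0
  set D1 : ℝ → ℝ → ℝ := fun ε τ =>
    Real.exp (-r * τ) * ((g1 (X τ + ε * (Real.exp (r * τ) * Z τ)) - g1 (X τ)) / ε) with hD1
  have hbd0 : ∀ ε, 0 < ε → ε ≤ ρ / N → ∀ᵐ t ∂timeMeasure,
      |weight r t * ((g0 (m.flow t + ε * (ζ t / weight r t)) - g0 (m.flow t)) / ε)| ≤
        (Icc 0 S).indicator (fun _ => K0 * K) t := by
    intro ε hε hε'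
    filter_upwards [hgood] with t ⟨h0, hXt, hxu, _⟩
    have hw := weight_pos hr t
    by_cases ht : t ∈ Icc 0 S
    · rw [indicator_of_mem ht]
      have hb := abs_le.1 (hstep ε hε hε' _ (hq t))
      have hXt' := hXlow t ht.1 ht.2
      have hl := hLip0 (m.flow t + ε * (ζ t / weight r t)) ⟨by linarith, by linarith⟩ (m.flow t)
        ⟨by linarith, by linarith⟩
      have e : (m.flow t : ℝ) + ε * (ζ t / weight r t) - m.flow t = ε * (ζ t / weight r t) := by ring
      rw [e, abs_mul, abs_of_pos hε, abs_div, abs_of_pos hw] at hl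
      rw [abs_mul, abs_of_pos hw, abs_div, abs_of_pos hε]
      have h1 : |g0 (m.flow t + ε * (ζ t / weight r t)) - g0 (m.flow t)| / ε ≤
          K0 * (|ζ t| / weight r t) := by
        rw [div_le_iff₀ hε]; linarith
      calc _ ≤ weight r t * (K0 * (|ζ t| / weight r t)) := mul_le_mul_of_nonneg_left h1 hw.le
        _ = K0 * |ζ t| := by field_simp
        _ ≤ K0 * K := mul_le_mul_of_nonneg_left (hζK t) hK0'
    · rw [indicator_of_notMem ht, hζS t ht]; simp
  have hbd1 : ∀ ε, 0 < ε → ε ≤ ρ / N → ∀ τ, 0 ≤ τ → |D1 ε τ| ≤ K1 * (K * S) := by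
    intro ε hε hε' τ hτ
    have he := Real.exp_pos (-r * τ)
    rcases le_or_gt τ S with ht | ht
    · have hb := abs_le.1 (hstep ε hε hε' _ (hQ τ hτ))
      have h1 := hXlow τ hτ ht
      have h2 := hXup τ hτ
      have hl := hLip1 (X τ + ε * (Real.exp (r * τ) * Z τ)) ⟨by linarith, by linarith⟩ (X τ)
        ⟨by linarith, by linarith⟩
      have e : X τ + ε * (Real.exp (r * τ) * Z τ) - X τ = ε * (Real.exp (r * τ) * Z τ) := by ring
      rw [e, abs_mul, abs_of_pos hε, abs_mul, abs_of_pos (Real.exp_pos _)] at hl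
      simp only [hD1]
      rw [abs_mul, abs_of_pos he, abs_div, abs_of_pos hε]
      have h3 : |g1 (X τ + ε * (Real.exp (r * τ) * Z τ)) - g1 (X τ)| / ε ≤
          K1 * (Real.exp (r * τ) * |Z τ|) := by
        rw [div_le_iff₀ hε]; linarith
      have h4 := exp_mul_exp_neg r τ
      calc _ ≤ Real.exp (-r * τ) * (K1 * (Real.exp (r * τ) * |Z τ|)) :=
            mul_le_mul_of_nonneg_left h3 he.le
        _ = K1 * |Z τ| := by linear_combination (K1 * |Z τ|) * h4
        _ ≤ K1 * (K * S) := mul_le_mul_of_nonneg_left (hZK τ hτ) hK1'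
    · simp only [hD1, hZS τ ht]
      simp only [mul_zero, add_zero, sub_self, zero_div, abs_zero]
      positivity
  -- the deviations
  have hdev : ∀ ε, 0 < ε → ε ≤ ρ / N →
      AEStronglyMeasurable (D0 ε) timeMeasure ∧ AEStronglyMeasurable (D1 ε) G ∧
        ∫ t, D0 ε t ∂timeMeasure + ∫ τ, D1 ε τ ∂G ≤ 0 := by
    intro ε hε hε'
    set y : ℝ → ℝ≥0 := fun t => ((m.flow t : ℝ) + ε * (ζ t / weight r t)).toNNReal with hy
    -- Where `ζ` is negative, the flow is at least the continuation value, hence at least `δ ≥ ρ`,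
    -- and the truncation at zero is inactive.
    have hyr : ∀ᵐ t ∂timeMeasure, (y t : ℝ) = m.flow t + ε * (ζ t / weight r t) := by
      filter_upwards [hgood] with t ⟨h0, hXt, hxu, _⟩
      refine Real.coe_toNNReal _ ?_
      rcases le_or_gt 0 (ζ t) with hz | hz
      · have := weight_pos hr t
        positivity
      · have h1 := hneg t h0 hz
        have hb := abs_le.1 (hstep ε hε hε' _ (hq t))
        linarith
    have hyb : BddFlow y (T.u0 + ρ.toNNReal) := by
      refine ⟨?_, ?_⟩
      · exact (hx.meas.coe_nnreal_real.add ((hζm.div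
          (continuous_weight r).measurable).const_mul ε).aemeasurable).real_toNNReal
      · filter_upwards [hyr, hgood] with t h1 ⟨h0, hXt, hxu, _⟩
        rw [← NNReal.coe_le_coe, h1, NNReal.coe_add, Real.coe_toNNReal _ hρpos.le]
        have hb := abs_le.1 (hstep ε hε hε' _ (hq t))
        linarith
    have hcv : ∀ τ, 0 ≤ τ → contValue r y τ = X τ + ε * (Real.exp (r * τ) * Z τ) := by
      intro τ hτ
      rw [contValue_add hr hx hyb (z := fun t => ε * ζ t) ?_ hτ, integral_const_mul]
      · ring
      · filter_upwards [hyr] with t ht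
        have := (weight_pos hr t).ne'
        rw [ht]; field_simp
    have hcv' : ∀ τ, 0 ≤ τ → l < contValue r y τ ∧ contValue r y τ < T.u0 := by
      intro τ hτ
      rw [hcv τ hτ]
      have h2 := hXup τ hτ
      have hb := abs_le.1 (hstep ε hε hε' _ (hQ τ hτ))
      refine ⟨?_, by linarith⟩
      rcases le_or_gt τ S with ht | ht
      · have h1 := hXlow τ hτ ht
        linarith
      · rw [hZS τ ht]; simpa using hE.lt_value τ hτ
    have hF1y : ∀ τ, 0 ≤ τ → T.F1 (contValue r y τ).toNNReal ≠ ⊥ ∧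
        (T.F1 (contValue r y τ).toNNReal).toReal = g1 (X τ + ε * (Real.exp (r * τ) * Z τ)) := by
      intro τ hτ
      have e := Real.coe_toNNReal _ (hyb.contValue_nonneg hr τ)
      have := hE.eq1 (contValue r y τ).toNNReal (by rw [e]; exact (hcv' τ hτ).1)
        (by rw [← NNReal.coe_lt_coe, e]; exact (hcv' τ hτ).2)
      rw [e] at this
      rw [← hcv τ hτ]
      exact this
    have hF1x : ∀ τ, 0 ≤ τ → (T.F1 (X τ).toNNReal).toReal = g1 (X τ) := by
      intro τ hτ
      have e := Real.coe_toNNReal _ (hx.contValue_nonneg hr τ)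
      have := hE.eq1 (X τ).toNNReal (by rw [e]; exact hE.lt_value τ hτ)
        (by rw [← NNReal.coe_lt_coe, e]; exact (hXup τ hτ).trans_lt hX0)
      rw [e] at this
      exact this.2
    have hF0 : ∀ᵐ t ∂timeMeasure, T.F0 (min (y t) T.u0) ≠ ⊥ ∧
        (T.F0 (min (y t) T.u0)).toReal - (T.F0 (m.flow t)).toReal =
          g0 (m.flow t + ε * (ζ t / weight r t)) - g0 (m.flow t) := by
      filter_upwards [hyr, hgood] with t h1 ⟨h0, hXt, hxu, hb⟩
      have hmin : min (m.flow t) T.u0 = m.flow t := min_eq_left (by exact_mod_cast hxu)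
      have hlx : l < m.flow t := (hE.lt_value t h0).trans_le hXt
      have h3 := hE.eq0 (m.flow t) hlx
      rw [hmin] at h3
      by_cases ht : t ∈ Icc 0 S
      · have hbd := abs_le.1 (hstep ε hε hε' _ (hq t))
        have h2 := hE.eq0 (y t) (by rw [h1]; have := hXlow t ht.1 ht.2; linarith)
        rw [h2.2, h3.2, h1]
        exact ⟨h2.1, rfl⟩
      · have e : y t = m.flow t := by
          rw [← NNReal.coe_inj, h1, hζS t ht]; simp
        rw [e, hmin, hζS t ht]
        exact ⟨hb, by simp⟩
    have hwD : (fun t => weight r t * ((T.F0 (min (y t) T.u0)).toReal -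
        (T.F0 (m.flow t)).toReal)) =ᵐ[timeMeasure] fun t => ε * (weight r t *
          ((g0 (m.flow t + ε * (ζ t / weight r t)) - g0 (m.flow t)) / ε)) := by
      filter_upwards [hF0] with t ht
      rw [ht.2]; field_simp
    have hmeas0 : AEStronglyMeasurable (fun t => weight r t * ((T.F0 (min (y t) T.u0)).toReal -
        (T.F0 (m.flow t)).toReal)) timeMeasure := by
      refine AEMeasurable.aestronglyMeasurable
        ((continuous_weight r).measurable.aemeasurable.mul (AEMeasurable.sub ?_ ?_))
      · exact (T.measurable_F0.comp_aemeasurable (hyb.meas.min aemeasurable_const)).ereal_toReal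
      · exact (T.measurable_F0.comp_aemeasurable hx.meas).ereal_toReal
    have hi0 : Integrable (fun t => weight r t * ((T.F0 (min (y t) T.u0)).toReal -
        (T.F0 (m.flow t)).toReal)) timeMeasure := by
      have hind : Integrable ((Icc 0 S).indicator fun _ => K0 * K) timeMeasure := by
        rw [integrable_indicator_iff measurableSet_Icc, timeMeasure, IntegrableOn,
          Measure.restrict_restrict measurableSet_Icc, inter_eq_self_of_subset_left Icc_subset_Ici_self]
        exact integrable_const _
      refine Integrable.mono' (hind.const_mul ε) hmeas0 ?_
      filter_upwards [hwD, hbd0 ε hε hε'] with t h1 h2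
      rw [h1, Real.norm_eq_abs, abs_mul, abs_of_pos hε]
      exact mul_le_mul_of_nonneg_left h2 hε.le
    have hD1e : (fun τ => Real.exp (-r * τ) * ((T.F1 (contValue r y τ).toNNReal).toReal -
        (T.F1 (X τ).toNNReal).toReal)) =ᵐ[G] fun τ => ε * D1 ε τ := by
      filter_upwards [hG.ae_nonneg] with τ hτ
      rw [(hF1y τ hτ).2, hF1x τ hτ]
      simp only [hD1]
      field_simp
    have hmeas1 : AEStronglyMeasurable (fun τ => Real.exp (-r * τ) *
        ((T.F1 (contValue r y τ).toNNReal).toReal - (T.F1 (X τ).toNNReal).toReal)) G := by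
      refine Measurable.aestronglyMeasurable (Measurable.mul (by fun_prop) (Measurable.sub ?_ ?_))
      · exact (T.measurable_F1.comp
          (hyb.continuous_contValue hr).measurable.real_toNNReal).ereal_toReal
      · exact (T.measurable_F1.comp
          (hx.continuous_contValue hr).measurable.real_toNNReal).ereal_toReal
    have hi1 : Integrable (fun τ => Real.exp (-r * τ) *
        ((T.F1 (contValue r y τ).toNNReal).toReal - (T.F1 (X τ).toNNReal).toReal)) G := by
      refine Integrable.mono' (integrable_const (ε * (K1 * (K * S)))) hmeas1 ?_
      filter_upwards [hD1e, hG.ae_nonneg] with τ h1 h2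
      rw [h1, Real.norm_eq_abs, abs_mul, abs_of_pos hε]
      exact mul_le_mul_of_nonneg_left (hbd1 ε hε hε' τ h2) hε.le
    have hg := h.gain_nonpos hr hG hsupp hyb (hF0.mono fun t ht => ht.1)
      (fun τ hτ => (hF1y τ hτ).1) hi0 hi1
    have e0 : (fun t => weight r t * ((T.F0 (min (y t) T.u0)).toReal -
        (T.F0 (m.flow t)).toReal) * tail G t) =ᵐ[timeMeasure] fun t => ε * D0 ε t := by
      filter_upwards [hwD] with t ht
      rw [ht]; simp only [hD0]; ring
    rw [integral_congr_ae e0, integral_congr_ae hD1e, integral_const_mul, integral_const_mul,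
      ← mul_add] at hg
    refine ⟨?_, ?_, nonpos_of_mul_nonpos_right hg hε⟩
    · refine ((hmeas0.mul (antitone_tail (G := G)).measurable.aestronglyMeasurable).const_mul ε⁻¹).congr ?_
      filter_upwards [e0] with t ht
      simp only [Pi.mul_apply]
      rw [ht]; field_simp
    · refine (hmeas1.const_mul ε⁻¹).congr ?_
      filter_upwards [hD1e] with t ht
      rw [ht]; field_simp
  have hev : ∀ᶠ ε in 𝓝[>] (0 : ℝ), 0 < ε ∧ ε ≤ ρ / N := by
    have : Ioc 0 (ρ / N) ∈ 𝓝[>] (0 : ℝ) := Ioc_mem_nhdsGT (by positivity)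
    exact this
  have hlim0 : Tendsto (fun ε => ∫ t, D0 ε t ∂timeMeasure) (𝓝[>] 0)
      (𝓝 (∫ t, dirSlope g0 (m.flow t) (ζ t) * tail G t ∂timeMeasure)) := by
    refine tendsto_integral_filter_of_dominated_convergence ((Icc 0 S).indicator fun _ => K0 * K)
      ?_ ?_ ?_ ?_
    · filter_upwards [hev] with ε hε using (hdev ε hε.1 hε.2).1
    · filter_upwards [hev] with ε hε
      filter_upwards [hbd0 ε hε.1 hε.2] with t ht
      simp only [hD0]
      rw [norm_mul, Real.norm_eq_abs, Real.norm_of_nonneg (tail_nonneg G t)]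
      exact (mul_le_of_le_one_right (abs_nonneg _) (tail_le_one t)).trans ht
    · rw [integrable_indicator_iff measurableSet_Icc, timeMeasure, IntegrableOn,
        Measure.restrict_restrict measurableSet_Icc, inter_eq_self_of_subset_left Icc_subset_Ici_self]
      exact integrable_const _
    · filter_upwards [hgood] with t ⟨h0, hXt, _, _⟩
      have hw := weight_pos hr t
      have hmem : (m.flow t : ℝ) ∈ interior (Ioi l) := by
        rw [interior_Ioi]; exact (hE.lt_value t h0).trans_le hXt
      have := (hE.concave0.tendsto_dirSlope hmem (ζ t / weight r t)).const_mul (weight r t)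
      rw [← dirSlope_mul hw, mul_div_cancel₀ _ hw.ne'] at this
      exact this.mul_const _
  have hlim1 : Tendsto (fun ε => ∫ τ, D1 ε τ ∂G) (𝓝[>] 0)
      (𝓝 (∫ τ, dirSlope g1 (X τ) (Z τ) ∂G)) := by
    refine tendsto_integral_filter_of_dominated_convergence (fun _ => K1 * (K * S)) ?_ ?_
      (integrable_const _) ?_
    · filter_upwards [hev] with ε hε using (hdev ε hε.1 hε.2).2.1
    · filter_upwards [hev] with ε hε
      filter_upwards [hG.ae_nonneg] with τ hτ
      exact hbd1 ε hε.1 hε.2 τ hτ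
    · filter_upwards [hG.ae_nonneg] with τ hτ
      have he := Real.exp_pos (-r * τ)
      have hmem : X τ ∈ interior (Ioo l T.u0) := by
        rw [interior_Ioo]; exact ⟨hE.lt_value τ hτ, (hXup τ hτ).trans_lt hX0⟩
      have := (hE.concave1.tendsto_dirSlope hmem (Real.exp (r * τ) * Z τ)).const_mul
        (Real.exp (-r * τ))
      rw [← dirSlope_mul he, ← mul_assoc, mul_comm (Real.exp (-r * τ)), exp_mul_exp_neg,
        one_mul] at this
      exact this
  refine le_of_tendsto (hlim0.add hlim1) ?_
  filter_upwards [hev] with ε hε using (hdev ε hε.1 hε.2).2.2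

end FirstOrder

/-! ### Needle variations -/

section Window

/-- The unit mass spread uniformly over `(t, t + h]`. -/
noncomputable def window (t h : ℝ) : ℝ → ℝ := (Ioc t (t + h)).indicator fun _ => h⁻¹

/-- The mass of `window t h` to the right of `τ`. -/
noncomputable def windowMass (t h τ : ℝ) : ℝ := ∫ u in Ioi τ, window t h u

variable {s t h τ : ℝ}

theorem measurable_window : Measurable (window t h) :=
  measurable_const.indicator measurableSet_Ioc

theorem window_nonneg (hh : 0 < h) (u : ℝ) : 0 ≤ window t h u :=
  indicator_nonneg (fun _ _ => by positivity) _

theorem window_le (hh : 0 < h) (u : ℝ) : window t h u ≤ h⁻¹ :=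
  indicator_le_self' (fun _ _ => by positivity) _

theorem integrable_window : Integrable (window t h) := by
  rw [window, integrable_indicator_iff measurableSet_Ioc]
  exact integrableOn_const measure_Ioc_lt_top.ne

theorem windowMass_eq : windowMass t h τ = max (t + h - max τ t) 0 / h := by
  rw [windowMass, window, setIntegral_indicator measurableSet_Ioc, setIntegral_const, smul_eq_mul,
    ← div_eq_mul_inv, inter_comm, Ioc_inter_Ioi, Real.volume_real_Ioc, max_comm t τ]

theorem windowMass_of_le (hh : 0 < h) (hτ : τ ≤ t) : windowMass t h τ = 1 := by
  rw [windowMass_eq, max_eq_right hτ, add_sub_cancel_left, max_eq_left hh.le, div_self hh.ne']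

theorem windowMass_of_ge (hh : 0 < h) (hτ : t + h ≤ τ) : windowMass t h τ = 0 := by
  rw [windowMass_eq, max_eq_left (by linarith : t ≤ τ), max_eq_right (by linarith), zero_div]

theorem windowMass_nonneg (hh : 0 < h) : 0 ≤ windowMass t h τ := by
  rw [windowMass_eq]; positivity

theorem windowMass_le_one (hh : 0 < h) : windowMass t h τ ≤ 1 := by
  rw [windowMass_eq, div_le_one hh]
  refine max_le ?_ hh.le
  linarith [le_max_right τ t]

/-- Moving mass between disjoint windows thus changes all continuation values in the same direction,
and only one of the two one-sided slopes of `F1` is involved. -/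
theorem windowMass_mono (hh : 0 < h) (hst : s + h ≤ t) : windowMass s h τ ≤ windowMass t h τ := by
  rcases le_or_gt τ t with hτ | hτ
  · rw [windowMass_of_le hh hτ]; exact windowMass_le_one hh
  · rw [windowMass_of_ge hh (hst.trans hτ.le)]; exact windowMass_nonneg hh

theorem measurable_windowMass : Measurable (windowMass t h) := by
  have : windowMass t h = fun τ => max (t + h - max τ t) 0 / h := funext fun τ => windowMass_eq
  rw [this]
  fun_prop

theorem tendsto_windowMass (t τ : ℝ) :
    Tendsto (fun h => windowMass t h τ) (𝓝[>] 0) (𝓝 ((Iic t).indicator (fun _ => 1) τ)) := by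
  rcases le_or_gt τ t with hτ | hτ
  · rw [indicator_of_mem (mem_Iic.2 hτ)]
    refine tendsto_const_nhds.congr' ?_
    filter_upwards [self_mem_nhdsWithin] with h hh
    rw [windowMass_of_le hh hτ]
  · rw [indicator_of_notMem (by simpa using hτ)]
    refine tendsto_const_nhds.congr' ?_
    filter_upwards [self_mem_nhdsWithin, mem_nhdsWithin_of_mem_nhds (Iio_mem_nhds (sub_pos.2 hτ))]
      with h hh hlt
    rw [windowMass_of_ge hh (by have := mem_Iio.1 hlt; linarith)]

theorem tendsto_window_average {a : ℝ → ℝ} (ha : LocallyIntegrable a)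
    (ht : HasDerivAt (fun t => ∫ u in 0..t, a u) (a t) t) :
    Tendsto (fun h => ∫ u, window t h u * a u) (𝓝[>] 0) (𝓝 (a t)) := by
  refine ht.tendsto_slope_zero_right.congr' ?_
  filter_upwards [self_mem_nhdsWithin] with h hh
  have hh : 0 < h := hh
  have hi : ∀ a' b', IntervalIntegrable a volume a' b' := fun a' b' =>
    intervalIntegrable_iff.2
      ((ha.integrableOn_isCompact isCompact_uIcc).mono_set uIoc_subset_uIcc)
  rw [intervalIntegral.integral_interval_sub_left (hi _ _) (hi _ _),
    intervalIntegral.integral_of_le (by linarith), smul_eq_mul, ← integral_const_mul,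
    ← integral_indicator measurableSet_Ioc]
  congr 1
  funext u
  simp only [window, indicator]
  split_ifs <;> simp

end Window

/-! ### First-order conditions for shifting flow between two dates -/

section Pairs

variable {T : Technology} {r l : ℝ} {m : Mechanism} {G : Measure ℝ} {g0 g1 : ℝ → ℝ}

/-- On a bounded set of times the flow lies between the continuation value at the last of them and
`u0`, where the monotone slope is bounded. -/
theorem locallyIntegrable_slope_tail (hr : 0 < r) [IsProbabilityMeasure G] (hreg : Regular T r m)
    (hl : ∀ t, 0 ≤ t → l < contValue r m.flow t) {σ : ℝ → ℝ} (hσ : AntitoneOn σ (Ioi l)) :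
    LocallyIntegrable ((Ici 0).indicator fun t => σ (m.flow t) * tail G t) := by
  have hx := hreg.bddFlow hr
  have hanti := hreg.antitoneOn_contValue hr
  rw [locallyIntegrable_iff]
  intro k hk
  obtain ⟨S, hS⟩ := hk.bddAbove
  set S' := max S 0 with hS'
  set w := contValue r m.flow S' with hw
  have hlw : l < w := hl S' (le_max_right _ _)
  -- Truncation at `w` changes nothing at the relevant flows and makes the slope antitone on the
  -- whole line, hence measurable.
  have hanti' : Antitone fun u => σ (max u w) := fun u v huv =>
    hσ (hlw.trans_le (le_max_right _ _)) (hlw.trans_le (le_max_right _ _)) (max_le_max_right _ huv)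
  have hae : ∀ᵐ t ∂volume, t ∈ k → 0 ≤ t → w ≤ m.flow t ∧ m.flow t ≤ T.u0 := by
    have h1 := hreg.contValue_le_flow hr
    have h2 := hx.le
    rw [timeMeasure, ae_restrict_iff' measurableSet_Ici] at h1 h2
    filter_upwards [h1, h2] with t h1 h2 htk ht
    exact ⟨(hanti ht (le_max_right S 0) ((hS htk).trans (le_max_left _ _))).trans (h1 ht), h2 ht⟩
  set b : ℝ → ℝ := (Ici 0).indicator fun t => σ (max (m.flow t) w) * tail G t with hb
  have hbm : AEStronglyMeasurable b volume := by
    rw [hb, aestronglyMeasurable_indicator_iff measurableSet_Ici]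
    refine AEMeasurable.aestronglyMeasurable ?_
    exact (hanti'.measurable.comp_aemeasurable hx.meas.coe_nnreal_real).mul
      (antitone_tail (G := G)).measurable.aemeasurable
  have hbb : ∀ᵐ t ∂volume.restrict k, ‖b t‖ ≤ |σ w| + |σ (max T.u0 w)| := by
    rw [ae_restrict_iff' hk.measurableSet]
    filter_upwards [hae] with t ht htk
    rw [hb]
    by_cases h0 : t ∈ Ici (0 : ℝ)
    · rw [indicator_of_mem h0, norm_mul, Real.norm_eq_abs, Real.norm_eq_abs,
        abs_of_nonneg (tail_nonneg G t)]
      obtain ⟨h1, h2⟩ := ht htk h0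
      have u1 : σ (max (m.flow t) w) ≤ σ w := by
        rw [← max_self w]
        conv_lhs => rw [max_self w]
        exact hanti' h1
      have u2 : σ (max T.u0 w) ≤ σ (max (m.flow t) w) := hanti' (by exact_mod_cast h2)
      refine (mul_le_of_le_one_right (abs_nonneg _) (tail_le_one t)).trans ?_
      rw [abs_le]
      constructor
      · linarith [neg_abs_le (σ (max T.u0 w)), abs_nonneg (σ w)]
      · linarith [le_abs_self (σ w), abs_nonneg (σ (max T.u0 w))]
    · rw [indicator_of_notMem h0, norm_zero]; positivity
  have hbi : IntegrableOn b k :=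
    ⟨hbm.restrict, HasFiniteIntegral.restrict_of_bounded _ hk.measure_lt_top hbb⟩
  refine hbi.congr_fun_ae ?_
  rw [EventuallyEq, ae_restrict_iff' hk.measurableSet]
  filter_upwards [hae] with t ht htk
  rw [hb]
  by_cases h0 : t ∈ Ici (0 : ℝ)
  · rw [indicator_of_mem h0, indicator_of_mem h0, max_eq_left (ht htk h0).1]
  · rw [indicator_of_notMem h0, indicator_of_notMem h0]

theorem monotone_slope_value (hX : AntitoneOn (contValue r m.flow) (Ici 0))
    (hX0 : contValue r m.flow 0 < T.u0) (hl : ∀ t, 0 ≤ t → l < contValue r m.flow t) {σ : ℝ → ℝ}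
    (hσ : AntitoneOn σ (Ioo l T.u0)) : Monotone fun τ => σ (contValue r m.flow (max τ 0)) := by
  have hm : ∀ τ, contValue r m.flow (max τ 0) ∈ Ioo l (T.u0 : ℝ) := fun τ =>
    ⟨hl _ (le_max_right _ _), (hX (mem_Ici.2 le_rfl) (mem_Ici.2 (le_max_right τ 0))
      (le_max_right τ 0)).trans_lt hX0⟩
  intro a b hab
  exact hσ (hm b) (hm a) (hX (mem_Ici.2 (le_max_right _ _)) (mem_Ici.2 (le_max_right _ _))
    (max_le_max_right _ hab))

theorem _root_.Monotone.integrableOn_Iic_of_le [IsFiniteMeasure G] {c : ℝ → ℝ}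
    (hc : Monotone c) (h0 : ∀ τ, c 0 ≤ c τ) (t : ℝ) : IntegrableOn c (Iic t) G := by
  refine ⟨hc.measurable.aestronglyMeasurable.restrict, ?_⟩
  refine HasFiniteIntegral.restrict_of_bounded (|c 0| + |c t|) (measure_lt_top _ _) ?_
  rw [ae_restrict_iff' measurableSet_Iic]
  refine ae_of_all _ fun τ hτ => ?_
  have h1 := h0 τ
  have h2 := hc (mem_Iic.1 hτ)
  rw [Real.norm_eq_abs, abs_le]
  constructor
  · linarith [neg_abs_le (c 0), abs_nonneg (c t)]
  · linarith [le_abs_self (c t), abs_nonneg (c 0)]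

/-- The effect on the payoff of moving mass `β` of the flow at `s` and mass `α` to the flow at
`t`. -/
theorem Optimal.needle (hr : 0 < r) (hG : IsTimeDistribution G) (hsupp : ¬ BddAbove G.support)
    (h : Optimal T r G m) (hE : Extension T r m l g0 g1) {e : ℝ → ℝ}
    (he : ∀ t, IntegrableOn e (Iic t) G) {α β s t : ℝ} (hα : 0 ≤ α) (hβ : 0 ≤ β) (hs : 0 ≤ s)
    (ht : 0 ≤ t) (hX : β = 0 ∨ 0 < contValue r m.flow s)
    (hst : α = 0 ∨ β = 0 ∨ s ≠ t)
    (hdir : ∀ᶠ h in 𝓝[>] 0, ∀ τ, 0 ≤ τ → dirSlope g1 (contValue r m.flow τ)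
      (α * windowMass t h τ - β * windowMass s h τ) =
        e τ * (α * windowMass t h τ - β * windowMass s h τ))
    {a b : ℝ → ℝ} (ha : a = (Ici 0).indicator fun t => rightSlope g0 (m.flow t) * tail G t)
    (hb : b = (Ici 0).indicator fun t => leftSlope g0 (m.flow t) * tail G t)
    (hat : HasDerivAt (fun t => ∫ u in 0..t, a u) (a t) t)
    (hbs : HasDerivAt (fun t => ∫ u in 0..t, b u) (b s) s) :
    α * a t - β * b s + (α * ∫ τ in Iic t, e τ ∂G - β * ∫ τ in Iic s, e τ ∂G) ≤ 0 := by
  have := hG.isProbabilityMeasure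
  have hreg := h.regular hr hG hsupp
  have hx := hreg.bddFlow hr
  have hcont := hx.continuous_contValue hr
  have hl : ∀ t, 0 ≤ t → l < contValue r m.flow t := hE.lt_value
  have hai : LocallyIntegrable a := ha ▸ locallyIntegrable_slope_tail hr hreg hl
    (by simpa using hE.concave0.antitoneOn_rightSlope)
  have hbi : LocallyIntegrable b := hb ▸ locallyIntegrable_slope_tail hr hreg hl
    (by simpa using hE.concave0.antitoneOn_leftSlope)
  -- the limit of the first-order condition
  have hlim1 : Tendsto (fun h => α * (∫ u, window t h u * a u) - β * (∫ u, window s h u * b u))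
      (𝓝[>] 0) (𝓝 (α * a t - β * b s)) :=
    ((tendsto_window_average hai hat).const_mul α).sub
      ((tendsto_window_average hbi hbs).const_mul β)
  have hind : ∀ t, ∫ τ in Iic t, e τ ∂G = ∫ τ, (Iic t).indicator e τ ∂G := fun t =>
    (integral_indicator measurableSet_Iic).symm
  have hii : ∀ t, Integrable ((Iic t).indicator e) G := fun t =>
    (he t).integrable_indicator measurableSet_Iic
  set S := max s t + 1 with hS
  have hSs : s + 1 ≤ S := by linarith [le_max_left s t]
  have hSt : t + 1 ≤ S := by linarith [le_max_right s t]
  have hlim2 : Tendsto (fun h => ∫ τ, e τ * (α * windowMass t h τ - β * windowMass s h τ) ∂G)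
      (𝓝[>] 0) (𝓝 (α * ∫ τ in Iic t, e τ ∂G - β * ∫ τ in Iic s, e τ ∂G)) := by
    have e2 : α * ∫ τ in Iic t, e τ ∂G - β * ∫ τ in Iic s, e τ ∂G =
        ∫ τ, e τ * (α * (Iic t).indicator (fun _ => (1 : ℝ)) τ -
          β * (Iic s).indicator (fun _ => (1 : ℝ)) τ) ∂G := by
      rw [hind, hind, ← integral_const_mul, ← integral_const_mul,
        ← integral_sub ((hii t).const_mul α) ((hii s).const_mul β)]
      congr 1
      funext τ
      simp only [indicator]
      split_ifs <;> ring
    rw [e2]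
    have hmeas : ∀ h, 0 < h → AEStronglyMeasurable
        (fun τ => e τ * (α * windowMass t h τ - β * windowMass s h τ)) G := by
      intro h hh
      have : (fun τ => e τ * (α * windowMass t h τ - β * windowMass s h τ)) =
          fun τ => (Iic (max s t + h)).indicator e τ *
            (α * windowMass t h τ - β * windowMass s h τ) := by
        funext τ
        by_cases hτ : τ ∈ Iic (max s t + h)
        · rw [indicator_of_mem hτ]
        · have hτ' : max s t + h < τ := by simpa using hτ
          rw [indicator_of_notMem hτ, windowMass_of_ge hh (by linarith [le_max_left s t]),
            windowMass_of_ge hh (by linarith [le_max_right s t])]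
          ring
      rw [this]
      refine (hii _).aestronglyMeasurable.mul (Measurable.aestronglyMeasurable ?_)
      exact ((measurable_windowMass).const_mul α).sub ((measurable_windowMass).const_mul β)
    refine tendsto_integral_filter_of_dominated_convergence
      (fun τ => (α + β) * ‖(Iic S).indicator e τ‖) ?_ ?_ ((hii S).norm.const_mul _) ?_
    · filter_upwards [self_mem_nhdsWithin] with h hh using hmeas h hh
    · filter_upwards [self_mem_nhdsWithin, mem_nhdsWithin_of_mem_nhds (Iio_mem_nhds zero_lt_one)]
        with h hh hh1
      have hh : 0 < h := hh
      have hh1 : h < 1 := hh1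
      refine ae_of_all _ fun τ => ?_
      by_cases hτ : τ ∈ Iic S
      · rw [indicator_of_mem hτ, norm_mul, mul_comm]
        refine mul_le_mul_of_nonneg_right ?_ (norm_nonneg _)
        rw [Real.norm_eq_abs, abs_le]
        have := windowMass_nonneg (t := t) (τ := τ) hh
        have := windowMass_nonneg (t := s) (τ := τ) hh
        have := windowMass_le_one (t := t) (τ := τ) hh
        have := windowMass_le_one (t := s) (τ := τ) hh
        constructor <;> nlinarith
      · have hτ' : S < τ := by simpa using hτ
        rw [indicator_of_notMem hτ, windowMass_of_ge hh (by linarith),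
          windowMass_of_ge hh (by linarith)]
        simp
    · refine ae_of_all _ fun τ => ?_
      exact (((tendsto_windowMass t τ).const_mul α).sub
        ((tendsto_windowMass s τ).const_mul β)).const_mul (e τ)
  refine le_of_tendsto (hlim1.add hlim2) ?_
  -- The value remains positive for a while after `s`. Being decreasing, it is at least its value at
  -- `s + h0` throughout the window, which serves as `δ` in `Optimal.first_order`.
  have hXs : ∃ h0, 0 < h0 ∧ (β = 0 ∨ 0 < contValue r m.flow (s + h0)) := by
    rcases hX with hX | hX
    · exact ⟨1, one_pos, Or.inl hX⟩
    · have hc : Tendsto (fun h => contValue r m.flow (s + h)) (𝓝[>] 0) (𝓝 (contValue r m.flow s)) := by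
        have : ContinuousAt (fun h => contValue r m.flow (s + h)) 0 := by fun_prop
        have := this.tendsto
        simp only [add_zero] at this
        exact this.mono_left nhdsWithin_le_nhds
      obtain ⟨h0, h1, h2⟩ := ((hc.eventually_const_lt hX).and self_mem_nhdsWithin).exists
      exact ⟨h0, h2, Or.inr h1⟩
  obtain ⟨h0, hh0, hXs⟩ := hXs
  -- For small `h` the windows do not overlap, so the perturbation has one sign at each time: right
  -- slopes apply near `t`, left slopes near `s`.
  have hdisj : ∀ᶠ h in 𝓝[>] (0 : ℝ), ∀ u, u ∈ Ioc t (t + h) → u ∈ Ioc s (s + h) → α = 0 ∨ β = 0 := by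
    rcases hst with hst | hst | hst
    · exact Eventually.of_forall fun _ _ _ _ => Or.inl hst
    · exact Eventually.of_forall fun _ _ _ _ => Or.inr hst
    · filter_upwards [mem_nhdsWithin_of_mem_nhds (Iio_mem_nhds (abs_pos.2 (sub_ne_zero.2 hst)))]
        with h hh u h1 h2
      exfalso
      have hh : h < |s - t| := hh
      rcases lt_abs.1 hh with hh | hh
      · linarith [h1.2, h2.1]
      · linarith [h1.1, h2.2]
  filter_upwards [self_mem_nhdsWithin, hdir, hdisj,
    mem_nhdsWithin_of_mem_nhds (Iio_mem_nhds zero_lt_one),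
    mem_nhdsWithin_of_mem_nhds (Iio_mem_nhds hh0)] with h' hh hdir hdisj hh1 hh2
  have hh : 0 < h' := hh
  have hh1 : h' < 1 := hh1
  have hh2 : h' < h0 := hh2
  set ζ : ℝ → ℝ := fun u => α * window t h' u - β * window s h' u with hζ
  have hinv : 0 < h'⁻¹ := inv_pos.2 hh
  have hζb : ∀ u, |ζ u| ≤ (α + β) * h'⁻¹ := by
    intro u
    have := window_nonneg (t := t) hh u
    have := window_nonneg (t := s) hh u
    have := window_le (t := t) hh u
    have := window_le (t := s) hh u
    rw [abs_le, hζ]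
    constructor <;> nlinarith
  have hw0 : ∀ {t u : ℝ}, u ∉ Ioc t (t + h') → window t h' u = 0 := fun hu => indicator_of_notMem hu _
  have hw1 : ∀ {t u : ℝ}, u ∈ Ioc t (t + h') → window t h' u = h'⁻¹ := fun hu => indicator_of_mem hu _
  have hζS : ∀ u, u ∉ Icc 0 S → ζ u = 0 := by
    intro u hu
    have h1 : u ∉ Ioc t (t + h') := fun h1 => hu ⟨ht.trans h1.1.le, by linarith [h1.2]⟩
    have h2 : u ∉ Ioc s (s + h') := fun h1 => hu ⟨hs.trans h1.1.le, by linarith [h1.2]⟩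
    simp only [hζ, hw0 h1, hw0 h2, mul_zero, sub_zero]
  have hfirst := h.first_order hr hG hsupp hE (ζ := ζ) (K := (α + β) * h'⁻¹) (S := S)
    (δ := if β = 0 then 1 else contValue r m.flow (s + h0))
    ((measurable_window.const_mul α).sub (measurable_window.const_mul β)) (by linarith) hζb hζS
    (by
      split_ifs with hβ0
      · exact one_pos
      · exact hXs.resolve_left hβ0)
    (by
      intro u hu hneg
      have hus : u ∈ Ioc s (s + h') := by
        by_contra hus
        simp only [hζ, hw0 hus, mul_zero, sub_zero] at hneg
        exact absurd hneg (not_lt.2 (mul_nonneg hα (window_nonneg hh u)))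
      have hβ0 : β ≠ 0 := by
        rintro rfl
        simp only [hζ, zero_mul, sub_zero] at hneg
        exact absurd hneg (not_lt.2 (mul_nonneg hα (window_nonneg hh u)))
      rw [if_neg hβ0]
      exact hreg.antitoneOn_contValue hr hu (mem_Ici.2 (by linarith)) (by linarith [hus.2]))
  refine le_trans (le_of_eq ?_) hfirst
  congr 1
  · have hwa : ∀ (t : ℝ) (a : ℝ → ℝ), LocallyIntegrable a → Integrable fun u => window t h' u * a u := by
      intro t a ha
      have : (fun u => window t h' u * a u) = (Ioc t (t + h')).indicator fun u => h'⁻¹ * a u := by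
        funext u
        simp only [window, indicator]
        split_ifs <;> simp
      rw [this, integrable_indicator_iff measurableSet_Ioc]
      exact ((ha.integrableOn_isCompact isCompact_Icc).mono_set Ioc_subset_Icc_self).const_mul _
    rw [← integral_const_mul, ← integral_const_mul,
      ← integral_sub ((hwa t a hai).const_mul α) ((hwa s b hbi).const_mul β), timeMeasure,
      ← integral_indicator measurableSet_Ici]
    congr 1
    funext u
    rw [ha, hb]
    by_cases hu : u ∈ Ici (0 : ℝ)
    · rw [indicator_of_mem hu, indicator_of_mem hu, indicator_of_mem hu]
      have hαz : 0 ≤ α * h'⁻¹ := by positivity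
      by_cases h1 : u ∈ Ioc t (t + h') <;> by_cases h2 : u ∈ Ioc s (s + h')
      · rcases hdisj u h1 h2 with rfl | rfl
        · simp only [hζ, hw1 h1, hw1 h2]
          rcases hβ.eq_or_lt with rfl | hβ
          · simp [dirSlope_zero]
          · rw [dirSlope, if_neg (by rw [not_le]; nlinarith [mul_pos hβ hinv])]
            ring
        · simp only [hζ, hw1 h1, hw1 h2]
          rw [dirSlope, if_pos (by linarith)]
          ring
      · simp only [hζ, hw1 h1, hw0 h2]
        rw [dirSlope, if_pos (by linarith)]
        ring
      · simp only [hζ, hw0 h1, hw1 h2]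
        rcases hβ.eq_or_lt with rfl | hβ
        · simp [dirSlope_zero]
        · rw [dirSlope, if_neg (by rw [not_le]; nlinarith [mul_pos hβ hinv])]
          ring
      · simp only [hζ, hw0 h1, hw0 h2]
        simp [dirSlope_zero]
    · rw [indicator_of_notMem hu, indicator_of_notMem hu, indicator_of_notMem hu]
      ring
  · refine integral_congr_ae ?_
    filter_upwards [hG.ae_nonneg] with τ hτ
    rw [← hdir τ hτ]
    congr 1
    rw [hζ, integral_sub (integrable_window.integrableOn.const_mul α)
      (integrable_window.integrableOn.const_mul β), integral_const_mul, integral_const_mul]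
    rfl

end Pairs

/-! ### From first-order conditions to the Euler equation -/

section Euler

variable {T : Technology} {r l : ℝ} {m : Mechanism} {G : Measure ℝ} {g0 g1 : ℝ → ℝ}

/-- Slope `σ` of the old frontier at the flow, weighted by the probability that the breakthrough is
still to come. -/
noncomputable def flowSlope (σ : ℝ → ℝ) (G : Measure ℝ) (m : Mechanism) : ℝ → ℝ :=
  (Ici 0).indicator fun t => σ (m.flow t) * tail G t

/-- Slope `σ` of the new frontier at the continuation value. -/
noncomputable def valueSlope (σ : ℝ → ℝ) (r : ℝ) (m : Mechanism) (τ : ℝ) : ℝ :=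
  σ (contValue r m.flow (max τ 0))

theorem flowSlope_of_nonneg {σ : ℝ → ℝ} {t : ℝ} (ht : 0 ≤ t) :
    flowSlope σ G m t = σ (m.flow t) * tail G t := indicator_of_mem (mem_Ici.2 ht) _

theorem flowSlope_of_neg {σ : ℝ → ℝ} {t : ℝ} (ht : t < 0) : flowSlope σ G m t = 0 :=
  indicator_of_notMem (by simpa using ht) _

theorem valueSlope_of_nonneg {σ : ℝ → ℝ} {t : ℝ} (ht : 0 ≤ t) :
    valueSlope σ r m t = σ (contValue r m.flow t) := by rw [valueSlope, max_eq_left ht]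

theorem IsTimeDistribution.setIntegral_Ioc (hG : IsTimeDistribution G) {s : ℝ} (hs : s < 0) (t : ℝ)
    (f : ℝ → ℝ) : ∫ τ in Ioc s t, f τ ∂G = ∫ τ in Iic t, f τ ∂G := by
  refine setIntegral_congr_set ?_
  filter_upwards [hG.ae_nonneg] with τ hτ
  have : τ ∈ Ioc s t ↔ τ ∈ Iic t := ⟨fun h => h.2, fun h => ⟨hs.trans_le hτ, h⟩⟩
  exact propext this

theorem IsTimeDistribution.setIntegral_Icc (hG : IsTimeDistribution G) (t : ℝ) (f : ℝ → ℝ) :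
    ∫ τ in Icc 0 t, f τ ∂G = ∫ τ in Iic t, f τ ∂G := by
  refine setIntegral_congr_set ?_
  filter_upwards [hG.ae_nonneg] with τ hτ
  have : τ ∈ Icc 0 t ↔ τ ∈ Iic t := ⟨fun h => h.2, fun h => ⟨hτ, h⟩⟩
  exact propext this

theorem exists_mem_Ioo_of_ae_timeMeasure {p : ℝ → Prop} (h : ∀ᵐ t ∂timeMeasure, p t) {t u : ℝ}
    (ht : 0 ≤ t) (htu : t < u) : ∃ s ∈ Ioo t u, p s := by
  by_contra! hcon
  have h0 : volume (Ioo t u) = 0 := by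
    rw [timeMeasure, ae_restrict_iff' measurableSet_Ici, ae_iff] at h
    refine measure_mono_null (fun s hs => ?_) h
    simp only [mem_ofPred_eq, Classical.not_imp]
    exact ⟨ht.trans hs.1.le, hcon s hs⟩
  rw [Real.volume_Ioo, ENNReal.ofReal_eq_zero] at h0
  linarith

/-- The first-order conditions at pairs of times, together with their counterparts at times where
the continuation value vanishes, yield the Euler equation. -/
theorem Optimal.exists_realEuler_of_extension (hr : 0 < r) (hG : IsTimeDistribution G)
    (hsupp : ¬ BddAbove G.support) (h : Optimal T r G m) (hE : Extension T r m l g0 g1)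
    (hmono : MonotoneOn g0 (Ioi l)) {Q : ℝ → Prop} (hQ : ∀ᵐ t ∂timeMeasure, Q t)
    (hlow : ∀ s t, 0 ≤ s → s < t → Q s → Q t → contValue r m.flow s = 0 →
      flowSlope (rightSlope g0) G m t ≤
        flowSlope (leftSlope g0) G m s - ∫ τ in Ioc s t, valueSlope (rightSlope g1) r m τ ∂G)
    (hup : ∀ s t, s < t → 0 ≤ t → (s = -1 ∨ 0 ≤ s ∧ Q s) → Q t → contValue r m.flow t = 0 →
      flowSlope (rightSlope g0) G m s ≤
        flowSlope (leftSlope g0) G m t + ∫ τ in Ioc s t, valueSlope (leftSlope g1) r m τ ∂G) :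
    ∃ p f, RealEuler T G m p f := by
  have := hG.isProbabilityMeasure
  have hreg := h.regular hr hG hsupp
  have hx := hreg.bddFlow hr
  have hanti := hreg.antitoneOn_contValue hr
  have hX0 : contValue r m.flow 0 < T.u0 := h.contValue_lt hr hG hsupp le_rfl
  have hl : ∀ t, 0 ≤ t → l < contValue r m.flow t := hE.lt_value
  set X := contValue r m.flow with hXdef
  set a := flowSlope (rightSlope g0) G m with ha
  set b := flowSlope (leftSlope g0) G m with hb
  set c := valueSlope (rightSlope g1) r m with hc
  set d := valueSlope (leftSlope g1) r m with hd
  have hXu : ∀ t, 0 ≤ t → X t < T.u0 := fun t ht => h.contValue_lt hr hG hsupp ht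
  have hmem : ∀ τ, X (max τ 0) ∈ interior (Ioo l (T.u0 : ℝ)) := fun τ => by
    rw [interior_Ioo]
    exact ⟨hl _ (le_max_right _ _), hXu _ (le_max_right _ _)⟩
  have hcm : Monotone c := monotone_slope_value hanti hX0 hl
    (by simpa using hE.concave1.antitoneOn_rightSlope)
  have hdm : Monotone d := monotone_slope_value hanti hX0 hl
    (by simpa using hE.concave1.antitoneOn_leftSlope)
  have hc0 : ∀ τ, c 0 ≤ c τ := fun τ => by
    have : c τ = c (max τ 0) := by simp [hc, valueSlope]
    rw [this]; exact hcm (le_max_right _ _)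
  have hd0 : ∀ τ, d 0 ≤ d τ := fun τ => by
    have : d τ = d (max τ 0) := by simp [hd, valueSlope]
    rw [this]; exact hdm (le_max_right _ _)
  have hci : ∀ t, IntegrableOn c (Iic t) G := hcm.integrableOn_Iic_of_le hc0
  have hdi : ∀ t, IntegrableOn d (Iic t) G := hdm.integrableOn_Iic_of_le hd0
  have hcd : ∀ τ, c τ ≤ d τ := fun τ => hE.concave1.rightDeriv_le_leftDeriv (hmem τ)
  have hai : LocallyIntegrable a := locallyIntegrable_slope_tail hr hreg hl
    (by simpa using hE.concave0.antitoneOn_rightSlope)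
  have hbi : LocallyIntegrable b := locallyIntegrable_slope_tail hr hreg hl
    (by simpa using hE.concave0.antitoneOn_leftSlope)
  -- times at which the conditions hold
  set P : ℝ → Prop := fun t => Q t ∧ X t ≤ m.flow t ∧ m.flow t ≤ T.u0 ∧
    HasDerivAt (fun t => ∫ u in 0..t, a u) (a t) t ∧
    HasDerivAt (fun t => ∫ u in 0..t, b u) (b t) t with hP
  have hPae : ∀ᵐ t ∂timeMeasure, P t := by
    filter_upwards [hQ, hreg.contValue_le_flow hr, hx.le,
      ae_restrict_of_ae (LocallyIntegrable.ae_hasDerivAt_integral hai), ae_restrict_of_ae (LocallyIntegrable.ae_hasDerivAt_integral hbi)]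
      with t h1 h2 h3 h4 h5
    exact ⟨h1, h2, h3, h4 0, h5 0⟩
  have hab : ∀ t, 0 ≤ t → P t → a t ≤ b t := by
    intro t ht hPt
    rw [ha, hb, flowSlope_of_nonneg ht, flowSlope_of_nonneg ht]
    refine mul_le_mul_of_nonneg_right ?_ (tail_nonneg G t)
    refine hE.concave0.rightDeriv_le_leftDeriv ?_
    rw [interior_Ioi]
    exact (hl t ht).trans_le hPt.2.1
  -- The date `-1` stands for the time before the start. Both bounds vanish there, and pairs with it
  -- express the conditions for a change of flow at one date only.
  set E : Set ℝ := {t | t = -1 ∨ 0 ≤ t ∧ P t} with hEdef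
  have ha1 : a (-1) = 0 := flowSlope_of_neg (by norm_num)
  have hb1 : b (-1) = 0 := flowSlope_of_neg (by norm_num)
  have hdirc : ∀ q τ, 0 ≤ τ → 0 ≤ q → dirSlope g1 (X τ) q = c τ * q := by
    intro q τ hτ hq
    rw [dirSlope, if_pos hq, hc, valueSlope_of_nonneg hτ]
  have hdird : ∀ q τ, 0 ≤ τ → q ≤ 0 → dirSlope g1 (X τ) q = d τ * q := by
    intro q τ hτ hq
    rcases hq.eq_or_lt with rfl | hq
    · simp [dirSlope_zero]
    · rw [dirSlope, if_neg (not_le.2 hq), hd, valueSlope_of_nonneg hτ]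
  have hgap : ∀ s t : ℝ, s < t → ∀ᶠ h' in 𝓝[>] (0 : ℝ), 0 < h' ∧ s + h' ≤ t := by
    intro s t hst
    filter_upwards [self_mem_nhdsWithin, mem_nhdsWithin_of_mem_nhds (Iio_mem_nhds (sub_pos.2 hst))]
      with h' h1 h2
    exact ⟨h1, by have := mem_Iio.1 h2; linarith⟩
  -- Moving flow from `s` to the later date `t` raises the continuation values in between, hence the
  -- right slopes `c`. If the value at `s` is zero the move is infeasible, and `hlow` takes over.
  have hlow' : ∀ s ∈ E, ∀ t ∈ E, s ≤ t → a t ≤ b s - ∫ τ in Ioc s t, c τ ∂G := by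
    intro s hs t ht hst
    rcases hst.eq_or_lt with rfl | hst
    · rcases hs with rfl | ⟨h0, hPs⟩
      · simp [ha1, hb1]
      · simpa using hab s h0 hPs
    have ht' : 0 ≤ t ∧ P t := by
      rcases ht with rfl | ht
      · rcases hs with rfl | ⟨h0, -⟩
        · exact absurd hst (lt_irrefl _)
        · linarith
      · exact ht
    obtain ⟨ht0, hPt⟩ := ht'
    rcases hs with rfl | ⟨hs0, hPs⟩
    · rw [hb1, hG.setIntegral_Ioc (by norm_num)]
      have := h.needle hr hG hsupp hE hci (α := 1) (β := 0) zero_le_one le_rfl ht0 ht0 (Or.inl rfl)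
        (Or.inr (Or.inl rfl)) (by
          filter_upwards [self_mem_nhdsWithin] with h' hh τ hτ
          exact hdirc _ _ hτ (by
            have := windowMass_nonneg (t := t) (τ := τ) hh
            linarith)) (a := a) (b := b) rfl rfl hPt.2.2.2.1 hPt.2.2.2.2
      linarith
    · rcases (hx.contValue_nonneg hr s).eq_or_lt with hXs | hXs
      · exact hlow s t hs0 hst hPs.1 hPt.1 hXs.symm
      · have := h.needle hr hG hsupp hE hci (α := 1) (β := 1) zero_le_one zero_le_one hs0 ht0
          (Or.inr hXs) (Or.inr (Or.inr hst.ne)) (by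
            filter_upwards [hgap s t hst] with h' hh τ hτ
            exact hdirc _ _ hτ (by
              have := windowMass_mono (τ := τ) hh.1 hh.2
              linarith)) (a := a) (b := b) rfl rfl hPt.2.2.2.1 hPs.2.2.2.2
        have := setIntegral_Iic_sub hci hst.le
        linarith
  -- Moving flow from `t` to the earlier date `s` lowers the continuation values in between, hence
  -- the left slopes `d`.
  have hup' : ∀ s ∈ E, ∀ t ∈ E, s ≤ t → a s ≤ b t + ∫ τ in Ioc s t, d τ ∂G := by
    intro s hs t ht hst
    rcases hst.eq_or_lt with rfl | hst
    · rcases hs with rfl | ⟨h0, hPs⟩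
      · simp [ha1, hb1]
      · simpa using hab s h0 hPs
    have ht' : 0 ≤ t ∧ P t := by
      rcases ht with rfl | ht
      · rcases hs with rfl | ⟨h0, -⟩
        · exact absurd hst (lt_irrefl _)
        · linarith
      · exact ht
    obtain ⟨ht0, hPt⟩ := ht'
    rcases (hx.contValue_nonneg hr t).eq_or_lt with hXt | hXt
    · exact hup s t hst ht0 (hs.imp_right fun hs => ⟨hs.1, hs.2.1⟩) hPt.1 hXt.symm
    rcases hs with rfl | ⟨hs0, hPs⟩
    · rw [ha1, hG.setIntegral_Ioc (by norm_num)]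
      have := h.needle hr hG hsupp hE hdi (α := 0) (β := 1) le_rfl zero_le_one ht0 ht0 (Or.inr hXt)
        (Or.inl rfl) (by
          filter_upwards [self_mem_nhdsWithin] with h' hh τ hτ
          exact hdird _ _ hτ (by
            have := windowMass_nonneg (t := t) (τ := τ) hh
            linarith)) (a := a) (b := b) rfl rfl hPt.2.2.2.1 hPt.2.2.2.2
      linarith
    · have := h.needle hr hG hsupp hE hdi (α := 1) (β := 1) zero_le_one zero_le_one ht0 hs0
        (Or.inr hXt) (Or.inr (Or.inr hst.ne')) (by
          filter_upwards [hgap s t hst] with h' hh τ hτ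
          exact hdird _ _ hτ (by
            have := windowMass_mono (τ := τ) hh.1 hh.2
            linarith)) (a := a) (b := b) rfl rfl hPs.2.2.2.1 hPt.2.2.2.2
      have := setIntegral_Iic_sub hdi hst.le
      linarith
  -- `f` selects supergradients of `F1` along the rewards so that its cumulated integral, with
  -- reversed sign, stays between the weighted right and left slopes of `F0`.
  obtain ⟨f, hfm, hfcd, hfE⟩ := exists_density_between hcd hci hdi (E := E) (t₀ := -1)
    (Or.inl rfl) (by
      rintro t (rfl | ⟨ht, -⟩)
      · exact le_rfl
      · linarith) ha1 hb1 hlow' hup'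
  have hfi : ∀ t, IntegrableOn f (Iic t) G := by
    intro t
    refine Integrable.mono' ((hci t).norm.add (hdi t).norm) hfm.restrict ?_
    refine ae_restrict_of_ae ?_
    filter_upwards [hfcd] with τ hτ
    simp only [Real.norm_eq_abs, Pi.add_apply]
    rw [abs_le]
    constructor
    · linarith [neg_abs_le (c τ), abs_nonneg (d τ)]
    · linarith [le_abs_self (d τ), abs_nonneg (c τ)]
  set Φ : ℝ → ℝ := fun t => ∫ τ in Iic t, f τ ∂G with hΦ
  have hΦP : ∀ t, 0 ≤ t → P t → a t ≤ -Φ t ∧ -Φ t ≤ b t := by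
    intro t ht hPt
    have := hfE t (Or.inr ⟨ht, hPt⟩)
    rwa [hG.setIntegral_Ioc (by norm_num)] at this
  have ha0 : ∀ t, 0 ≤ t → P t → 0 ≤ a t := by
    intro t ht hPt
    rw [ha, flowSlope_of_nonneg ht]
    refine mul_nonneg ?_ (tail_nonneg G t)
    have hlt : l < m.flow t := (hl t ht).trans_le hPt.2.1
    refine MonotoneOn.derivWithin_nonneg ?_
    exact hmono.mono fun u hu => hlt.trans hu
  -- The sign is clear at almost every time, because `g0` is nondecreasing; right-continuity of `Φ`
  -- extends it to all times.
  have hΦ0 : ∀ t, 0 ≤ t → Φ t ≤ 0 := by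
    intro t ht
    by_contra! hpos
    have hev := (continuousWithinAt_setIntegral_Iic hfi t).tendsto.eventually_const_lt hpos
    rw [eventually_iff, mem_nhdsGE_iff_exists_Ico_subset] at hev
    obtain ⟨u, hu, hsub⟩ := hev
    obtain ⟨s, hs, hPs⟩ := exists_mem_Ioo_of_ae_timeMeasure hPae ht hu
    have h1 := hsub (Ioo_subset_Ico_self hs)
    have h2 := hΦP s (ht.trans hs.1.le) hPs
    have h3 := ha0 s (ht.trans hs.1.le) hPs
    simp only [mem_ofPred_eq] at h1
    linarith
  have hg0 : ∀ᵐ τ ∂G, 0 ≤ f τ - c 0 := by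
    filter_upwards [hfcd] with τ hτ
    linarith [hc0 τ, hτ.1]
  have hgi : ∀ t, IntegrableOn (fun τ => f τ - c 0) (Iic t) G := fun t =>
    (hfi t).sub (integrable_const (c 0))
  have hgsplit : ∀ t, ∫ τ in Iic t, (f τ - c 0) ∂G = Φ t - G.real (Iic t) * c 0 := by
    intro t
    rw [integral_sub (hfi t) (integrable_const _), setIntegral_const, smul_eq_mul]
  -- `f - c 0` is nonnegative, and its integrals over initial segments are bounded since `Φ ≤ 0`.
  have hinteg : Integrable f G := by
    have : Integrable (fun τ => f τ - c 0) G := by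
      refine (aecover_Iic tendsto_id).integrable_of_integral_bounded_of_nonneg_ae (l := atTop)
        |c 0| hgi hg0 ?_
      filter_upwards [eventually_ge_atTop 0] with t ht
      rw [id, hgsplit]
      have h1 := hΦ0 t ht
      have h2 : G.real (Iic t) * (-c 0) ≤ 1 * |c 0| :=
        (mul_le_mul_of_nonneg_left (neg_le_abs _) measureReal_nonneg).trans
          (mul_le_mul_of_nonneg_right measureReal_le_one (abs_nonneg _))
      linarith
    have h2 := this.add (integrable_const (c 0))
    refine h2.congr (ae_of_all _ fun τ => ?_)
    simp
  have hΦmeas : Measurable Φ := by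
    have h1 : Monotone fun t => ∫ τ in Iic t, (f τ - c 0) ∂G := fun s t hst =>
      setIntegral_mono_set (hgi t) (ae_restrict_of_ae hg0) (Iic_subset_Iic.2 hst).eventuallyLE
    have h2 : Monotone fun t => G.real (Iic t) := fun s t hst =>
      measureReal_mono (Iic_subset_Iic.2 hst)
    have e : Φ = fun t => (∫ τ in Iic t, (f τ - c 0) ∂G) + G.real (Iic t) * c 0 := by
      funext t; rw [hgsplit]; ring
    rw [e]
    exact h1.measurable.add (h2.measurable.mul_const _)
  -- The Euler equation holds by the choice of `p`; what needs proof is that `p` and `f` are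
  -- supergradients.
  refine ⟨fun t => -Φ t / tail G t, f, ?_, ?_, hinteg, ?_, ?_, ?_⟩
  · exact (hΦmeas.neg.div (antitone_tail (G := G)).measurable).aemeasurable
  · exact fun t ht => div_nonneg (neg_nonneg.2 (hΦ0 t ht)) (tail_nonneg G t)
  · have hae0 : ∀ᵐ t ∂timeMeasure, 0 ≤ t := ae_restrict_mem measurableSet_Ici
    filter_upwards [hPae, hae0] with t hPt ht
    have hlt : l < m.flow t := (hl t ht).trans_le hPt.2.1
    have htail := tail_pos hsupp t
    obtain ⟨h1, h2⟩ := hΦP t ht hPt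
    rw [ha, flowSlope_of_nonneg ht, ← le_div_iff₀ htail] at h1
    rw [hb, flowSlope_of_nonneg ht, ← div_le_iff₀ htail] at h2
    obtain ⟨e1, e2⟩ := hE.eq0 (m.flow t) hlt
    rw [min_eq_left hPt.2.2.1] at e1 e2
    refine T.concave_F0.slopeAt_of_eventually T.F0_lt_top e1 ?_
    have hnhd : ∀ᶠ v : ℝ≥0 in 𝓝 (m.flow t), l < v :=
      (NNReal.continuous_coe.tendsto (m.flow t)).eventually_const_lt hlt
    filter_upwards [hnhd] with v hv
    refine (T.F0_le_min v).trans ?_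
    obtain ⟨e3, e4⟩ := hE.eq0 v hv
    rw [← EReal.coe_toReal (T.F0_lt_top _).ne e3, EReal.coe_le_coe_iff, e4, e2]
    exact hE.concave0.le_of_mem_sideDerivs (by simpa using hlt) hv h1 h2
  · filter_upwards [hfcd, hG.ae_nonneg] with τ hτ hτ0
    rw [hreg.reward_eq_contValue hr hτ0]
    refine ⟨ENNReal.ofReal_ne_top, ?_⟩
    change SlopeAt T.F1 (X τ).toNNReal (f τ)
    have hw : ((X τ).toNNReal : ℝ) = X τ := Real.coe_toNNReal _ (hx.contValue_nonneg hr τ)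
    have hm : X τ ∈ Ioo l (T.u0 : ℝ) := ⟨hl τ hτ0, hXu τ hτ0⟩
    rw [hc, hd, valueSlope_of_nonneg hτ0, valueSlope_of_nonneg hτ0] at hτ
    set w := (X τ).toNNReal
    obtain ⟨e1, e2⟩ := hE.eq1 w (hw ▸ hm.1) (by exact_mod_cast hw ▸ hm.2)
    refine T.concave_F1.slopeAt_of_eventually T.F1_lt_top e1 ?_
    have hnhd : ∀ᶠ v : ℝ≥0 in 𝓝 w, (v : ℝ) ∈ Ioo l (T.u0 : ℝ) :=
      (NNReal.continuous_coe.tendsto w).eventually (Ioo_mem_nhds (hw ▸ hm.1) (hw ▸ hm.2))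
    filter_upwards [hnhd] with v hv
    obtain ⟨e3, e4⟩ := hE.eq1 v hv.1 (by exact_mod_cast hv.2)
    rw [← EReal.coe_toReal (T.F1_lt_top _).ne e3, EReal.coe_le_coe_iff, e4, e2, hw]
    exact hE.concave1.le_of_mem_sideDerivs (by simpa using hm) hv hτ.1 hτ.2
  · intro t ht
    rw [mul_div_cancel₀ _ (tail_pos hsupp t).ne', hG.setIntegral_Icc]
    ring

end Euler

/-! ### Necessity of the Euler equation -/

section Extend

/-- Linear extension with slope `κ` to the negative half-line. -/
noncomputable def extendNeg (κ : ℝ) (f : ℝ → ℝ) (u : ℝ) : ℝ := if u < 0 then f 0 + κ * u else f u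

variable {κ u : ℝ} {f : ℝ → ℝ}

theorem extendNeg_of_neg (hu : u < 0) : extendNeg κ f u = f 0 + κ * u := if_pos hu

theorem extendNeg_of_nonneg (hu : 0 ≤ u) : extendNeg κ f u = f u := if_neg (not_lt.2 hu)

/-- The assumption on `κ` says that the added line is at least as steep as every chord of `f` from
zero, so slopes still decrease across zero. -/
theorem _root_.ConcaveOn.extendNeg {D : Set ℝ} (hf : ConcaveOn ℝ (D ∩ Ici 0) f) (hD : Convex ℝ D)
    (h0 : (0 : ℝ) ∈ D) (hκ : ∀ v ∈ D, 0 ≤ v → f v ≤ f 0 + κ * v) :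
    ConcaveOn ℝ D (extendNeg κ f) := by
  refine LinearOrder.concaveOn_of_lt hD fun u hu v hv huv a b ha hb hab => ?_
  simp only [smul_eq_mul]
  rcases le_or_gt 0 u with hu0 | hu0
  · have hv0 : 0 ≤ v := hu0.trans huv.le
    rw [extendNeg_of_nonneg hu0, extendNeg_of_nonneg hv0, extendNeg_of_nonneg (by positivity)]
    exact hf.2 ⟨hu, hu0⟩ ⟨hv, hv0⟩ ha.le hb.le hab
  rcases lt_or_ge v 0 with hv0 | hv0
  · rw [extendNeg_of_neg hu0, extendNeg_of_neg hv0, extendNeg_of_neg (by nlinarith)]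
    have : a * (f 0 + κ * u) + b * (f 0 + κ * v) = (a + b) * f 0 + κ * (a * u + b * v) := by ring
    rw [this, hab, one_mul]
  rw [extendNeg_of_neg hu0, extendNeg_of_nonneg hv0]
  have hκv := hκ v hv hv0
  rcases le_or_gt 0 (a * u + b * v) with hw | hw
  · rw [extendNeg_of_nonneg hw]
    rcases hv0.eq_or_lt with rfl | hv0'
    · exfalso; nlinarith
    set w := a * u + b * v with hwdef
    have hwv : w ≤ v := by nlinarith
    have h2 := hf.2 ⟨h0, mem_Ici.2 le_rfl⟩ ⟨hv, hv0⟩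
      (sub_nonneg.2 ((div_le_one hv0').2 hwv)) (div_nonneg hw hv0) (sub_add_cancel 1 (w / v))
    simp only [smul_eq_mul, mul_zero, zero_add] at h2
    rw [div_mul_cancel₀ _ hv0'.ne'] at h2
    refine le_trans ?_ h2
    have hd : w / v * f v + (1 - w / v) * f 0 = f 0 + w * ((f v - f 0) / v) := by field_simp; ring
    have hs : (f v - f 0) / v ≤ κ := by rw [div_le_iff₀ hv0']; linarith
    have hfv : f v = f 0 + (f v - f 0) / v * v := by field_simp; ring
    set q := (f v - f 0) / v
    have e1 : a * (f 0 + κ * u) + b * f v = (a + b) * f 0 + a * κ * u + b * q * v := by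
      rw [hfv]; ring
    have e2 : (1 - w / v) * f 0 + w / v * f v = f 0 + w * q := by linarith
    rw [e1, e2, hab, one_mul, hwdef]
    nlinarith [mul_nonneg (mul_nonneg ha.le (neg_nonneg.2 hu0.le)) (sub_nonneg.2 hs)]
  · rw [extendNeg_of_neg hw]
    have h3 : b * f v ≤ b * (f 0 + κ * v) := mul_le_mul_of_nonneg_left hκv hb.le
    have : f 0 = (a + b) * f 0 := by rw [hab, one_mul]
    nlinarith

theorem leftSlope_extendNeg_zero : leftSlope (extendNeg κ f) 0 = κ := by
  have h1 : HasDerivWithinAt (fun u : ℝ => f 0 + κ * u) κ (Iio 0) 0 := by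
    simpa using (((hasDerivAt_id (0 : ℝ)).const_mul κ).const_add (f 0)).hasDerivWithinAt
  have h2 : HasDerivWithinAt (extendNeg κ f) κ (Iio 0) 0 :=
    h1.congr (fun u hu => extendNeg_of_neg hu) (by simp [extendNeg])
  exact h2.derivWithin (uniqueDiffWithinAt_Iio 0)

theorem rightSlope_extendNeg (hu : 0 ≤ u) : rightSlope (extendNeg κ f) u = rightSlope f u :=
  derivWithin_congr (fun _ hv => extendNeg_of_nonneg (hu.trans (mem_Ioi.1 hv).le))
    (extendNeg_of_nonneg hu)

theorem rightSlope_le {g : ℝ → ℝ} {K : ℝ} (hd : DifferentiableWithinAt ℝ g (Ioi u) u)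
    (hK : ∀ᶠ v in 𝓝[>] u, g v - g u ≤ K * (v - u)) : rightSlope g u ≤ K := by
  have h1 := hd.hasDerivWithinAt
  rw [hasDerivWithinAt_iff_tendsto_slope' (by simp)] at h1
  refine le_of_tendsto h1 ?_
  filter_upwards [hK, self_mem_nhdsWithin] with v hv huv
  rw [slope_def_field, div_le_iff₀ (sub_pos.2 huv)]
  exact hv

end Extend

/-! ### The old frontier with free disposal above its peak -/

namespace Technology

variable (T : Technology)

/-- The old frontier, flattened above its peak. -/
noncomputable def flat (u : ℝ≥0) : EReal := T.F0 (min u T.u0)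

/-- Truncation at `u0` is concave and `F0` is nondecreasing up to `u0`. -/
theorem concave_flat : EConcave T.flat := fun u v a b hab =>
  (T.concave_F0 _ _ a b hab).trans (T.F0_mono
    (le_min (by gcongr <;> exact min_le_left _ _) (by
      calc a * min u T.u0 + b * min v T.u0 ≤ a * T.u0 + b * T.u0 := by
            gcongr <;> exact min_le_right _ _
        _ = T.u0 := by rw [← add_mul, hab, one_mul])) (min_le_right _ _))

theorem flat_ne_bot {u : ℝ≥0} (hu : 0 < u) : T.flat u ≠ ⊥ :=
  T.finite_F0 _ (lt_min hu T.u0_pos) (min_le_right _ _)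

theorem realize_flat (u : ℝ) (hu : 0 ≤ u) : realize T.flat u = realize T.F0 (min u T.u0) := by
  lift u to ℝ≥0 using hu
  rw [← NNReal.coe_min, realize_coe, realize_coe, flat]

theorem realize_flat_mono {u v : ℝ} (huv : u ≤ v) (hu : T.flat u.toNNReal ≠ ⊥) :
    realize T.flat u ≤ realize T.flat v := by
  refine EReal.toReal_le_toReal ?_ hu (T.F0_lt_top _).ne
  exact T.F0_mono (min_le_min_right _ (Real.toNNReal_le_toNNReal huv)) (min_le_right _ _)

theorem flat_slope_le {K : ℝ} (hK0 : 0 ≤ K) (hF0 : T.F0 0 ≠ ⊥)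
    (hK : ∀ v : ℝ, 0 ≤ v → v ≤ T.u0 → realize T.F0 v - realize T.F0 0 ≤ K * v) {p q : ℝ}
    (hp : 0 ≤ p) (hpq : p ≤ q) : realize T.flat q - realize T.flat p ≤ K * (q - p) := by
  rw [T.realize_flat q (hp.trans hpq), T.realize_flat p hp]
  refine (T.F0_slope_le hF0 hK (le_min hp T.u0.coe_nonneg) (min_le_min_right _ hpq)
    (min_le_right _ _)).trans (mul_le_mul_of_nonneg_left ?_ hK0)
  rcases le_total p T.u0 with h | h
  · rw [min_eq_left h]
    linarith [min_le_left q (T.u0 : ℝ)]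
  · rw [min_eq_right h]
    linarith [min_le_right q (T.u0 : ℝ)]

end Technology

/-! ### Optimal mechanisms satisfy the Euler equation -/

section Necessity

variable {T : Technology} {r : ℝ} {m : Mechanism} {G : Measure ℝ}

/-- The frontiers themselves, on positive utilities, serve as the extension, and there are no dates
at which the flow cannot be lowered. -/
theorem Optimal.exists_realEuler_of_pos (hr : 0 < r) (hG : IsTimeDistribution G)
    (hsupp : ¬ BddAbove G.support) (h : Optimal T r G m)
    (hpos : ∀ t, 0 ≤ t → 0 < contValue r m.flow t) : ∃ p f, RealEuler T G m p f := by
  have hE : Extension T r m 0 (realize T.flat) (realize T.F1) := by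
    refine ⟨?_, ?_, fun u hu => ⟨?_, ?_⟩, fun u hu hu' => ⟨?_, ?_⟩, hpos⟩
    · exact T.concave_flat.concaveOn_realize (fun u => T.F0_lt_top _) (convex_Ioi 0)
        (fun u hu => (mem_Ioi.1 hu).le) fun u hu => T.flat_ne_bot (Real.toNNReal_pos.2 hu)
    · exact T.concaveOn_F1.subset Ioo_subset_Ioc_self (convex_Ioo _ _)
    · exact T.flat_ne_bot (by exact_mod_cast hu)
    · rw [realize_coe, Technology.flat]
    · exact T.F1_ne_bot (by exact_mod_cast hu) hu'.le
    · rw [realize_coe]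
  refine h.exists_realEuler_of_extension hr hG hsupp hE (Q := fun _ => True) ?_
    (ae_of_all _ fun _ => trivial) ?_ ?_
  · exact fun u hu v _ huv => T.realize_flat_mono huv (T.flat_ne_bot (Real.toNNReal_pos.2 hu))
  · exact fun s t hs _ _ _ h0 => absurd h0 (hpos s hs).ne'
  · exact fun s t _ ht _ _ h0 => absurd h0 (hpos t ht).ne'

/-- From some first date `T1` on the continuation value is zero. Then `ustar = 0`, and both
frontiers have slope at most `K` at zero. Extending them linearly below zero with a large slope `κ`
adds only supergradients that they already have at zero, and supplies the conditions at dates where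
the flow cannot be lowered. -/
theorem Optimal.exists_realEuler_of_zero (hr : 0 < r) (hG : IsTimeDistribution G)
    (hsupp : ¬ BddAbove G.support) (h : Optimal T r G m) {S : ℝ} (hS : 0 ≤ S)
    (hS0 : contValue r m.flow S = 0) : ∃ p f, RealEuler T G m p f := by
  have := hG.isProbabilityMeasure
  have hreg := h.regular hr hG hsupp
  have hx := hreg.bddFlow hr
  have hanti := hreg.antitoneOn_contValue hr
  have hX0 : contValue r m.flow 0 < T.u0 := h.contValue_lt hr hG hsupp le_rfl
  have hF0 := hreg.F0_zero_ne_bot hr hS hS0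
  have hus : T.us = 0 := by
    have := hreg.us_le_contValue hr hS
    rw [hS0] at this
    exact le_antisymm (by exact_mod_cast this) zero_le
  obtain ⟨K, hK0, hK⟩ := h.exists_slope_zero hr hG hsupp hS hS0
  set X := contValue r m.flow with hX
  have hXnn : ∀ t, 0 ≤ X t := hx.contValue_nonneg hr
  have hXu : ∀ t, 0 ≤ t → X t < T.u0 := fun t ht => h.contValue_lt hr hG hsupp ht
  -- the first time at which the continuation value vanishes
  obtain ⟨T1, hT1, hmin⟩ : ∃ T1, (0 ≤ T1 ∧ X T1 = 0) ∧ ∀ t, 0 ≤ t → X t = 0 → T1 ≤ t := by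
    have hcomp : IsCompact (Icc 0 S ∩ X ⁻¹' {0}) :=
      isCompact_Icc.inter_right (isClosed_singleton.preimage (hx.continuous_contValue hr))
    obtain ⟨T1, h1, h2⟩ := hcomp.exists_isLeast ⟨S, ⟨hS, le_rfl⟩, hS0⟩
    refine ⟨T1, ⟨h1.1.1, h1.2⟩, fun t ht ht0 => ?_⟩
    rcases le_total t S with hts | hts
    · exact h2 ⟨⟨ht, hts⟩, ht0⟩
    · exact h1.1.2.trans hts
  have hafter : ∀ t, T1 ≤ t → X t = 0 := fun t ht =>
    le_antisymm (hT1.2 ▸ hanti hT1.1 (mem_Ici.2 (hT1.1.trans ht)) ht) (hXnn t)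
  set M := |rightSlope (realize T.F1) (X 0)| with hM
  have htail1 : 0 < tail G T1 := tail_pos hsupp T1
  -- The left slope `κ`, weighted by the probability of a breakthrough after `T1`, must cover a
  -- right slope of `F0` of at most `K` at an earlier date and a loss of at most `M` from negative
  -- slopes of `F1` before `T1`.
  set κ := (K + M) / tail G T1 with hκ
  have hκmul : κ * tail G T1 = K + M := div_mul_cancel₀ _ htail1.ne'
  have hM0 : 0 ≤ M := abs_nonneg _
  have hκ0 : 0 ≤ κ := div_nonneg (by linarith) htail1.le
  have hKκ : K ≤ κ := by
    have := mul_le_of_le_one_right hκ0 (tail_le_one (G := G) T1)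
    linarith
  set g0 := extendNeg κ (realize T.flat) with hg0
  set g1 := extendNeg κ (realize T.F1) with hg1
  have hflat0 : ∀ u, T.flat u ≠ ⊥ := fun u => by
    rcases eq_or_lt_of_le (zero_le : 0 ≤ u) with rfl | hu
    · rw [Technology.flat, min_eq_left zero_le]; exact hF0
    · exact T.flat_ne_bot hu
  have hF1 : ∀ u, u ≤ T.u0 → T.F1 u ≠ ⊥ := fun u hu => by
    rcases eq_or_lt_of_le (zero_le : 0 ≤ u) with rfl | hu'
    · exact ne_bot_of_le_ne_bot hF0 (T.F0_le_F1 0)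
    · exact T.F1_ne_bot hu' hu
  have hu0 : (0 : ℝ) < T.u0 := T.u0_pos
  have hE : Extension T r m (-1) g0 g1 := by
    refine ⟨?_, ?_, fun u hu => ⟨?_, ?_⟩, fun u hu hu' => ⟨?_, ?_⟩, fun t _ => ?_⟩
    · refine ConcaveOn.extendNeg ?_ (convex_Ioi _) (by simp) fun v _ hv => ?_
      · exact T.concave_flat.concaveOn_realize (fun u => T.F0_lt_top _)
          ((convex_Ioi _).inter (convex_Ici _)) (fun u hu => hu.2) fun u _ => hflat0 _
      · have := T.flat_slope_le hK0 hF0 hK le_rfl hv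
        have := mul_le_mul_of_nonneg_right hKκ hv
        linarith
    · refine ConcaveOn.extendNeg ?_ (convex_Ioo _ _) (by simp [T.u0_pos]) fun v hv hv0 => ?_
      · exact (T.concaveOn_F1_zero hF0).subset (fun u hu => ⟨hu.2, hu.1.2.le⟩)
          ((convex_Ioo _ _).inter (convex_Ici _))
      · have := T.F1_slope_le hF0 hus hK le_rfl hv0 hv.2.le
        have := mul_le_mul_of_nonneg_right hKκ hv0
        linarith
    · exact hflat0 u
    · rw [hg0, extendNeg_of_nonneg u.coe_nonneg, realize_coe, Technology.flat]
    · exact hF1 u hu'.le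
    · rw [hg1, extendNeg_of_nonneg u.coe_nonneg, realize_coe]
    · linarith [hXnn t]
  have hR0 : ∀ u, 0 ≤ u → rightSlope g0 u ≤ K := by
    intro u hu
    refine rightSlope_le (hE.concave0.hasDerivWithinAt_rightSlope
      (by rw [interior_Ioi]; exact lt_of_lt_of_le (by norm_num) hu)).differentiableWithinAt ?_
    filter_upwards [self_mem_nhdsWithin] with v hv
    have hv : u < v := hv
    rw [hg0, extendNeg_of_nonneg hu, extendNeg_of_nonneg (hu.trans hv.le)]
    exact T.flat_slope_le hK0 hF0 hK hu hv.le
  have hR1 : rightSlope g1 0 ≤ K := by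
    refine rightSlope_le (hE.concave1.hasDerivWithinAt_rightSlope
      (by rw [interior_Ioo]; exact ⟨by norm_num, hu0⟩)).differentiableWithinAt ?_
    filter_upwards [self_mem_nhdsWithin, mem_nhdsWithin_of_mem_nhds (Iio_mem_nhds hu0)] with v hv hv'
    have hv : 0 < v := hv
    rw [hg1, extendNeg_of_nonneg le_rfl, extendNeg_of_nonneg hv.le]
    exact T.F1_slope_le hF0 hus hK le_rfl hv.le (mem_Iio.1 hv').le
  have hL0 : leftSlope g0 0 = κ := leftSlope_extendNeg_zero
  have hL1 : leftSlope g1 0 = κ := leftSlope_extendNeg_zero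
  set c := valueSlope (rightSlope g1) r m with hc
  set d := valueSlope (leftSlope g1) r m with hd
  have hcm : Monotone c := monotone_slope_value hanti hX0 hE.lt_value
    (by simpa using hE.concave1.antitoneOn_rightSlope)
  have hdm : Monotone d := monotone_slope_value hanti hX0 hE.lt_value
    (by simpa using hE.concave1.antitoneOn_leftSlope)
  have hd0 : ∀ τ, d 0 ≤ d τ := fun τ => by
    have : d τ = d (max τ 0) := by simp [hd, valueSlope]
    rw [this]; exact hdm (le_max_right _ _)
  have hdi : ∀ t, IntegrableOn d (Iic t) G := hdm.integrableOn_Iic_of_le hd0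
  have hdM : ∀ τ, -M ≤ d τ := by
    intro τ
    refine le_trans ?_ (hd0 τ)
    have h1 : c 0 ≤ d 0 := hE.concave1.rightDeriv_le_leftDeriv (by
      rw [interior_Ioo, max_self]
      exact ⟨hE.lt_value 0 le_rfl, hX0⟩)
    have h2 : c 0 = rightSlope (realize T.F1) (X 0) := by
      rw [hc, valueSlope_of_nonneg le_rfl, hg1, rightSlope_extendNeg (hXnn 0)]
    have := neg_abs_le (rightSlope (realize T.F1) (X 0))
    linarith
  have hcT : ∀ τ, T1 ≤ τ → c τ = rightSlope g1 0 := fun τ hτ => by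
    rw [hc, valueSlope_of_nonneg (hT1.1.trans hτ)]
    exact congrArg _ (hafter τ hτ)
  have hdT : ∀ τ, T1 ≤ τ → d τ = κ := fun τ hτ => by
    rw [hd, valueSlope_of_nonneg (hT1.1.trans hτ), ← hL1]
    exact congrArg _ (hafter τ hτ)
  have htailsub : ∀ s t, s ≤ t → tail G s = tail G t + G.real (Ioc s t) := by
    intro s t hst
    rw [tail, tail, ← Ioc_union_Ioi_eq_Ioi hst, measureReal_union (by
      rw [disjoint_left]; exact fun τ h1 h2 => absurd h1.2 (not_le.2 h2)) measurableSet_Ioi]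
    ring
  have hconst : ∀ (e : ℝ → ℝ) (k s t : ℝ), (∀ τ, T1 ≤ τ → e τ = k) → T1 ≤ s →
      ∫ τ in Ioc s t, e τ ∂G = k * G.real (Ioc s t) := by
    intro e k s t he hs
    rw [setIntegral_congr_fun measurableSet_Ioc (g := fun _ => k)
      fun τ hτ => he τ (hs.trans hτ.1.le), setIntegral_const, smul_eq_mul, mul_comm]
  -- A zero value forces a zero flow at almost every time after `T1`, so `Q` discards only a null
  -- set of dates.
  refine h.exists_realEuler_of_extension hr hG hsupp hE (Q := fun t => X t = 0 → m.flow t = 0)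
    ?_ ?_ ?_ ?_
  · intro u hu v _ huv
    rw [hg0]
    rcases lt_or_ge v 0 with hv0 | hv0
    · rw [extendNeg_of_neg hv0, extendNeg_of_neg (huv.trans_lt hv0)]
      have := mul_le_mul_of_nonneg_left huv hκ0
      linarith
    rw [extendNeg_of_nonneg hv0]
    rcases lt_or_ge u 0 with hu0 | hu0
    · rw [extendNeg_of_neg hu0]
      have h1 := T.realize_flat_mono hv0 (hflat0 _)
      have h2 := mul_nonpos_of_nonneg_of_nonpos hκ0 hu0.le
      linarith
    · rw [extendNeg_of_nonneg hu0]
      exact T.realize_flat_mono huv (hflat0 _)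
  · have h1 := hx.ae_eq_zero_of_contValue hr hT1.1 hT1.2
    have h2 : ∀ᵐ t ∂timeMeasure, t ≠ T1 := ae_restrict_of_ae (by simp [ae_iff])
    have h3 : ∀ᵐ t ∂timeMeasure, 0 ≤ t := ae_restrict_mem measurableSet_Ici
    filter_upwards [h1, h2, h3] with t h1 h2 h3 h4
    exact h1 (lt_of_le_of_ne (hmin t h3 h4) (Ne.symm h2))
  · intro s t hs hst hQs hQt hXs
    have hT1s := hmin s hs hXs
    rw [hconst c _ s t hcT hT1s, flowSlope_of_nonneg (hs.trans hst.le), flowSlope_of_nonneg hs,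
      hQs hXs, hQt (hafter t (hT1s.trans hst.le)), NNReal.coe_zero, hL0, htailsub s t hst.le]
    have h1 := mul_le_mul_of_nonneg_right (hR0 0 le_rfl) (tail_nonneg G t)
    have h2 := mul_le_mul_of_nonneg_right hKκ (tail_nonneg G t)
    have h3 : rightSlope g1 0 * G.real (Ioc s t) ≤ κ * G.real (Ioc s t) :=
      mul_le_mul_of_nonneg_right (hR1.trans hKκ) measureReal_nonneg
    linarith
  · intro s t hst ht hs hQt hXt
    have hT1t := hmin t ht hXt
    rw [flowSlope_of_nonneg ht, hQt hXt, NNReal.coe_zero, hL0]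
    rcases le_or_gt T1 s with hT1s | hT1s
    · have hs0 : 0 ≤ s := hT1.1.trans hT1s
      have hQs := (hs.resolve_left (by linarith)).2 (hafter s hT1s)
      rw [hconst d _ s t hdT hT1s, flowSlope_of_nonneg hs0, hQs, NNReal.coe_zero]
      have h1 := mul_le_mul_of_nonneg_right ((hR0 0 le_rfl).trans hKκ) (tail_nonneg G s)
      rw [← mul_add, ← htailsub s t hst.le]
      exact h1
    -- With `s` before `T1`, the integral of `d` splits at `T1`: at least `-M` before, and `κ` times
    -- the probability after. Together with the tail at `t` this leaves `κ * tail G T1 - M = K`.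
    · have ha : flowSlope (rightSlope g0) G m s ≤ K := by
        rcases lt_or_ge s 0 with hs0 | hs0
        · rw [flowSlope_of_neg hs0]; exact hK0
        · rw [flowSlope_of_nonneg hs0]
          exact (mul_le_mul_of_nonneg_right (hR0 _ (m.flow s).coe_nonneg) (tail_nonneg G s)).trans
            (mul_le_of_le_one_right hK0 (tail_le_one s))
      have e1 := setIntegral_Iic_sub hdi hst.le
      have e2 := setIntegral_Iic_sub hdi hT1s.le
      have e3 := setIntegral_Iic_sub hdi hT1t
      rw [hconst d _ T1 t hdT le_rfl] at e3
      have e4 : -M ≤ ∫ τ in Ioc s T1, d τ ∂G := by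
        have h1 : ∫ τ in Ioc s T1, -M ∂G ≤ ∫ τ in Ioc s T1, d τ ∂G :=
          setIntegral_mono (integrable_const _) ((hdi T1).mono_set Ioc_subset_Iic_self) hdM
        rw [setIntegral_const, smul_eq_mul] at h1
        have h2 := mul_le_mul_of_nonneg_right (measureReal_le_one (μ := G) (s := Ioc s T1)) hM0
        linarith
      have e5 : κ * tail G T1 = κ * tail G t + κ * G.real (Ioc T1 t) := by
        rw [htailsub T1 t hT1t, mul_add]
      linarith

theorem Optimal.exists_realEuler (hr : 0 < r) (hG : IsTimeDistribution G)
    (hsupp : ¬ BddAbove G.support) (h : Optimal T r G m) : ∃ p f, RealEuler T G m p f := by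
  by_cases hpos : ∀ t, 0 ≤ t → 0 < contValue r m.flow t
  · exact h.exists_realEuler_of_pos hr hG hsupp hpos
  · push Not at hpos
    obtain ⟨S, hS, hS0⟩ := hpos
    exact h.exists_realEuler_of_zero hr hG hsupp hS (le_antisymm hS0
      (((h.regular hr hG hsupp).bddFlow hr).contValue_nonneg hr S))

theorem RealEuler.satisfiesEuler (hG : IsTimeDistribution G) {p f : ℝ → ℝ}
    (h : RealEuler T G m p f) : SatisfiesEuler T G m := by
  have := hG.isProbabilityMeasure
  refine ⟨fun t => ENNReal.ofReal (p t), fun t => (f t : EReal), h.meas.ennreal_ofReal, ?_, ?_, ?_, ?_⟩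
  · exact eIntegrable_coe h.int
  · have h3 : ∀ᵐ t ∂timeMeasure, 0 ≤ t := ae_restrict_mem measurableSet_Ici
    filter_upwards [h.slope0, h3] with t ht ht0 _
    rw [EReal.coe_ennreal_ofReal, max_eq_left (h.nonneg t ht0)]
    exact ht.isSupergradient T.F0_lt_top
  · filter_upwards [h.slope1] with t ht
    exact ⟨ht.1, ht.2.isSupergradient T.F1_lt_top⟩
  · intro t ht
    rw [one_sub_cdf, EReal.coe_ennreal_ofReal, max_eq_left (h.nonneg t ht),
      eintegral_coe h.int.integrableOn, ← EReal.coe_mul, ← EReal.coe_add, h.eq t ht, EReal.coe_zero]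

end Necessity

/-! ### Differentiable frontiers -/

section Differentiable

variable {T : Technology} {r : ℝ} {m : Mechanism} {G : Measure ℝ} {p f : ℝ → ℝ}

/-- The function less its supporting line has a local maximum at `u`, so its derivative vanishes. -/
theorem SlopeAt.frontierDeriv_eq {F : ℝ≥0 → EReal} (hF : ∀ u, F u < ⊤) {u u0 : ℝ≥0} {η : ℝ}
    (h : SlopeAt F u η) (hu : 0 < u) (hu0 : u < u0) (hfin : ∀ v, 0 < v → v ≤ u0 → F v ≠ ⊥)
    (hd : DifferentiableAt ℝ (realize F) u) : frontierDeriv u0 F u = η := by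
  have hmem : (u : ℝ) ∈ Ioo (0 : ℝ) u0 := ⟨by exact_mod_cast hu, by exact_mod_cast hu0⟩
  have hmax : IsLocalMax (fun v : ℝ => realize F v - η * v) u := by
    filter_upwards [Ioo_mem_nhds hmem.1 hmem.2] with v hv
    lift v to ℝ≥0 using hv.1.le
    have := h.le_toReal hF (hfin v (by exact_mod_cast hv.1) (by exact_mod_cast hv.2.le))
    rw [realize_coe, realize_coe]
    linarith
  have h0 := hmax.hasDerivAt_eq_zero (hd.hasDerivAt.sub ((hasDerivAt_id (u : ℝ)).const_mul η))
  rw [frontierDeriv, derivWithin_of_mem_nhds (Icc_mem_nhds hmem.1 hmem.2)]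
  linarith

/-- At the peak a supergradient is only bounded by the left-hand derivative. This is why the Euler
condition is an inequality at `u0`. -/
theorem Technology.le_frontierDeriv_u0 (T : Technology) {η : ℝ} (h : SlopeAt T.F0 T.u0 η) :
    η ≤ frontierDeriv T.u0 T.F0 T.u0 := by
  have hu0 : (0 : ℝ) < T.u0 := T.u0_pos
  have hconc : ConcaveOn ℝ (Ioi 0) (realize T.flat) :=
    T.concave_flat.concaveOn_realize (fun u => T.F0_lt_top _) (convex_Ioi 0)
      (fun u hu => (mem_Ioi.1 hu).le) fun u hu => T.flat_ne_bot (Real.toNNReal_pos.2 hu)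
  have h1 := hconc.hasDerivWithinAt_leftSlope (u := T.u0) (by rw [interior_Ioi]; exact hu0)
  have heq : ∀ u ∈ Icc (0 : ℝ) T.u0, realize T.F0 u = realize T.flat u := fun u hu => by
    rw [T.realize_flat u hu.1, min_eq_left hu.2]
  have h2 : HasDerivWithinAt (realize T.F0) (leftSlope (realize T.flat) T.u0) (Icc 0 (T.u0 : ℝ))
      T.u0 :=
    ((hasDerivWithinAt_Iio_iff_Iic.1 h1).mono Icc_subset_Iic_self).congr heq
      (heq _ ⟨hu0.le, le_rfl⟩)
  rw [frontierDeriv, h2.derivWithin (uniqueDiffOn_Icc hu0 _ ⟨hu0.le, le_rfl⟩)]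
  rw [hasDerivWithinAt_iff_tendsto_slope' (by simp)] at h1
  refine ge_of_tendsto h1 ?_
  filter_upwards [self_mem_nhdsWithin, mem_nhdsWithin_of_mem_nhds (Ioi_mem_nhds hu0)] with v hv hv0
  have hv : v < T.u0 := hv
  have hv0 : 0 < v := hv0
  have hle : realize T.F0 v ≤ realize T.F0 T.u0 + η * (v - T.u0) := by
    lift v to ℝ≥0 using hv0.le
    rw [realize_coe, realize_coe]
    exact h.le_toReal T.F0_lt_top (T.finite_F0 v (by exact_mod_cast hv0) (by exact_mod_cast hv.le))
  rw [heq v ⟨hv0.le, hv.le⟩, heq T.u0 ⟨hu0.le, le_rfl⟩] at hle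
  rw [slope_comm, slope_def_field, le_div_iff₀ (sub_pos.2 hv)]
  linarith

/-- By the Euler equation `tail G t * p t` tends to minus the mean of `f`. A flow of at least `w`
keeps `p` bounded, because a steep supporting line would lie below `F0` at `w / 2`; and the tail
tends to zero. -/
theorem RealEuler.integral_eq_zero (hG : IsTimeDistribution G)
    (h : RealEuler T G m p f) {w : ℝ≥0} (hw : 0 < w) (hw0 : w ≤ T.u0)
    (hx : ∀ᵐ t ∂timeMeasure, w ≤ m.flow t ∧ m.flow t ≤ T.u0) : ∫ τ, f τ ∂G = 0 := by
  have := hG.isProbabilityMeasure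
  have hlim : Tendsto (fun t => tail G t * p t) atTop (𝓝 (-∫ τ, f τ ∂G)) := by
    have h1 : Tendsto (fun t => -∫ τ in Iic t, f τ ∂G) atTop (𝓝 (-∫ τ, f τ ∂G)) :=
      ((aecover_Iic tendsto_id).integral_tendsto_of_countably_generated h.int).neg
    refine h1.congr' ?_
    filter_upwards [eventually_ge_atTop 0] with t ht
    have := h.eq t ht
    rw [hG.setIntegral_Icc] at this
    linarith
  set B := 2 * ((T.F0 T.u0).toReal - (T.F0 (w / 2)).toReal) / w with hB
  have hw' : (0 : ℝ) < w := by exact_mod_cast hw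
  have hfin : T.F0 (w / 2) ≠ ⊥ :=
    T.finite_F0 _ (by positivity) ((NNReal.half_le_self w).trans hw0)
  have hpB : ∀ᵐ t ∂timeMeasure, 0 ≤ t ∧ p t ≤ B := by
    have h3 : ∀ᵐ t ∂timeMeasure, 0 ≤ t := ae_restrict_mem measurableSet_Ici
    filter_upwards [h3, h.slope0, hx] with t ht hs hx
    refine ⟨ht, ?_⟩
    have h1 := hs.le_toReal T.F0_lt_top hfin
    have h2 : (T.F0 (m.flow t)).toReal ≤ (T.F0 T.u0).toReal :=
      EReal.toReal_le_toReal (T.F0_le_peak _) hs.1 (T.F0_lt_top _).ne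
    have h4 : (w : ℝ) ≤ m.flow t := by exact_mod_cast hx.1
    have h5 := mul_le_mul_of_nonneg_left h4 (h.nonneg t ht)
    rw [hB, le_div_iff₀ hw']
    push_cast at h1
    linarith
  refine le_antisymm ?_ ?_
  · have : 0 ≤ -∫ τ, f τ ∂G := by
      refine ge_of_tendsto hlim ?_
      filter_upwards [eventually_ge_atTop 0] with t ht
      exact mul_nonneg (tail_nonneg G t) (h.nonneg t ht)
    linarith
  · by_contra! hneg
    have hL : 0 < -∫ τ, f τ ∂G := by linarith
    have h1 := hlim.eventually_const_lt (half_lt_self hL)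
    have h2 : Tendsto (fun t => tail G t * B) atTop (𝓝 0) := by
      simpa using (tendsto_tail (G := G)).mul_const B
    have h3 := h2.eventually_lt_const (half_pos hL)
    obtain ⟨N, hN⟩ := eventually_atTop.1 (h1.and h3)
    obtain ⟨t, ht, ht0, htB⟩ := exists_mem_Ioo_of_ae_timeMeasure hpB (le_max_right N 0)
      (lt_add_one _)
    obtain ⟨h4, h5⟩ := hN t ((le_max_left N 0).trans ht.1.le)
    have := mul_le_mul_of_nonneg_left htB (tail_nonneg G t)
    linarith

/-- When `f` has mean zero, minus its integral up to `t` is its integral after `t`. -/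
theorem RealEuler.eq_cond (hsupp : ¬ BddAbove G.support) (hG : IsTimeDistribution G)
    (h : RealEuler T G m p f) (h0 : ∫ τ, f τ ∂G = 0) {t : ℝ} (ht : 0 ≤ t) :
    ∫ s, f s ∂(ProbabilityTheory.cond G (Ioi t)) = p t := by
  have := hG.isProbabilityMeasure
  have htail := tail_pos hsupp t
  have h1 := h.eq t ht
  have h2 : ∫ τ in Iic t, f τ ∂G + ∫ τ in Ioi t, f τ ∂G = ∫ τ, f τ ∂G := by
    rw [← compl_Iic]; exact integral_add_compl measurableSet_Iic h.int
  rw [hG.setIntegral_Icc] at h1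
  rw [ProbabilityTheory.cond, integral_smul_measure, ENNReal.toReal_inv, smul_eq_mul]
  change (tail G t)⁻¹ * _ = _
  rw [inv_mul_eq_iff_eq_mul₀ htail.ne']
  linarith

theorem RealEuler.continuousWithinAt (hsupp : ¬ BddAbove G.support) (hG : IsTimeDistribution G)
    (h : RealEuler T G m p f) {t : ℝ} (ht : 0 ≤ t) : ContinuousWithinAt p (Ici t) t := by
  have := hG.isProbabilityMeasure
  have htl : ∀ t, tail G t = 1 - ∫ τ in Iic t, (1 : ℝ) ∂G := by
    intro t
    rw [setIntegral_const, smul_eq_mul, mul_one, tail, ← compl_Iic,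
      probReal_compl_eq_one_sub measurableSet_Iic]
  have h1 := continuousWithinAt_setIntegral_Iic (G := G) (g := f) (fun _ => h.int.integrableOn) t
  have h2 : ContinuousWithinAt (tail G) (Ici t) t := by
    have h3 : ContinuousWithinAt (fun t => 1 - ∫ τ in Iic t, (1 : ℝ) ∂G) (Ici t) t :=
      continuousWithinAt_const.sub (continuousWithinAt_setIntegral_Iic (G := G)
        (g := fun _ => (1 : ℝ)) (fun _ => (integrable_const 1).integrableOn) t)
    exact h3.congr (fun s _ => htl s) (htl t)
  have key : ∀ s ∈ Ici t, p s = -(∫ τ in Iic s, f τ ∂G) / tail G s := by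
    intro s hs
    have := h.eq s (ht.trans hs)
    rw [hG.setIntegral_Icc] at this
    rw [eq_div_iff (tail_pos hsupp s).ne']
    linarith
  exact (h1.neg.div h2 (tail_pos hsupp t).ne').congr key (key t (mem_Ici.2 le_rfl))

/-- A slope of the old frontier at the flow at almost all times is one at some level at all times. -/
theorem RealEuler.exists_slopeAt (hsupp : ¬ BddAbove G.support) (hG : IsTimeDistribution G)
    (h : RealEuler T G m p f) {w : ℝ≥0} (hw : 0 < w) (hw0 : w ≤ T.u0)
    (hx : ∀ᵐ t ∂timeMeasure, w ≤ m.flow t ∧ m.flow t ≤ T.u0) {t : ℝ} (ht : 0 ≤ t) :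
    ∃ u, 0 < u ∧ u ≤ T.u0 ∧ SlopeAt T.F0 u (p t) := by
  have hw' : (0 : ℝ) < w := by exact_mod_cast hw
  have hw0' : (w : ℝ) ≤ T.u0 := by exact_mod_cast hw0
  have hconc : ConcaveOn ℝ (Ioi 0) (realize T.flat) :=
    T.concave_flat.concaveOn_realize (fun u => T.F0_lt_top _) (convex_Ioi 0)
      (fun u hu => (mem_Ioi.1 hu).le) fun u hu => T.flat_ne_bot (Real.toNNReal_pos.2 hu)
  have hcont : ContinuousOn (fun u => realize T.flat u - p t * u) (Icc (w : ℝ) T.u0) :=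
    ((hconc.continuousOn isOpen_Ioi).mono fun u hu => hw'.trans_le hu.1).sub (by fun_prop)
  -- The candidate level maximises `F0 v - p t * v` over `[w, u0]`. That range suffices, because the
  -- slopes at nearby good times are attained at flows inside it.
  obtain ⟨u, hu, hmax⟩ := isCompact_Icc.exists_isMaxOn (nonempty_Icc.2 hw0') hcont
  lift u to ℝ≥0 using hw'.le.trans hu.1
  have hu1 : w ≤ u := by exact_mod_cast hu.1
  have hu2 : u ≤ T.u0 := by exact_mod_cast hu.2
  have hmax' : ∀ v : ℝ≥0, w ≤ v → v ≤ T.u0 →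
      (T.F0 v).toReal - p t * v ≤ (T.F0 u).toReal - p t * u := by
    intro v h1 h2
    have := hmax (show (v : ℝ) ∈ Icc (w : ℝ) T.u0 from ⟨by exact_mod_cast h1, by exact_mod_cast h2⟩)
    simp only [mem_ofPred_eq, realize_coe, Technology.flat, min_eq_left h2, min_eq_left hu2] at this
    exact this
  have hfu : T.F0 u ≠ ⊥ := T.finite_F0 u (hw.trans_le hu1) hu2
  refine ⟨u, hw.trans_le hu1, hu2, hfu, fun v => ?_⟩
  by_cases hv : T.F0 v = ⊥
  · rw [hv]; exact bot_le
  rw [← EReal.coe_toReal (T.F0_lt_top v).ne hv, EReal.coe_le_coe_iff]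
  have hpt := h.nonneg t ht
  -- approximation from the right by times at which the slope condition holds
  refine le_of_forall_pos_le_add fun ε hε => ?_
  set L : ℝ := v + T.u0 + 1 with hL
  have hLpos : 0 < L := by positivity
  have hev := Metric.continuousWithinAt_iff.1 (h.continuousWithinAt hsupp hG ht) (ε / L) (by positivity)
  obtain ⟨δ, hδ, hδp⟩ := hev
  obtain ⟨s, hs, hslope, hsx⟩ := exists_mem_Ioo_of_ae_timeMeasure (h.slope0.and hx) ht
    (lt_add_of_pos_right t hδ)
  have hd := hδp (mem_Ici.2 hs.1.le) (by rw [Real.dist_eq, abs_lt]; constructor <;> linarith [hs.1, hs.2])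
  rw [Real.dist_eq] at hd
  have h1 := hslope.le_toReal T.F0_lt_top hv
  have h2 := hmax' (m.flow s) hsx.1 hsx.2
  have h3 : |(v : ℝ) - m.flow s| ≤ L := by
    have : (m.flow s : ℝ) ≤ T.u0 := by exact_mod_cast hsx.2
    have := (m.flow s).coe_nonneg
    have := v.coe_nonneg
    rw [abs_le]
    constructor <;> linarith
  have h4 : (p s - p t) * (v - m.flow s) ≤ ε := by
    calc (p s - p t) * (v - m.flow s) ≤ |p s - p t| * |(v : ℝ) - m.flow s| := by
          rw [← abs_mul]; exact le_abs_self _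
      _ ≤ ε / L * L := by gcongr
      _ = ε := div_mul_cancel₀ _ hLpos.ne'
  linarith

theorem eulerAt_of_slopeAt (hd : ∀ u ∈ Ioo (0 : ℝ) T.u0, DifferentiableAt ℝ (realize T.F0) u)
    {x : ℝ → ℝ≥0} {t : ℝ} (h0 : 0 < x t) (hu : x t ≤ T.u0)
    (h : SlopeAt T.F0 (x t) (∫ s, rewardSlope T m s ∂(ProbabilityTheory.cond G (Ioi t)))) :
    EulerAt T G m x t := by
  have hlt : x t < T.u0 →
      frontierDeriv T.u0 T.F0 (x t) =
        ∫ s, rewardSlope T m s ∂(ProbabilityTheory.cond G (Ioi t)) := fun hlt =>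
    h.frontierDeriv_eq T.F0_lt_top h0 hlt T.finite_F0
      (hd _ ⟨by exact_mod_cast h0, by exact_mod_cast hlt⟩)
  refine ⟨⟨h0, hu⟩, ?_, hlt⟩
  rcases hu.eq_or_lt with he | hlt'
  · rw [he] at h ⊢
    exact T.le_frontierDeriv_u0 h
  · exact (hlt hlt').ge

/-- Continuation values, and with them almost all flows, lie above `ustar > 0`, and rewards lie
below `u0`. So `f` coincides almost surely with the derivative of `F1` at the reward, and `p t` is
its conditional mean at every date. -/
theorem Optimal.differentiable_euler (hr : 0 < r) (hG : IsTimeDistribution G)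
    (hsupp : ¬ BddAbove G.support) (hus : 0 < T.us)
    (hd : ∀ u ∈ Ioo (0 : ℝ) T.u0,
      DifferentiableAt ℝ (realize T.F0) u ∧ DifferentiableAt ℝ (realize T.F1) u)
    (h : Optimal T r G m) :
    (∀ t : ℝ, 0 ≤ t → 0 < m.reward t ∧ m.reward t < (T.u0 : ℝ≥0∞)) ∧
      (Integrable (rewardSlope T m) G ∧ ∫ s, rewardSlope T m s ∂G = 0) ∧
      (∀ᵐ t ∂timeMeasure, EulerAt T G m m.flow t) ∧
      ∃ x : ℝ → ℝ≥0, x =ᵐ[timeMeasure] m.flow ∧ ∀ t : ℝ, 0 ≤ t → EulerAt T G m x t := by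
  have := hG.isProbabilityMeasure
  have hreg := h.regular hr hG hsupp
  have hx := hreg.bddFlow hr
  have hX1 : ∀ t, 0 ≤ t → (T.us : ℝ) ≤ contValue r m.flow t := fun t ht =>
    hreg.us_le_contValue hr ht
  have hX2 : ∀ t, 0 ≤ t → contValue r m.flow t < T.u0 := fun t ht => h.contValue_lt hr hG hsupp ht
  have hus' : (0 : ℝ) < T.us := by exact_mod_cast hus
  have hXpos : ∀ t, 0 ≤ t → 0 < contValue r m.flow t := fun t ht => hus'.trans_le (hX1 t ht)
  have h3 : ∀ᵐ t ∂timeMeasure, 0 ≤ t := ae_restrict_mem measurableSet_Ici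
  have hflow : ∀ᵐ t ∂timeMeasure, T.us ≤ m.flow t ∧ m.flow t ≤ T.u0 := by
    filter_upwards [h3, hreg.contValue_le_flow hr, hx.le] with t ht h1 h2
    exact ⟨by exact_mod_cast (hX1 t ht).trans h1, h2⟩
  obtain ⟨p, f, hE⟩ := h.exists_realEuler hr hG hsupp
  have hf : f =ᵐ[G] rewardSlope T m := by
    filter_upwards [hE.slope1, hG.ae_nonneg] with τ hs hτ
    have hv := hX2 τ hτ
    have hp := hXpos τ hτ
    have hrew := hreg.reward_eq_contValue hr hτ
    have hs := hs.2
    have hcoe : (((m.reward τ).toNNReal : ℝ≥0) : ℝ) = contValue r m.flow τ := by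
      rw [hrew]; exact ENNReal.toReal_ofReal hp.le
    have h1 : 0 < (m.reward τ).toNNReal := by
      rw [← NNReal.coe_pos, hcoe]; exact hp
    have h2 : (m.reward τ).toNNReal < T.u0 := by
      rw [← NNReal.coe_lt_coe, hcoe]; exact hv
    exact (hs.frontierDeriv_eq T.F1_lt_top h1 h2 (fun v h1 h2 => T.F1_ne_bot h1 h2)
      (hd _ ⟨by exact_mod_cast h1, by exact_mod_cast h2⟩).2).symm
  have hf0 := hE.integral_eq_zero hG hus T.us_lt_u0.le hflow
  have hcond : ∀ t, 0 ≤ t →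
      ∫ s, rewardSlope T m s ∂(ProbabilityTheory.cond G (Ioi t)) = p t := by
    intro t ht
    rw [← hE.eq_cond hsupp hG hf0 ht]
    refine integral_congr_ae ?_
    exact ProbabilityTheory.cond_absolutelyContinuous.ae_le hf.symm
  have hae : ∀ᵐ t ∂timeMeasure, EulerAt T G m m.flow t := by
    filter_upwards [h3, hE.slope0, hflow] with t ht hs hxt
    refine eulerAt_of_slopeAt (fun u hu => (hd u hu).1) (hus.trans_le hxt.1) hxt.2 ?_
    rw [hcond t ht]; exact hs
  refine ⟨fun t ht => ?_, ⟨hE.int.congr hf, (integral_congr_ae hf).symm.trans hf0⟩, hae, ?_⟩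
  · rw [hreg.reward_eq_contValue hr ht]
    refine ⟨ENNReal.ofReal_pos.2 (hXpos t ht), ?_⟩
    rw [← ENNReal.ofReal_coe_nnreal]
    exact (ENNReal.ofReal_lt_ofReal_iff (by exact_mod_cast T.u0_pos)).2 (hX2 t ht)
  -- The version keeps the flow wherever the condition holds; at the exceptional dates it takes a
  -- level supported by the slope `p t`. Negative times are irrelevant.
  · have hex : ∀ t, ∃ u, (EulerAt T G m m.flow t → u = m.flow t) ∧
        (0 ≤ t → EulerAt T G m (fun _ => u) t) := by
      intro t
      by_cases hgood : EulerAt T G m m.flow t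
      · exact ⟨m.flow t, fun _ => rfl, fun _ => hgood⟩
      · by_cases ht : 0 ≤ t
        · obtain ⟨u, hu1, hu2, hu3⟩ := hE.exists_slopeAt hsupp hG hus T.us_lt_u0.le hflow ht
          refine ⟨u, fun hg => absurd hg hgood, fun _ => ?_⟩
          refine eulerAt_of_slopeAt (fun u hu => (hd u hu).1) hu1 hu2 ?_
          rw [hcond t ht]; exact hu3
        · exact ⟨0, fun hg => absurd hg hgood, fun h => absurd h ht⟩
    choose x hx1 hx2 using hex
    exact ⟨x, hae.mono fun t ht => hx1 t ht, hx2⟩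

end Differentiable

end Breakthrough

open Breakthrough in
theorem proposition3 (T : Technology) (r : ℝ) (hr : 0 < r)
    (G : Measure ℝ) (hG : IsTimeDistribution G) (hsupp : ¬ BddAbove G.support) :
    -- necessary conditions when `ustar` is interior and the frontiers are differentiable
    (0 < ustar T.F0 T.F1 T.u0 →
      (∀ u ∈ Ioo (0 : ℝ) T.u0,
        DifferentiableAt ℝ (realize T.F0) u ∧ DifferentiableAt ℝ (realize T.F1) u) →
      ProbabilityTheory.cdf G 0 = 0 →
      ∀ m : Mechanism, Optimal T r G m →
        -- `F1'(X_t)` is evaluated at points of differentiability only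
        (∀ t : ℝ, 0 ≤ t → 0 < m.reward t ∧ m.reward t < (T.u0 : ℝ≥0∞)) ∧
        -- initial condition
        (Integrable (rewardSlope T m) G ∧ ∫ s, rewardSlope T m s ∂G = 0) ∧
        -- every version satisfies the Euler condition at almost every time
        (∀ᵐ t ∂timeMeasure, EulerAt T G m m.flow t) ∧
        -- some version satisfies it at every time
        (∃ x : ℝ → ℝ≥0, x =ᵐ[timeMeasure] m.flow ∧ ∀ t : ℝ, 0 ≤ t → EulerAt T G m x t)) ∧
    -- the superdifferential Euler equation is necessary
    (∀ m : Mechanism, Optimal T r G m → SatisfiesEuler T G m) ∧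
    -- and sufficient
    (∀ m : Mechanism, Undominated T r m → SatisfiesEuler T G m → Optimal T r G m) := by
  refine ⟨fun hus hd _ m h => h.differentiable_euler hr hG hsupp hus hd, fun m h => ?_,
    fun m hu he => ?_⟩
  · obtain ⟨p, f, hE⟩ := h.exists_realEuler hr hG hsupp
    exact hE.satisfiesEuler hG
  · obtain ⟨p, f, hE⟩ := he.exists_realEuler hG hsupp
    exact hE.optimal hr hG hsupp hu
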